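/- Let $G=(V,E)$ be a finite simple undirected graph with $n$ vertices, $m\ge 1$ edges and maximum degree $\Delta$. For a nonempty $S\subseteq V$ its density is $|E(S)|/|S|$, where $E(S)$ is the set of edges with both endpoints in $S$, and $\mathrm{OPT}$ is the maximum density. Write $z\in\mathbb R^{2m}$ for vectors indexed by pairs $(e,u)$ with $u\in e\in E$, let $\Delta_m=\{y\in\mathbb R_{\ge0}^m:\sum_e y_e=1\}$, and for $D\in\mathbb R$ put $$C(D)=\Big\{z\in[0,1]^{2m}:\ \sum_{e\ni u}z_{eu}\le D\ \ \forall u\in V\Big\}.$$ Let $B\in\mathbb R^{m\times 2m}$ be given by $(Bz)_e=z_{eu}+z_{ev}$ for $e=uv$, let $A(z,y)=(B^{T}y,\,-Bz)$ on $\mathbb R^{2m}\times\mathbb R^m$, and let $$\phi(z,y)=6\sqrt3\Big(\sum_{e=uv\in E}\big(y_e(z_{eu}^2+z_{ev}^2)+6\,y_e\log y_e\big)-2\Big),\qquad 0\log 0=0 .$$ An $\epsilon$-approximate oracle answer to a query $x\in\mathbb R^{3m}$ for the guess $D$ is a point of $C(D)\times\Delta_m$ that maximizes $\langle w,x\rangle-\phi(w)$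 over $w\in C(D)\times\Delta_m$ up to additive error $\epsilon$. An extragradient step for the guess $D$ replaces $w$ by $w+q$, where $p$ and $q$ are $\epsilon$-approximate oracle answers to the queries $Aw$ and $Aw+2Ap$, respectively. **Theorem.** There are an absolute constant $c>0$ and an algorithm (one real-RAM program, with unit-cost integer addition, subtraction and comparison, real arithmetic, comparison, $\exp$ and $\log$, and array access, on memory that is initially zero outside the input), of the form "preprocessing; main loop; postprocessing", such that on every such graph $G$ with $m\ge1$, given by $n$, $m$ and a list of its edges, and every $\epsilon\in(0,1)$, the algorithm halts and outputs a nonempty set $S\subseteq V$ of density at least $(1-\epsilon)\,\mathrm{OPT}$, and 1. the main loop makes at most $c\,\frac{\log(m+1)}{\epsilon}$ iterations; 2. each iteration takes at most $c\,m\log(\Delta+1)\log(1+\frac1\epsilon)$ time; 3. the total time is at most $c\,\frac m\epsilon\,\log(m+1)\log(\Delta+1)\log(1+\frac1\epsilon)$. Moreover, the algorithm maintains a guess $D$ and an iterate $w=(z,y)$. Before the first iteration $w=w^{(0)}:=(0,(\frac1m,\dots,\frac1m))$, and each iteration performs one extragradient step, either on the current iterate for the current guess, or on $w^{(0)}$ for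 a newly chosen guess. When the loop ends, the current guess $\overline D$ and iterate $(z,y)$ satisfy $\sum_e y_e(\overline z_{eu}+\overline z_{ev})<\sum_e y_e$ for all $\overline z\in C(\overline D)$, and $(1-\epsilon)\,\mathrm{OPT}\le\overline D\le |E(S)|/|S|$. -/

import Mathlib

open Finset

noncomputable section

/-! ### Densest subgraph -/

/-- `|E(S)| / |S|`, where `E(S)` is the set of edges of `G` with both endpoints in `S`. -/
def density {n : ℕ} (G : SimpleGraph (Fin n)) (S : Finset (Fin n)) : ℝ :=
  (({e | e ∈ G.edgeSet ∧ ∀ v ∈ e, v ∈ S} : Set (Sym2 (Fin n))).ncard : ℝ) / (S.card : ℝ)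

/-- `OPT`: the maximum density of a subgraph induced by a nonempty vertex set. -/
def maxDensity {n : ℕ} (G : SimpleGraph (Fin n)) : ℝ :=
  sSup (density G '' {S | S.Nonempty})

/-- A listing of the `m` edges of `G`, each edge exactly once, in any order and with its two
endpoints in any order: edge number `e` joins `ends e 0` and `ends e 1`. -/
structure EdgeListing {n : ℕ} (G : SimpleGraph (Fin n)) (m : ℕ) where
  ends : Fin m → Fin 2 → Fin n
  inj : Function.Injective fun e => s(ends e 0, ends e 1)
  range_eq : Set.range (fun e => s(ends e 0, ends e 1)) = G.edgeSet

/-! ### The saddle point problem, its regularizer and the extragradient step -/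

/-- Pairs `w = (z, y)` in `ℝ^{2m} × ℝ^m`; the coordinate `z_{eu}` is `w.1 e k` for the index `k`
with `ends e k = u`. -/
abbrev SaddleVec (m : ℕ) : Type := (Fin m → Fin 2 → ℝ) × (Fin m → ℝ)

/-- `C(D) = {z ∈ [0,1]^{2m} : ∑_{e ∋ u} z_{eu} ≤ D for all u}`. -/
def feasibleSet {n m : ℕ} (ends : Fin m → Fin 2 → Fin n) (D : ℝ) : Set (Fin m → Fin 2 → ℝ) :=
  {z | (∀ e k, 0 ≤ z e k ∧ z e k ≤ 1) ∧
    ∀ u, ∑ e, ∑ k, (if ends e k = u then z e k else 0) ≤ D}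

/-- The domain `C(D) × Δ_m` of the saddle point problem. -/
def saddleDomain {n m : ℕ} (ends : Fin m → Fin 2 → Fin n) (D : ℝ) : Set (SaddleVec m) :=
  feasibleSet ends D ×ˢ stdSimplex ℝ (Fin m)

/-- The antisymmetric operator `A (z, y) = (Bᵀ y, -B z)`, where `(B z)_e = z_{eu} + z_{ev}` for
`e = uv`. -/
def saddleOp {m : ℕ} (w : SaddleVec m) : SaddleVec m :=
  (fun e _ => w.2 e, fun e => -(w.1 e 0 + w.1 e 1))

/-- The inner product on `ℝ^{2m} × ℝ^m`. -/
def pairing {m : ℕ} (w x : SaddleVec m) : ℝ :=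
  ∑ e, ∑ k, w.1 e k * x.1 e k + ∑ e, w.2 e * x.2 e

/-- The regularizer
`φ(z, y) = 6√3 (∑_{e = uv} (y_e (z_{eu}² + z_{ev}²) + 6 y_e log y_e) - 2)`, with `0 log 0 = 0`. -/
def regularizer {m : ℕ} (w : SaddleVec m) : ℝ :=
  6 * Real.sqrt 3 *
    (∑ e, (w.2 e * (w.1 e 0 ^ 2 + w.1 e 1 ^ 2) + 6 * (w.2 e * Real.log (w.2 e))) - 2)

/-- `w` is an admissible answer of a `δ`-approximate minimization oracle for the regularizer on
the query `x`: it maximizes `⟨w, x⟩ - φ(w)` over `C(D) × Δ_m` up to an additive error `δ`. -/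
def IsOracleAnswer {n m : ℕ} (ends : Fin m → Fin 2 → Fin n) (D δ : ℝ) (x w : SaddleVec m) : Prop :=
  w ∈ saddleDomain ends D ∧ ∀ w' ∈ saddleDomain ends D,
    pairing w' x - regularizer w' ≤ pairing w x - regularizer w + δ

/-- One extragradient step `w' = w + Φ(A w + 2 A Φ(A w))`, where `Φ` is a `δ`-approximate
minimization oracle for the regularizer on `C(D) × Δ_m`. -/
def IsExtragradientStep {n m : ℕ} (ends : Fin m → Fin 2 → Fin n) (D δ : ℝ)
    (w w' : SaddleVec m) : Prop :=
  ∃ p q : SaddleVec m, IsOracleAnswer ends D δ (saddleOp w) p ∧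
    IsOracleAnswer ends D δ (saddleOp w + (2 : ℝ) • saddleOp p) q ∧ w' = w + q

/-- The starting point `z = 0`, `y = (1/m, …, 1/m)`. -/
def startVec (m : ℕ) : SaddleVec m :=
  (fun _ _ => 0, fun _ => 1 / (m : ℝ))

/-! ### Real RAM: a finite program over integer and real registers and arrays -/

/-- A memory configuration: integer registers, real registers, integer arrays, real arrays. -/
structure RamState where
  nreg : ℕ → ℕ
  rreg : ℕ → ℝ
  narr : ℕ → ℕ → ℕ
  rarr : ℕ → ℕ → ℝ

/-- Unit-cost instructions; `d` is the destination register, and array cells are addressed by the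
content of the integer register `i`. Reals are never converted to integers, and the only numerical
constants are natural numbers. -/
inductive RamInstr where
  | nconst (d k : ℕ)
  | nmove (d a : ℕ)
  | nadd (d a b : ℕ)
  | nsub (d a b : ℕ)
  | nload (d arr i : ℕ)
  | nstore (arr i a : ℕ)
  | rcast (d a : ℕ)
  | rmove (d a : ℕ)
  | radd (d a b : ℕ)
  | rsub (d a b : ℕ)
  | rmul (d a b : ℕ)
  | rdiv (d a b : ℕ)
  | rexp (d a : ℕ)
  | rlog (d a : ℕ)
  | rload (d arr i : ℕ)
  | rstore (arr i a : ℕ)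

namespace RamState

def setN (s : RamState) (d x : ℕ) : RamState :=
  { s with nreg := Function.update s.nreg d x }

def setR (s : RamState) (d : ℕ) (x : ℝ) : RamState :=
  { s with rreg := Function.update s.rreg d x }

def setNArr (s : RamState) (arr i x : ℕ) : RamState :=
  { s with narr := Function.update s.narr arr (Function.update (s.narr arr) i x) }

def setRArr (s : RamState) (arr i : ℕ) (x : ℝ) : RamState :=
  { s with rarr := Function.update s.rarr arr (Function.update (s.rarr arr) i x) }

end RamState

/-- The effect of an instruction. -/
def RamInstr.apply (s : RamState) : RamInstr → RamState
  | .nconst d k => s.setN d k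
  | .nmove d a => s.setN d (s.nreg a)
  | .nadd d a b => s.setN d (s.nreg a + s.nreg b)
  | .nsub d a b => s.setN d (s.nreg a - s.nreg b)
  | .nload d arr i => s.setN d (s.narr arr (s.nreg i))
  | .nstore arr i a => s.setNArr arr (s.nreg i) (s.nreg a)
  | .rcast d a => s.setR d (s.nreg a : ℝ)
  | .rmove d a => s.setR d (s.rreg a)
  | .radd d a b => s.setR d (s.rreg a + s.rreg b)
  | .rsub d a b => s.setR d (s.rreg a - s.rreg b)
  | .rmul d a b => s.setR d (s.rreg a * s.rreg b)
  | .rdiv d a b => s.setR d (s.rreg a / s.rreg b)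
  | .rexp d a => s.setR d (Real.exp (s.rreg a))
  | .rlog d a => s.setR d (Real.log (s.rreg a))
  | .rload d arr i => s.setR d (s.rarr arr (s.nreg i))
  | .rstore arr i a => s.setRArr arr (s.nreg i) (s.rreg a)

/-- Unit-cost tests comparing two registers. -/
inductive RamTest where
  | nlt (a b : ℕ)
  | neq (a b : ℕ)
  | rlt (a b : ℕ)
  | req (a b : ℕ)

def RamTest.holds (s : RamState) : RamTest → Prop
  | .nlt a b => s.nreg a < s.nreg b
  | .neq a b => s.nreg a = s.nreg b
  | .rlt a b => s.rreg a < s.rreg b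
  | .req a b => s.rreg a = s.rreg b

/-- Programs. -/
inductive RamCmd where
  | skip
  | instr (i : RamInstr)
  | seq (c₁ c₂ : RamCmd)
  | ite (b : RamTest) (c₁ c₂ : RamCmd)
  | loop (b : RamTest) (c : RamCmd)

/-- `RamExec c s s' t`: started in `s`, the program `c` halts in `s'` after exactly `t` steps. Each
executed instruction and each evaluated test is one step; `loop b c` is `while b do c`. -/
inductive RamExec : RamCmd → RamState → RamState → ℕ → Prop
  | skip (s : RamState) : RamExec .skip s s 1
  | instr (i : RamInstr) (s : RamState) : RamExec (.instr i) s (i.apply s) 1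
  | seq {c₁ c₂ : RamCmd} {s s₁ s₂ : RamState} {t₁ t₂ : ℕ} :
      RamExec c₁ s s₁ t₁ → RamExec c₂ s₁ s₂ t₂ → RamExec (.seq c₁ c₂) s s₂ (t₁ + t₂)
  | ite_true {b : RamTest} {c₁ c₂ : RamCmd} {s s' : RamState} {t : ℕ} :
      b.holds s → RamExec c₁ s s' t → RamExec (.ite b c₁ c₂) s s' (t + 1)
  | ite_false {b : RamTest} {c₁ c₂ : RamCmd} {s s' : RamState} {t : ℕ} :
      ¬ b.holds s → RamExec c₂ s s' t → RamExec (.ite b c₁ c₂) s s' (t + 1)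
  | loop_true {b : RamTest} {c : RamCmd} {s s₁ s₂ : RamState} {t₁ t₂ : ℕ} :
      b.holds s → RamExec c s s₁ t₁ → RamExec (.loop b c) s₁ s₂ t₂ →
      RamExec (.loop b c) s s₂ (t₁ + t₂ + 1)
  | loop_false {b : RamTest} {c : RamCmd} {s : RamState} :
      ¬ b.holds s → RamExec (.loop b c) s s 1

/-- An iterative program `pre; while guard do body; post`. One execution of `body` is one
iteration. -/
structure IterProgram where
  pre : RamCmd
  guard : RamTest
  body : RamCmd
  post : RamCmd

def IterProgram.toCmd (P : IterProgram) : RamCmd :=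
  .seq P.pre (.seq (.loop P.guard P.body) P.post)

/-- Started in `s₀`, the program halts in `s₁` after `t` steps in total; its main loop makes `K`
iterations, `σ 0` is the state before the first one, and iteration number `i` leads from `σ i` to
`σ (i + 1)` in `c i` steps. -/
structure IterProgram.Runs (P : IterProgram) (s₀ : RamState) (K : ℕ) (σ : ℕ → RamState)
    (c : ℕ → ℕ) (s₁ : RamState) (t : ℕ) : Prop where
  start : ∃ t₀, RamExec P.pre s₀ (σ 0) t₀
  iter : ∀ i < K, P.guard.holds (σ i) ∧ RamExec P.body (σ i) (σ (i + 1)) (c i)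
  guard_exit : ¬ P.guard.holds (σ K)
  finish : ∃ t₁, RamExec P.post (σ K) s₁ t₁
  total : RamExec P.toCmd s₀ s₁ t

/-! ### Input and output conventions -/

/-- The input: `n` and `m` in the integer registers `0` and `1`, the two endpoints of edge number
`e` in cell `e` of the integer arrays `0` and `1`, the accuracy `ε` in the real register `0`; the
rest of the memory is `0`. -/
def inputState {n m : ℕ} (ends : Fin m → Fin 2 → Fin n) (ε : ℝ) : RamState where
  nreg := fun r => if r = 0 then n else if r = 1 then m else 0
  rreg := fun r => if r = 0 then ε else 0
  narr := fun a i =>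
    if h : i < m ∧ a < 2 then (ends ⟨i, h.1⟩ ⟨a, h.2⟩ : ℕ) else 0
  rarr := fun _ _ => 0

/-- The output: the set of vertices marked by a nonzero entry of the integer array `2`. -/
def outputSet (n : ℕ) (s : RamState) : Finset (Fin n) :=
  {v | s.narr 2 v ≠ 0}

/-- The current guess `D`, kept in the real register `1`. -/
def guessOf (s : RamState) : ℝ := s.rreg 1

/-- The current iterate `w = (z, y)`: `z` is kept in the real arrays `0` and `1` (first and second
endpoint of each edge), `y` in the real array `2`. -/
def iterateOf (m : ℕ) (s : RamState) : SaddleVec m :=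
  (fun e k => s.rarr k e, fun e => s.rarr 2 e)

end

/-!
The algorithm searches for `OPT` through the feasibility problems `max_{z ∈ C(D)} min_e (B z)_e ≥ 1`,
whose values compare the guess `D` with `OPT` by LP duality.

**One guess.** The potential `max_u ⟨u, A w⟩ - φ(u)` over `C(D) × Δ_m` is `O(log m)` at the starting
point. The regularizer is area convex with respect to `A`: its convexity defect at a triangle
dominates the area of the triangle. With Gibbs' inequality for `y log y` this reduces to the fact
that three exponentials with small exponents sum to at most `3` (`two_mul_abs_area_le`). Hence an
extragradient step with a `δ`-approximate oracle raises the potential by at most `δ`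
(`potential_extragradient`). After `T ≥ 256 (log m + 1) / η` steps with `δ ≤ η / 4` there are two
cases. Either every edge has `(B z)_e ≥ (1 - η) T`, and then `OPT ≤ D / (1 - η)`
(`RunInv.maxDensity_le`); or some edge has not, and then comparing with the vertex of `Δ_m` at this
edge shows that `y` certifies infeasibility with slack: `⟨y, B z⟩ ≤ (1 - η / 2) T` on `C(D)`, while
`y` sums to `T + 1` (`RunInv.certificate`).

**The oracle** maximizes alternately over `y` (a softmax) and `z`. Maximized over `y`, the objective
is strongly concave in `z` relative to the weights `y`, so each round reduces the gap by the factor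
`3/4` (`oracleObj_contract`), starting from a constant (`oracleObj_first`); `O(log (1 + 1/ε))` rounds
suffice. The maximization over `z` splits into one concave quadratic knapsack problem for each vertex
`u`. It is solved by a multiplier `λ_u` (`zObj_le_of_kkt`), found exactly by sorting the breakpoints
of the piecewise linear load function, a binary search in the sorted table, and interpolation
(`run_solveVertex`). This takes `O(d log (d + 1))` time for degree `d`, in total `O(m log (Δ + 1))`.

**The search.** Batch peeling gives an upper bound `U ≤ 4 OPT` for `OPT` in `O(m log (m + 1))` time
(`peel_card`, `maxDensity_le_of_peel`). The guess is `D = (1 - 2 η) U`. An infeasible guess gives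
`U < OPT / (1 - 2 η)`, and `η` is halved, or the search ends when `2 η ≤ ε`; a feasible guess lowers
`U`, at most `12` times for the same `η`. The numbers of steps `O(log m / η)` for the decreasing
accuracies form a geometric sum `O(log m / ε)`, which `budget` turns into a potential that falls by
at least `1` in each iteration.

**Rounding.** If no level set `L = {e | y_e ≥ t}` with `t` on a geometric grid were too dense, that is,
if `|L| ≤ ∑_u min(D, deg_L u)` for all of them, then a greedy `z ∈ C(D)` that fills each vertex in
decreasing order of `y` would contradict the certificate (`exists_dense_level`). In a level set with
`|L| > ∑_u min(D, deg_L u)`, the vertices of degree more than `D` induce a density more than `D`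
(`lt_density_of_level`).

**The program** is written in a structured language with expressions (`HCmd`) and compiled to the
real RAM with exact preservation of the number of steps (`HExec.exec_comp`). `Run c s T Q` is total
correctness with a time bound, and `Frame c s s'` says what a command leaves alone.

Use of the memory. Integer registers: `0` to `3` hold `n`, `m`, `2 m` and the number of vertices that
are not isolated, `4` stops the search, `5` requests a restart, `6` to `9` count edges, vertices,
slots and incidences, `23`, `28`, `29` hold numbers of flagged edges, the success of the rounding
and numbers of covered vertices, `40` is always `0`, and the others below `64` are temporary. Real
registers: `0` to `7` hold `ε`, `D`, `η`, `U`, `256 (log m + 1)`, the number of steps of the current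
run, `ε / 16` and `6√3`. Integer arrays: `0` and `1` endpoints, `2` output, `3` vertices of the
incidences, `4` to `8` the incidence lists (`Layout`), `9` degrees, `10` flags of edges, `11` powers
of two. Real arrays: `0`, `1`, `2` the iterate, `4` and `7` the query, `5` and `6` the answer of the
oracle, `8` quadratic coefficients, `9` and `10` the sorting buffers.
-/


noncomputable section

/-! ### A structured language compiled to the real RAM -/

/-- Integer expressions over integer registers and arrays. -/
inductive NExp where
  | reg (r : ℕ)
  | const (k : ℕ)
  | add (a b : NExp)
  | sub (a b : NExp)
  | load (arr : ℕ) (i : NExp)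

/-- Real expressions; integers enter them by a cast. -/
inductive RExp where
  | reg (r : ℕ)
  | nat (e : NExp)
  | add (a b : RExp)
  | sub (a b : RExp)
  | mul (a b : RExp)
  | div (a b : RExp)
  | exp (a : RExp)
  | log (a : RExp)
  | max (a b : RExp)
  | min (a b : RExp)
  | load (arr : ℕ) (i : NExp)

/-- Comparisons of expressions. -/
inductive HTest where
  | nlt (a b : NExp)
  | neq (a b : NExp)
  | rlt (a b : RExp)

/-- Structured commands: assignments of expressions to registers and array cells, sequencing,
conditionals and while loops. -/
inductive HCmd where
  | skip
  | asgN (d : ℕ) (e : NExp)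
  | asgR (d : ℕ) (e : RExp)
  | stN (arr : ℕ) (i e : NExp)
  | stR (arr : ℕ) (i : NExp) (e : RExp)
  | seq (c₁ c₂ : HCmd)
  | ite (b : HTest) (c₁ c₂ : HCmd)
  | loop (b : RamTest) (c : HCmd)

infixr:60 " ;; " => HCmd.seq

instance : Add NExp := ⟨.add⟩
instance : Sub NExp := ⟨.sub⟩
instance (k : ℕ) : OfNat NExp k := ⟨.const k⟩
instance : Add RExp := ⟨.add⟩
instance : Sub RExp := ⟨.sub⟩
instance : Mul RExp := ⟨.mul⟩
instance : Div RExp := ⟨.div⟩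
instance (k : ℕ) : OfNat RExp k := ⟨.nat (.const k)⟩

namespace NExp

def eval (s : RamState) : NExp → ℕ
  | reg r => s.nreg r
  | const k => k
  | add a b => a.eval s + b.eval s
  | sub a b => a.eval s - b.eval s
  | load arr i => s.narr arr (i.eval s)

/-- The number of steps of the compiled expression. -/
def cost : NExp → ℕ
  | reg _ => 1
  | const _ => 1
  | add a b => a.cost + (b.cost + 1)
  | sub a b => a.cost + (b.cost + 1)
  | load _ i => i.cost + 1

/-- Code that leaves the value of the expression in register `d` and uses registers above `d` as
scratch memory. -/
def comp : NExp → ℕ → RamCmd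
  | reg r, d => .instr (.nmove d r)
  | const k, d => .instr (.nconst d k)
  | add a b, d => .seq (a.comp d) (.seq (b.comp (d + 1)) (.instr (.nadd d d (d + 1))))
  | sub a b, d => .seq (a.comp d) (.seq (b.comp (d + 1)) (.instr (.nsub d d (d + 1))))
  | load arr i, d => .seq (i.comp d) (.instr (.nload d arr d))

/-- All registers that occur are below `64`, the first scratch register. -/
def wf : NExp → Bool
  | reg r => r < 64
  | const _ => true
  | add a b => a.wf && b.wf
  | sub a b => a.wf && b.wf
  | load _ i => i.wf

@[simp] lemma eval_reg (s : RamState) (r : ℕ) : (reg r).eval s = s.nreg r := rfl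
@[simp] lemma eval_const (s : RamState) (k : ℕ) : (const k).eval s = k := rfl
@[simp] lemma eval_ofNat (s : RamState) (k : ℕ) : (no_index (OfNat.ofNat k) : NExp).eval s = k := rfl
@[simp] lemma eval_add (s : RamState) (a b : NExp) : (a + b).eval s = a.eval s + b.eval s := rfl
@[simp] lemma eval_sub (s : RamState) (a b : NExp) : (a - b).eval s = a.eval s - b.eval s := rfl
@[simp] lemma eval_load (s : RamState) (arr : ℕ) (i : NExp) :
    (load arr i).eval s = s.narr arr (i.eval s) := rfl

end NExp

namespace RExp

def eval (s : RamState) : RExp → ℝ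
  | reg r => s.rreg r
  | nat e => (e.eval s : ℝ)
  | add a b => a.eval s + b.eval s
  | sub a b => a.eval s - b.eval s
  | mul a b => a.eval s * b.eval s
  | div a b => a.eval s / b.eval s
  | exp a => Real.exp (a.eval s)
  | log a => Real.log (a.eval s)
  | max a b => Max.max (a.eval s) (b.eval s)
  | min a b => Min.min (a.eval s) (b.eval s)
  | load arr i => s.rarr arr (i.eval s)

/-- The number of steps of the compiled expression; `max` and `min` compile to a conditional. -/
def cost : RExp → ℕ
  | reg _ => 1
  | nat e => e.cost + 1
  | add a b => a.cost + (b.cost + 1)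
  | sub a b => a.cost + (b.cost + 1)
  | mul a b => a.cost + (b.cost + 1)
  | div a b => a.cost + (b.cost + 1)
  | exp a => a.cost + 1
  | log a => a.cost + 1
  | max a b => a.cost + (b.cost + 2)
  | min a b => a.cost + (b.cost + 2)
  | load _ i => i.cost + 1

/-- Code that leaves the value of the expression in the real register `d`; integer
subexpressions are evaluated in the integer registers from `64` on. -/
def comp : RExp → ℕ → RamCmd
  | reg r, d => .instr (.rmove d r)
  | nat e, d => .seq (e.comp 64) (.instr (.rcast d 64))
  | add a b, d => .seq (a.comp d) (.seq (b.comp (d + 1)) (.instr (.radd d d (d + 1))))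
  | sub a b, d => .seq (a.comp d) (.seq (b.comp (d + 1)) (.instr (.rsub d d (d + 1))))
  | mul a b, d => .seq (a.comp d) (.seq (b.comp (d + 1)) (.instr (.rmul d d (d + 1))))
  | div a b, d => .seq (a.comp d) (.seq (b.comp (d + 1)) (.instr (.rdiv d d (d + 1))))
  | exp a, d => .seq (a.comp d) (.instr (.rexp d d))
  | log a, d => .seq (a.comp d) (.instr (.rlog d d))
  | max a b, d => .seq (a.comp d) (.seq (b.comp (d + 1))
      (.ite (.rlt d (d + 1)) (.instr (.rmove d (d + 1))) .skip))
  | min a b, d => .seq (a.comp d) (.seq (b.comp (d + 1))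
      (.ite (.rlt (d + 1) d) (.instr (.rmove d (d + 1))) .skip))
  | load arr i, d => .seq (i.comp 64) (.instr (.rload d arr 64))

/-- All registers that occur are below `64`. -/
def wf : RExp → Bool
  | reg r => r < 64
  | nat e => e.wf
  | add a b => a.wf && b.wf
  | sub a b => a.wf && b.wf
  | mul a b => a.wf && b.wf
  | div a b => a.wf && b.wf
  | exp a => a.wf
  | log a => a.wf
  | max a b => a.wf && b.wf
  | min a b => a.wf && b.wf
  | load _ i => i.wf

@[simp] lemma eval_reg (s : RamState) (r : ℕ) : (reg r).eval s = s.rreg r := rfl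
@[simp] lemma eval_nat (s : RamState) (e : NExp) : (nat e).eval s = (e.eval s : ℝ) := rfl
@[simp] lemma eval_ofNat (s : RamState) (k : ℕ) : (no_index (OfNat.ofNat k) : RExp).eval s = (k : ℝ) := rfl
@[simp] lemma eval_add (s : RamState) (a b : RExp) : (a + b).eval s = a.eval s + b.eval s := rfl
@[simp] lemma eval_sub (s : RamState) (a b : RExp) : (a - b).eval s = a.eval s - b.eval s := rfl
@[simp] lemma eval_mul (s : RamState) (a b : RExp) : (a * b).eval s = a.eval s * b.eval s := rfl
@[simp] lemma eval_div (s : RamState) (a b : RExp) : (a / b).eval s = a.eval s / b.eval s := rfl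
@[simp] lemma eval_exp (s : RamState) (a : RExp) : (exp a).eval s = Real.exp (a.eval s) := rfl
@[simp] lemma eval_log (s : RamState) (a : RExp) : (log a).eval s = Real.log (a.eval s) := rfl
@[simp] lemma eval_max (s : RamState) (a b : RExp) :
    (max a b).eval s = Max.max (a.eval s) (b.eval s) := rfl
@[simp] lemma eval_min (s : RamState) (a b : RExp) :
    (min a b).eval s = Min.min (a.eval s) (b.eval s) := rfl
@[simp] lemma eval_load (s : RamState) (arr : ℕ) (i : NExp) :
    (load arr i).eval s = s.rarr arr (i.eval s) := rfl

end RExp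

namespace HTest

def holds (s : RamState) : HTest → Prop
  | nlt a b => a.eval s < b.eval s
  | neq a b => a.eval s = b.eval s
  | rlt a b => a.eval s < b.eval s

@[simp] lemma holds_nlt (s : RamState) (a b : NExp) :
    (nlt a b).holds s ↔ a.eval s < b.eval s := Iff.rfl
@[simp] lemma holds_neq (s : RamState) (a b : NExp) :
    (neq a b).holds s ↔ a.eval s = b.eval s := Iff.rfl
@[simp] lemma holds_rlt (s : RamState) (a b : RExp) :
    (rlt a b).holds s ↔ a.eval s < b.eval s := Iff.rfl

/-- The number of steps needed to evaluate both sides; the comparison itself is a step of the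
enclosing conditional. -/
def cost : HTest → ℕ
  | nlt a b => a.cost + b.cost
  | neq a b => a.cost + b.cost
  | rlt a b => a.cost + b.cost

/-- Code that evaluates both sides of the comparison in the registers `64` and `65`. -/
def comp : HTest → RamCmd
  | nlt a b => .seq (a.comp 64) (b.comp 65)
  | neq a b => .seq (a.comp 64) (b.comp 65)
  | rlt a b => .seq (a.comp 64) (b.comp 65)

/-- The comparison of the two evaluated sides. -/
def test : HTest → RamTest
  | nlt _ _ => .nlt 64 65
  | neq _ _ => .neq 64 65
  | rlt _ _ => .rlt 64 65

/-- All registers that occur are below `64`. -/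
def wf : HTest → Bool
  | nlt a b => a.wf && b.wf
  | neq a b => a.wf && b.wf
  | rlt a b => a.wf && b.wf

end HTest

/-- Both registers of the test are below `64`. -/
def RamTest.wf : RamTest → Bool
  | .nlt a b => a < 64 && b < 64
  | .neq a b => a < 64 && b < 64
  | .rlt a b => a < 64 && b < 64
  | .req a b => a < 64 && b < 64

namespace HCmd

/-- The compiled command. The guard of a loop is compiled to a bare RAM test, so that one loop
iteration costs nothing but its body and the test. -/
def comp : HCmd → RamCmd
  | skip => .skip
  | asgN d e => .seq (e.comp 64) (.instr (.nmove d 64))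
  | asgR d e => .seq (e.comp 64) (.instr (.rmove d 64))
  | stN arr i e => .seq (i.comp 64) (.seq (e.comp 65) (.instr (.nstore arr 64 65)))
  | stR arr i e => .seq (e.comp 64) (.seq (i.comp 64) (.instr (.rstore arr 64 64)))
  | seq c₁ c₂ => .seq c₁.comp c₂.comp
  | ite b c₁ c₂ => .seq b.comp (.ite b.test c₁.comp c₂.comp)
  | loop b c => .loop b c.comp

/-- All registers that occur are below `64`, so that the scratch registers stay free. -/
def wf : HCmd → Bool
  | skip => true
  | asgN d e => d < 64 && e.wf
  | asgR d e => d < 64 && e.wf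
  | stN _ i e => i.wf && e.wf
  | stR _ i e => i.wf && e.wf
  | seq c₁ c₂ => c₁.wf && c₂.wf
  | ite b c₁ c₂ => b.wf && c₁.wf && c₂.wf
  | loop b c => b.wf && c.wf

end HCmd

/-- `HExec c s s' t`: the structured command `c` leads from `s` to `s'`, and its compiled code takes
`t` steps. Scratch registers do not occur at this level. -/
inductive HExec : HCmd → RamState → RamState → ℕ → Prop
  | skip (s) : HExec .skip s s 1
  | asgN (d e s) : HExec (.asgN d e) s (s.setN d (e.eval s)) (e.cost + 1)
  | asgR (d e s) : HExec (.asgR d e) s (s.setR d (e.eval s)) (e.cost + 1)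
  | stN (arr i e s) : HExec (.stN arr i e) s (s.setNArr arr (i.eval s) (e.eval s))
      (i.cost + (e.cost + 1))
  | stR (arr i e s) : HExec (.stR arr i e) s (s.setRArr arr (i.eval s) (e.eval s))
      (e.cost + (i.cost + 1))
  | seq {c₁ c₂ s s₁ s₂ t₁ t₂} : HExec c₁ s s₁ t₁ → HExec c₂ s₁ s₂ t₂ →
      HExec (.seq c₁ c₂) s s₂ (t₁ + t₂)
  | ite_true {b c₁ c₂ s s' t} : b.holds s → HExec c₁ s s' t →
      HExec (.ite b c₁ c₂) s s' (b.cost + (t + 1))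
  | ite_false {b c₁ c₂ s s' t} : ¬ b.holds s → HExec c₂ s s' t →
      HExec (.ite b c₁ c₂) s s' (b.cost + (t + 1))
  | loop_true {b c s s₁ s₂ t₁ t₂} : b.holds s → HExec c s s₁ t₁ → HExec (.loop b c) s₁ s₂ t₂ →
      HExec (.loop b c) s s₂ (t₁ + t₂ + 1)
  | loop_false {b c s} : ¬ b.holds s → HExec (.loop b c) s s 1

/-- Two states agree outside the scratch registers. -/
structure Agree (s r : RamState) : Prop where
  nreg : ∀ i < 64, s.nreg i = r.nreg i
  rreg : ∀ i < 64, s.rreg i = r.rreg i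
  narr : s.narr = r.narr
  rarr : s.rarr = r.rarr

section reads

variable (s : RamState) (d : ℕ)

@[simp] lemma setN_nreg (x r : ℕ) : (s.setN d x).nreg r = if r = d then x else s.nreg r := by
  simp [RamState.setN, Function.update_apply]
@[simp] lemma setN_rreg (x : ℕ) : (s.setN d x).rreg = s.rreg := rfl
@[simp] lemma setN_narr (x : ℕ) : (s.setN d x).narr = s.narr := rfl
@[simp] lemma setN_rarr (x : ℕ) : (s.setN d x).rarr = s.rarr := rfl
@[simp] lemma setR_rreg (x : ℝ) (r : ℕ) : (s.setR d x).rreg r = if r = d then x else s.rreg r := by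
  simp [RamState.setR, Function.update_apply]
@[simp] lemma setR_nreg (x : ℝ) : (s.setR d x).nreg = s.nreg := rfl
@[simp] lemma setR_narr (x : ℝ) : (s.setR d x).narr = s.narr := rfl
@[simp] lemma setR_rarr (x : ℝ) : (s.setR d x).rarr = s.rarr := rfl
@[simp] lemma setNArr_narr (i x a : ℕ) : (s.setNArr d i x).narr a =
    if a = d then Function.update (s.narr d) i x else s.narr a := by
  simp [RamState.setNArr, Function.update_apply]
@[simp] lemma setNArr_nreg (i x : ℕ) : (s.setNArr d i x).nreg = s.nreg := rfl
@[simp] lemma setNArr_rreg (i x : ℕ) : (s.setNArr d i x).rreg = s.rreg := rfl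
@[simp] lemma setNArr_rarr (i x : ℕ) : (s.setNArr d i x).rarr = s.rarr := rfl
@[simp] lemma setRArr_rarr (i : ℕ) (x : ℝ) (a : ℕ) : (s.setRArr d i x).rarr a =
    if a = d then Function.update (s.rarr d) i x else s.rarr a := by
  simp [RamState.setRArr, Function.update_apply]
@[simp] lemma setRArr_nreg (i : ℕ) (x : ℝ) : (s.setRArr d i x).nreg = s.nreg := rfl
@[simp] lemma setRArr_rreg (i : ℕ) (x : ℝ) : (s.setRArr d i x).rreg = s.rreg := rfl
@[simp] lemma setRArr_narr (i : ℕ) (x : ℝ) : (s.setRArr d i x).narr = s.narr := rfl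

end reads

/-! ### Correctness of the compilation -/

/-- The compiled expression leaves its value in `d`, takes exactly `cost` steps, and changes no
register below `d`. The last part keeps the value of a left operand while the right one is
evaluated. -/
lemma NExp.exec_comp {s : RamState} (e : NExp) (hw : e.wf = true) :
    ∀ (d : ℕ) (r : RamState), 64 ≤ d → Agree s r →
    ∃ r', RamExec (e.comp d) r r' e.cost ∧ Agree s r' ∧ r'.nreg d = e.eval s ∧
      (∀ i < d, r'.nreg i = r.nreg i) ∧ r'.rreg = r.rreg := by
  have upd : ∀ (d x : ℕ) (r r₀ : RamState), 64 ≤ d → Agree s r →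
      (∀ i < d, r.nreg i = r₀.nreg i) → r.rreg = r₀.rreg → Agree s (r.setN d x) ∧
      (r.setN d x).nreg d = x ∧ (∀ i < d, (r.setN d x).nreg i = r₀.nreg i) ∧
      (r.setN d x).rreg = r₀.rreg := by
    intro d x r r₀ hd h h1 h2
    refine ⟨⟨fun i hi => ?_, fun i hi => h.rreg i hi, h.narr, h.rarr⟩, by simp, ?_, h2⟩
    · rw [setN_nreg, if_neg (by omega), h.nreg i hi]
    · intro i hi
      rw [setN_nreg, if_neg (by omega), h1 i hi]
  have bin : ∀ (a b : NExp) (ins : ℕ → ℕ → ℕ → RamInstr) (f : ℕ → ℕ → ℕ),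
      (∀ (r : RamState) d x y, (ins d x y).apply r = r.setN d (f (r.nreg x) (r.nreg y))) →
      (∀ (d : ℕ) (r : RamState), 64 ≤ d → Agree s r →
        ∃ r', RamExec (a.comp d) r r' a.cost ∧ Agree s r' ∧ r'.nreg d = a.eval s ∧
        (∀ i < d, r'.nreg i = r.nreg i) ∧ r'.rreg = r.rreg) →
      (∀ (d : ℕ) (r : RamState), 64 ≤ d → Agree s r →
        ∃ r', RamExec (b.comp d) r r' b.cost ∧ Agree s r' ∧ r'.nreg d = b.eval s ∧
        (∀ i < d, r'.nreg i = r.nreg i) ∧ r'.rreg = r.rreg) →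
      ∀ (d : ℕ) (r : RamState), 64 ≤ d → Agree s r →
      ∃ r', RamExec (.seq (a.comp d) (.seq (b.comp (d + 1)) (.instr (ins d d (d + 1))))) r r'
          (a.cost + (b.cost + 1)) ∧ Agree s r' ∧ r'.nreg d = f (a.eval s) (b.eval s) ∧
        (∀ i < d, r'.nreg i = r.nreg i) ∧ r'.rreg = r.rreg := by
    intro a b ins f hins ha hb d r hd hr
    obtain ⟨r₁, e₁, g₁, v₁, k₁, l₁⟩ := ha d r hd hr
    obtain ⟨r₂, e₂, g₂, v₂, k₂, l₂⟩ := hb (d + 1) r₁ (by omega) g₁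
    have hx : (ins d d (d + 1)).apply r₂ = r₂.setN d (f (a.eval s) (b.eval s)) := by
      rw [hins, v₂, k₂ d (by omega), v₁]
    refine ⟨_, .seq e₁ (.seq e₂ (.instr _ _)), ?_⟩
    rw [hx]
    exact upd _ _ _ _ hd g₂ (fun i hi => by rw [k₂ i (by omega), k₁ i hi]) (by rw [l₂, l₁])
  induction e with
  | reg i =>
    intro d r hd hr
    refine ⟨_, .instr _ _, ?_⟩
    have := hr.nreg i (by simpa [wf] using hw)
    simp only [RamInstr.apply, eval, this]
    exact upd _ _ _ _ hd hr (fun _ _ => rfl) rfl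
  | const k =>
    intro d r hd hr
    exact ⟨_, .instr _ _, upd _ _ _ _ hd hr (fun _ _ => rfl) rfl⟩
  | add a b iha ihb =>
    simp only [wf, Bool.and_eq_true] at hw
    exact bin a b .nadd (· + ·) (fun _ _ _ _ => rfl) (iha hw.1) (ihb hw.2)
  | sub a b iha ihb =>
    simp only [wf, Bool.and_eq_true] at hw
    exact bin a b .nsub (· - ·) (fun _ _ _ _ => rfl) (iha hw.1) (ihb hw.2)
  | load arr i ih =>
    intro d r hd hr
    obtain ⟨r₁, e₁, g₁, v₁, k₁, l₁⟩ := ih hw d r hd hr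
    refine ⟨_, .seq e₁ (.instr _ _), ?_⟩
    simp only [RamInstr.apply, eval, v₁, ← g₁.narr]
    exact upd _ _ _ _ hd g₁ k₁ l₁

lemma Agree.setN {s r : RamState} (h : Agree s r) (d x : ℕ) : Agree (s.setN d x) (r.setN d x) :=
  ⟨fun i hi => by simp [h.nreg i hi], fun i hi => h.rreg i hi, h.narr, h.rarr⟩

lemma Agree.setR {s r : RamState} (h : Agree s r) (d : ℕ) (x : ℝ) :
    Agree (s.setR d x) (r.setR d x) :=
  ⟨fun i hi => h.nreg i hi, fun i hi => by simp [h.rreg i hi], h.narr, h.rarr⟩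

lemma RExp.exec_comp {s : RamState} (e : RExp) (hw : e.wf = true) :
    ∀ (d : ℕ) (r : RamState), 64 ≤ d → Agree s r →
    ∃ r', RamExec (e.comp d) r r' e.cost ∧ Agree s r' ∧ r'.rreg d = e.eval s ∧
      (∀ i < d, r'.rreg i = r.rreg i) := by
  have upd : ∀ (d : ℕ) (x : ℝ) (r r₀ : RamState), 64 ≤ d → Agree s r →
      (∀ i < d, r.rreg i = r₀.rreg i) → Agree s (r.setR d x) ∧
      (r.setR d x).rreg d = x ∧ (∀ i < d, (r.setR d x).rreg i = r₀.rreg i) := by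
    intro d x r r₀ hd h h1
    refine ⟨⟨fun i hi => h.nreg i hi, fun i hi => ?_, h.narr, h.rarr⟩, by simp, ?_⟩
    · rw [setR_rreg, if_neg (by omega), h.rreg i hi]
    · intro i hi
      rw [setR_rreg, if_neg (by omega), h1 i hi]
  have bin : ∀ (a b : RExp) (c : ℕ → RamCmd) (k : ℕ) (f : ℝ → ℝ → ℝ),
      (∀ (r : RamState) d, RamExec (c d) r (r.setR d (f (r.rreg d) (r.rreg (d + 1)))) k) →
      (∀ (d : ℕ) (r : RamState), 64 ≤ d → Agree s r →
        ∃ r', RamExec (a.comp d) r r' a.cost ∧ Agree s r' ∧ r'.rreg d = a.eval s ∧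
        (∀ i < d, r'.rreg i = r.rreg i)) →
      (∀ (d : ℕ) (r : RamState), 64 ≤ d → Agree s r →
        ∃ r', RamExec (b.comp d) r r' b.cost ∧ Agree s r' ∧ r'.rreg d = b.eval s ∧
        (∀ i < d, r'.rreg i = r.rreg i)) →
      ∀ (d : ℕ) (r : RamState), 64 ≤ d → Agree s r →
      ∃ r', RamExec (.seq (a.comp d) (.seq (b.comp (d + 1)) (c d))) r r'
          (a.cost + (b.cost + k)) ∧ Agree s r' ∧ r'.rreg d = f (a.eval s) (b.eval s) ∧
        (∀ i < d, r'.rreg i = r.rreg i) := by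
    intro a b c k f hc ha hb d r hd hr
    obtain ⟨r₁, e₁, g₁, v₁, k₁⟩ := ha d r hd hr
    obtain ⟨r₂, e₂, g₂, v₂, k₂⟩ := hb (d + 1) r₁ (by omega) g₁
    have hx := hc r₂ d
    rw [v₂, k₂ d (by omega), v₁] at hx
    exact ⟨_, .seq e₁ (.seq e₂ hx),
      upd _ _ _ _ hd g₂ (fun i hi => by rw [k₂ i (by omega), k₁ i hi])⟩
  have setR_self : ∀ (r : RamState) (d : ℕ), r.setR d (r.rreg d) = r := by
    intro r d
    simp [RamState.setR]
  induction e with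
  | reg i =>
    intro d r hd hr
    refine ⟨_, .instr _ _, ?_⟩
    have := hr.rreg i (by simpa [wf] using hw)
    simp only [RamInstr.apply, eval, this]
    exact upd _ _ _ _ hd hr (fun _ _ => rfl)
  | nat e =>
    intro d r hd hr
    obtain ⟨r₁, e₁, g₁, v₁, k₁, l₁⟩ := e.exec_comp hw 64 r le_rfl hr
    refine ⟨_, .seq e₁ (.instr _ _), ?_⟩
    simp only [RamInstr.apply, eval, v₁]
    exact upd _ _ _ _ hd g₁ (fun i _ => by rw [l₁])
  | load arr e =>
    intro d r hd hr
    obtain ⟨r₁, e₁, g₁, v₁, k₁, l₁⟩ := e.exec_comp hw 64 r le_rfl hr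
    refine ⟨_, .seq e₁ (.instr _ _), ?_⟩
    simp only [RamInstr.apply, eval, v₁, ← g₁.rarr]
    exact upd _ _ _ _ hd g₁ (fun i _ => by rw [l₁])
  | add a b iha ihb =>
    simp only [wf, Bool.and_eq_true] at hw
    exact bin a b _ 1 (· + ·) (fun r d => .instr _ _) (iha hw.1) (ihb hw.2)
  | sub a b iha ihb =>
    simp only [wf, Bool.and_eq_true] at hw
    exact bin a b _ 1 (· - ·) (fun r d => .instr _ _) (iha hw.1) (ihb hw.2)
  | mul a b iha ihb =>
    simp only [wf, Bool.and_eq_true] at hw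
    exact bin a b _ 1 (· * ·) (fun r d => .instr _ _) (iha hw.1) (ihb hw.2)
  | div a b iha ihb =>
    simp only [wf, Bool.and_eq_true] at hw
    exact bin a b _ 1 (· / ·) (fun r d => .instr _ _) (iha hw.1) (ihb hw.2)
  | max a b iha ihb =>
    simp only [wf, Bool.and_eq_true] at hw
    refine bin a b _ 2 Max.max (fun r d => ?_) (iha hw.1) (ihb hw.2)
    by_cases h : r.rreg d < r.rreg (d + 1)
    · rw [max_eq_right h.le]
      exact .ite_true h (.instr _ _)
    · rw [max_eq_left (not_lt.mp h), setR_self]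
      exact .ite_false h (.skip _)
  | min a b iha ihb =>
    simp only [wf, Bool.and_eq_true] at hw
    refine bin a b _ 2 Min.min (fun r d => ?_) (iha hw.1) (ihb hw.2)
    by_cases h : r.rreg (d + 1) < r.rreg d
    · rw [min_eq_right h.le]
      exact .ite_true h (.instr _ _)
    · rw [min_eq_left (not_lt.mp h), setR_self]
      exact .ite_false h (.skip _)
  | exp a ih =>
    intro d r hd hr
    obtain ⟨r₁, e₁, g₁, v₁, k₁⟩ := ih hw d r hd hr
    refine ⟨_, .seq e₁ (.instr _ _), ?_⟩
    simp only [RamInstr.apply, eval, v₁]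
    exact upd _ _ _ _ hd g₁ k₁
  | log a ih =>
    intro d r hd hr
    obtain ⟨r₁, e₁, g₁, v₁, k₁⟩ := ih hw d r hd hr
    refine ⟨_, .seq e₁ (.instr _ _), ?_⟩
    simp only [RamInstr.apply, eval, v₁]
    exact upd _ _ _ _ hd g₁ k₁

lemma HTest.exec_comp {s : RamState} (b : HTest) (hw : b.wf = true) (r : RamState)
    (hr : Agree s r) :
    ∃ r', RamExec b.comp r r' b.cost ∧ Agree s r' ∧ (b.test.holds r' ↔ b.holds s) := by
  cases b with
  | nlt a b =>
    simp only [wf, Bool.and_eq_true] at hw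
    obtain ⟨r₁, e₁, g₁, v₁, k₁, l₁⟩ := a.exec_comp hw.1 64 r le_rfl hr
    obtain ⟨r₂, e₂, g₂, v₂, k₂, l₂⟩ := b.exec_comp hw.2 65 r₁ (by omega) g₁
    refine ⟨r₂, .seq e₁ e₂, g₂, ?_⟩
    simp [test, RamTest.holds, v₂, k₂ 64 (by omega), v₁]
  | neq a b =>
    simp only [wf, Bool.and_eq_true] at hw
    obtain ⟨r₁, e₁, g₁, v₁, k₁, l₁⟩ := a.exec_comp hw.1 64 r le_rfl hr
    obtain ⟨r₂, e₂, g₂, v₂, k₂, l₂⟩ := b.exec_comp hw.2 65 r₁ (by omega) g₁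
    refine ⟨r₂, .seq e₁ e₂, g₂, ?_⟩
    simp [test, RamTest.holds, v₂, k₂ 64 (by omega), v₁]
  | rlt a b =>
    simp only [wf, Bool.and_eq_true] at hw
    obtain ⟨r₁, e₁, g₁, v₁, k₁⟩ := a.exec_comp hw.1 64 r le_rfl hr
    obtain ⟨r₂, e₂, g₂, v₂, k₂⟩ := b.exec_comp hw.2 65 r₁ (by omega) g₁
    refine ⟨r₂, .seq e₁ e₂, g₂, ?_⟩
    simp [test, RamTest.holds, v₂, k₂ 64 (by omega), v₁]

lemma Agree.test_iff {s r : RamState} (h : Agree s r) (b : RamTest) (hw : b.wf = true) :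
    b.holds s ↔ b.holds r := by
  cases b <;> simp only [RamTest.wf, Bool.and_eq_true, decide_eq_true_eq] at hw <;>
    simp [RamTest.holds, h.nreg _ hw.1, h.nreg _ hw.2, h.rreg _ hw.1, h.rreg _ hw.2]

/-- The compiled code simulates the structured command step by step. -/
theorem HExec.exec_comp {c : HCmd} {s s' : RamState} {t : ℕ} (h : HExec c s s' t)
    (hw : c.wf = true) : ∀ r, Agree s r → ∃ r', RamExec c.comp r r' t ∧ Agree s' r' := by
  induction h with
  | skip s => exact fun r hr => ⟨r, .skip r, hr⟩
  | asgN d e s =>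
    intro r hr
    simp only [HCmd.wf, Bool.and_eq_true, decide_eq_true_eq] at hw
    obtain ⟨r₁, e₁, g₁, v₁, -, -⟩ := e.exec_comp hw.2 64 r le_rfl hr
    refine ⟨_, .seq e₁ (.instr _ _), ?_⟩
    simp only [RamInstr.apply, v₁]
    exact g₁.setN _ _
  | asgR d e s =>
    intro r hr
    simp only [HCmd.wf, Bool.and_eq_true, decide_eq_true_eq] at hw
    obtain ⟨r₁, e₁, g₁, v₁, -⟩ := e.exec_comp hw.2 64 r le_rfl hr
    refine ⟨_, .seq e₁ (.instr _ _), ?_⟩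
    simp only [RamInstr.apply, v₁]
    exact g₁.setR _ _
  | stN arr i e s =>
    intro r hr
    simp only [HCmd.wf, Bool.and_eq_true] at hw
    obtain ⟨r₁, e₁, g₁, v₁, k₁, -⟩ := i.exec_comp hw.1 64 r le_rfl hr
    obtain ⟨r₂, e₂, g₂, v₂, k₂, -⟩ := e.exec_comp hw.2 65 r₁ (by omega) g₁
    refine ⟨_, .seq e₁ (.seq e₂ (.instr _ _)), ?_⟩
    simp only [RamInstr.apply, v₂, k₂ 64 (by omega), v₁]
    exact ⟨g₂.nreg, g₂.rreg, by simp [RamState.setNArr, g₂.narr], g₂.rarr⟩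
  | stR arr i e s =>
    intro r hr
    simp only [HCmd.wf, Bool.and_eq_true] at hw
    obtain ⟨r₁, e₁, g₁, v₁, k₁⟩ := e.exec_comp hw.2 64 r le_rfl hr
    obtain ⟨r₂, e₂, g₂, v₂, k₂, l₂⟩ := i.exec_comp hw.1 64 r₁ (by omega) g₁
    refine ⟨_, .seq e₁ (.seq e₂ (.instr _ _)), ?_⟩
    simp only [RamInstr.apply, v₂, l₂, v₁]
    exact ⟨g₂.nreg, g₂.rreg, g₂.narr, by simp [RamState.setRArr, g₂.rarr]⟩
  | seq _ _ ih₁ ih₂ =>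
    intro r hr
    simp only [HCmd.wf, Bool.and_eq_true] at hw
    obtain ⟨r₁, e₁, g₁⟩ := ih₁ hw.1 r hr
    obtain ⟨r₂, e₂, g₂⟩ := ih₂ hw.2 r₁ g₁
    exact ⟨r₂, .seq e₁ e₂, g₂⟩
  | ite_true hb _ ih =>
    intro r hr
    simp only [HCmd.wf, Bool.and_eq_true] at hw
    obtain ⟨r₁, e₁, g₁, v₁⟩ := HTest.exec_comp _ hw.1.1 r hr
    obtain ⟨r₂, e₂, g₂⟩ := ih hw.1.2 r₁ g₁
    exact ⟨r₂, .seq e₁ (.ite_true (v₁.mpr hb) e₂), g₂⟩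
  | ite_false hb _ ih =>
    intro r hr
    simp only [HCmd.wf, Bool.and_eq_true] at hw
    obtain ⟨r₁, e₁, g₁, v₁⟩ := HTest.exec_comp _ hw.1.1 r hr
    obtain ⟨r₂, e₂, g₂⟩ := ih hw.2 r₁ g₁
    exact ⟨r₂, .seq e₁ (.ite_false (mt v₁.mp hb) e₂), g₂⟩
  | loop_true hb _ _ ih₁ ih₂ =>
    intro r hr
    have hw' := hw
    simp only [HCmd.wf, Bool.and_eq_true] at hw
    obtain ⟨r₁, e₁, g₁⟩ := ih₁ hw.2 r hr
    obtain ⟨r₂, e₂, g₂⟩ := ih₂ hw' r₁ g₁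
    exact ⟨r₂, .loop_true ((hr.test_iff _ hw.1).mp hb) e₁ e₂, g₂⟩
  | loop_false hb =>
    intro r hr
    simp only [HCmd.wf, Bool.and_eq_true] at hw
    exact ⟨r, .loop_false (mt (hr.test_iff _ hw.1).mpr hb), hr⟩

end

noncomputable section

/-! ### A program logic for total correctness with running times -/

namespace HCmd

/-- The integer register `r` is assigned somewhere in the command. -/
def wN (r : ℕ) : HCmd → Bool
  | asgN d _ => d == r
  | seq c₁ c₂ => c₁.wN r || c₂.wN r
  | ite _ c₁ c₂ => c₁.wN r || c₂.wN r
  | loop _ c => c.wN r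
  | _ => false

/-- The real register `r` is assigned somewhere in the command. -/
def wR (r : ℕ) : HCmd → Bool
  | asgR d _ => d == r
  | seq c₁ c₂ => c₁.wR r || c₂.wR r
  | ite _ c₁ c₂ => c₁.wR r || c₂.wR r
  | loop _ c => c.wR r
  | _ => false

/-- The integer array `a` is written somewhere in the command. -/
def wNA (a : ℕ) : HCmd → Bool
  | stN d _ _ => d == a
  | seq c₁ c₂ => c₁.wNA a || c₂.wNA a
  | ite _ c₁ c₂ => c₁.wNA a || c₂.wNA a
  | loop _ c => c.wNA a
  | _ => false

/-- The real array `a` is written somewhere in the command. -/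
def wRA (a : ℕ) : HCmd → Bool
  | stR d _ _ => d == a
  | seq c₁ c₂ => c₁.wRA a || c₂.wRA a
  | ite _ c₁ c₂ => c₁.wRA a || c₂.wRA a
  | loop _ c => c.wRA a
  | _ => false

end HCmd

/-- The states `s` and `s'` agree on everything that the command `c` does not write. -/
structure Frame (c : HCmd) (s s' : RamState) : Prop where
  n : ∀ r, c.wN r = false → s'.nreg r = s.nreg r
  r : ∀ r, c.wR r = false → s'.rreg r = s.rreg r
  na : ∀ a, c.wNA a = false → s'.narr a = s.narr a
  ra : ∀ a, c.wRA a = false → s'.rarr a = s.rarr a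

lemma Frame.refl (c : HCmd) (s : RamState) : Frame c s s :=
  ⟨fun _ _ => rfl, fun _ _ => rfl, fun _ _ => rfl, fun _ _ => rfl⟩

lemma Frame.trans {c : HCmd} {s s' s'' : RamState} (h : Frame c s s') (h' : Frame c s' s'') :
    Frame c s s'' :=
  ⟨fun r hr => (h'.n r hr).trans (h.n r hr), fun r hr => (h'.r r hr).trans (h.r r hr),
    fun r hr => (h'.na r hr).trans (h.na r hr), fun r hr => (h'.ra r hr).trans (h.ra r hr)⟩

/-- `c` writes at most what `c'` writes. -/
def HCmd.Sub (c c' : HCmd) : Prop :=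
  (∀ r, c'.wN r = false → c.wN r = false) ∧ (∀ r, c'.wR r = false → c.wR r = false) ∧
    (∀ r, c'.wNA r = false → c.wNA r = false) ∧ (∀ r, c'.wRA r = false → c.wRA r = false)

lemma Frame.mono {c c' : HCmd} {s s' : RamState} (h : Frame c s s') (hc : c.Sub c') :
    Frame c' s s' :=
  ⟨fun r hr => h.n r (hc.1 r hr), fun r hr => h.r r (hc.2.1 r hr),
    fun r hr => h.na r (hc.2.2.1 r hr), fun r hr => h.ra r (hc.2.2.2 r hr)⟩

lemma HCmd.sub_seq_left (c c' : HCmd) : c.Sub (c ;; c') := by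
  simp +contextual [HCmd.Sub, wN, wR, wNA, wRA]
lemma HCmd.sub_seq_right (c c' : HCmd) : c'.Sub (c ;; c') := by
  simp +contextual [HCmd.Sub, wN, wR, wNA, wRA]
lemma HCmd.sub_ite_left (b : HTest) (c c' : HCmd) : c.Sub (.ite b c c') := by
  simp +contextual [HCmd.Sub, wN, wR, wNA, wRA]
lemma HCmd.sub_ite_right (b : HTest) (c c' : HCmd) : c'.Sub (.ite b c c') := by
  simp +contextual [HCmd.Sub, wN, wR, wNA, wRA]
lemma HCmd.sub_loop (b : RamTest) (c : HCmd) : c.Sub (.loop b c) := by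
  simp [HCmd.Sub, wN, wR, wNA, wRA]

/-- What a command does not write does not change. Since the write sets are computed by recursion on
the command, a frame condition for a concrete program is proved by `rfl`. -/
theorem HExec.frame {c : HCmd} {s s' : RamState} {t : ℕ} (h : HExec c s s' t) : Frame c s s' := by
  induction h with
  | skip s => exact .refl _ _
  | asgN d e s =>
    refine ⟨fun r hr => ?_, fun _ _ => rfl, fun _ _ => rfl, fun _ _ => rfl⟩
    simp only [HCmd.wN, beq_eq_false_iff_ne] at hr
    rw [setN_nreg, if_neg (Ne.symm hr)]
  | asgR d e s =>
    refine ⟨fun _ _ => rfl, fun r hr => ?_, fun _ _ => rfl, fun _ _ => rfl⟩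
    simp only [HCmd.wR, beq_eq_false_iff_ne] at hr
    rw [setR_rreg, if_neg (Ne.symm hr)]
  | stN arr i e s =>
    refine ⟨fun _ _ => rfl, fun _ _ => rfl, fun r hr => ?_, fun _ _ => rfl⟩
    simp only [HCmd.wNA, beq_eq_false_iff_ne] at hr
    rw [setNArr_narr, if_neg (Ne.symm hr)]
  | stR arr i e s =>
    refine ⟨fun _ _ => rfl, fun _ _ => rfl, fun _ _ => rfl, fun r hr => ?_⟩
    simp only [HCmd.wRA, beq_eq_false_iff_ne] at hr
    rw [setRArr_rarr, if_neg (Ne.symm hr)]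
  | seq _ _ ih₁ ih₂ =>
    exact (ih₁.mono (HCmd.sub_seq_left _ _)).trans (ih₂.mono (HCmd.sub_seq_right _ _))
  | ite_true _ _ ih => exact ih.mono (HCmd.sub_ite_left _ _ _)
  | ite_false _ _ ih => exact ih.mono (HCmd.sub_ite_right _ _ _)
  | loop_true _ _ _ ih₁ ih₂ => exact (ih₁.mono (HCmd.sub_loop _ _)).trans ih₂
  | loop_false _ => exact .refl _ _

/-- Started in `s`, the command `c` halts within `T` steps in a state that satisfies `Q`. -/
def Run (c : HCmd) (s : RamState) (T : ℕ) (Q : RamState → Prop) : Prop :=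
  ∃ s' t, HExec c s s' t ∧ t ≤ T ∧ Q s'

namespace Run

variable {c c₁ c₂ : HCmd} {s : RamState} {T T' T₁ T₂ : ℕ} {Q Q' Q₁ : RamState → Prop}

lemma mono (h : Run c s T Q) (hT : T ≤ T') (hQ : ∀ s', Q s' → Q' s') : Run c s T' Q' := by
  obtain ⟨s', t, he, ht, hq⟩ := h
  exact ⟨s', t, he, ht.trans hT, hQ _ hq⟩

lemma time_le (h : Run c s T Q) (hT : T ≤ T') : Run c s T' Q := h.mono hT fun _ => id

lemma frame (h : Run c s T Q) : Run c s T (fun s' => Frame c s s' ∧ Q s') := by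
  obtain ⟨s', t, he, ht, hq⟩ := h
  exact ⟨s', t, he, ht, he.frame, hq⟩

lemma seq (h₁ : Run c₁ s T₁ Q₁) (h₂ : ∀ s₁, Frame c₁ s s₁ → Q₁ s₁ → Run c₂ s₁ T₂ Q) :
    Run (c₁ ;; c₂) s (T₁ + T₂) Q := by
  obtain ⟨s₁, t₁, he₁, ht₁, hq₁⟩ := h₁
  obtain ⟨s₂, t₂, he₂, ht₂, hq₂⟩ := h₂ s₁ he₁.frame hq₁
  exact ⟨s₂, _, .seq he₁ he₂, Nat.add_le_add ht₁ ht₂, hq₂⟩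

end Run

namespace HCmd

/-- No loops. -/
def straight : HCmd → Bool
  | seq c₁ c₂ => c₁.straight && c₂.straight
  | ite _ c₁ c₂ => c₁.straight && c₂.straight
  | loop _ _ => false
  | _ => true

/-- A bound for the running time of a loop-free command. -/
def cost : HCmd → ℕ
  | skip => 1
  | asgN _ e => e.cost + 1
  | asgR _ e => e.cost + 1
  | stN _ i e => i.cost + (e.cost + 1)
  | stR _ i e => e.cost + (i.cost + 1)
  | seq c₁ c₂ => c₁.cost + c₂.cost
  | ite b c₁ c₂ => b.cost + (Nat.max c₁.cost c₂.cost + 1)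
  | loop _ _ => 0

open Classical in
/-- The effect of a loop-free command. -/
def eff : HCmd → RamState → RamState
  | skip, s => s
  | asgN d e, s => s.setN d (e.eval s)
  | asgR d e, s => s.setR d (e.eval s)
  | stN arr i e, s => s.setNArr arr (i.eval s) (e.eval s)
  | stR arr i e, s => s.setRArr arr (i.eval s) (e.eval s)
  | seq c₁ c₂, s => c₂.eff (c₁.eff s)
  | ite b c₁ c₂, s => if b.holds s then c₁.eff s else c₂.eff s
  | loop _ _, s => s

end HCmd

/-- Loop-free commands are executed symbolically. -/
lemma Run.straight {c : HCmd} {s : RamState} {T : ℕ} {Q : RamState → Prop}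
    (hc : c.straight = true) (hT : c.cost ≤ T) (hQ : Q (c.eff s)) : Run c s T Q := by
  suffices h : ∀ (c : HCmd), c.straight = true → ∀ s, ∃ t, HExec c s (c.eff s) t ∧ t ≤ c.cost by
    obtain ⟨t, he, ht⟩ := h c hc s
    exact ⟨_, t, he, ht.trans hT, hQ⟩
  clear hc hT hQ
  intro c
  induction c with
  | skip => exact fun _ s => ⟨_, .skip s, le_rfl⟩
  | asgN d e => exact fun _ s => ⟨_, .asgN d e s, le_rfl⟩
  | asgR d e => exact fun _ s => ⟨_, .asgR d e s, le_rfl⟩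
  | stN a i e => exact fun _ s => ⟨_, .stN a i e s, le_rfl⟩
  | stR a i e => exact fun _ s => ⟨_, .stR a i e s, le_rfl⟩
  | seq c₁ c₂ ih₁ ih₂ =>
    intro h s
    simp only [HCmd.straight, Bool.and_eq_true] at h
    obtain ⟨t₁, e₁, h₁⟩ := ih₁ h.1 s
    obtain ⟨t₂, e₂, h₂⟩ := ih₂ h.2 (c₁.eff s)
    exact ⟨_, .seq e₁ e₂, Nat.add_le_add h₁ h₂⟩
  | ite b c₁ c₂ ih₁ ih₂ =>
    intro h s
    simp only [HCmd.straight, Bool.and_eq_true] at h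
    by_cases hb : b.holds s
    · obtain ⟨t₁, e₁, h₁⟩ := ih₁ h.1 s
      refine ⟨_, by simpa [HCmd.eff, hb] using HExec.ite_true hb e₁, ?_⟩
      exact Nat.add_le_add_left (Nat.add_le_add_right (h₁.trans (Nat.le_max_left _ _)) 1) _
    · obtain ⟨t₁, e₁, h₁⟩ := ih₂ h.2 s
      refine ⟨_, by simpa [HCmd.eff, hb] using HExec.ite_false hb e₁, ?_⟩
      exact Nat.add_le_add_left (Nat.add_le_add_right (h₁.trans (Nat.le_max_right _ _)) 1) _
  | loop b c _ =>
    intro h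
    simp [HCmd.straight] at h

/-- Prepending a loop-free command. -/
lemma Run.straight_seq {c c₂ : HCmd} {s : RamState} {T T₂ : ℕ} {Q : RamState → Prop}
    (hc : c.straight = true) (h : Run c₂ (c.eff s) T₂ Q) (hT : c.cost + T₂ ≤ T) :
    Run (c ;; c₂) s T Q := by
  obtain ⟨s₁, t₁, he₁, ht₁, hq₁⟩ := Run.straight (Q := fun s' => s' = c.eff s) hc le_rfl rfl
  obtain ⟨s₂, t₂, he₂, ht₂, hq₂⟩ := h
  subst hq₁
  exact ⟨s₂, _, .seq he₁ he₂, (Nat.add_le_add ht₁ ht₂).trans hT, hq₂⟩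

lemma Run.ite {b : HTest} {c₁ c₂ : HCmd} {s : RamState} {T : ℕ} {Q : RamState → Prop}
    (h₁ : b.holds s → Run c₁ s T Q) (h₂ : ¬ b.holds s → Run c₂ s T Q) :
    Run (.ite b c₁ c₂) s (b.cost + (T + 1)) Q := by
  by_cases hb : b.holds s
  · obtain ⟨s', t, he, ht, hq⟩ := h₁ hb
    exact ⟨s', _, .ite_true hb he, by omega, hq⟩
  · obtain ⟨s', t, he, ht, hq⟩ := h₂ hb
    exact ⟨s', _, .ite_false hb he, by omega, hq⟩

/-- While loops: `Inv j` holds when at most `j` further iterations are needed. -/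
lemma Run.loop {b : RamTest} {c : HCmd} {τ : ℕ} (Inv : ℕ → RamState → Prop) (N : ℕ)
    {s : RamState} (h0 : Inv N s)
    (hexit : ∀ s', Frame (.loop b c) s s' → Inv 0 s' → ¬ b.holds s')
    (hstep : ∀ j s', Frame (.loop b c) s s' → Inv (j + 1) s' → b.holds s' → Run c s' τ (Inv j)) :
    Run (.loop b c) s (N * (τ + 1) + 1)
      (fun s' => Frame (.loop b c) s s' ∧ (∃ j ≤ N, Inv j s') ∧ ¬ b.holds s') := by
  suffices H : ∀ N s₁, Frame (.loop b c) s s₁ → Inv N s₁ →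
      Run (.loop b c) s₁ (N * (τ + 1) + 1)
        (fun s' => Frame (.loop b c) s s' ∧ (∃ j ≤ N, Inv j s') ∧ ¬ b.holds s') from
    H N s (.refl _ _) h0
  intro N
  induction N with
  | zero =>
    intro s₁ hf h
    exact ⟨s₁, _, .loop_false (hexit _ hf h), by omega, hf, ⟨0, le_rfl, h⟩, hexit _ hf h⟩
  | succ N ih =>
    intro s₁ hf h
    by_cases hb : b.holds s₁
    · obtain ⟨s₂, t₂, he₂, ht₂, h₂⟩ := hstep N s₁ hf h hb
      obtain ⟨s₃, t₃, he₃, ht₃, hf₃, ⟨j, hj, hj'⟩, h₃⟩ :=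
        ih s₂ (hf.trans (he₂.frame.mono (HCmd.sub_loop _ _))) h₂
      refine ⟨s₃, _, .loop_true hb he₂ he₃, ?_, hf₃, ⟨j, by omega, hj'⟩, h₃⟩
      rw [Nat.succ_mul]
      omega
    · exact ⟨s₁, _, .loop_false hb, by omega, hf, ⟨N + 1, le_rfl, h⟩, hb⟩

/-- `for i in [0, lim) do c`, where `lim` is a register. -/
def forLoop (i lim : ℕ) (c : HCmd) : HCmd :=
  .asgN i (.const 0) ;; .loop (.nlt i lim) (c ;; .asgN i (.add (.reg i) (.const 1)))

/-- For loops; the invariant is stated for states whose loop counter is already advanced. -/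
lemma Run.forLoop {i lim : ℕ} {c : HCmd} {s : RamState} {n : ℕ} (hn : s.nreg lim = n)
    (hi : c.wN i = false) (hl : (forLoop i lim c).wN lim = false)
    (Inv : ℕ → RamState → Prop) (τ : ℕ → ℕ) (h0 : Inv 0 (s.setN i 0))
    (hstep : ∀ k < n, ∀ s', Frame (forLoop i lim c) s s' → s'.nreg i = k → Inv k s' →
      Run c s' (τ k) (fun s'' => Inv (k + 1) (s''.setN i (k + 1)))) :
    Run (forLoop i lim c) s (∑ k ∈ range n, (τ k + 5) + 3)
      (fun s' => Frame (forLoop i lim c) s s' ∧ s'.nreg i = n ∧ Inv n s') := by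
  have hne : i ≠ lim := by
    rintro rfl
    simp [_root_.forLoop, HCmd.wN] at hl
  have key : ∀ j k s₁, k + j = n → Frame (_root_.forLoop i lim c) s s₁ → s₁.nreg i = k → Inv k s₁ →
      Run (.loop (.nlt i lim) (c ;; .asgN i (.add (.reg i) (.const 1)))) s₁
        (∑ l ∈ range j, (τ (k + l) + 5) + 1)
        (fun s' => Frame (_root_.forLoop i lim c) s s' ∧ s'.nreg i = n ∧ Inv n s') := by
    intro j
    induction j with
    | zero =>
      intro k s₁ hk hf hik hI
      obtain rfl : k = n := by omega
      refine ⟨s₁, _, .loop_false ?_, by simp, hf, hik, hI⟩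
      simp [RamTest.holds, hf.n lim hl, hn, hik]
    | succ j ih =>
      intro k s₁ hk hf hik hI
      obtain ⟨s₂, t₂, he₂, ht₂, h₂⟩ := hstep k (by omega) s₁ hf hik hI
      have hi2 : s₂.nreg i = k := by rw [he₂.frame.n i hi, hik]
      have hev : (NExp.add (.reg i) (.const 1)).eval s₂ = k + 1 := by simp [NExp.eval, hi2]
      have hst := HExec.seq he₂ (.asgN i (.add (.reg i) (.const 1)) s₂)
      rw [hev] at hst
      have hf2 : Frame (_root_.forLoop i lim c) s (s₂.setN i (k + 1)) :=
        hf.trans (hst.frame.mono ⟨fun r hr => by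
          simp only [_root_.forLoop, HCmd.wN, Bool.or_eq_false_iff] at hr ⊢; exact hr.2,
          fun r hr => by simpa [_root_.forLoop, HCmd.wR] using hr,
          fun r hr => by simpa [_root_.forLoop, HCmd.wNA] using hr,
          fun r hr => by simpa [_root_.forLoop, HCmd.wRA] using hr⟩)
      obtain ⟨s₃, t₃, he₃, ht₃, h₃⟩ := ih (k + 1) (s₂.setN i (k + 1)) (by omega) hf2 (by simp) h₂
      refine ⟨s₃, _, .loop_true ?_ hst he₃, ?_, h₃⟩
      · simp only [RamTest.holds, hik, hf.n lim hl, hn]; omega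
      · rw [Finset.sum_range_succ']
        simp only [NExp.cost, add_zero]
        have : ∑ l ∈ range j, (τ (k + (l + 1)) + 5) = ∑ l ∈ range j, (τ (k + 1 + l) + 5) :=
          Finset.sum_congr rfl fun l _ => by rw [Nat.add_assoc, Nat.add_comm 1 l]
        omega
  have e0 := HExec.asgN i (.const 0) s
  have hf0 : Frame (_root_.forLoop i lim c) s (s.setN i 0) := e0.frame.mono (HCmd.sub_seq_left _ _)
  obtain ⟨s₃, t₃, he₃, ht₃, h₃⟩ := key n 0 (s.setN i 0) (by omega) hf0 (by simp) h0
  refine ⟨s₃, _, .seq e0 he₃, ?_, h₃⟩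
  simp only [NExp.cost, zero_add] at ht₃ ⊢
  omega

/-- For loops whose iterations all have the same time bound. -/
lemma Run.forLoop_const {i lim : ℕ} {c : HCmd} {s : RamState} {n : ℕ} (hn : s.nreg lim = n)
    (hi : c.wN i = false) (hl : (_root_.forLoop i lim c).wN lim = false)
    (Inv : ℕ → RamState → Prop) (τ T : ℕ) (h0 : Inv 0 (s.setN i 0))
    (hstep : ∀ k < n, ∀ s', Frame (_root_.forLoop i lim c) s s' → s'.nreg i = k → Inv k s' →
      Run c s' τ (fun s'' => Inv (k + 1) (s''.setN i (k + 1))))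
    (hT : n * (τ + 5) + 3 ≤ T) :
    Run (_root_.forLoop i lim c) s T
      (fun s' => Frame (_root_.forLoop i lim c) s s' ∧ s'.nreg i = n ∧ Inv n s') := by
  refine (Run.forLoop hn hi hl Inv (fun _ => τ) h0 hstep).time_le ?_
  rw [Finset.sum_const, card_range, smul_eq_mul]
  exact hT

/-- `for i in [0, lim) do arr[i] := e`, provided that the value of `e` in iteration `k` does not
depend on the cells written before. -/
lemma Run.mapR {i lim arr : ℕ} {e : RExp} {s : RamState} {n : ℕ} (F : ℕ → ℝ) (hne : i ≠ lim)
    (hn : s.nreg lim = n) {T : ℕ}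
    (hF : ∀ k < n, ∀ s', Frame (_root_.forLoop i lim (.stR arr (.reg i) e)) s s' → s'.nreg i = k →
      (∀ j, k ≤ j → s'.rarr arr j = s.rarr arr j) → e.eval s' = F k)
    (hT : n * (e.cost + 7) + 3 ≤ T) :
    Run (_root_.forLoop i lim (.stR arr (.reg i) e)) s T
      (fun s' => ∀ j, s'.rarr arr j = if j < n then F j else s.rarr arr j) := by
  refine (Run.forLoop_const hn rfl (by simpa [_root_.forLoop, HCmd.wN] using hne)
    (fun k s' => ∀ j, s'.rarr arr j = if j < k then F j else s.rarr arr j) (e.cost + 2) T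
    (by simp) ?_ (by simpa using hT)).mono le_rfl (fun s' h => h.2.2)
  intro k hk s' hf hik hI
  refine Run.straight rfl (by simp [HCmd.cost, NExp.cost]) ?_
  intro j
  have := hF k hk s' hf hik (fun j hj => by rw [hI j, if_neg (by omega)])
  simp only [HCmd.eff, this, NExp.eval_reg, hik, setN_rarr, setRArr_rarr, if_true,
    Function.update_apply, hI j]
  split_ifs <;> first | omega | (subst_vars; rfl)

/-- `for i in [0, lim) do arr[i] := e` for integer arrays. -/
lemma Run.mapN {i lim arr : ℕ} {e : NExp} {s : RamState} {n : ℕ} (F : ℕ → ℕ) (hne : i ≠ lim)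
    (hn : s.nreg lim = n) {T : ℕ}
    (hF : ∀ k < n, ∀ s', Frame (_root_.forLoop i lim (.stN arr (.reg i) e)) s s' → s'.nreg i = k →
      (∀ j, k ≤ j → s'.narr arr j = s.narr arr j) → e.eval s' = F k)
    (hT : n * (e.cost + 7) + 3 ≤ T) :
    Run (_root_.forLoop i lim (.stN arr (.reg i) e)) s T
      (fun s' => ∀ j, s'.narr arr j = if j < n then F j else s.narr arr j) := by
  refine (Run.forLoop_const hn rfl (by simpa [_root_.forLoop, HCmd.wN] using hne)
    (fun k s' => ∀ j, s'.narr arr j = if j < k then F j else s.narr arr j) (e.cost + 2) T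
    (by simp) ?_ (by simpa using hT)).mono le_rfl (fun s' h => h.2.2)
  intro k hk s' hf hik hI
  refine Run.straight rfl (by simp [HCmd.cost, NExp.cost]; omega) ?_
  intro j
  have := hF k hk s' hf hik (fun j hj => by rw [hI j, if_neg (by omega)])
  simp only [HCmd.eff, this, NExp.eval_reg, hik, setN_narr, setNArr_narr, if_true,
    Function.update_apply, hI j]
  split_ifs <;> first | omega | (subst_vars; rfl)

/-- `x := e₀; for i in [0, lim) do x := e`, where the value of `e` is a function of the
iteration and of the current value of `x`. -/
lemma Run.foldR {i lim x : ℕ} {e₀ e : RExp} {s : RamState} {n : ℕ} (F : ℕ → ℝ → ℝ) (a₀ : ℝ)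
    (hne : i ≠ lim) (hn : s.nreg lim = n) {T : ℕ} (h0 : e₀.eval s = a₀)
    (hF : ∀ k < n, ∀ s', Frame (.asgR x e₀ ;; _root_.forLoop i lim (.asgR x e)) s s' →
      s'.nreg i = k → e.eval s' = F k (s'.rreg x))
    (hT : n * (e.cost + 6) + e₀.cost + 4 ≤ T) :
    Run (.asgR x e₀ ;; _root_.forLoop i lim (.asgR x e)) s T
      (fun s' => s'.rreg x = Nat.rec (motive := fun _ => ℝ) a₀ F n) := by
  refine Run.straight_seq (T₂ := n * (e.cost + 6) + 3) rfl ?_ (by simp [HCmd.cost]; omega)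
  have hfr : Frame (.asgR x e₀ ;; _root_.forLoop i lim (.asgR x e)) s ((HCmd.asgR x e₀).eff s) :=
    (HExec.asgR x e₀ s).frame.mono (HCmd.sub_seq_left _ _)
  refine (Run.forLoop_const (by simpa [HCmd.eff] using hn) rfl
    (by simpa [_root_.forLoop, HCmd.wN] using hne)
    (fun k s' => s'.rreg x = Nat.rec (motive := fun _ => ℝ) a₀ F k) (e.cost + 1) _
    (by simp [HCmd.eff, h0]) ?_ le_rfl).mono le_rfl (fun s' h => h.2.2)
  intro k hk s' hf hik hI
  refine Run.straight rfl le_rfl ?_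
  have := hF k hk s' (hfr.trans (hf.mono (HCmd.sub_seq_right _ _))) hik
  simp [HCmd.eff, this, hI]

/-- The value of a summation loop. -/
lemma Nat.rec_add_eq_sum (F : ℕ → ℝ) (n : ℕ) :
    Nat.rec (motive := fun _ => ℝ) 0 (fun k x => x + F k) n = ∑ k ∈ range n, F k := by
  induction n with
  | zero => simp
  | succ n ih => rw [Finset.sum_range_succ, ← ih]

end

noncomputable section

/-! ### Area convexity of the regularizer -/

/-- Gibbs' inequality for one coordinate. -/
lemma sub_le_mul_log_sub {y r : ℝ} (hy : 0 ≤ y) (hr : 0 < r) :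
    y - r ≤ y * Real.log y - y * Real.log r := by
  rcases hy.eq_or_lt with rfl | hy
  · simp [hr.le]
  · have h := Real.log_le_sub_one_of_pos (div_pos hr hy)
    rw [Real.log_div hr.ne' hy.ne'] at h
    have h2 : y * (r / y) = r := by field_simp
    nlinarith

/-- The constant `11 / 20` instead of `1 / 2` pays for the cubic term on this range of exponents. -/
lemma exp_le_quadratic {v : ℝ} (h₁ : -(2 / 5) ≤ v) (h₂ : v ≤ 1 / 4) :
    Real.exp v ≤ 1 + v + 11 / 20 * v ^ 2 := by
  have h := Real.exp_bound (x := v) (abs_le.mpr ⟨by linarith, by linarith⟩) (n := 4) (by norm_num)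
  have h3 := (abs_le.mp h).2
  rw [show |v| ^ 4 = v ^ 4 from Even.pow_abs (by decide) v] at h3
  norm_num [Finset.sum_range_succ, Nat.factorial] at h3
  have : v ^ 2 * (1 / 20 - v / 6 - 5 / 96 * v ^ 2) ≥ 0 := by
    apply mul_nonneg (sq_nonneg v)
    nlinarith
  nlinarith

/-- The part of one query coordinate in the proof of area convexity: `τ` is `±√3 / 27`, and `v` is
the exponent that Gibbs' inequality produces. -/
lemma exponent_bounds {a a' a'' τ : ℝ} (h : a ∈ Set.Icc (0 : ℝ) 1) (h' : a' ∈ Set.Icc (0 : ℝ) 1)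
    (h'' : a'' ∈ Set.Icc (0 : ℝ) 1) (hτ : τ ^ 2 = 1 / 243) :
    Real.exp (-(a ^ 2 - ((a + a' + a'') / 3) ^ 2) / 3 + τ * (a'' - a')) ≤
      1 + (-(a ^ 2 - ((a + a' + a'') / 3) ^ 2) / 3 + τ * (a'' - a')) +
      11 / 20 * (14 / 27 * (a - (a + a' + a'') / 3) ^ 2 + 7 / 243 * (a'' - a') ^ 2) := by
  obtain ⟨h0, h1⟩ := h
  obtain ⟨h0', h1'⟩ := h'
  obtain ⟨h0'', h1''⟩ := h''
  set b := (a + a' + a'') / 3 with hb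
  have hb0 : 0 ≤ b := by positivity
  have hb1 : b ≤ 1 := by rw [hb]; linarith
  have hτ' : |τ| ≤ 13 / 200 := abs_le_of_sq_le_sq (by rw [hτ]; norm_num) (by norm_num)
  have hq : |τ * (a'' - a')| ≤ 13 / 200 := by
    rw [abs_mul]
    have : |a'' - a'| ≤ 1 := abs_le.mpr ⟨by linarith, by linarith⟩
    nlinarith [abs_nonneg τ, abs_nonneg (a'' - a')]
  obtain ⟨hq1, hq2⟩ := abs_le.mp hq
  have hp1 : a ^ 2 - b ^ 2 ≤ 1 := by nlinarith
  have hp2 : b ^ 2 - a ^ 2 ≤ 1 / 2 := by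
    have : b ≤ (2 + a) / 3 := by rw [hb]; linarith
    nlinarith [sq_nonneg (4 * a - 1)]
  refine (exp_le_quadratic (by linarith) (by linarith)).trans ?_
  have hp : ((a ^ 2 - b ^ 2) / 3) ^ 2 ≤ 4 / 9 * (a - b) ^ 2 := by
    have : (a ^ 2 - b ^ 2) ^ 2 = (a + b) ^ 2 * (a - b) ^ 2 := by ring
    have h4 : (a + b) ^ 2 ≤ 4 := by nlinarith
    nlinarith [mul_le_mul_of_nonneg_right h4 (sq_nonneg (a - b))]
  have hqq : (τ * (a'' - a')) ^ 2 = 1 / 243 * (a'' - a') ^ 2 := by rw [mul_pow, hτ]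
  -- `(p + q)² ≤ (7/6) p² + 7 q²`, weighted so that both parts fit into the available slack
  have hv : (-(a ^ 2 - b ^ 2) / 3 + τ * (a'' - a')) ^ 2 ≤
      7 / 6 * ((a ^ 2 - b ^ 2) / 3) ^ 2 + 7 * (τ * (a'' - a')) ^ 2 := by
    nlinarith [sq_nonneg ((a ^ 2 - b ^ 2) / 3 + 6 * (τ * (a'' - a')))]
  nlinarith

/-- Area convexity of `y a² + 3 y log y` on `[0, ∞) × [0, 1]`, signed form. After Gibbs' inequality
it says that three exponentials with explicit exponents sum to at most `3`. -/
lemma area_le_of_sq {y₁ y₂ y₃ a₁ a₂ a₃ τ : ℝ} (hy₁ : 0 ≤ y₁) (hy₂ : 0 ≤ y₂) (hy₃ : 0 ≤ y₃)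
    (h₁ : a₁ ∈ Set.Icc (0 : ℝ) 1) (h₂ : a₂ ∈ Set.Icc (0 : ℝ) 1) (h₃ : a₃ ∈ Set.Icc (0 : ℝ) 1)
    (hτ : τ ^ 2 = 1 / 243) :
    3 * τ * ((a₁ * y₂ - y₁ * a₂) + (a₂ * y₃ - y₂ * a₃) + (a₃ * y₁ - y₃ * a₁)) ≤
      (y₁ * a₁ ^ 2 + 3 * (y₁ * Real.log y₁)) + (y₂ * a₂ ^ 2 + 3 * (y₂ * Real.log y₂)) +
      (y₃ * a₃ ^ 2 + 3 * (y₃ * Real.log y₃)) -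
      3 * ((y₁ + y₂ + y₃) / 3 * ((a₁ + a₂ + a₃) / 3) ^ 2 +
        3 * ((y₁ + y₂ + y₃) / 3 * Real.log ((y₁ + y₂ + y₃) / 3))) := by
  have e₁ := exponent_bounds h₁ h₂ h₃ hτ
  have e₂ := exponent_bounds h₂ h₃ h₁ hτ
  have e₃ := exponent_bounds h₃ h₁ h₂ hτ
  rw [show a₂ + a₃ + a₁ = a₁ + a₂ + a₃ by ring] at e₂
  rw [show a₃ + a₁ + a₂ = a₁ + a₂ + a₃ by ring] at e₃
  set b := (a₁ + a₂ + a₃) / 3 with hb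
  set Y := (y₁ + y₂ + y₃) / 3 with hY
  have hb' : a₃ = 3 * b - a₁ - a₂ := by rw [hb]; ring
  have hY' : y₃ = 3 * Y - y₁ - y₂ := by rw [hY]; ring
  set v₁ := -(a₁ ^ 2 - b ^ 2) / 3 + τ * (a₃ - a₂) with hv₁
  set v₂ := -(a₂ ^ 2 - b ^ 2) / 3 + τ * (a₁ - a₃) with hv₂
  set v₃ := -(a₃ ^ 2 - b ^ 2) / 3 + τ * (a₂ - a₁) with hv₃
  have hsum : Real.exp v₁ + Real.exp v₂ + Real.exp v₃ ≤ 3 := by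
    -- the linear terms in `τ` cancel, and what remains is negative enough to absorb the squares
    have hv : v₁ + v₂ + v₃ = -((a₁ - b) ^ 2 + (a₂ - b) ^ 2 + (a₃ - b) ^ 2) / 3 := by
      rw [hv₁, hv₂, hv₃, hb']; ring
    have hg : (a₃ - a₂) ^ 2 + (a₁ - a₃) ^ 2 + (a₂ - a₁) ^ 2 =
        3 * ((a₁ - b) ^ 2 + (a₂ - b) ^ 2 + (a₃ - b) ^ 2) := by
      rw [hb']; ring
    nlinarith [sq_nonneg (a₁ - b), sq_nonneg (a₂ - b), sq_nonneg (a₃ - b)]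
  have hY0 : 0 ≤ Y := by positivity
  rcases hY0.eq_or_lt with h0 | hpos
  · have z₁ : y₁ = 0 := by linarith
    have z₂ : y₂ = 0 := by linarith
    have z₃ : y₃ = 0 := by linarith
    simp [← h0, z₁, z₂, z₃]
  -- Gibbs' inequality relative to `Y exp v_i`
  · have g₁ := sub_le_mul_log_sub hy₁ (mul_pos hpos (Real.exp_pos v₁))
    have g₂ := sub_le_mul_log_sub hy₂ (mul_pos hpos (Real.exp_pos v₂))
    have g₃ := sub_le_mul_log_sub hy₃ (mul_pos hpos (Real.exp_pos v₃))
    rw [Real.log_mul hpos.ne' (Real.exp_pos _).ne', Real.log_exp] at g₁ g₂ g₃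
    have hs : Y * (Real.exp v₁ + Real.exp v₂ + Real.exp v₃) ≤ Y * 3 :=
      mul_le_mul_of_nonneg_left hsum hpos.le
    have key : 0 ≤ (y₁ * Real.log y₁ - y₁ * (Real.log Y + v₁)) +
        (y₂ * Real.log y₂ - y₂ * (Real.log Y + v₂)) +
        (y₃ * Real.log y₃ - y₃ * (Real.log Y + v₃)) := by
      nlinarith
    have id : 3 * ((y₁ * Real.log y₁ - y₁ * (Real.log Y + v₁)) +
        (y₂ * Real.log y₂ - y₂ * (Real.log Y + v₂)) +
        (y₃ * Real.log y₃ - y₃ * (Real.log Y + v₃))) =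
        (y₁ * a₁ ^ 2 + 3 * (y₁ * Real.log y₁)) + (y₂ * a₂ ^ 2 + 3 * (y₂ * Real.log y₂)) +
      (y₃ * a₃ ^ 2 + 3 * (y₃ * Real.log y₃)) -
      3 * (Y * b ^ 2 + 3 * (Y * Real.log Y)) -
      3 * τ * ((a₁ * y₂ - y₁ * a₂) + (a₂ * y₃ - y₂ * a₃) + (a₃ * y₁ - y₃ * a₁)) := by
      have : 3 * Y = y₁ + y₂ + y₃ := by rw [hY]; ring
      rw [hv₁, hv₂, hv₃]
      linear_combination (b ^ 2 + 3 * Real.log Y) * this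
    linarith

/-- Area convexity of `y a² + 3 y log y` on `[0, ∞) × [0, 1]`: its defect at a triangle dominates
the area of the triangle. -/
lemma two_mul_abs_area_le {y₁ y₂ y₃ a₁ a₂ a₃ : ℝ} (hy₁ : 0 ≤ y₁) (hy₂ : 0 ≤ y₂) (hy₃ : 0 ≤ y₃)
    (h₁ : a₁ ∈ Set.Icc (0 : ℝ) 1) (h₂ : a₂ ∈ Set.Icc (0 : ℝ) 1) (h₃ : a₃ ∈ Set.Icc (0 : ℝ) 1) :
    2 * |(a₁ * y₂ - y₁ * a₂) + (a₂ * y₃ - y₂ * a₃) + (a₃ * y₁ - y₃ * a₁)| ≤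
      6 * Real.sqrt 3 * ((y₁ * a₁ ^ 2 + 3 * (y₁ * Real.log y₁)) +
      (y₂ * a₂ ^ 2 + 3 * (y₂ * Real.log y₂)) + (y₃ * a₃ ^ 2 + 3 * (y₃ * Real.log y₃)) -
      3 * ((y₁ + y₂ + y₃) / 3 * ((a₁ + a₂ + a₃) / 3) ^ 2 +
        3 * ((y₁ + y₂ + y₃) / 3 * Real.log ((y₁ + y₂ + y₃) / 3)))) := by
  have h3 : Real.sqrt 3 ^ 2 = 3 := Real.sq_sqrt (by norm_num)
  have h3' : 0 ≤ Real.sqrt 3 := Real.sqrt_nonneg 3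
  have p := area_le_of_sq hy₁ hy₂ hy₃ h₁ h₂ h₃ (τ := Real.sqrt 3 / 27) (by rw [div_pow, h3]; norm_num)
  have q := area_le_of_sq hy₁ hy₂ hy₃ h₁ h₂ h₃ (τ := -Real.sqrt 3 / 27)
    (by rw [div_pow, neg_sq, h3]; norm_num)
  set X := (y₁ * a₁ ^ 2 + 3 * (y₁ * Real.log y₁)) +
      (y₂ * a₂ ^ 2 + 3 * (y₂ * Real.log y₂)) + (y₃ * a₃ ^ 2 + 3 * (y₃ * Real.log y₃)) -
      3 * ((y₁ + y₂ + y₃) / 3 * ((a₁ + a₂ + a₃) / 3) ^ 2 +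
        3 * ((y₁ + y₂ + y₃) / 3 * Real.log ((y₁ + y₂ + y₃) / 3)))
  have p' := mul_le_mul_of_nonneg_left p (mul_nonneg (by norm_num : (0 : ℝ) ≤ 6) h3')
  have q' := mul_le_mul_of_nonneg_left q (mul_nonneg (by norm_num : (0 : ℝ) ≤ 6) h3')
  set A := (a₁ * y₂ - y₁ * a₂) + (a₂ * y₃ - y₂ * a₃) + (a₃ * y₁ - y₃ * a₁)
  have i₁ : 6 * Real.sqrt 3 * (3 * (Real.sqrt 3 / 27) * A) = 2 * A := by
    linear_combination (2 / 3 * A) * h3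
  have i₂ : 6 * Real.sqrt 3 * (3 * (-Real.sqrt 3 / 27) * A) = -(2 * A) := by
    linear_combination (-(2 / 3) * A) * h3
  rw [i₁] at p'
  rw [i₂] at q'
  rcases abs_cases A with ⟨h, -⟩ | ⟨h, -⟩ <;> rw [h] <;> linarith

/-! ### The extragradient step -/

section saddle

variable {n m : ℕ} {ends : Fin m → Fin 2 → Fin n} {D δ : ℝ}

lemma pairing_add (u x x' : SaddleVec m) : pairing u (x + x') = pairing u x + pairing u x' := by
  simp only [pairing, Prod.fst_add, Prod.snd_add, Pi.add_apply, mul_add, Finset.sum_add_distrib]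
  ring

lemma pairing_smul (c : ℝ) (u x : SaddleVec m) : pairing u (c • x) = c * pairing u x := by
  simp only [pairing, Prod.smul_fst, Prod.smul_snd, Pi.smul_apply, smul_eq_mul, mul_add,
    Finset.mul_sum]
  congr 1
  · exact Finset.sum_congr rfl fun e _ => Finset.sum_congr rfl fun k _ => by ring
  · exact Finset.sum_congr rfl fun e _ => by ring

lemma pairing_smul_left (c : ℝ) (u x : SaddleVec m) : pairing (c • u) x = c * pairing u x := by
  simp only [pairing, Prod.smul_fst, Prod.smul_snd, Pi.smul_apply, smul_eq_mul, mul_add,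
    Finset.mul_sum]
  congr 1
  · exact Finset.sum_congr rfl fun e _ => Finset.sum_congr rfl fun k _ => by ring
  · exact Finset.sum_congr rfl fun e _ => by ring

lemma pairing_add_left (u u' x : SaddleVec m) : pairing (u + u') x = pairing u x + pairing u' x := by
  simp only [pairing, Prod.fst_add, Prod.snd_add, Pi.add_apply, add_mul, Finset.sum_add_distrib]
  ring

lemma saddleOp_add (w w' : SaddleVec m) : saddleOp (w + w') = saddleOp w + saddleOp w' := by
  ext <;> simp [saddleOp]
  ring

lemma pairing_saddleOp (u w : SaddleVec m) : pairing u (saddleOp w) =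
    ∑ e, ∑ k, (u.1 e k * w.2 e - u.2 e * w.1 e k) := by
  simp only [pairing, saddleOp, Fin.sum_univ_two, ← Finset.sum_add_distrib]
  exact Finset.sum_congr rfl fun e _ => by ring

lemma centroid_mem {u p q : SaddleVec m} (hu : u ∈ saddleDomain ends D)
    (hp : p ∈ saddleDomain ends D) (hq : q ∈ saddleDomain ends D) :
    (1 / 3 : ℝ) • (u + p + q) ∈ saddleDomain ends D := by
  obtain ⟨⟨u1, u2⟩, u3, u4⟩ := hu
  obtain ⟨⟨p1, p2⟩, p3, p4⟩ := hp
  obtain ⟨⟨q1, q2⟩, q3, q4⟩ := hq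
  refine ⟨⟨fun e k => ?_, fun v => ?_⟩, fun e => ?_, ?_⟩
  · have := u1 e k; have := p1 e k; have := q1 e k
    simp only [Prod.smul_fst, Prod.fst_add, Pi.smul_apply, Pi.add_apply, smul_eq_mul]
    constructor <;> linarith
  · have e1 : ∑ e, ∑ k, (if ends e k = v then ((1 / 3 : ℝ) • (u + p + q)).1 e k else 0) =
        1 / 3 * (∑ e, ∑ k, (if ends e k = v then u.1 e k else 0) +
          ∑ e, ∑ k, (if ends e k = v then p.1 e k else 0) +
          ∑ e, ∑ k, (if ends e k = v then q.1 e k else 0)) := by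
      simp only [← Finset.sum_add_distrib, Finset.mul_sum]
      refine Finset.sum_congr rfl fun e _ => Finset.sum_congr rfl fun k _ => ?_
      split_ifs <;> simp [mul_add]
    rw [e1]
    linarith [u2 v, p2 v, q2 v]
  · have := u3 e; have := p3 e; have := q3 e
    simp only [Prod.smul_snd, Prod.snd_add, Pi.smul_apply, Pi.add_apply, smul_eq_mul]
    linarith
  · simp only [Prod.smul_snd, Prod.snd_add, Pi.smul_apply, Pi.add_apply, smul_eq_mul,
      ← Finset.mul_sum, Finset.sum_add_distrib, u4, p4, q4]
    norm_num

/-- The signed area `⟨u, A q⟩ + ⟨q, A p⟩ - ⟨u, A p⟩` of the triangle `u, q, p` is dominated by the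
convexity defect of the regularizer. -/
lemma area_le_regularizer {u p q : SaddleVec m} (hu : u ∈ saddleDomain ends D)
    (hp : p ∈ saddleDomain ends D) (hq : q ∈ saddleDomain ends D) :
    2 * (pairing u (saddleOp q) + pairing q (saddleOp p) - pairing u (saddleOp p)) ≤
      regularizer u + regularizer p + regularizer q -
        3 * regularizer ((1 / 3 : ℝ) • (u + p + q)) := by
  obtain ⟨⟨u1, u2⟩, u3, u4⟩ := hu
  obtain ⟨⟨p1, p2⟩, p3, p4⟩ := hp
  obtain ⟨⟨q1, q2⟩, q3, q4⟩ := hq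
  have key : ∀ e k, 2 * (u.1 e k * q.2 e - u.2 e * q.1 e k + (q.1 e k * p.2 e - q.2 e * p.1 e k) -
      (u.1 e k * p.2 e - u.2 e * p.1 e k)) ≤
      6 * Real.sqrt 3 * ((u.2 e * u.1 e k ^ 2 + 3 * (u.2 e * Real.log (u.2 e))) +
      (p.2 e * p.1 e k ^ 2 + 3 * (p.2 e * Real.log (p.2 e))) +
      (q.2 e * q.1 e k ^ 2 + 3 * (q.2 e * Real.log (q.2 e))) -
      3 * ((1 / 3 * (u.2 e + p.2 e + q.2 e)) * (1 / 3 * (u.1 e k + p.1 e k + q.1 e k)) ^ 2 +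
        3 * ((1 / 3 * (u.2 e + p.2 e + q.2 e)) *
          Real.log (1 / 3 * (u.2 e + p.2 e + q.2 e))))) := by
    intro e k
    have h := two_mul_abs_area_le (u3 e) (q3 e) (p3 e) (u1 e k) (q1 e k) (p1 e k)
    rw [show (u.2 e + q.2 e + p.2 e) / 3 = 1 / 3 * (u.2 e + p.2 e + q.2 e) by ring,
      show (u.1 e k + q.1 e k + p.1 e k) / 3 = 1 / 3 * (u.1 e k + p.1 e k + q.1 e k) by ring] at h
    have := le_abs_self ((u.1 e k * q.2 e - u.2 e * q.1 e k) + (q.1 e k * p.2 e - q.2 e * p.1 e k) +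
      (p.1 e k * u.2 e - p.2 e * u.1 e k))
    linarith
  have hs := Finset.sum_le_sum fun e (_ : e ∈ (Finset.univ : Finset (Fin m))) =>
    Finset.sum_le_sum fun k (_ : k ∈ (Finset.univ : Finset (Fin 2))) => key e k
  refine (le_of_eq ?_).trans (hs.trans (le_of_eq ?_))
  · simp only [pairing_saddleOp, Finset.mul_sum, ← Finset.sum_add_distrib,
      ← Finset.sum_sub_distrib]
  · simp only [regularizer, Prod.smul_fst, Prod.fst_add, Prod.smul_snd, Prod.snd_add,
      Pi.smul_apply, Pi.add_apply, smul_eq_mul, Fin.sum_univ_two]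
    rw [show ∀ a b c d s : ℝ, s * (a - 2) + s * (b - 2) + s * (c - 2) - 3 * (s * (d - 2)) =
      s * (a + b + c - 3 * d) from fun a b c d s => by ring]
    rw [Finset.mul_sum, ← Finset.sum_add_distrib, ← Finset.sum_add_distrib,
      ← Finset.sum_sub_distrib, Finset.mul_sum]
    exact Finset.sum_congr rfl fun e _ => by ring

/-- One extragradient step increases the potential `max_u ⟨u, A w⟩ - φ(u)` by at most the oracle
error. -/
theorem potential_extragradient {w p q : SaddleVec m} {M : ℝ}
    (hM : ∀ u ∈ saddleDomain ends D, pairing u (saddleOp w) - regularizer u ≤ M)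
    (hp : IsOracleAnswer ends D δ (saddleOp w) p)
    (hq : IsOracleAnswer ends D δ (saddleOp w + (2 : ℝ) • saddleOp p) q) :
    ∀ u ∈ saddleDomain ends D, pairing u (saddleOp (w + q)) - regularizer u ≤ M + δ := by
  intro u hu
  -- the first oracle answer and the old potential are tested at the centroid of `u, p, q`
  have hc := centroid_mem hu hp.1 hq.1
  have h1 := hM _ hc
  have h2 := hp.2 _ hc
  have h3 := hq.2 u hu
  have h4 := area_le_regularizer hu hp.1 hq.1
  simp only [pairing_add, pairing_smul, pairing_smul_left, pairing_add_left, saddleOp_add]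
    at h1 h2 h3 h4 ⊢
  linarith

end saddle

end

noncomputable section

/-! ### Densities and degrees in an edge listing -/

section graph

variable {n m : ℕ} {G : SimpleGraph (Fin n)}

lemma density_le_maxDensity (G : SimpleGraph (Fin n)) {S : Finset (Fin n)} (hS : S.Nonempty) :
    density G S ≤ maxDensity G :=
  le_csSup ((Set.toFinite _).image _).bddAbove ⟨S, hS, rfl⟩

lemma exists_density_eq_maxDensity (G : SimpleGraph (Fin n)) (hn : 0 < n) :
    ∃ S : Finset (Fin n), S.Nonempty ∧ density G S = maxDensity G := by
  have hne : (density G '' {S | S.Nonempty}).Nonempty := ⟨_, {⟨0, hn⟩}, by simp, rfl⟩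
  obtain ⟨S, hS, h⟩ := hne.csSup_mem ((Set.toFinite _).image _)
  exact ⟨S, hS, h⟩

/-- The edges, by their numbers, that have both endpoints in `S`. -/
def edgesIn (ends : Fin m → Fin 2 → Fin n) (S : Finset (Fin n)) : Finset (Fin m) :=
  {e | ends e 0 ∈ S ∧ ends e 1 ∈ S}

lemma density_eq (E : EdgeListing G m) (S : Finset (Fin n)) :
    density G S = ((edgesIn E.ends S).card : ℝ) / S.card := by
  have h : ({e | e ∈ G.edgeSet ∧ ∀ v ∈ e, v ∈ S} : Set (Sym2 (Fin n))) =
      (fun e => s(E.ends e 0, E.ends e 1)) '' (edgesIn E.ends S : Set (Fin m)) := by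
    ext x
    simp only [Set.mem_ofPred_eq, ← E.range_eq, Set.mem_range, Set.mem_image, Finset.mem_coe,
      edgesIn, Finset.mem_filter, Finset.mem_univ, true_and]
    constructor
    · rintro ⟨⟨e, rfl⟩, h⟩
      exact ⟨e, ⟨h _ (Sym2.mem_mk_left _ _), h _ (Sym2.mem_mk_right _ _)⟩, rfl⟩
    · rintro ⟨e, ⟨h0, h1⟩, rfl⟩
      refine ⟨⟨e, rfl⟩, fun v hv => ?_⟩
      rcases Sym2.mem_iff.mp hv with rfl | rfl <;> assumption
  rw [density, h, Set.ncard_image_of_injective _ E.inj, Set.ncard_coe_finset]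

lemma EdgeListing.ne (E : EdgeListing G m) (e : Fin m) : E.ends e 0 ≠ E.ends e 1 := by
  have : s(E.ends e 0, E.ends e 1) ∈ G.edgeSet := by rw [← E.range_eq]; exact ⟨e, rfl⟩
  exact G.ne_of_adj this

/-- The degree of `u` in the subgraph with edge set `F`. -/
def degIn (ends : Fin m → Fin 2 → Fin n) (F : Finset (Fin m)) (u : Fin n) : ℕ :=
  ∑ e ∈ F, ∑ k, if ends e k = u then 1 else 0

lemma degIn_mono {ends : Fin m → Fin 2 → Fin n} {F F' : Finset (Fin m)} (h : F ⊆ F') (u : Fin n) :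
    degIn ends F u ≤ degIn ends F' u :=
  Finset.sum_le_sum_of_subset h

lemma sum_degIn (ends : Fin m → Fin 2 → Fin n) (F : Finset (Fin m)) :
    ∑ u, degIn ends F u = 2 * F.card := by
  simp only [degIn]
  rw [Finset.sum_comm]
  have : ∀ e ∈ F, ∑ u, ∑ k, (if ends e k = u then 1 else 0) = 2 := by
    intro e _
    rw [Finset.sum_comm]
    simp
  rw [Finset.sum_congr rfl this, Finset.sum_const, smul_eq_mul, mul_comm]

lemma degIn_pos {ends : Fin m → Fin 2 → Fin n} {F : Finset (Fin m)} {e : Fin m} (he : e ∈ F)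
    (k : Fin 2) : 0 < degIn ends F (ends e k) := by
  refine Finset.sum_pos' (fun _ _ => Nat.zero_le _) ⟨e, he, ?_⟩
  exact Finset.sum_pos' (fun _ _ => Nat.zero_le _) ⟨k, Finset.mem_univ _, by simp⟩

lemma exists_of_degIn_pos {ends : Fin m → Fin 2 → Fin n} {F : Finset (Fin m)} {u : Fin n}
    (h : 0 < degIn ends F u) : ∃ e ∈ F, ∃ k, ends e k = u := by
  by_contra! hc
  refine h.ne' (Finset.sum_eq_zero fun e he => Finset.sum_eq_zero fun k _ => if_neg (hc e he k))

lemma degIn_univ_le_maxDegree [DecidableRel G.Adj] (E : EdgeListing G m) (u : Fin n) :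
    degIn E.ends univ u ≤ G.maxDegree := by
  refine le_trans ?_ (G.degree_le_maxDegree u)
  have h1 : degIn E.ends univ u = #{e : Fin m | E.ends e 0 = u ∨ E.ends e 1 = u} := by
    rw [degIn, Finset.card_filter]
    refine Finset.sum_congr rfl fun e _ => ?_
    have := E.ne e
    rw [Fin.sum_univ_two]
    by_cases h0 : E.ends e 0 = u
    · have h1 : E.ends e 1 ≠ u := fun h => this (h0.trans h.symm)
      simp [h0, h1]
    · simp [h0]
  rw [h1, ← SimpleGraph.card_incidenceFinset_eq_degree]
  refine Finset.card_le_card_of_injOn (fun e => s(E.ends e 0, E.ends e 1)) ?_ E.inj.injOn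
  intro e he
  have hmem : s(E.ends e 0, E.ends e 1) ∈ G.edgeSet := by rw [← E.range_eq]; exact ⟨e, rfl⟩
  simp only [Finset.coe_filter, Finset.mem_univ, true_and, Set.mem_ofPred_eq] at he
  rw [Finset.mem_coe, SimpleGraph.mem_incidenceFinset]
  exact ⟨hmem, by rcases he with rfl | rfl <;> simp⟩

/-- A fractional orientation `z` with vertex loads at most `B` that gives every edge at least `θ`
bounds all densities by `B / θ`: the easy direction of Charikar's duality. -/
lemma mul_maxDensity_le (E : EdgeListing G m) (hn : 0 < n) {z : Fin m → Fin 2 → ℝ} {θ B : ℝ}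
    (hz : ∀ e k, 0 ≤ z e k) (hB : ∀ u, ∑ e, ∑ k, (if E.ends e k = u then z e k else 0) ≤ B)
    (hθ : ∀ e, θ ≤ z e 0 + z e 1) : θ * maxDensity G ≤ B := by
  obtain ⟨S, hS, h⟩ := exists_density_eq_maxDensity G hn
  have hc : (0 : ℝ) < S.card := by exact_mod_cast hS.card_pos
  rw [← h, density_eq E, ← mul_div_assoc, div_le_iff₀ hc]
  calc θ * ((edgesIn E.ends S).card : ℝ) = ∑ e ∈ edgesIn E.ends S, θ := by
        rw [Finset.sum_const, nsmul_eq_mul, mul_comm]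
    _ ≤ ∑ e ∈ edgesIn E.ends S, ∑ k, (if E.ends e k ∈ S then z e k else 0) := by
        refine Finset.sum_le_sum fun e he => ?_
        simp only [edgesIn, Finset.mem_filter, Finset.mem_univ, true_and] at he
        rw [Fin.sum_univ_two, if_pos he.1, if_pos he.2]
        exact hθ e
    _ ≤ ∑ e, ∑ k, (if E.ends e k ∈ S then z e k else 0) := by
        refine Finset.sum_le_sum_of_subset_of_nonneg (Finset.subset_univ _) fun e _ _ => ?_
        refine Finset.sum_nonneg fun k _ => ?_
        split_ifs
        exacts [hz e k, le_rfl]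
    _ = ∑ u ∈ S, ∑ e, ∑ k, (if E.ends e k = u then z e k else 0) := by
        rw [Finset.sum_comm (s := S)]
        refine Finset.sum_congr rfl fun e _ => ?_
        rw [Finset.sum_comm (s := S)]
        refine Finset.sum_congr rfl fun k _ => ?_
        rw [Finset.sum_ite_eq]
    _ ≤ ∑ u ∈ S, B := Finset.sum_le_sum fun u _ => hB u
    _ = B * S.card := by rw [Finset.sum_const, nsmul_eq_mul, mul_comm]

/-! ### Rounding a dual certificate to a dense vertex set -/

/-- A fractional greedy choice of weight at most `D` takes at least `min D |L|` out of each upper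
level set `L`. -/
lemma exists_greedy {ι : Type*} [DecidableEq ι] (I : Finset ι) (Y : ι → ℝ) {D : ℝ} (hD : 0 ≤ D) :
    ∃ z : ι → ℝ, (∀ i, 0 ≤ z i ∧ z i ≤ 1) ∧ ∑ i ∈ I, z i ≤ D ∧
      ∀ t : ℝ, min D (#{i ∈ I | t ≤ Y i} : ℝ) ≤ ∑ i ∈ I with t ≤ Y i, z i := by
  -- elements are added in decreasing order of `Y`, each with the weight that is still available
  induction I using Finset.induction_on_min_value Y with
  | empty => exact ⟨fun _ => 0, by simp, by simpa using hD, by simp [hD]⟩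
  | insert a s ha hmin ih =>
    obtain ⟨z, h01, hsum, hlev⟩ := ih
    have hup : ∀ s' ⊆ s, ∀ x, ∑ i ∈ s', Function.update z a x i = ∑ i ∈ s', z i := fun s' hs' x =>
      Finset.sum_congr rfl fun i hi => Function.update_of_ne (ne_of_mem_of_not_mem (hs' hi) ha) _ _
    refine ⟨Function.update z a (min 1 (D - ∑ i ∈ s, z i)), fun i => ?_, ?_, fun t => ?_⟩
    · by_cases hi : i = a
      · subst hi
        rw [Function.update_self]
        exact ⟨le_min zero_le_one (by linarith), min_le_left _ _⟩
      · rw [Function.update_of_ne hi]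
        exact h01 i
    · rw [Finset.sum_insert ha, Function.update_self, hup s subset_rfl]
      linarith [min_le_right 1 (D - ∑ i ∈ s, z i)]
    · by_cases ht : t ≤ Y a
      · rw [Finset.filter_true_of_mem (fun i hi => ?_), Finset.sum_insert ha, Function.update_self,
          hup s subset_rfl, Finset.card_insert_of_notMem ha]
        · have := hlev (Y a)
          rw [Finset.filter_true_of_mem hmin] at this
          push_cast
          rcases le_total 1 (D - ∑ i ∈ s, z i) with h | h
          · rw [min_eq_left h]
            rcases le_total D (s.card : ℝ) with h' | h'
            · rw [min_eq_left h'] at this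
              linarith
            · rw [min_eq_right h'] at this
              linarith [min_le_right D ((s.card : ℝ) + 1)]
          · rw [min_eq_right h]
            linarith [min_le_left D ((s.card : ℝ) + 1)]
        · rcases Finset.mem_insert.mp hi with rfl | hi
          exacts [ht, ht.trans (hmin i hi)]
      · rw [Finset.filter_insert, if_neg ht, hup _ (Finset.filter_subset _ _)]
        exact hlev t

/-- The edges of weight at least `t`. -/
def levelSet (Y : Fin m → ℝ) (t : ℝ) : Finset (Fin m) := {e | t ≤ Y e}

lemma exists_greedy_feasible (ends : Fin m → Fin 2 → Fin n) (Y : Fin m → ℝ) {D : ℝ} (hD : 0 ≤ D) :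
    ∃ z ∈ feasibleSet ends D, ∀ (t : ℝ) (u : Fin n), min D (degIn ends (levelSet Y t) u : ℝ) ≤
      ∑ e ∈ levelSet Y t, ∑ k, (if ends e k = u then z e k else 0) := by
  choose z h01 hsum hlev using fun u : Fin n =>
    exists_greedy ({x | ends x.1 x.2 = u} : Finset (Fin m × Fin 2)) (fun x => Y x.1) hD
  refine ⟨fun e k => z (ends e k) (e, k), ⟨fun e k => h01 _ _, fun u => ?_⟩, fun t u => ?_⟩
  · have h := hsum u
    rw [Finset.sum_filter, Fintype.sum_prod_type] at h
    refine (le_of_eq ?_).trans h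
    refine Finset.sum_congr rfl fun e _ => Finset.sum_congr rfl fun k _ => ?_
    split_ifs with h <;> simp_all
  · have h := hlev u t
    refine (le_of_eq ?_).trans (h.trans (le_of_eq ?_))
    · congr 1
      rw [Finset.filter_filter, Finset.card_filter, Fintype.sum_prod_type, degIn, levelSet,
        Finset.sum_filter]
      congr 1
      refine Finset.sum_congr rfl fun e _ => ?_
      by_cases he : t ≤ Y e <;> simp [he]
    · rw [Finset.filter_filter, Finset.sum_filter, Fintype.sum_prod_type, levelSet,
        Finset.sum_filter]
      refine Finset.sum_congr rfl fun e _ => ?_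
      by_cases he : t ≤ Y e
      · simp only [he, and_true, if_true]
        refine Finset.sum_congr rfl fun k _ => ?_
        split_ifs with h <;> simp_all
      · simp [he]

/-- Rounding `y` down to the geometric grid `t₀, t₀ ρ, …, t₀ ρ ^ J` costs a factor `ρ` and the
additive error `t₀ ρ ^ (J + 1)`. -/
lemma grid_round {y t₀ ρ : ℝ} (hy : 0 ≤ y) (hyt : y ≤ t₀) (ht : 0 < t₀) (hρ : 0 < ρ) (hρ1 : ρ < 1)
    (J : ℕ) :
    (y < t₀ * ρ ^ J →
      ∑ j ∈ range (J + 1), (if t₀ * ρ ^ j ≤ y then t₀ * ρ ^ j - t₀ * ρ ^ (j + 1) else 0) = 0) ∧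
    (t₀ * ρ ^ J ≤ y →
      ∑ j ∈ range (J + 1), (if t₀ * ρ ^ j ≤ y then t₀ * ρ ^ j - t₀ * ρ ^ (j + 1) else 0) ≤
        y - t₀ * ρ ^ (J + 1)) ∧
    ρ * y - t₀ * ρ ^ (J + 1) ≤
      ∑ j ∈ range (J + 1), (if t₀ * ρ ^ j ≤ y then t₀ * ρ ^ j - t₀ * ρ ^ (j + 1) else 0) := by
  induction J with
  | zero =>
    simp only [zero_add, Finset.sum_range_one, pow_zero, mul_one, pow_one]
    refine ⟨fun h => if_neg (not_le.mpr h), fun h => by rw [if_pos h]; linarith, ?_⟩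
    split_ifs with h
    · nlinarith
    · nlinarith
  | succ J ih =>
    obtain ⟨h1, h2, h3⟩ := ih
    rw [Finset.sum_range_succ]
    have hp : 0 < t₀ * ρ ^ (J + 1) := by positivity
    have hlt : t₀ * ρ ^ (J + 1) < t₀ * ρ ^ J := by
      rw [pow_succ]; nlinarith [mul_pos ht (pow_pos hρ J)]
    have hs : t₀ * ρ ^ (J + 1 + 1) = ρ * (t₀ * ρ ^ (J + 1)) := by ring
    refine ⟨fun h => ?_, fun h => ?_, ?_⟩
    · rw [h1 (h.trans hlt), if_neg (not_le.mpr h), add_zero]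
    · rw [if_pos h]
      rcases lt_or_ge y (t₀ * ρ ^ J) with h' | h'
      · rw [h1 h']; linarith
      · linarith [h2 h']
    · split_ifs with h
      · linarith
      · have : 0 ≤ ∑ j ∈ range (J + 1),
            (if t₀ * ρ ^ j ≤ y then t₀ * ρ ^ j - t₀ * ρ ^ (j + 1) else 0) := by
          refine Finset.sum_nonneg fun j _ => ?_
          split_ifs
          · rw [pow_succ]; nlinarith [mul_pos ht (pow_pos hρ j)]
          · exact le_rfl
        rw [hs]
        nlinarith [not_le.mp h]

/-- If no level set on the grid is too dense for `D`, then some `z ∈ C(D)` covers `Y` up to the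
rounding errors. -/
lemma exists_feasible_of_levels {ends : Fin m → Fin 2 → Fin n} {Y : Fin m → ℝ} {D t₀ ρ : ℝ}
    (hD : 0 ≤ D) (hY : ∀ e, 0 ≤ Y e) (hYt : ∀ e, Y e ≤ t₀) (ht : 0 < t₀) (hρ : 0 < ρ) (hρ1 : ρ < 1)
    (J : ℕ) (hlev : ∀ j ≤ J, ((levelSet Y (t₀ * ρ ^ j)).card : ℝ) ≤
      ∑ u, min D (degIn ends (levelSet Y (t₀ * ρ ^ j)) u : ℝ)) :
    ∃ z ∈ feasibleSet ends D,
      ρ * ∑ e, Y e - m * (t₀ * ρ ^ (J + 1)) ≤ ∑ e, Y e * (z e 0 + z e 1) := by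
  obtain ⟨z, hz, hg⟩ := exists_greedy_feasible ends Y hD
  refine ⟨z, hz, ?_⟩
  -- `R` is `Y` rounded down to the grid, written as a combination of indicators of level sets
  set R : Fin m → ℝ := fun e =>
    ∑ j ∈ range (J + 1), (if t₀ * ρ ^ j ≤ Y e then t₀ * ρ ^ j - t₀ * ρ ^ (j + 1) else 0) with hR
  have hw : ∀ j, 0 ≤ t₀ * ρ ^ j - t₀ * ρ ^ (j + 1) := fun j => by
    rw [pow_succ]; nlinarith [mul_pos ht (pow_pos hρ j)]
  have swap : ∀ f : Fin m → ℝ, ∑ e, R e * f e = ∑ j ∈ range (J + 1),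
      (t₀ * ρ ^ j - t₀ * ρ ^ (j + 1)) * ∑ e ∈ levelSet Y (t₀ * ρ ^ j), f e := by
    intro f
    simp only [hR, Finset.sum_mul, levelSet, Finset.sum_filter, Finset.mul_sum]
    rw [Finset.sum_comm]
    refine Finset.sum_congr rfl fun j _ => Finset.sum_congr rfl fun e _ => ?_
    split_ifs <;> simp
  calc ρ * ∑ e, Y e - m * (t₀ * ρ ^ (J + 1)) = ∑ e, (ρ * Y e - t₀ * ρ ^ (J + 1)) := by
        rw [Finset.sum_sub_distrib, ← Finset.mul_sum, Finset.sum_const, Finset.card_univ,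
          Fintype.card_fin, nsmul_eq_mul]
    _ ≤ ∑ e, R e * 1 := Finset.sum_le_sum fun e _ => by
        rw [mul_one]; exact (grid_round (hY e) (hYt e) ht hρ hρ1 J).2.2
    _ = ∑ j ∈ range (J + 1), (t₀ * ρ ^ j - t₀ * ρ ^ (j + 1)) *
          (levelSet Y (t₀ * ρ ^ j)).card := by
        rw [swap]; simp
    _ ≤ ∑ j ∈ range (J + 1), (t₀ * ρ ^ j - t₀ * ρ ^ (j + 1)) *
          ∑ e ∈ levelSet Y (t₀ * ρ ^ j), (z e 0 + z e 1) := by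
        refine Finset.sum_le_sum fun j hj => mul_le_mul_of_nonneg_left ?_ (hw j)
        refine (hlev j (by simpa [Nat.lt_succ_iff] using hj)).trans
          ((Finset.sum_le_sum fun u _ => hg (t₀ * ρ ^ j) u).trans (le_of_eq ?_))
        rw [Finset.sum_comm]
        refine Finset.sum_congr rfl fun e _ => ?_
        rw [Finset.sum_comm]
        simp
    _ = ∑ e, R e * (z e 0 + z e 1) := (swap _).symm
    _ ≤ ∑ e, Y e * (z e 0 + z e 1) := by
        refine Finset.sum_le_sum fun e _ => mul_le_mul_of_nonneg_right ?_
          (add_nonneg (hz.1 e 0).1 (hz.1 e 1).1)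
        have := grid_round (hY e) (hYt e) ht hρ hρ1 J
        rcases lt_or_ge (Y e) (t₀ * ρ ^ J) with h | h
        · rw [hR]; simp only [this.1 h]; exact hY e
        · have : 0 < t₀ * ρ ^ (J + 1) := by positivity
          simp only [hR]; linarith [(grid_round (hY e) (hYt e) ht hρ hρ1 J).2.1 h]

/-- The vertices of degree more than `D` in a too dense level set form a set of density more than
`D`. -/
lemma lt_density_of_level (E : EdgeListing G m) {F : Finset (Fin m)} {D : ℝ}
    (h : ∑ u, min D (degIn E.ends F u : ℝ) < F.card) {S : Finset (Fin n)}
    (hS : ∀ u, u ∈ S ↔ D < degIn E.ends F u) : S.Nonempty ∧ D < density G S := by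
  -- an edge of `F` that is not inside `S` is counted in the degree of a vertex outside `S`
  have h1 : (F.card : ℝ) ≤ (edgesIn E.ends S).card + ∑ u ∈ Sᶜ, (degIn E.ends F u : ℝ) := by
    have hsub : F ⊆ edgesIn E.ends S ∪ {e ∈ F | ∃ k, E.ends e k ∉ S} := by
      intro e he
      by_cases h' : ∃ k, E.ends e k ∉ S
      · exact Finset.mem_union_right _ (Finset.mem_filter.mpr ⟨he, h'⟩)
      · push Not at h'
        exact Finset.mem_union_left _ (by simp [edgesIn, h'])
    have hc := (Finset.card_le_card hsub).trans (Finset.card_union_le _ _)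
    have h2 : #{e ∈ F | ∃ k, E.ends e k ∉ S} ≤ ∑ u ∈ Sᶜ, degIn E.ends F u := by
      simp only [degIn]
      rw [Finset.sum_comm, Finset.card_filter]
      refine Finset.sum_le_sum fun e _ => ?_
      split_ifs with h'
      · obtain ⟨k, hk⟩ := h'
        rw [Finset.sum_comm]
        refine (Finset.sum_pos' (fun _ _ => Nat.zero_le _) ⟨k, Finset.mem_univ _, ?_⟩ :
          0 < _)
        rw [Finset.sum_ite_eq, if_pos (Finset.mem_compl.mpr hk)]
        exact one_pos
      · exact Nat.zero_le _
    exact_mod_cast hc.trans (Nat.add_le_add_left h2 _)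
  have h2 : ∑ u, min D (degIn E.ends F u : ℝ) =
      D * S.card + ∑ u ∈ Sᶜ, (degIn E.ends F u : ℝ) := by
    rw [← Finset.sum_add_sum_compl S]
    congr 1
    · rw [Finset.sum_congr rfl fun u hu => min_eq_left ((hS u).mp hu).le, Finset.sum_const,
        nsmul_eq_mul, mul_comm]
    · refine Finset.sum_congr rfl fun u hu => min_eq_right ?_
      exact not_lt.mp fun h' => Finset.mem_compl.mp hu ((hS u).mpr h')
  have h3 : D * S.card < (edgesIn E.ends S).card := by linarith
  have hne : S.Nonempty := by
    rw [Finset.nonempty_iff_ne_empty]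
    rintro rfl
    simp [edgesIn] at h3
  refine ⟨hne, ?_⟩
  rw [density_eq E, lt_div_iff₀ (by exact_mod_cast hne.card_pos)]
  exact h3

/-! ### Batch peeling -/

/-- Removing all edges at vertices of degree at most `4 |F| / |V(F)|` at least halves the number of
vertices that are covered. -/
lemma peel_card {ends : Fin m → Fin 2 → Fin n} {F F' : Finset (Fin m)} {ρ : ℝ} (hF : F.Nonempty)
    (hρ : ρ = F.card / #{u | 0 < degIn ends F u})
    (hF' : ∀ e ∈ F', e ∈ F ∧ ∀ k, 4 * ρ < degIn ends F (ends e k)) :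
    2 * #{u | 0 < degIn ends F' u} ≤ #{u | 0 < degIn ends F u} := by
  have hpos : 0 < #{u | 0 < degIn ends F u} := by
    obtain ⟨e, he⟩ := hF
    exact Finset.card_pos.mpr ⟨ends e 0, by simpa using degIn_pos he 0⟩
  have hpos' : (0 : ℝ) < #{u | 0 < degIn ends F u} := by exact_mod_cast hpos
  have hFpos : (0 : ℝ) < F.card := by exact_mod_cast hF.card_pos
  have hρ0 : 0 < ρ := by rw [hρ]; positivity
  -- the surviving vertices have degree more than `4 ρ`, and all degrees sum to `2 |F|`
  have h1 : (#{u | 0 < degIn ends F' u} : ℝ) * (4 * ρ) ≤ 2 * F.card := by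
    calc (#{u | 0 < degIn ends F' u} : ℝ) * (4 * ρ)
        = ∑ u with 0 < degIn ends F' u, 4 * ρ := by rw [Finset.sum_const, nsmul_eq_mul]
      _ ≤ ∑ u with 0 < degIn ends F' u, (degIn ends F u : ℝ) := by
          refine Finset.sum_le_sum fun u hu => ?_
          obtain ⟨e, he, k, rfl⟩ := exists_of_degIn_pos (Finset.mem_filter.mp hu).2
          exact ((hF' e he).2 k).le
      _ ≤ ∑ u, (degIn ends F u : ℝ) :=
          Finset.sum_le_sum_of_subset_of_nonneg (Finset.filter_subset _ _)
            fun _ _ _ => Nat.cast_nonneg _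
      _ = 2 * F.card := by exact_mod_cast sum_degIn ends F
  have h2 : (F.card : ℝ) = ρ * #{u | 0 < degIn ends F u} := by
    rw [hρ]; field_simp
  rw [h2] at h1
  have : (2 : ℝ) * #{u | 0 < degIn ends F' u} ≤ #{u | 0 < degIn ends F u} := by
    by_contra! hc
    nlinarith
  exact_mod_cast this

lemma peel_le_maxDensity (E : EdgeListing G m) {F : Finset (Fin m)} (hF : F.Nonempty) :
    (F.card : ℝ) / #{u | 0 < degIn E.ends F u} ≤ maxDensity G := by
  have hne : ({u | 0 < degIn E.ends F u} : Finset (Fin n)).Nonempty := by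
    obtain ⟨e, he⟩ := hF
    exact ⟨E.ends e 0, by simpa using degIn_pos he 0⟩
  refine le_trans ?_ (density_le_maxDensity G hne)
  rw [density_eq E]
  refine div_le_div_of_nonneg_right ?_ (Nat.cast_nonneg _)
  have hsub : F ⊆ edgesIn E.ends {u | 0 < degIn E.ends F u} := fun e he => by
    simp only [edgesIn, Finset.mem_filter, Finset.mem_univ, true_and]
    exact ⟨degIn_pos he 0, degIn_pos he 1⟩
  exact_mod_cast Finset.card_le_card hsub

/-- Every vertex of a densest set has degree at least `OPT` in it. -/
lemma maxDensity_le_degIn (E : EdgeListing G m) {S : Finset (Fin n)} (hS : S.Nonempty)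
    (h : density G S = maxDensity G) {v : Fin n} (hv : v ∈ S) :
    maxDensity G ≤ degIn E.ends (edgesIn E.ends S) v := by
  have hc : (0 : ℝ) < S.card := by exact_mod_cast hS.card_pos
  have h1 : ((edgesIn E.ends S).card : ℝ) = maxDensity G * S.card := by
    rw [← h, density_eq E]; field_simp
  have h2 : (edgesIn E.ends S).card ≤
      (edgesIn E.ends (S.erase v)).card + degIn E.ends (edgesIn E.ends S) v := by
    have hsub : edgesIn E.ends S ⊆
        edgesIn E.ends (S.erase v) ∪ {e ∈ edgesIn E.ends S | ∃ k, E.ends e k = v} := by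
      intro e he
      by_cases h' : ∃ k, E.ends e k = v
      · exact Finset.mem_union_right _ (Finset.mem_filter.mpr ⟨he, h'⟩)
      · push Not at h'
        simp only [edgesIn, Finset.mem_filter, Finset.mem_univ, true_and] at he
        exact Finset.mem_union_left _ (by simp [edgesIn, h', he])
    refine (Finset.card_le_card hsub).trans ((Finset.card_union_le _ _).trans
      (Nat.add_le_add_left ?_ _))
    rw [Finset.card_filter, degIn]
    refine Finset.sum_le_sum fun e _ => ?_
    split_ifs with h'
    · obtain ⟨k, hk⟩ := h'
      refine (Finset.sum_pos' (fun _ _ => Nat.zero_le _) ⟨k, Finset.mem_univ _, ?_⟩ : 0 < _)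
      rw [if_pos hk]
      exact one_pos
    · exact Nat.zero_le _
  -- `S.erase v` is not denser than `S`; it may be empty
  have h3 : ((edgesIn E.ends (S.erase v)).card : ℝ) ≤ maxDensity G * (S.card - 1) := by
    rcases (S.erase v).eq_empty_or_nonempty with h0 | h0
    · have : S.card = 1 := by
        have := Finset.card_erase_of_mem hv
        rw [h0, Finset.card_empty] at this
        have := hS.card_pos
        omega
      rw [h0, this]
      simp [edgesIn]
    · have h4 := density_le_maxDensity G h0
      have h5 : (0 : ℝ) < (S.erase v).card := by exact_mod_cast h0.card_pos
      rw [density_eq E, div_le_iff₀ h5] at h4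
      rwa [Finset.card_erase_of_mem hv, Nat.cast_sub hS.card_pos, Nat.cast_one] at h4
  have h4 : ((edgesIn E.ends S).card : ℝ) ≤
      (edgesIn E.ends (S.erase v)).card + degIn E.ends (edgesIn E.ends S) v := by exact_mod_cast h2
  linarith

/-- If peeling destroys an edge of a densest set, then the current density is at least `OPT / 4`. -/
lemma maxDensity_le_of_peel (E : EdgeListing G m) {S : Finset (Fin n)} (hS : S.Nonempty)
    (h : density G S = maxDensity G) {F : Finset (Fin m)} (hF : edgesIn E.ends S ⊆ F) {e : Fin m}
    (he : e ∈ edgesIn E.ends S) {k : Fin 2} {x : ℝ} (hx : (degIn E.ends F (E.ends e k) : ℝ) ≤ x) :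
    maxDensity G ≤ x := by
  have hv : E.ends e k ∈ S := by
    simp only [edgesIn, Finset.mem_filter, Finset.mem_univ, true_and] at he
    fin_cases k
    exacts [he.1, he.2]
  refine (maxDensity_le_degIn E hS h hv).trans (le_trans ?_ hx)
  exact_mod_cast degIn_mono hF _

lemma maxDensity_pos (E : EdgeListing G m) (hm : 1 ≤ m) : 0 < maxDensity G := by
  have hF : (univ : Finset (Fin m)).Nonempty := ⟨⟨0, hm⟩, Finset.mem_univ _⟩
  refine lt_of_lt_of_le ?_ (peel_le_maxDensity E hF)
  obtain ⟨e, he⟩ := hF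
  have h1 : 0 < #{u | 0 < degIn E.ends univ u} :=
    Finset.card_pos.mpr ⟨E.ends e 0, by simpa using degIn_pos he 0⟩
  have h2 : 0 < (univ : Finset (Fin m)).card := Finset.card_pos.mpr ⟨e, he⟩
  positivity

lemma EdgeListing.pos (E : EdgeListing G m) (hm : 1 ≤ m) : 0 < n :=
  (Nat.zero_le _).trans_lt (E.ends ⟨0, hm⟩ 0).isLt

end graph

end

noncomputable section

/-! ### Alternating maximization for the oracle -/

section oracle

variable {n m : ℕ} {ends : Fin m → Fin 2 → Fin n} {D : ℝ}

/-- The objective `⟨w, x⟩ - φ(w)` of the oracle. -/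
def oracleObj (x w : SaddleVec m) : ℝ := pairing w x - regularizer w

/-- `y` maximizes the objective for fixed `z` and the query part `b`: it is the probability vector
proportional to `exp ((b_e / (6√3) - z_{eu}² - z_{ev}²) / 6)`. -/
structure IsSoftmax (b : Fin m → ℝ) (z : Fin m → Fin 2 → ℝ) (y : Fin m → ℝ) : Prop where
  pos : ∀ e, 0 < y e
  sum_eq : ∑ e, y e = 1
  log_eq : ∃ c, ∀ e, 6 * (6 * Real.sqrt 3) * Real.log (y e) =
    b e - 6 * Real.sqrt 3 * (z e 0 ^ 2 + z e 1 ^ 2) - c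

/-- The part of the objective that depends on `z`, for fixed `y`. -/
def zObj (a z : Fin m → Fin 2 → ℝ) (y : Fin m → ℝ) : ℝ :=
  ∑ e, ∑ k, (a e k * z e k - 6 * Real.sqrt 3 * y e * z e k ^ 2)

lemma exp_neg_le {v : ℝ} (h : |v| ≤ 1 / 3) : Real.exp (-v) ≤ 1 - v + 9 / 16 * v ^ 2 := by
  obtain ⟨h1, h2⟩ := abs_le.mp h
  have h := Real.exp_bound (x := -v) (by rw [abs_neg]; linarith) (n := 4) (by norm_num)
  have h3 := (abs_le.mp h).2
  rw [show |(-v)| ^ 4 = v ^ 4 by rw [abs_neg]; exact Even.pow_abs (by decide) v] at h3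
  norm_num [Finset.sum_range_succ, Nat.factorial] at h3
  have : v ^ 2 * (1 / 16 + v / 6 - 5 / 96 * v ^ 2) ≥ 0 := by
    apply mul_nonneg (sq_nonneg v)
    nlinarith
  nlinarith

lemma oracleObj_eq (a : Fin m → Fin 2 → ℝ) (b : Fin m → ℝ) (z : Fin m → Fin 2 → ℝ)
    (y : Fin m → ℝ) : oracleObj (a, b) (z, y) = ∑ e, (∑ k, a e k * z e k +
      (b e * y e - 6 * Real.sqrt 3 * (y e * (z e 0 ^ 2 + z e 1 ^ 2)) -
        6 * (6 * Real.sqrt 3) * (y e * Real.log (y e)))) + 12 * Real.sqrt 3 := by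
  simp only [oracleObj, pairing, regularizer, Finset.sum_add_distrib, Finset.sum_sub_distrib,
    ← Finset.mul_sum]
  have e1 : ∑ e, ∑ k, z e k * a e k = ∑ e, ∑ k, a e k * z e k :=
    Finset.sum_congr rfl fun e _ => Finset.sum_congr rfl fun k _ => mul_comm _ _
  have e2 : ∑ e, y e * b e = ∑ e, b e * y e := Finset.sum_congr rfl fun e _ => mul_comm _ _
  rw [e1, e2]
  ring

/-- First order upper bound for the objective with a quadratic gain: the function
`z ↦ max_y ⟨w, x⟩ - φ(w)` is strongly concave relative to the weights `y`. -/
lemma oracleObj_le {a : Fin m → Fin 2 → ℝ} {b : Fin m → ℝ} {z z' : Fin m → Fin 2 → ℝ}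
    {y y' : Fin m → ℝ} (hz : ∀ e k, z e k ∈ Set.Icc (0 : ℝ) 1)
    (hz' : ∀ e k, z' e k ∈ Set.Icc (0 : ℝ) 1) (hy : IsSoftmax b z y)
    (hy' : y' ∈ stdSimplex ℝ (Fin m)) :
    oracleObj (a, b) (z', y') - oracleObj (a, b) (z, y) ≤
      ∑ e, ∑ k, (a e k * (z' e k - z e k) - 6 * Real.sqrt 3 * y e *
        (2 * z e k * (z' e k - z e k) + (z' e k - z e k) ^ 2 / 4)) := by
  obtain ⟨c, hc⟩ := hy.log_eq
  have h3 : 0 ≤ Real.sqrt 3 := Real.sqrt_nonneg 3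
  have hsum : ∑ e, (y' e - y e) = 0 := by
    rw [Finset.sum_sub_distrib, hy'.2, hy.sum_eq, sub_self]
  rw [oracleObj_eq, oracleObj_eq, add_sub_add_right_eq_sub, ← Finset.sum_sub_distrib, ← sub_nonneg,
    ← Finset.sum_sub_distrib]
  -- the multiplier of the left side is constant, and `y' - y` sums to zero
  have key : ∀ e, (36 * Real.sqrt 3 - c) * (y' e - y e) ≤
      ∑ k, (a e k * (z' e k - z e k) - 6 * Real.sqrt 3 * y e *
        (2 * z e k * (z' e k - z e k) + (z' e k - z e k) ^ 2 / 4)) -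
      (∑ k, a e k * z' e k + (b e * y' e - 6 * Real.sqrt 3 * (y' e * (z' e 0 ^ 2 + z' e 1 ^ 2)) -
        6 * (6 * Real.sqrt 3) * (y' e * Real.log (y' e))) -
      (∑ k, a e k * z e k + (b e * y e - 6 * Real.sqrt 3 * (y e * (z e 0 ^ 2 + z e 1 ^ 2)) -
        6 * (6 * Real.sqrt 3) * (y e * Real.log (y e))))) := by
    intro e
    simp only [Fin.sum_univ_two]
    obtain ⟨p0, p1⟩ := hz e 0
    obtain ⟨q0, q1⟩ := hz e 1
    obtain ⟨p0', p1'⟩ := hz' e 0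
    obtain ⟨q0', q1'⟩ := hz' e 1
    set s := z' e 0 ^ 2 + z' e 1 ^ 2 - (z e 0 ^ 2 + z e 1 ^ 2) with hs
    have hs2 : |s / 6| ≤ 1 / 3 := by
      rw [abs_le, hs]
      constructor <;> nlinarith
    -- Gibbs' inequality compares `y'` with `y exp (-s / 6)`, the softmax for `z'` up to normalization
    have hexp := exp_neg_le hs2
    have hss : s ^ 2 ≤ 8 * ((z' e 0 - z e 0) ^ 2 + (z' e 1 - z e 1) ^ 2) := by
      have : s = (z' e 0 - z e 0) * (z' e 0 + z e 0) + (z' e 1 - z e 1) * (z' e 1 + z e 1) := by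
        rw [hs]; ring
      have i1 : ((z' e 0 - z e 0) * (z' e 0 + z e 0)) ^ 2 ≤ 4 * (z' e 0 - z e 0) ^ 2 := by
        rw [mul_pow, mul_comm]
        exact mul_le_mul_of_nonneg_right (by nlinarith) (sq_nonneg _)
      have i2 : ((z' e 1 - z e 1) * (z' e 1 + z e 1)) ^ 2 ≤ 4 * (z' e 1 - z e 1) ^ 2 := by
        rw [mul_pow, mul_comm]
        exact mul_le_mul_of_nonneg_right (by nlinarith) (sq_nonneg _)
      rw [this]
      nlinarith [sq_nonneg ((z' e 0 - z e 0) * (z' e 0 + z e 0) -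
        (z' e 1 - z e 1) * (z' e 1 + z e 1))]
    have hg := sub_le_mul_log_sub (hy'.1 e) (mul_pos (hy.pos e) (Real.exp_pos (-(s / 6))))
    rw [Real.log_mul (hy.pos e).ne' (Real.exp_pos _).ne', Real.log_exp] at hg
    have hE : y e * Real.exp (-(s / 6)) ≤ y e * (1 - s / 6 +
        (9 / 16 * (8 * ((z' e 0 - z e 0) ^ 2 + (z' e 1 - z e 1) ^ 2)) / 36)) := by
      refine mul_le_mul_of_nonneg_left ?_ (hy.pos e).le
      nlinarith
    have hlog := hc e
    have hmain : 0 ≤ y' e * Real.log (y' e) - y' e * (Real.log (y e) + -(s / 6)) - (y' e - y e *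
        (1 - s / 6 + (9 / 16 * (8 * ((z' e 0 - z e 0) ^ 2 + (z' e 1 - z e 1) ^ 2)) / 36))) := by
      linarith
    have hmul := mul_nonneg (mul_nonneg (by norm_num : (0 : ℝ) ≤ 36) h3) hmain
    refine sub_nonneg.mp (hmul.trans (le_of_eq ?_))
    have hb : b e = 6 * (6 * Real.sqrt 3) * Real.log (y e) +
      6 * Real.sqrt 3 * (z e 0 ^ 2 + z e 1 ^ 2) + c := by linarith
    rw [hb, hs]
    ring
  have := Finset.sum_le_sum fun e (_ : e ∈ (Finset.univ : Finset (Fin m))) => key e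
  rw [← Finset.mul_sum, hsum, mul_zero] at this
  exact this

lemma oracleObj_le_softmax {a : Fin m → Fin 2 → ℝ} {b : Fin m → ℝ} {z : Fin m → Fin 2 → ℝ}
    {y y' : Fin m → ℝ} (hz : ∀ e k, z e k ∈ Set.Icc (0 : ℝ) 1) (hy : IsSoftmax b z y)
    (hy' : y' ∈ stdSimplex ℝ (Fin m)) :
    oracleObj (a, b) (z, y') ≤ oracleObj (a, b) (z, y) := by
  have := oracleObj_le (a := a) hz hz hy hy'
  simp only [sub_self, mul_zero, zero_pow (two_ne_zero), zero_div, add_zero,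
    Finset.sum_const_zero] at this
  linarith

lemma IsSoftmax.mem {b : Fin m → ℝ} {z : Fin m → Fin 2 → ℝ} {y : Fin m → ℝ}
    (hy : IsSoftmax b z y) : y ∈ stdSimplex ℝ (Fin m) :=
  ⟨fun e => (hy.pos e).le, hy.sum_eq⟩

lemma oracleObj_sub (a : Fin m → Fin 2 → ℝ) (b : Fin m → ℝ) (z z' : Fin m → Fin 2 → ℝ)
    (y : Fin m → ℝ) : oracleObj (a, b) (z', y) - oracleObj (a, b) (z, y) =
      zObj a z' y - zObj a z y := by
  rw [oracleObj_eq, oracleObj_eq, add_sub_add_right_eq_sub, ← Finset.sum_sub_distrib, zObj, zObj,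
    ← Finset.sum_sub_distrib]
  refine Finset.sum_congr rfl fun e _ => ?_
  simp only [Fin.sum_univ_two]
  ring

/-- One round of alternating maximization reduces the gap by the factor `3/4`. -/
theorem oracleObj_contract {a : Fin m → Fin 2 → ℝ} {b : Fin m → ℝ} {z z' : Fin m → Fin 2 → ℝ}
    {y y' : Fin m → ℝ} (hz : z ∈ feasibleSet ends D) (hy : IsSoftmax b z y)
    (hz' : z' ∈ feasibleSet ends D) (hmax : ∀ x ∈ feasibleSet ends D, zObj a x y ≤ zObj a z' y)
    (hy' : IsSoftmax b z' y') {w : SaddleVec m} (hw : w ∈ saddleDomain ends D) :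
    oracleObj (a, b) w - oracleObj (a, b) (z', y') ≤
      3 / 4 * (oracleObj (a, b) w - oracleObj (a, b) (z, y)) := by
  obtain ⟨zs, ys⟩ := w
  have h1 := oracleObj_le (a := a) hz.1 hw.1.1 hy hw.2
  have h2 := oracleObj_le_softmax (a := a) hz'.1 hy' hy.mem
  have h3 := oracleObj_sub a b z z' y
  -- the new `z'` is at least as good as moving a quarter of the way to the optimum, for which the
  -- loss `|z* - z|² / 16` in the quadratic term matches the gain in `oracleObj_le`
  have hθ : (fun e k => z e k + 1 / 4 * (zs e k - z e k)) ∈ feasibleSet ends D := by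
    refine ⟨fun e k => ?_, fun u => ?_⟩
    · have := hz.1 e k; have := hw.1.1 e k
      simp only at this
      constructor <;> linarith
    · have e1 : ∑ e, ∑ k, (if ends e k = u then z e k + 1 / 4 * (zs e k - z e k) else 0) =
          3 / 4 * ∑ e, ∑ k, (if ends e k = u then z e k else 0) +
          1 / 4 * ∑ e, ∑ k, (if ends e k = u then zs e k else 0) := by
        simp only [Finset.mul_sum, ← Finset.sum_add_distrib]
        refine Finset.sum_congr rfl fun e _ => Finset.sum_congr rfl fun k _ => ?_
        split_ifs
        · ring
        · simp
      rw [e1]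
      have h5 := hz.2 u
      have h6 := hw.1.2 u
      simp only at h6
      linarith
  have h4 := hmax _ hθ
  have h5 : zObj a (fun e k => z e k + 1 / 4 * (zs e k - z e k)) y - zObj a z y = 1 / 4 *
      ∑ e, ∑ k, (a e k * (zs e k - z e k) - 6 * Real.sqrt 3 * y e *
        (2 * z e k * (zs e k - z e k) + (zs e k - z e k) ^ 2 / 4)) := by
    simp only [zObj, ← Finset.sum_sub_distrib, Finset.mul_sum]
    exact Finset.sum_congr rfl fun e _ => Finset.sum_congr rfl fun k _ => by ring
  linarith

/-- The first round of alternating maximization reaches a constant gap from any start. -/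
theorem oracleObj_first {a : Fin m → Fin 2 → ℝ} {b : Fin m → ℝ} {z z' : Fin m → Fin 2 → ℝ}
    {y y' : Fin m → ℝ} (hz : ∀ e k, z e k ∈ Set.Icc (0 : ℝ) 1) (hy : IsSoftmax b z y)
    (hz' : z' ∈ feasibleSet ends D) (hmax : ∀ x ∈ feasibleSet ends D, zObj a x y ≤ zObj a z' y)
    (hy' : IsSoftmax b z' y') {w : SaddleVec m} (hw : w ∈ saddleDomain ends D) :
    oracleObj (a, b) w - oracleObj (a, b) (z', y') ≤ 42 := by
  obtain ⟨zs, ys⟩ := w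
  have h2 := oracleObj_le_softmax (a := a) hz'.1 hy' hy.mem
  have h3 := oracleObj_sub a b zs z' y
  have h4 := hmax _ hw.1
  have h5 := oracleObj_le_softmax (a := a) hz hy hw.2
  have hbd : ∀ (p : Fin m → ℝ) (x : Fin m → Fin 2 → ℝ), p ∈ stdSimplex ℝ (Fin m) →
      (∀ e k, x e k ∈ Set.Icc (0 : ℝ) 1) → 0 ≤ ∑ e, p e * (x e 0 ^ 2 + x e 1 ^ 2) ∧
      ∑ e, p e * (x e 0 ^ 2 + x e 1 ^ 2) ≤ 2 := by
    intro p x hp hx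
    have hx2 : ∀ e k, x e k ^ 2 ≤ 1 := fun e k => pow_le_one₀ (hx e k).1 (hx e k).2
    refine ⟨Finset.sum_nonneg fun e _ => mul_nonneg (hp.1 e) (by positivity), ?_⟩
    calc ∑ e, p e * (x e 0 ^ 2 + x e 1 ^ 2) ≤ ∑ e, p e * 2 :=
          Finset.sum_le_sum fun e _ => mul_le_mul_of_nonneg_left
            (by linarith [hx2 e 0, hx2 e 1]) (hp.1 e)
      _ = 2 := by rw [← Finset.sum_mul, hp.2, one_mul]
  -- the objective differs from a separable function of `z` and `y` only by the bounded quadratic term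
  have b1 := hbd ys z hw.2 hz
  have b2 := hbd y z hy.mem hz
  have b3 := hbd ys zs hw.2 hw.1.1
  have b4 := hbd y zs hy.mem hw.1.1
  have h7 : oracleObj (a, b) (zs, ys) - oracleObj (a, b) (zs, y) =
      oracleObj (a, b) (z, ys) - oracleObj (a, b) (z, y) + 6 * Real.sqrt 3 *
      (∑ e, ys e * (z e 0 ^ 2 + z e 1 ^ 2) - ∑ e, y e * (z e 0 ^ 2 + z e 1 ^ 2) -
      ∑ e, ys e * (zs e 0 ^ 2 + zs e 1 ^ 2) + ∑ e, y e * (zs e 0 ^ 2 + zs e 1 ^ 2)) := by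
    simp only [oracleObj_eq, Finset.sum_add_distrib, Finset.sum_sub_distrib, ← Finset.mul_sum]
    ring
  have h8 : Real.sqrt 3 ≤ 7 / 4 := Real.sqrt_le_iff.mpr ⟨by norm_num, by norm_num⟩
  nlinarith [Real.sqrt_nonneg 3]

/-- Optimality of the clamped multiplier solution of the per-vertex quadratic knapsack problems. -/
theorem zObj_le_of_kkt {a z : Fin m → Fin 2 → ℝ} {y : Fin m → ℝ} {lam : Fin n → ℝ}
    (hy : ∀ e, 0 < y e) (hlam : ∀ u, 0 ≤ lam u)
    (hz : ∀ e k, z e k = max 0 (min 1 ((a e k - lam (ends e k)) / (12 * Real.sqrt 3 * y e))))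
    (hcomp : ∀ u, lam u = 0 ∨ ∑ e, ∑ k, (if ends e k = u then z e k else 0) = D) :
    ∀ x ∈ feasibleSet ends D, zObj a x y ≤ zObj a z y := by
  intro x hx
  have h3 : 0 < Real.sqrt 3 := Real.sqrt_pos.mpr (by norm_num)
  have key : ∀ e k, a e k * x e k - 6 * Real.sqrt 3 * y e * x e k ^ 2 -
      (a e k * z e k - 6 * Real.sqrt 3 * y e * z e k ^ 2) ≤
      lam (ends e k) * (x e k - z e k) := by
    intro e k
    have hq : 0 < 12 * Real.sqrt 3 * y e := mul_pos (by positivity) (hy e)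
    set t := (a e k - lam (ends e k)) / (12 * Real.sqrt 3 * y e) with ht
    have ha : a e k = lam (ends e k) + 12 * Real.sqrt 3 * y e * t := by
      rw [ht, mul_div_cancel₀ _ hq.ne']; ring
    obtain ⟨x0, x1⟩ := hx.1 e k
    -- clamping is the projection to `[0, 1]`
    have hzz : (z e k - t) ^ 2 ≤ (x e k - t) ^ 2 := by
      rw [hz e k]
      rcases le_total t 0 with h | h
      · rw [min_eq_right (by linarith), max_eq_left h]; nlinarith
      · rcases le_total t 1 with h' | h'
        · rw [min_eq_right h', max_eq_right h, sub_self, zero_pow two_ne_zero]; positivity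
        · rw [min_eq_left h', max_eq_right zero_le_one]; nlinarith
    rw [ha]
    nlinarith
  have hs := Finset.sum_le_sum fun e (_ : e ∈ (Finset.univ : Finset (Fin m))) =>
    Finset.sum_le_sum fun k (_ : k ∈ (Finset.univ : Finset (Fin 2))) => key e k
  have hswap : ∑ e, ∑ k, lam (ends e k) * (x e k - z e k) =
      ∑ u, lam u * (∑ e, ∑ k, (if ends e k = u then x e k else 0) -
        ∑ e, ∑ k, (if ends e k = u then z e k else 0)) := by
    simp only [← Finset.sum_sub_distrib, Finset.mul_sum]
    rw [Finset.sum_comm (s := (univ : Finset (Fin n)))]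
    refine Finset.sum_congr rfl fun e _ => ?_
    rw [Finset.sum_comm (s := (univ : Finset (Fin n)))]
    refine Finset.sum_congr rfl fun k _ => ?_
    rw [Finset.sum_eq_single (ends e k)]
    · simp
    · intro u _ hu
      simp [Ne.symm hu]
    · simp
  have hneg : ∑ u, lam u * (∑ e, ∑ k, (if ends e k = u then x e k else 0) -
        ∑ e, ∑ k, (if ends e k = u then z e k else 0)) ≤ 0 := by
    refine Finset.sum_nonpos fun u _ => ?_
    rcases hcomp u with h | h
    · rw [h, zero_mul]
    · rw [h]
      exact mul_nonpos_of_nonneg_of_nonpos (hlam u) (sub_nonpos.mpr (hx.2 u))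
  simp only [Finset.sum_sub_distrib] at hs
  simp only [zObj, Finset.sum_sub_distrib]
  linarith

end oracle

/-! ### What the iterates of a run certify -/

section run

variable {n m : ℕ} {G : SimpleGraph (Fin n)}

/-- The invariant of `T` consecutive extragradient steps for the guess `D` with oracle error `δ`:
the potential has grown by at most `T δ`, and the iterate is a sum of `T` points of the domain and
the starting point. -/
structure RunInv (ends : Fin m → Fin 2 → Fin n) (D δ : ℝ) (T : ℕ) (w : SaddleVec m) : Prop where
  pot : ∀ u ∈ saddleDomain ends D,
    pairing u (saddleOp w) - regularizer u ≤ 64 * (Real.log m + 1) + T * δ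
  y_nonneg : ∀ e, 0 ≤ w.2 e
  y_sum : ∑ e, w.2 e = T + 1
  z_nonneg : ∀ e k, 0 ≤ w.1 e k
  load : ∀ u, ∑ e, ∑ k, (if ends e k = u then w.1 e k else 0) ≤ T * D

lemma sqrt_three_le : Real.sqrt 3 ≤ 16 / 9 := Real.sqrt_le_iff.mpr ⟨by norm_num, by norm_num⟩

/-- The potential of the starting point: the entropy is at most `log m`, everything else is bounded. -/
lemma runInv_start (ends : Fin m → Fin 2 → Fin n) (D δ : ℝ) (hm : 1 ≤ m) :
    RunInv ends D δ 0 (startVec m) := by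
  have hm' : (0 : ℝ) < m := by exact_mod_cast hm
  have hlog : 0 ≤ Real.log m := Real.log_nonneg (by exact_mod_cast hm)
  refine ⟨?_, fun e => by simp [startVec], ?_, fun e k => by simp [startVec], fun u => by
    simp [startVec]⟩
  · rintro ⟨z, y⟩ ⟨⟨hz, -⟩, hy0, hy1⟩
    simp only at hz hy0 hy1
    have h1 : pairing (z, y) (saddleOp (startVec m)) ≤ 2 := by
      rw [pairing_saddleOp]
      simp only [startVec, mul_zero, sub_zero]
      calc ∑ e, ∑ k, z e k * (1 / (m : ℝ)) ≤ ∑ _e : Fin m, ∑ _k : Fin 2, 1 / (m : ℝ) :=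
            Finset.sum_le_sum fun e _ => Finset.sum_le_sum fun k _ => by
              have := (hz e k).2
              exact mul_le_of_le_one_left (by positivity) this
        _ = 2 := by simp; field_simp
    have h2 : -Real.log m ≤ ∑ e, y e * Real.log (y e) := by
      have h := Finset.sum_le_sum fun e (_ : e ∈ (univ : Finset (Fin m))) =>
        sub_le_mul_log_sub (hy0 e) (show (0 : ℝ) < 1 / m by positivity)
      rw [Finset.sum_sub_distrib, Finset.sum_sub_distrib, ← Finset.sum_mul, hy1, one_mul] at h
      simp only [Finset.sum_const, Finset.card_univ, Fintype.card_fin, nsmul_eq_mul, one_div,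
        Real.log_inv] at h
      rw [mul_inv_cancel₀ hm'.ne'] at h
      linarith
    have h3 : 0 ≤ ∑ e, y e * (z e 0 ^ 2 + z e 1 ^ 2) :=
      Finset.sum_nonneg fun e _ => mul_nonneg (hy0 e) (by positivity)
    have h4 : regularizer (z, y) = 6 * Real.sqrt 3 * (∑ e, y e * (z e 0 ^ 2 + z e 1 ^ 2) +
        6 * ∑ e, y e * Real.log (y e) - 2) := by
      simp only [regularizer, Finset.sum_add_distrib, Finset.mul_sum]
    rw [h4]
    have h5 := sqrt_three_le
    have h6 := Real.sqrt_nonneg 3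
    have h7 : 6 * Real.sqrt 3 * (∑ e, y e * (z e 0 ^ 2 + z e 1 ^ 2) +
        6 * ∑ e, y e * Real.log (y e) - 2) ≥ 6 * Real.sqrt 3 * (6 * (-Real.log m) - 2) :=
      mul_le_mul_of_nonneg_left (by linarith) (by positivity)
    have h8 : Real.sqrt 3 * Real.log m ≤ 16 / 9 * Real.log m :=
      mul_le_mul_of_nonneg_right h5 hlog
    push_cast
    nlinarith
  · simp [startVec]; field_simp

lemma RunInv.step {ends : Fin m → Fin 2 → Fin n} {D δ : ℝ} {T : ℕ} {w w' : SaddleVec m}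
    (h : RunInv ends D δ T w) (hs : IsExtragradientStep ends D δ w w') :
    RunInv ends D δ (T + 1) w' := by
  obtain ⟨p, q, hp, hq, rfl⟩ := hs
  refine ⟨fun u hu => ?_, fun e => ?_, ?_, fun e k => ?_, fun u => ?_⟩
  · have := potential_extragradient h.pot hp hq u hu
    push_cast
    linarith
  · exact add_nonneg (h.y_nonneg e) (hq.1.2.1 e)
  · simp only [Prod.snd_add, Pi.add_apply, Finset.sum_add_distrib, h.y_sum, hq.1.2.2]
    push_cast
    ring
  · exact add_nonneg (h.z_nonneg e k) (hq.1.1.1 e k).1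
  · have e1 : ∑ e, ∑ k, (if ends e k = u then (w + q).1 e k else 0) =
        ∑ e, ∑ k, (if ends e k = u then w.1 e k else 0) +
        ∑ e, ∑ k, (if ends e k = u then q.1 e k else 0) := by
      simp only [← Finset.sum_add_distrib]
      refine Finset.sum_congr rfl fun e _ => Finset.sum_congr rfl fun k _ => ?_
      split_ifs <;> simp
    rw [e1]
    push_cast
    linarith [h.load u, hq.1.1.2 u]

lemma regularizer_nonpos {ends : Fin m → Fin 2 → Fin n} {D : ℝ} {u : SaddleVec m}
    (hu : u ∈ saddleDomain ends D) : regularizer u ≤ 0 := by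
  obtain ⟨⟨hz, -⟩, hy0, hy1⟩ := hu
  have h : ∑ e, (u.2 e * (u.1 e 0 ^ 2 + u.1 e 1 ^ 2) + 6 * (u.2 e * Real.log (u.2 e))) ≤
      ∑ e, u.2 e * 2 := by
    refine Finset.sum_le_sum fun e _ => ?_
    have hx : ∀ k, u.1 e k ^ 2 ≤ 1 := fun k => pow_le_one₀ (hz e k).1 (hz e k).2
    have h1 : u.2 e ≤ 1 := by
      rw [← hy1]
      exact Finset.single_le_sum (fun i _ => hy0 i) (Finset.mem_univ e)
    have h2 := mul_nonpos_of_nonneg_of_nonpos (hy0 e) (Real.log_nonpos (hy0 e) h1)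
    have h3 := mul_le_mul_of_nonneg_left (show u.1 e 0 ^ 2 + u.1 e 1 ^ 2 ≤ 2 by
      linarith [hx 0, hx 1]) (hy0 e)
    linarith
  rw [← Finset.sum_mul, hy1, one_mul] at h
  exact mul_nonpos_of_nonneg_of_nonpos (by positivity) (by linarith)

/-- If some edge is covered badly, then the dual iterate is a certificate of infeasibility with
slack. -/
lemma RunInv.certificate {ends : Fin m → Fin 2 → Fin n} {D δ η : ℝ} {T : ℕ} {w : SaddleVec m}
    (h : RunInv ends D δ T w) (hδ : δ ≤ η / 4) (hT : 256 * (Real.log m + 1) ≤ T * η) {e₀ : Fin m}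
    (he : w.1 e₀ 0 + w.1 e₀ 1 < (1 - η) * T) :
    ∀ z ∈ feasibleSet ends D, ∑ e, w.2 e * (z e 0 + z e 1) ≤ (1 - η / 2) * T := by
  intro z hz
  -- the potential is evaluated at the vertex of the simplex that belongs to `e₀`
  have hu : (z, fun e => if e = e₀ then (1 : ℝ) else 0) ∈ saddleDomain ends D := by
    refine ⟨hz, fun e => ?_, by simp⟩
    simp only
    split_ifs <;> norm_num
  have h1 := h.pot _ hu
  have h2 := regularizer_nonpos hu
  have h3 : pairing (z, fun e => if e = e₀ then (1 : ℝ) else 0) (saddleOp w) =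
      ∑ e, w.2 e * (z e 0 + z e 1) - (w.1 e₀ 0 + w.1 e₀ 1) := by
    simp only [pairing, saddleOp, ite_mul, one_mul, zero_mul, Finset.sum_ite_eq', Finset.mem_univ,
      if_true, Fin.sum_univ_two]
    rw [sub_eq_add_neg]
    congr 1
    exact Finset.sum_congr rfl fun e _ => by ring
  have h4 : (T : ℝ) * δ ≤ T * (η / 4) := mul_le_mul_of_nonneg_left hδ (Nat.cast_nonneg _)
  rw [h3] at h1
  nlinarith

/-- If all edges are covered well, then `OPT` is at most about the guess. -/
lemma RunInv.maxDensity_le (E : EdgeListing G m) (hm : 1 ≤ m) {D δ η : ℝ} {T : ℕ}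
    {w : SaddleVec m} (h : RunInv E.ends D δ T w) (hη : η < 1) (hT : 0 < T)
    (he : ∀ e, (1 - η) * T ≤ w.1 e 0 + w.1 e 1) : maxDensity G ≤ D / (1 - η) := by
  have h1 := mul_maxDensity_le E (E.pos hm) h.z_nonneg h.load he
  have hT' : (0 : ℝ) < T := by exact_mod_cast hT
  rw [le_div_iff₀ (by linarith)]
  nlinarith

/-- A certificate with slack has a level set on the geometric grid that is too dense. -/
lemma exists_dense_level {ends : Fin m → Fin 2 → Fin n} {D θ : ℝ} {T J : ℕ} {Y : Fin m → ℝ}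
    (hD : 0 ≤ D) (hY : ∀ e, 0 ≤ Y e) (hsum : ∑ e, Y e = T + 1) (hθ : 0 < θ) (hθ1 : θ < 1 / 2)
    (hJ : m * (1 - θ) ^ (J + 1) ≤ θ)
    (hcert : ∀ z ∈ feasibleSet ends D, ∑ e, Y e * (z e 0 + z e 1) ≤ (1 - 2 * θ) * T) :
    ∃ j ≤ J, ∑ u, min D (degIn ends (levelSet Y ((T + 1) * (1 - θ) ^ j)) u : ℝ) <
      (levelSet Y ((T + 1) * (1 - θ) ^ j)).card := by
  by_contra! hc
  have hT : (0 : ℝ) < T + 1 := by positivity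
  obtain ⟨z, hz, h⟩ := exists_feasible_of_levels hD hY (fun e => by
    rw [← hsum]; exact Finset.single_le_sum (fun i _ => hY i) (Finset.mem_univ e)) hT
    (by linarith : 0 < 1 - θ) (by linarith) J hc
  have h1 := hcert z hz
  rw [hsum] at h
  have h2 : (m : ℝ) * ((T + 1) * (1 - θ) ^ (J + 1)) ≤ (T + 1) * θ := by
    calc (m : ℝ) * ((T + 1) * (1 - θ) ^ (J + 1)) = (T + 1) * (m * (1 - θ) ^ (J + 1)) := by ring
      _ ≤ _ := mul_le_mul_of_nonneg_left hJ hT.le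
  nlinarith

end run

end

noncomputable section

/-! ### Merge sort -/

/-- `P` is sorted on each of the first `B` blocks of length `w`. -/
def BlockSorted (P : ℕ → ℝ) (w B : ℕ) : Prop :=
  ∀ b < B, ∀ r r', r ≤ r' → r' < w → P (b * w + r) ≤ P (b * w + r')

/-- The state of a merge of the blocks of length `w` that start at `lo` and `lo + w` in `P` after
`x + y` steps: `Q` holds, from `lo` on, the first `x` entries of the first block and the first `y`
entries of the second block in sorted order. -/
structure MergeInv (P Q₀ : ℕ → ℝ) (lo w x y : ℕ) (Q : ℕ → ℝ) : Prop where
  hx : x ≤ w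
  hy : y ≤ w
  sorted : ∀ r r', r ≤ r' → r' < x + y → Q (lo + r) ≤ Q (lo + r')
  le₁ : ∀ r < x + y, ∀ r', x ≤ r' → r' < w → Q (lo + r) ≤ P (lo + r')
  le₂ : ∀ r < x + y, ∀ r', y ≤ r' → r' < w → Q (lo + r) ≤ P (lo + w + r')
  mem₁ : ∀ r' < x, ∃ r < x + y, Q (lo + r) = P (lo + r')
  mem₂ : ∀ r' < y, ∃ r < x + y, Q (lo + r) = P (lo + w + r')
  out : ∀ j, j < lo ∨ lo + (x + y) ≤ j → Q j = Q₀ j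

lemma MergeInv.take₁ {P Q₀ Q : ℕ → ℝ} {lo w x y : ℕ} (h : MergeInv P Q₀ lo w x y Q)
    (hP : ∀ r r', r ≤ r' → r' < w → P (lo + r) ≤ P (lo + r'))
    (hP' : ∀ r r', r ≤ r' → r' < w → P (lo + w + r) ≤ P (lo + w + r')) (hxw : x < w)
    (hle : y < w → P (lo + x) ≤ P (lo + w + y)) :
    MergeInv P Q₀ lo w (x + 1) y (Function.update Q (lo + (x + y)) (P (lo + x))) := by
  have old : ∀ r < x + y, Function.update Q (lo + (x + y)) (P (lo + x)) (lo + r) = Q (lo + r) :=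
    fun r hr => Function.update_of_ne (by omega) _ _
  have new : Function.update Q (lo + (x + y)) (P (lo + x)) (lo + (x + y)) = P (lo + x) :=
    Function.update_self _ _ _
  refine ⟨hxw, h.hy, fun r r' hr hr' => ?_, fun r hr r' h1 h2 => ?_, fun r hr r' h1 h2 => ?_,
    fun r' hr' => ?_, fun r' hr' => ?_, fun j hj => ?_⟩
  · rcases Nat.lt_or_ge r' (x + y) with h' | h'
    · rw [old r (by omega), old r' h']; exact h.sorted r r' hr h'
    · obtain rfl : r' = x + y := by omega
      rw [new]
      rcases Nat.lt_or_ge r (x + y) with h'' | h''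
      · rw [old r h'']; exact h.le₁ r h'' x le_rfl hxw
      · obtain rfl : r = x + y := by omega
        rw [new]
  · rcases Nat.lt_or_ge r (x + y) with h' | h'
    · rw [old r h']; exact h.le₁ r h' r' (by omega) h2
    · obtain rfl : r = x + y := by omega
      rw [new]; exact hP x r' (by omega) h2
  · rcases Nat.lt_or_ge r (x + y) with h' | h'
    · rw [old r h']; exact h.le₂ r h' r' h1 h2
    · obtain rfl : r = x + y := by omega
      rw [new]; exact (hle (by omega)).trans (hP' y r' h1 h2)
  · rcases Nat.lt_or_ge r' x with h' | h'
    · obtain ⟨r, hr, e⟩ := h.mem₁ r' h'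
      exact ⟨r, by omega, by rw [old r hr, e]⟩
    · obtain rfl : r' = x := by omega
      exact ⟨r' + y, by omega, new⟩
  · obtain ⟨r, hr, e⟩ := h.mem₂ r' hr'
    exact ⟨r, by omega, by rw [old r hr, e]⟩
  · rw [Function.update_of_ne (by omega)]
    exact h.out j (by omega)

lemma MergeInv.take₂ {P Q₀ Q : ℕ → ℝ} {lo w x y : ℕ} (h : MergeInv P Q₀ lo w x y Q)
    (hP : ∀ r r', r ≤ r' → r' < w → P (lo + r) ≤ P (lo + r'))
    (hP' : ∀ r r', r ≤ r' → r' < w → P (lo + w + r) ≤ P (lo + w + r')) (hyw : y < w)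
    (hle : x < w → P (lo + w + y) ≤ P (lo + x)) :
    MergeInv P Q₀ lo w x (y + 1) (Function.update Q (lo + (x + y)) (P (lo + w + y))) := by
  have old : ∀ r < x + y,
      Function.update Q (lo + (x + y)) (P (lo + w + y)) (lo + r) = Q (lo + r) :=
    fun r hr => Function.update_of_ne (by omega) _ _
  have new : Function.update Q (lo + (x + y)) (P (lo + w + y)) (lo + (x + y)) = P (lo + w + y) :=
    Function.update_self _ _ _
  refine ⟨h.hx, hyw, fun r r' hr hr' => ?_, fun r hr r' h1 h2 => ?_, fun r hr r' h1 h2 => ?_,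
    fun r' hr' => ?_, fun r' hr' => ?_, fun j hj => ?_⟩
  · rcases Nat.lt_or_ge r' (x + y) with h' | h'
    · rw [old r (by omega), old r' h']; exact h.sorted r r' hr h'
    · obtain rfl : r' = x + y := by omega
      rw [new]
      rcases Nat.lt_or_ge r (x + y) with h'' | h''
      · rw [old r h'']; exact h.le₂ r h'' y le_rfl hyw
      · obtain rfl : r = x + y := by omega
        rw [new]
  · rcases Nat.lt_or_ge r (x + y) with h' | h'
    · rw [old r h']; exact h.le₁ r h' r' h1 h2
    · obtain rfl : r = x + y := by omega
      rw [new]; exact (hle (by omega)).trans (hP x r' h1 h2)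
  · rcases Nat.lt_or_ge r (x + y) with h' | h'
    · rw [old r h']; exact h.le₂ r h' r' (by omega) h2
    · obtain rfl : r = x + y := by omega
      rw [new]; exact hP' y r' (by omega) h2
  · obtain ⟨r, hr, e⟩ := h.mem₁ r' hr'
    exact ⟨r, by omega, by rw [old r hr, e]⟩
  · rcases Nat.lt_or_ge r' y with h' | h'
    · obtain ⟨r, hr, e⟩ := h.mem₂ r' h'
      exact ⟨r, by omega, by rw [old r hr, e]⟩
    · obtain rfl : r' = y := by omega
      exact ⟨x + r', by omega, new⟩
  · rw [Function.update_of_ne (by omega)]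
    exact h.out j (by omega)

/-- Moves the next entry of the first block to the output. -/
def takeFst : HCmd :=
  .stR 10 (.reg 16 + .reg 20) (.load 9 (.reg 17)) ;; .asgN 17 (.reg 17 + 1)

/-- Moves the next entry of the second block to the output. -/
def takeSnd : HCmd :=
  .stR 10 (.reg 16 + .reg 20) (.load 9 (.reg 18)) ;; .asgN 18 (.reg 18 + 1)

/-- One step of a merge. -/
def mergeStep : HCmd :=
  .ite (.nlt (.reg 17) (.reg 19))
    (.ite (.nlt (.reg 18) (.reg 21))
      (.ite (.rlt (.load 9 (.reg 18)) (.load 9 (.reg 17))) takeSnd takeFst) takeFst) takeSnd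

/-- Merges two adjacent blocks of length `reg 14` from position `reg 16` on, from the real array
`9` to the real array `10`; the integer register `26` holds `2 * reg 14`. -/
def mergeBlocks : HCmd :=
  (.asgN 17 (.reg 16) ;; .asgN 18 (.reg 16 + .reg 14) ;; .asgN 19 (.reg 16 + .reg 14) ;;
    .asgN 21 (.reg 16 + .reg 26)) ;; forLoop 20 26 mergeStep

lemma run_mergeBlocks {s : RamState} {lo w : ℕ} (hlo : s.nreg 16 = lo) (hw : s.nreg 14 = w)
    (hww : s.nreg 26 = 2 * w)
    (hP : ∀ r r', r ≤ r' → r' < w → s.rarr 9 (lo + r) ≤ s.rarr 9 (lo + r'))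
    (hP' : ∀ r r', r ≤ r' → r' < w → s.rarr 9 (lo + w + r) ≤ s.rarr 9 (lo + w + r')) :
    Run mergeBlocks s (80 * w + 20)
      (fun s' => MergeInv (s.rarr 9) (s.rarr 10) lo w w w (s'.rarr 10)) := by
  refine Run.straight_seq (T₂ := 2 * w * 40 + 3) rfl ?_
    (by
      have : HCmd.cost (.asgN 17 (.reg 16) ;; .asgN 18 (.reg 16 + .reg 14) ;;
        .asgN 19 (.reg 16 + .reg 14) ;; .asgN 21 (.reg 16 + .reg 26)) = 14 := rfl
      omega)
  refine (Run.forLoop_const (n := 2 * w) (τ := 35) (by simpa [HCmd.eff] using hww) rfl rfl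
    (fun t s' => ∃ x y, x + y = t ∧ s'.nreg 17 = lo + x ∧ s'.nreg 18 = lo + w + y ∧
      MergeInv (s.rarr 9) (s.rarr 10) lo w x y (s'.rarr 10)) _ ?_ ?_ le_rfl).mono le_rfl ?_
  · refine ⟨0, 0, rfl, by simp [HCmd.eff, hlo], by simp [HCmd.eff, hlo, hw], ?_⟩
    exact ⟨Nat.zero_le _, Nat.zero_le _, by simp, by simp, by simp, by simp, by simp, fun _ _ => rfl⟩
  · rintro t ht s' hf hik ⟨x, y, hxy, h17, h18, hI⟩
    have h9 : s'.rarr 9 = s.rarr 9 := hf.ra 9 rfl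
    have h16 : s'.nreg 16 = lo := by rw [hf.n 16 rfl]; simp [HCmd.eff, hlo]
    have h19 : s'.nreg 19 = lo + w := by rw [hf.n 19 rfl]; simp [HCmd.eff, hlo, hw]
    have h21 : s'.nreg 21 = lo + 2 * w := by rw [hf.n 21 rfl]; simp [HCmd.eff, hlo, hww]
    refine Run.straight rfl (by decide) ?_
    simp only [mergeStep, HCmd.eff, HTest.holds_nlt, HTest.holds_rlt, NExp.eval_reg,
      RExp.eval_load, h17, h18, h19, h21, h9]
    have fst : x < w → (y < w → s.rarr 9 (lo + x) ≤ s.rarr 9 (lo + w + y)) → ∃ x₁ y₁,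
        x₁ + y₁ = t + 1 ∧ ((takeFst.eff s').setN 20 (t + 1)).nreg 17 = lo + x₁ ∧
        ((takeFst.eff s').setN 20 (t + 1)).nreg 18 = lo + w + y₁ ∧
        MergeInv (s.rarr 9) (s.rarr 10) lo w x₁ y₁
          (((takeFst.eff s').setN 20 (t + 1)).rarr 10) := by
      intro h1 h2
      refine ⟨x + 1, y, by omega, by simp [takeFst, HCmd.eff, h17]; omega,
        by simp [takeFst, HCmd.eff, h18], ?_⟩
      have := hI.take₁ hP hP' h1 h2
      simpa [takeFst, HCmd.eff, h16, h17, h9, hik, hxy] using this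
    have snd : y < w → (x < w → s.rarr 9 (lo + w + y) ≤ s.rarr 9 (lo + x)) → ∃ x₁ y₁,
        x₁ + y₁ = t + 1 ∧ ((takeSnd.eff s').setN 20 (t + 1)).nreg 17 = lo + x₁ ∧
        ((takeSnd.eff s').setN 20 (t + 1)).nreg 18 = lo + w + y₁ ∧
        MergeInv (s.rarr 9) (s.rarr 10) lo w x₁ y₁
          (((takeSnd.eff s').setN 20 (t + 1)).rarr 10) := by
      intro h1 h2
      refine ⟨x, y + 1, by omega, by simp [takeSnd, HCmd.eff, h17],
        by simp [takeSnd, HCmd.eff, h18]; omega, ?_⟩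
      have := hI.take₂ hP hP' h1 h2
      simpa [takeSnd, HCmd.eff, h16, h18, h9, hik, hxy] using this
    have hx := hI.hx
    have hy := hI.hy
    split_ifs with c1 c2 c3
    · exact snd (by omega) (fun _ => c3.le)
    · exact fst (by omega) (fun _ => not_lt.mp c3)
    · exact fst (by omega) (fun h => absurd h (by omega))
    · exact snd (by omega) (fun h => absurd h (by omega))
  · rintro s' ⟨-, -, x, y, hxy, -, -, hI⟩
    have hx := hI.hx
    have hy := hI.hy
    obtain rfl : x = w := by omega
    obtain rfl : y = x := by omega
    exact hI

/-- One pass of bottom-up merge sort: merges all pairs of adjacent blocks of length `reg 14` of the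
real array `9`, whose length is in the integer register `12`. -/
def mergePass : HCmd :=
  (.asgN 26 (.reg 14 + .reg 14) ;; .asgN 16 0) ;;
    .loop (.nlt 16 12) (mergeBlocks ;; .asgN 16 (.reg 16 + .reg 26)) ;;
    forLoop 20 12 (.stR 9 (.reg 20) (.load 10 (.reg 20)))

/-- A merge pass doubles the length of the sorted blocks and loses no entry. -/
lemma run_mergePass {s : RamState} {w B : ℕ} (hw0 : 0 < w) (hw : s.nreg 14 = w)
    (hW : s.nreg 12 = B * (2 * w)) (hP : BlockSorted (s.rarr 9) w (2 * B)) :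
    Run mergePass s (90 * (B * (2 * w)) + 20) (fun s' => BlockSorted (s'.rarr 9) (2 * w) B ∧
      ∀ j < B * (2 * w), ∃ j' < B * (2 * w), s'.rarr 9 j' = s.rarr 9 j) := by
  have hBw : B ≤ B * (2 * w) := Nat.le_mul_of_pos_right B (by omega)
  refine Run.straight_seq (T₂ := (B * (80 * w + 25 + 1) + 1) + (B * (2 * w) * 9 + 3)) rfl ?_ ?_
  swap
  · have : B * (80 * w + 25 + 1) = 40 * (B * (2 * w)) + 26 * B := by ring
    rw [this]
    have : HCmd.cost (.asgN 26 (.reg 14 + .reg 14) ;; .asgN 16 0) = 6 := rfl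
    omega
  set s₁ := HCmd.eff (.asgN 26 (.reg 14 + .reg 14) ;; .asgN 16 0) s with hs₁
  refine Run.seq (Q₁ := fun s' => ∀ b < B, (∀ r r', r ≤ r' → r' < 2 * w →
      s'.rarr 10 (b * (2 * w) + r) ≤ s'.rarr 10 (b * (2 * w) + r')) ∧
      ∀ r < 2 * w, ∃ r' < 2 * w, s'.rarr 10 (b * (2 * w) + r') = s.rarr 9 (b * (2 * w) + r))
    ?_ ?_
  · refine (Run.loop (τ := 80 * w + 25) (fun j s' => ∃ b, b + j = B ∧ s'.nreg 16 = b * (2 * w) ∧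
      ∀ b' < b, (∀ r r', r ≤ r' → r' < 2 * w →
      s'.rarr 10 (b' * (2 * w) + r) ≤ s'.rarr 10 (b' * (2 * w) + r')) ∧
      ∀ r < 2 * w, ∃ r' < 2 * w, s'.rarr 10 (b' * (2 * w) + r') = s.rarr 9 (b' * (2 * w) + r)) B
      ⟨0, by omega, by simp [hs₁, HCmd.eff], by simp⟩ ?_ ?_).mono le_rfl ?_
    · rintro s' hf ⟨b, hb, h16, -⟩
      have h12 : s'.nreg 12 = B * (2 * w) := by rw [hf.n 12 rfl]; simp [hs₁, HCmd.eff, hW]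
      obtain rfl : b = B := by omega
      simp [RamTest.holds, h16, h12]
    · rintro j s' hf ⟨b, hb, h16, hdone⟩ -
      have h9 : s'.rarr 9 = s.rarr 9 := hf.ra 9 rfl
      have h14 : s'.nreg 14 = w := by rw [hf.n 14 rfl]; simp [hs₁, HCmd.eff, hw]
      have h26 : s'.nreg 26 = 2 * w := by rw [hf.n 26 rfl]; simp [hs₁, HCmd.eff, hw]; omega
      have p1 := hP (2 * b) (by omega)
      have p2 := hP (2 * b + 1) (by omega)
      rw [show 2 * b * w = b * (2 * w) by ring] at p1
      rw [show (2 * b + 1) * w = b * (2 * w) + w by ring] at p2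
      refine (Run.seq (T₂ := 5) (run_mergeBlocks h16 h14 h26 (by rwa [h9]) (by rwa [h9]))
        fun s₂ hf₂ hI => Run.straight rfl (by decide) ?_).time_le (by omega)
      rw [h9] at hI
      have hs16 : s₂.nreg 16 = b * (2 * w) := by rw [hf₂.n 16 rfl, h16]
      have hs26 : s₂.nreg 26 = 2 * w := by rw [hf₂.n 26 rfl, h26]
      refine ⟨b + 1, by omega, by simp [HCmd.eff, hs16, hs26]; ring, fun b' hb' => ?_⟩
      simp only [HCmd.eff, setN_rarr]
      rcases Nat.lt_or_ge b' b with h' | h'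
      · have hout : ∀ r < 2 * w, s₂.rarr 10 (b' * (2 * w) + r) = s'.rarr 10 (b' * (2 * w) + r) := by
          intro r hr
          have : (b' + 1) * (2 * w) ≤ b * (2 * w) := Nat.mul_le_mul_right _ h'
          exact hI.out _ (Or.inl (by rw [Nat.add_mul] at this; omega))
        refine ⟨fun r r' h1 h2 => ?_, fun r hr => ?_⟩
        · rw [hout r (by omega), hout r' h2]; exact (hdone b' h').1 r r' h1 h2
        · obtain ⟨r', hr', e⟩ := (hdone b' h').2 r hr
          exact ⟨r', hr', by rw [hout r' hr', e]⟩
      · obtain rfl : b' = b := by omega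
        refine ⟨fun r r' h1 h2 => hI.sorted r r' h1 (by omega), fun r hr => ?_⟩
        rcases Nat.lt_or_ge r w with h'' | h''
        · obtain ⟨r', hr', e⟩ := hI.mem₁ r h''
          exact ⟨r', by omega, e⟩
        · obtain ⟨r', hr', e⟩ := hI.mem₂ (r - w) (by omega)
          exact ⟨r', by omega, by rw [e]; congr 1; omega⟩
    · rintro s' ⟨hf, ⟨j, hj, b, hb, h16, hdone⟩, hnt⟩
      have h12 : s'.nreg 12 = B * (2 * w) := by rw [hf.n 12 rfl]; simp [hs₁, HCmd.eff, hW]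
      rw [RamTest.holds, h16, h12, not_lt] at hnt
      have := Nat.le_of_mul_le_mul_right hnt (by omega : 0 < 2 * w)
      obtain rfl : b = B := by omega
      exact hdone
  · intro s₂ hf₂ hQ
    have h12 : s₂.nreg 12 = B * (2 * w) := by rw [hf₂.n 12 rfl]; simp [hs₁, HCmd.eff, hW]
    refine (Run.mapR (n := B * (2 * w)) (fun j => s₂.rarr 10 j) (by decide) h12
      (fun k hk s' hf hik _ => by simp [hik, hf.ra 10 rfl]) (by
        simp [RExp.cost, NExp.cost])).mono le_rfl fun s' hs' => ⟨fun b hb r r' h1 h2 => ?_, ?_⟩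
    · have : (b + 1) * (2 * w) ≤ B * (2 * w) := Nat.mul_le_mul_right _ hb
      rw [Nat.add_mul] at this
      rw [hs', hs', if_pos (by omega), if_pos (by omega)]
      exact (hQ b hb).1 r r' h1 h2
    · intro j hj
      have hb : j / (2 * w) < B := (Nat.div_lt_iff_lt_mul (by omega)).mpr hj
      obtain ⟨r', hr', e⟩ := (hQ _ hb).2 (j % (2 * w)) (Nat.mod_lt _ (by omega))
      have : (j / (2 * w) + 1) * (2 * w) ≤ B * (2 * w) := Nat.mul_le_mul_right _ hb
      rw [Nat.add_mul] at this
      refine ⟨j / (2 * w) * (2 * w) + r', by omega, ?_⟩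
      rw [hs', if_pos (by omega), e, mul_comm, Nat.div_add_mod]

end

noncomputable section

/-- Sets the integer register `12` to the least power of two `2 ^ k` that is at least `reg 22`,
register `27` to `k`, and tabulates the smaller powers of two in the integer array `11`. -/
def setLevels : HCmd :=
  (.asgN 12 1 ;; .asgN 27 0) ;;
    .loop (.nlt 12 22) (.stN 11 (.reg 27) (.reg 12) ;; .asgN 12 (.reg 12 + .reg 12) ;;
      .asgN 27 (.reg 27 + 1))

/-- The powers of two are tabulated because the machine can neither divide nor shift. -/
lemma run_setLevels {s : RamState} {L : ℕ} (hL : s.nreg 22 = L) (hL1 : 1 ≤ L) :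
    Run setLevels s (20 * L + 10) (fun s' => ∃ k, s'.nreg 12 = 2 ^ k ∧ s'.nreg 27 = k ∧
      L ≤ 2 ^ k ∧ 2 ^ k < 2 * L ∧ ∀ i < k, s'.narr 11 i = 2 ^ i) := by
  refine Run.straight_seq (T₂ := L * (15 + 1) + 1) rfl ?_ (by
    have : HCmd.cost (.asgN 12 1 ;; .asgN 27 0) = 4 := rfl
    omega)
  refine (Run.loop (τ := 15) (fun j s' => ∃ k, s'.nreg 12 = 2 ^ k ∧ s'.nreg 27 = k ∧
      (2 ^ k < 2 * L) ∧ (L ≤ j + 2 ^ k) ∧ ∀ i < k, s'.narr 11 i = 2 ^ i) L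
      ⟨0, by simp [HCmd.eff], by simp [HCmd.eff], by omega, by omega, by simp⟩ ?_ ?_).mono le_rfl ?_
  · rintro s' hf ⟨k, h12, h27, h1, h2, h3⟩
    have h22 : s'.nreg 22 = L := by rw [hf.n 22 rfl]; simp [HCmd.eff, hL]
    simp only [RamTest.holds, h12, h22]
    omega
  · rintro j s' hf ⟨k, h12, h27, h1, h2, h3⟩ ht
    have h22 : s'.nreg 22 = L := by rw [hf.n 22 rfl]; simp [HCmd.eff, hL]
    rw [RamTest.holds, h12, h22] at ht
    have hk : 0 < 2 ^ k := by positivity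
    refine Run.straight rfl (by decide) ⟨k + 1, by simp [HCmd.eff, h12]; ring,
      by simp [HCmd.eff, h27], by rw [pow_succ]; omega, by rw [pow_succ]; omega, fun i hi => ?_⟩
    simp only [HCmd.eff, setN_narr, setNArr_narr, if_true, NExp.eval_reg, h27, h12,
      Function.update_apply]
    split_ifs with h
    · rw [h]
    · exact h3 i (by omega)
  · rintro s' ⟨hf, ⟨j, -, k, h12, h27, h1, h2, h3⟩, ht⟩
    have h22 : s'.nreg 22 = L := by rw [hf.n 22 rfl]; simp [HCmd.eff, hL]
    rw [RamTest.holds, h12, h22] at ht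
    exact ⟨k, h12, h27, by omega, h1, h3⟩

/-- Sorts the first `reg 12 = 2 ^ reg 27` cells of the real array `9`. -/
def mergeSort : HCmd :=
  forLoop 13 27 (.asgN 14 (.load 11 (.reg 13)) ;; mergePass)

lemma run_mergeSort {s : RamState} {k : ℕ} (h12 : s.nreg 12 = 2 ^ k) (h27 : s.nreg 27 = k)
    (h11 : ∀ i < k, s.narr 11 i = 2 ^ i) :
    Run mergeSort s (k * (90 * 2 ^ k + 30) + 3) (fun s' =>
      (∀ r r', r ≤ r' → r' < 2 ^ k → s'.rarr 9 r ≤ s'.rarr 9 r') ∧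
      ∀ j < 2 ^ k, ∃ j' < 2 ^ k, s'.rarr 9 j' = s.rarr 9 j) := by
  refine (Run.forLoop_const (n := k) (τ := 90 * 2 ^ k + 23) h27 rfl rfl (fun l s' =>
    BlockSorted (s'.rarr 9) (2 ^ l) (2 ^ (k - l)) ∧
      ∀ j < 2 ^ k, ∃ j' < 2 ^ k, s'.rarr 9 j' = s.rarr 9 j) _ ?_ ?_ ?_).mono le_rfl ?_
  · refine ⟨fun b _ r r' h1 h2 => ?_, fun j hj => ⟨j, hj, rfl⟩⟩
    have h3 : r' = r := by simp at h2; omega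
    rw [h3]
  · rintro l hl s' hf hi ⟨hs, hm⟩
    have h12' : s'.nreg 12 = 2 ^ k := by rw [hf.n 12 rfl, h12]
    have h11' : s'.narr 11 l = 2 ^ l := by rw [hf.na 11 rfl, h11 l hl]
    have e1 : 2 ^ (k - l) = 2 * 2 ^ (k - (l + 1)) := by
      rw [← pow_succ']; congr 1; omega
    have e2 : 2 ^ (k - (l + 1)) * (2 * 2 ^ l) = 2 ^ k := by
      rw [← pow_succ', ← pow_add]; congr 1; omega
    refine Run.straight_seq (T₂ := 90 * (2 ^ (k - (l + 1)) * (2 * 2 ^ l)) + 20) rfl ?_ (by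
      have : HCmd.cost (.asgN 14 (.load 11 (.reg 13))) = 3 := rfl
      omega)
    refine (run_mergePass (w := 2 ^ l) (B := 2 ^ (k - (l + 1))) (by positivity)
      (by simp [HCmd.eff, hi, h11']) (by simp [HCmd.eff, h12', e2])
      (by rw [← e1]; simpa [HCmd.eff] using hs)).mono le_rfl ?_
    rintro s₂ ⟨hs₂, hm₂⟩
    refine ⟨by rw [pow_succ']; exact hs₂, fun j hj => ?_⟩
    obtain ⟨j₁, h1, h2⟩ := hm j hj
    obtain ⟨j₂, h3, h4⟩ := hm₂ j₁ (by rw [e2]; exact h1)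
    exact ⟨j₂, by rw [e2] at h3; exact h3, h4.trans (by simpa [HCmd.eff] using h2)⟩
  · have : k * (90 * 2 ^ k + 23 + 5) ≤ k * (90 * 2 ^ k + 30) := Nat.mul_le_mul_left _ (by omega)
    omega
  · rintro s' ⟨-, -, hs, hm⟩
    refine ⟨fun r r' h1 h2 => ?_, hm⟩
    have := hs 0 (by positivity) r r' h1 h2
    simpa using this

/-! ### The quadratic knapsack problem of one vertex -/

/-- The total load `∑_c clamp ((A_c - x) / Q_c)` of the multiplier `x`, where `clamp` is the projection
to `[0, 1]`. -/
def knapLoad (A Q : ℕ → ℝ) (d : ℕ) (x : ℝ) : ℝ :=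
  ∑ c ∈ range d, max 0 (min 1 ((A c - x) / Q c))

/-- The load is an affine function between neighbouring breakpoints. -/
lemma knapLoad_affine {A Q : ℕ → ℝ} {d : ℕ} {x x' τ : ℝ} (hQ : ∀ c < d, 0 < Q c) (hx : 0 ≤ x)
    (hxx' : x ≤ x') (hτ0 : 0 ≤ τ) (hτ1 : τ ≤ 1) (hA : ∀ c < d, A c ≤ x ∨ x' ≤ A c)
    (hAQ : ∀ c < d, max (A c - Q c) 0 ≤ x ∨ x' ≤ max (A c - Q c) 0) :
    knapLoad A Q d (x + (x' - x) * τ) =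
      knapLoad A Q d x + τ * (knapLoad A Q d x' - knapLoad A Q d x) := by
  simp only [knapLoad, ← Finset.sum_sub_distrib, Finset.mul_sum, ← Finset.sum_add_distrib]
  refine Finset.sum_congr rfl fun c hc => ?_
  have hc := Finset.mem_range.mp hc
  have hq := hQ c hc
  have l1 : x ≤ x + (x' - x) * τ := by nlinarith
  have l2 : x + (x' - x) * τ ≤ x' := by nlinarith
  have zero : ∀ v, A c ≤ v → max 0 (min 1 ((A c - v) / Q c)) = 0 := fun v hv => by
    have : (A c - v) / Q c ≤ 0 := div_nonpos_of_nonpos_of_nonneg (by linarith) hq.le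
    rw [min_eq_right (by linarith), max_eq_left this]
  have one : ∀ v, v ≤ A c - Q c → max 0 (min 1 ((A c - v) / Q c)) = 1 := fun v hv => by
    have : 1 ≤ (A c - v) / Q c := by rw [le_div_iff₀ hq]; linarith
    rw [min_eq_left this, max_eq_right zero_le_one]
  have lin : ∀ v, v ≤ A c → A c - Q c ≤ v →
      max 0 (min 1 ((A c - v) / Q c)) = (A c - v) / Q c := fun v h1 h2 => by
    have h3 : 0 ≤ (A c - v) / Q c := div_nonneg (by linarith) hq.le
    have h4 : (A c - v) / Q c ≤ 1 := by rw [div_le_iff₀ hq]; linarith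
    rw [min_eq_right h4, max_eq_right h3]
  rcases hA c hc with h | h
  · rw [zero _ h, zero _ (h.trans l1), zero _ (h.trans hxx')]; ring
  · rcases hAQ c hc with h' | h'
    · have h'' := (le_max_left _ _).trans h'
      rw [lin x (hxx'.trans h) h'', lin x' h (h''.trans hxx'), lin _ (l2.trans h) (h''.trans l1)]
      field_simp
      ring
    · rcases le_max_iff.mp h' with h'' | h''
      · rw [one x (hxx'.trans h''), one x' h'', one _ (l2.trans h'')]; ring
      · have e1 : x' = x := by linarith
        rw [e1, sub_self, zero_mul, add_zero]; ring

/-- At the largest breakpoint nothing is loaded any more. -/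
lemma knapLoad_eq_zero {A Q : ℕ → ℝ} {d : ℕ} {x : ℝ} (hQ : ∀ c < d, 0 < Q c)
    (hA : ∀ c < d, A c ≤ x) : knapLoad A Q d x = 0 := by
  refine Finset.sum_eq_zero fun c hc => ?_
  have hc := Finset.mem_range.mp hc
  have : (A c - x) / Q c ≤ 0 :=
    div_nonpos_of_nonpos_of_nonneg (by linarith [hA c hc]) (hQ c hc).le
  rw [min_eq_right (by linarith), max_eq_left this]

/-- The incidence in slot number `reg 8` of the current vertex. -/
def slotE : NExp := .load 8 (.reg 10 + .reg 8)

/-- The solution value of that incidence for the multiplier in the real register `10`. -/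
def clampE : RExp := .max 0 (.min 1 ((.load 7 slotE - .reg 10) / .load 8 slotE))

/-- The total load of the current vertex for the multiplier in the real register `10`. -/
def evalLoad : HCmd := .asgR 11 0 ;; forLoop 8 11 (.asgR 11 (.reg 11 + clampE))

lemma run_evalLoad {s : RamState} {d : ℕ} (hd : s.nreg 11 = d) :
    Run evalLoad s (30 * d + 6) (fun s' => s'.rreg 11 =
      knapLoad (fun c => s.rarr 7 (s.narr 8 (s.nreg 10 + c)))
        (fun c => s.rarr 8 (s.narr 8 (s.nreg 10 + c))) d (s.rreg 10)) := by
  refine (Run.foldR (fun c x => x + max 0 (min 1 ((s.rarr 7 (s.narr 8 (s.nreg 10 + c)) -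
    s.rreg 10) / s.rarr 8 (s.narr 8 (s.nreg 10 + c))))) 0 (by decide) hd (by simp) ?_ ?_).mono
    le_rfl ?_
  · intro k hk s' hf hik
    simp [clampE, slotE, hf.ra 7 rfl, hf.ra 8 rfl, hf.na 8 rfl, hf.n 10 rfl, hf.r 10 rfl, hik]
  · have h1 : (RExp.reg 11 + clampE).cost = 23 := rfl
    have h2 : (0 : RExp).cost = 2 := rfl
    rw [h1, h2]
    omega
  · intro s' h
    rw [h, Nat.rec_add_eq_sum, knapLoad]

/-- Tabulates the breakpoints of the load of the current vertex in the real array `9`, padded with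
zeros to a power of two. -/
def breakpoints : HCmd :=
  .asgN 22 (.reg 11 + .reg 11 + 1) ;; setLevels ;;
    forLoop 20 12 (.stR 9 (.reg 20) 0) ;;
    forLoop 8 11 (.stR 9 (.reg 8 + .reg 8) (.load 7 slotE) ;;
      .stR 9 (.reg 8 + .reg 8 + 1) (.max (.load 7 slotE - .load 8 slotE) 0))

/-- The table has a power of two as its length, contains all breakpoints, and contains zero: the
requested `2 d + 1` cells exceed the `2 d` breakpoints. -/
lemma run_breakpoints {s : RamState} {d : ℕ} (hd : s.nreg 11 = d) (hd1 : 1 ≤ d) :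
    Run breakpoints s (150 * d + 100) (fun s' => ∃ k, s'.nreg 12 = 2 ^ k ∧ s'.nreg 27 = k ∧
      2 ^ k ≤ 4 * d ∧ (∀ i < k, s'.narr 11 i = 2 ^ i) ∧
      (∀ c < d, (∃ j < 2 ^ k, s'.rarr 9 j = s.rarr 7 (s.narr 8 (s.nreg 10 + c))) ∧
        ∃ j < 2 ^ k, s'.rarr 9 j = max (s.rarr 7 (s.narr 8 (s.nreg 10 + c)) -
          s.rarr 8 (s.narr 8 (s.nreg 10 + c))) 0) ∧
      ∃ j < 2 ^ k, s'.rarr 9 j = 0) := by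
  refine Run.straight_seq (T₂ := (20 * (2 * d + 1) + 10) + ((36 * d + 3) + (d * 45 + 3))) rfl ?_ (by
    have : HCmd.cost (.asgN 22 (.reg 11 + .reg 11 + 1)) = 6 := rfl
    omega)
  refine Run.seq (run_setLevels (L := 2 * d + 1) (by simp [HCmd.eff, hd]; omega) (by omega)) ?_
  rintro s₁ hf₁ ⟨k, h12, h27, hL, hU, h11⟩
  have g10 : s₁.nreg 10 = s.nreg 10 := by rw [hf₁.n 10 rfl]; rfl
  have g11 : s₁.nreg 11 = d := by rw [hf₁.n 11 rfl]; simp [HCmd.eff, hd]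
  have g7 : s₁.rarr 7 = s.rarr 7 := by rw [hf₁.ra 7 rfl]; rfl
  have g8 : s₁.rarr 8 = s.rarr 8 := by rw [hf₁.ra 8 rfl]; rfl
  have n8 : s₁.narr 8 = s.narr 8 := by rw [hf₁.na 8 rfl]; rfl
  have hW : 2 ^ k ≤ 4 * d := by
    rcases Nat.eq_zero_or_pos k with rfl | hk
    · simp; omega
    · have : 2 ∣ 2 ^ k := dvd_pow_self 2 (by omega)
      omega
  refine Run.seq (Run.mapR (n := 2 ^ k) (fun _ => 0) (by decide) h12 (by simp) (by
    have : (0 : RExp).cost = 2 := rfl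
    rw [this]; omega)) ?_
  intro s₂ hf₂ hz
  have k10 : s₂.nreg 10 = s.nreg 10 := by rw [hf₂.n 10 rfl, g10]
  have k11 : s₂.nreg 11 = d := by rw [hf₂.n 11 rfl, g11]
  have k7 : s₂.rarr 7 = s.rarr 7 := by rw [hf₂.ra 7 rfl, g7]
  have k8 : s₂.rarr 8 = s.rarr 8 := by rw [hf₂.ra 8 rfl, g8]
  have l8 : s₂.narr 8 = s.narr 8 := by rw [hf₂.na 8 rfl, n8]
  refine (Run.forLoop_const (n := d) (τ := 40) k11 rfl rfl (fun l s' =>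
    (∀ c < l, s'.rarr 9 (2 * c) = s.rarr 7 (s.narr 8 (s.nreg 10 + c)) ∧
      s'.rarr 9 (2 * c + 1) = max (s.rarr 7 (s.narr 8 (s.nreg 10 + c)) -
          s.rarr 8 (s.narr 8 (s.nreg 10 + c))) 0) ∧
      ∀ j, 2 * l ≤ j → s'.rarr 9 j = s₂.rarr 9 j) _ ⟨by simp, by simp⟩ ?_ le_rfl).mono le_rfl ?_
  · rintro c hc s' hf hi ⟨h1, h2⟩
    refine Run.straight rfl (by decide) ?_
    have e1 : ∀ x : ℝ, max x 0 = max x ((0 : ℕ) : ℝ) := fun x => by simp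
    simp only [HCmd.eff, slotE, setN_rarr, setRArr_rarr, if_true, NExp.eval_add, NExp.eval_reg,
      NExp.eval_ofNat, hi, RExp.eval_load, NExp.eval_load, RExp.eval_max, RExp.eval_sub,
      RExp.eval_ofNat, setRArr_nreg, setRArr_narr, hf.n 10 rfl, k10, hf.ra 7 rfl, k7, hf.ra 8 rfl,
      k8, hf.na 8 rfl, l8, Function.update_apply, show (7 : ℕ) ≠ 9 by decide,
      show (8 : ℕ) ≠ 9 by decide, if_false, Nat.cast_zero]
    refine ⟨fun c' hc' => ?_, fun j hj => ?_⟩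
    · rcases Nat.lt_or_ge c' c with h | h
      · rw [if_neg (by omega), if_neg (by omega), if_neg (by omega), if_neg (by omega)]
        exact h1 c' h
      · obtain rfl : c' = c := by omega
        rw [if_neg (by omega), if_pos (by omega), if_pos (by omega)]
        exact ⟨rfl, rfl⟩
    · rw [if_neg (by omega), if_neg (by omega)]
      exact h2 j (by omega)
  · rintro s' ⟨hf, -, h1, h2⟩
    refine ⟨k, ?_, ?_, hW, ?_, fun c hc => ⟨⟨2 * c, by omega, (h1 c hc).1⟩,
      2 * c + 1, by omega, (h1 c hc).2⟩, 2 * d, by omega, ?_⟩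
    · rw [hf.n 12 rfl, hf₂.n 12 rfl, h12]
    · rw [hf.n 27 rfl, hf₂.n 27 rfl, h27]
    · rw [hf.na 11 rfl, hf₂.na 11 rfl]; exact h11
    · rw [h2 _ le_rfl, hz, if_pos (by omega)]

/-- Binary search for the largest breakpoint whose load exceeds the guess; its position is left in
the integer register `15`. -/
def searchBreakpoint : HCmd :=
  (.asgN 15 0 ;; .asgN 13 (.reg 27)) ;;
    .loop (.nlt 40 13) ((.asgN 13 (.reg 13 - 1) ;; .asgN 14 (.load 11 (.reg 13)) ;;
      .asgR 10 (.max (.load 9 (.reg 15 + .reg 14)) 0)) ;; evalLoad ;;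
      .ite (.rlt (.reg 1) (.reg 11)) (.asgN 15 (.reg 15 + .reg 14)) .skip)

/-- The search keeps the invariant that the load exceeds the capacity at the current position, or
the position is zero, and that it does not one block further on, or the table ends there. No
monotonicity of the load is needed. -/
lemma run_searchBreakpoint {s : RamState} {d k : ℕ} (hd : s.nreg 11 = d) (h27 : s.nreg 27 = k)
    (h40 : s.nreg 40 = 0) (h11 : ∀ i < k, s.narr 11 i = 2 ^ i) (g : ℝ → ℝ) (P : ℕ → ℝ)
    (hP : P = fun j => max (s.rarr 9 j) 0)
    (hg : g = knapLoad (fun c => s.rarr 7 (s.narr 8 (s.nreg 10 + c)))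
        (fun c => s.rarr 8 (s.narr 8 (s.nreg 10 + c))) d) :
    Run searchBreakpoint s (k * (30 * d + 40) + 10) (fun s' => ∃ pos, s'.nreg 15 = pos ∧
      pos < 2 ^ k ∧ (pos = 0 ∨ s.rreg 1 < g (P pos)) ∧
      (pos + 1 = 2 ^ k ∨ g (P (pos + 1)) ≤ s.rreg 1)) := by
  refine Run.straight_seq (T₂ := k * (30 * d + 35 + 1) + 1) rfl ?_ (by
    have h1 : HCmd.cost (.asgN 15 0 ;; .asgN 13 (.reg 27)) = 4 := rfl
    have h2 : k * (30 * d + 35 + 1) ≤ k * (30 * d + 40) := Nat.mul_le_mul_left _ (by omega)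
    omega)
  refine (Run.loop (τ := 30 * d + 35) (fun j s' => s'.nreg 13 = j ∧ j ≤ k ∧
    s'.nreg 15 + 2 ^ j ≤ 2 ^ k ∧
    (s'.nreg 15 = 0 ∨ s.rreg 1 < g (P (s'.nreg 15))) ∧
    (s'.nreg 15 + 2 ^ j = 2 ^ k ∨ g (P (s'.nreg 15 + 2 ^ j)) ≤ s.rreg 1)) k
    (by simp [HCmd.eff, h27]) ?_ ?_).mono le_rfl ?_
  · rintro s' hf ⟨h13, -⟩
    simp [RamTest.holds, h13]
  · rintro j s' hf ⟨h13, hjk, hp, hl, hr⟩ -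
    have k11 : s'.narr 11 j = 2 ^ j := by rw [hf.na 11 rfl]; exact h11 j (by omega)
    refine Run.straight_seq (T₂ := (30 * d + 6) + 12) rfl ?_ (by
      have h1 : HCmd.cost (.asgN 13 (.reg 13 - 1) ;; .asgN 14 (.load 11 (.reg 13)) ;;
        .asgR 10 (.max (.load 9 (.reg 15 + .reg 14)) 0)) = 16 := rfl
      omega)
    set s₁ := HCmd.eff (.asgN 13 (.reg 13 - 1) ;; .asgN 14 (.load 11 (.reg 13)) ;;
        .asgR 10 (.max (.load 9 (.reg 15 + .reg 14)) 0)) s' with hs₁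
    have a13 : s₁.nreg 13 = j := by simp [hs₁, HCmd.eff, h13]
    have a14 : s₁.nreg 14 = 2 ^ j := by simp [hs₁, HCmd.eff, h13, k11]
    have a15 : s₁.nreg 15 = s'.nreg 15 := by simp [hs₁, HCmd.eff]
    have a10 : s₁.rreg 10 = P (s'.nreg 15 + 2 ^ j) := by
      simp [hs₁, HCmd.eff, h13, k11, hf.ra 9 rfl, hP]
    have a1 : s₁.rreg 1 = s.rreg 1 := by simp [hs₁, HCmd.eff, hf.r 1 rfl]
    have b11 : s₁.nreg 11 = d := by simp [hs₁, HCmd.eff, hf.n 11 rfl, hd]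
    refine Run.seq (run_evalLoad b11) fun s₂ hf₂ hv => Run.straight rfl (by decide) ?_
    have hv' : s₂.rreg 11 = g (P (s'.nreg 15 + 2 ^ j)) := by
      rw [hv, a10, hg]
      simp [hs₁, HCmd.eff, hf.ra 7 rfl, hf.ra 8 rfl, hf.na 8 rfl, hf.n 10 rfl]
    have c13 : s₂.nreg 13 = j := by rw [hf₂.n 13 rfl, a13]
    have c14 : s₂.nreg 14 = 2 ^ j := by rw [hf₂.n 14 rfl, a14]
    have c15 : s₂.nreg 15 = s'.nreg 15 := by rw [hf₂.n 15 rfl, a15]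
    have c1 : s₂.rreg 1 = s.rreg 1 := by rw [hf₂.r 1 rfl, a1]
    rw [pow_succ] at hp hr
    simp only [HCmd.eff, HTest.holds_rlt, RExp.eval_reg, c1, hv', NExp.eval_add, NExp.eval_reg, c15,
      c14]
    split_ifs with hif
    · simp only [setN_nreg, if_true, show (13 : ℕ) ≠ 15 by decide, if_false, c13]
      refine ⟨trivial, by omega, by omega, Or.inr hif, ?_⟩
      rcases hr with hr | hr
      · exact Or.inl (by omega)
      · exact Or.inr (by rwa [show s'.nreg 15 + 2 ^ j + 2 ^ j = s'.nreg 15 + 2 ^ j * 2 by ring])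
    · rw [c13, c15]
      exact ⟨rfl, by omega, by omega, hl, Or.inr (not_lt.mp hif)⟩
  · rintro s' ⟨hf, ⟨j, -, h13, hjk, hp, hl, hr⟩, ht⟩
    have k40 : s'.nreg 40 = 0 := by rw [hf.n 40 rfl]; simp [HCmd.eff, h40]
    rw [RamTest.holds, k40, h13] at ht
    obtain rfl : j = 0 := by omega
    rw [pow_zero] at hp hr
    exact ⟨_, rfl, by omega, hl, hr⟩

/-- Solves the knapsack problem of the vertex whose `reg 11` incidences are listed in the integer
array `8` from position `reg 10` on: linear coefficients in the real array `7`, twice the quadratic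
coefficients in the real array `8`, capacity in the real register `1`, solution in the real
array `6`. -/
def solveVertex : HCmd :=
  breakpoints ;; mergeSort ;; searchBreakpoint ;; .asgR 10 (.max (.load 9 (.reg 15)) 0) ;; evalLoad ;;
    .ite (.rlt (.reg 1) (.reg 11))
      ((.asgR 12 (.reg 11) ;; .asgR 13 (.reg 10) ;; .asgR 10 (.max (.load 9 (.reg 15 + 1)) 0)) ;; evalLoad ;;
        .asgR 10 (.reg 13 + (.reg 10 - .reg 13) * ((.reg 12 - .reg 1) / (.reg 12 - .reg 11))))
      .skip ;;
    forLoop 8 11 (.stR 6 slotE clampE)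

/-- The solution is given by a multiplier `x ≥ 0` that satisfies the complementarity condition. Cells
that belong to other vertices are not changed. -/
lemma run_solveVertex {s : RamState} {d : ℕ} (hd : s.nreg 11 = d) (hd1 : 1 ≤ d)
    (h40 : s.nreg 40 = 0) (hD : 0 ≤ s.rreg 1) (A Q : ℕ → ℝ)
    (hA : A = fun c => s.rarr 7 (s.narr 8 (s.nreg 10 + c)))
    (hQ : Q = fun c => s.rarr 8 (s.narr 8 (s.nreg 10 + c)))
    (hA0 : ∀ c < d, 0 ≤ A c) (hQ0 : ∀ c < d, 0 < Q c) :
    Run solveVertex s (1000 * (d * (Nat.log 2 d + 3))) (fun s' => ∃ x, 0 ≤ x ∧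
      knapLoad A Q d x ≤ s.rreg 1 ∧ (x = 0 ∨ knapLoad A Q d x = s.rreg 1) ∧
      (∀ q, (∃ c < d, s.narr 8 (s.nreg 10 + c) = q) →
        s'.rarr 6 q = max 0 (min 1 ((s.rarr 7 q - x) / s.rarr 8 q))) ∧
      ∀ q, (¬ ∃ c < d, s.narr 8 (s.nreg 10 + c) = q) → s'.rarr 6 q = s.rarr 6 q) := by
  obtain ⟨k, hk, hrun⟩ : ∃ k, k ≤ Nat.log 2 d + 2 ∧ Run solveVertex s
      ((150 * d + 100) + ((k * (360 * d + 30) + 3) + ((k * (30 * d + 40) + 10) +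
        (7 + ((30 * d + 6) + ((30 * d + 60) + (d * 31 + 3))))))) (fun s' => ∃ x, 0 ≤ x ∧
      knapLoad A Q d x ≤ s.rreg 1 ∧ (x = 0 ∨ knapLoad A Q d x = s.rreg 1) ∧
      (∀ q, (∃ c < d, s.narr 8 (s.nreg 10 + c) = q) →
        s'.rarr 6 q = max 0 (min 1 ((s.rarr 7 q - x) / s.rarr 8 q))) ∧
      ∀ q, (¬ ∃ c < d, s.narr 8 (s.nreg 10 + c) = q) → s'.rarr 6 q = s.rarr 6 q) := by
    obtain ⟨s₁, t₁, e₁, ht₁, k, h12, h27, hk4, h11, hbp, hz⟩ := run_breakpoints hd hd1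
    have f₁ := e₁.frame
    refine ⟨k, ?_, ?_⟩
    · rcases Nat.lt_or_ge k 2 with h | h
      · omega
      · have e : 2 ^ k = 4 * 2 ^ (k - 2) := by
          rw [show (4 : ℕ) = 2 ^ 2 by norm_num, ← pow_add]; congr 1; omega
        have := Nat.le_log_of_pow_le (b := 2) (by norm_num) (show 2 ^ (k - 2) ≤ d by omega)
        omega
    have hbp' : ∀ c < d, (∃ j < 2 ^ k, s₁.rarr 9 j = A c) ∧
        ∃ j < 2 ^ k, s₁.rarr 9 j = max (A c - Q c) 0 := by
      intro c hc
      simp only [hA, hQ]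
      exact hbp c hc
    refine Run.seq (Q₁ := fun s' => s' = s₁) ⟨s₁, t₁, e₁, ht₁, rfl⟩ ?_
    intro s' _ hs'
    subst hs'
    clear e₁ ht₁
    have n8 : s'.narr 8 = s.narr 8 := f₁.na 8 rfl
    have n10 : s'.nreg 10 = s.nreg 10 := f₁.n 10 rfl
    have r7 : s'.rarr 7 = s.rarr 7 := f₁.ra 7 rfl
    have r8 : s'.rarr 8 = s.rarr 8 := f₁.ra 8 rfl
    have r6 : s'.rarr 6 = s.rarr 6 := f₁.ra 6 rfl
    have r1 : s'.rreg 1 = s.rreg 1 := f₁.r 1 rfl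
    have d1 : s'.nreg 11 = d := by rw [f₁.n 11 rfl, hd]
    have z1 : s'.nreg 40 = 0 := by rw [f₁.n 40 rfl, h40]
    refine Run.seq ((run_mergeSort h12 h27 h11).time_le (by
      have : k * (90 * 2 ^ k + 30) ≤ k * (360 * d + 30) := Nat.mul_le_mul_left _ (by omega)
      omega)) ?_
    rintro s₂ f₂ ⟨hsort, hmem⟩
    obtain ⟨P, hPdef⟩ : ∃ P : ℕ → ℝ, P = fun j => max (s₂.rarr 9 j) 0 := ⟨_, rfl⟩
    -- the sorted table, truncated at zero, starts with `0` and contains all breakpoints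
    have hP0 : ∀ j, 0 ≤ P j := fun j => by rw [hPdef]; exact le_max_right _ _
    have hPs : ∀ r r', r ≤ r' → r' < 2 ^ k → P r ≤ P r' := fun r r' h1 h2 => by
      rw [hPdef]; exact max_le_max_right _ (hsort r r' h1 h2)
    have hmem' : ∀ x, 0 ≤ x → (∃ j < 2 ^ k, s'.rarr 9 j = x) → ∃ j < 2 ^ k, P j = x := by
      rintro x hx ⟨j, hj, e⟩
      obtain ⟨j', hj', e'⟩ := hmem j hj
      exact ⟨j', hj', by rw [hPdef]; simp only; rw [e', e, max_eq_left hx]⟩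
    have hmemA : ∀ c < d, ∃ j < 2 ^ k, P j = A c := fun c hc =>
      hmem' _ (hA0 c hc) (hbp' c hc).1
    have hmemAQ : ∀ c < d, ∃ j < 2 ^ k, P j = max (A c - Q c) 0 := fun c hc =>
      hmem' _ (le_max_right _ _) (hbp' c hc).2
    have hPz : P 0 = 0 := by
      obtain ⟨j, hj, e⟩ := hmem' 0 le_rfl hz
      exact le_antisymm ((hPs 0 j (Nat.zero_le _) hj).trans e.le) (hP0 0)
    have m8 : s₂.narr 8 = s.narr 8 := by rw [f₂.na 8 rfl, n8]
    have m10 : s₂.nreg 10 = s.nreg 10 := by rw [f₂.n 10 rfl, n10]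
    have q7 : s₂.rarr 7 = s.rarr 7 := by rw [f₂.ra 7 rfl, r7]
    have q8 : s₂.rarr 8 = s.rarr 8 := by rw [f₂.ra 8 rfl, r8]
    have q6 : s₂.rarr 6 = s.rarr 6 := by rw [f₂.ra 6 rfl, r6]
    have q1 : s₂.rreg 1 = s.rreg 1 := by rw [f₂.r 1 rfl, r1]
    have d2 : s₂.nreg 11 = d := by rw [f₂.n 11 rfl, d1]
    have z2 : s₂.nreg 40 = 0 := by rw [f₂.n 40 rfl, z1]
    obtain ⟨g, hg⟩ : ∃ g : ℝ → ℝ, g = knapLoad A Q d := ⟨_, rfl⟩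
    have hg₂ : g = knapLoad (fun c => s₂.rarr 7 (s₂.narr 8 (s₂.nreg 10 + c)))
        (fun c => s₂.rarr 8 (s₂.narr 8 (s₂.nreg 10 + c))) d := by
      rw [hg, hA, hQ, m8, m10, q7, q8]
    refine Run.seq (run_searchBreakpoint d2 (by rw [f₂.n 27 rfl, h27]) z2
      (by rw [f₂.na 11 rfl]; exact h11) g P hPdef hg₂) ?_
    rintro s₃ f₃ ⟨pos, h15, hpos, hlo, hhi⟩
    rw [q1] at hlo hhi
    -- `pos` is followed by another breakpoint unless its load is within the capacity
    have hlast : s.rreg 1 < g (P pos) → pos + 1 < 2 ^ k := by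
      intro hlt
      by_contra hcon
      have : g (P pos) = 0 := by
        rw [hg]
        refine knapLoad_eq_zero hQ0 fun c hc => ?_
        obtain ⟨j, hj, e⟩ := hmemA c hc
        rw [← e]
        exact hPs _ _ (by omega) hpos
      linarith
    refine Run.straight_seq (T₂ := (30 * d + 6) + ((30 * d + 60) + (d * 31 + 3))) rfl ?_ (by
      have : HCmd.cost (.asgR 10 (.max (.load 9 (.reg 15)) 0)) = 7 := rfl
      omega)
    set s₄ := HCmd.eff (.asgR 10 (.max (.load 9 (.reg 15)) 0)) s₃ with hs₄
    have a10 : s₄.rreg 10 = P pos := by simp [hs₄, HCmd.eff, h15, f₃.ra 9 rfl, hPdef]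
    have F₄ : s₄.narr = s₃.narr ∧ s₄.nreg = s₃.nreg ∧ s₄.rarr = s₃.rarr ∧
      s₄.rreg 1 = s₃.rreg 1 := by simp [hs₄, HCmd.eff]
    have i8 : s₄.narr 8 = s.narr 8 := by rw [F₄.1, f₃.na 8 rfl, m8]
    have i10 : s₄.nreg 10 = s.nreg 10 := by rw [F₄.2.1, f₃.n 10 rfl, m10]
    have i11 : s₄.nreg 11 = d := by rw [F₄.2.1, f₃.n 11 rfl, d2]
    have i15 : s₄.nreg 15 = pos := by rw [F₄.2.1, h15]
    have i7 : s₄.rarr 7 = s.rarr 7 := by rw [F₄.2.2.1, f₃.ra 7 rfl, q7]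
    have i9 : s₄.rarr 9 = s₂.rarr 9 := by rw [F₄.2.2.1, f₃.ra 9 rfl]
    have ia8 : s₄.rarr 8 = s.rarr 8 := by rw [F₄.2.2.1, f₃.ra 8 rfl, q8]
    have i6 : s₄.rarr 6 = s.rarr 6 := by rw [F₄.2.2.1, f₃.ra 6 rfl, q6]
    have i1 : s₄.rreg 1 = s.rreg 1 := by rw [F₄.2.2.2, f₃.r 1 rfl, q1]
    clear_value s₄
    refine Run.seq (run_evalLoad i11) ?_
    intro s₅ f₅ hv
    have hv₅ : s₅.rreg 11 = g (P pos) := by rw [hv, hg, hA, hQ, i8, i10, i7, ia8, a10]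
    have j8 : s₅.narr 8 = s.narr 8 := by rw [f₅.na 8 rfl, i8]
    have j10 : s₅.nreg 10 = s.nreg 10 := by rw [f₅.n 10 rfl, i10]
    have j11 : s₅.nreg 11 = d := by rw [f₅.n 11 rfl, i11]
    have j15 : s₅.nreg 15 = pos := by rw [f₅.n 15 rfl, i15]
    have j7 : s₅.rarr 7 = s.rarr 7 := by rw [f₅.ra 7 rfl, i7]
    have j9 : s₅.rarr 9 = s₂.rarr 9 := by rw [f₅.ra 9 rfl, i9]
    have ja8 : s₅.rarr 8 = s.rarr 8 := by rw [f₅.ra 8 rfl, ia8]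
    have j6 : s₅.rarr 6 = s.rarr 6 := by rw [f₅.ra 6 rfl, i6]
    have j1 : s₅.rreg 1 = s.rreg 1 := by rw [f₅.r 1 rfl, i1]
    have jr10 : s₅.rreg 10 = P pos := by rw [f₅.r 10 rfl, a10]
    refine Run.seq (Q₁ := fun s' => 0 ≤ s'.rreg 10 ∧ g (s'.rreg 10) ≤ s.rreg 1 ∧
      (s'.rreg 10 = 0 ∨ g (s'.rreg 10) = s.rreg 1)) ?_ ?_
    · refine (Run.ite (T := 30 * d + 50) ?_ ?_).time_le ?_
      · intro ht
        simp only [HTest.holds_rlt, RExp.eval_reg, j1, hv₅] at ht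
        have hp1 := hlast ht
        have hhi' : g (P (pos + 1)) ≤ s.rreg 1 := hhi.resolve_left (by omega)
        refine Run.straight_seq (T₂ := (30 * d + 6) + 20) rfl ?_ (by
          have : HCmd.cost (.asgR 12 (.reg 11) ;; .asgR 13 (.reg 10) ;;
            .asgR 10 (.max (.load 9 (.reg 15 + 1)) 0)) = 13 := rfl
          omega)
        -- the multiplier is interpolated between two neighbouring breakpoints
        set s₆ := HCmd.eff (.asgR 12 (.reg 11) ;; .asgR 13 (.reg 10) ;;
            .asgR 10 (.max (.load 9 (.reg 15 + 1)) 0)) s₅ with hs₆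
        have F₆ : s₆.narr = s₅.narr ∧ s₆.nreg = s₅.nreg ∧ s₆.rarr = s₅.rarr ∧
          s₆.rreg 1 = s₅.rreg 1 := by simp [hs₆, HCmd.eff]
        have b10 : s₆.rreg 10 = P (pos + 1) := by simp [hs₆, HCmd.eff, j15, j9, hPdef]
        have b12 : s₆.rreg 12 = g (P pos) := by simp [hs₆, HCmd.eff, hv₅]
        have b13 : s₆.rreg 13 = P pos := by simp [hs₆, HCmd.eff, jr10]
        have b1 : s₆.rreg 1 = s.rreg 1 := by rw [F₆.2.2.2, j1]
        refine Run.seq (run_evalLoad (by rw [F₆.2.1, j11])) fun s₇ f₇ hv₇ =>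
          Run.straight rfl (by decide) ?_
        have hv₇' : s₇.rreg 11 = g (P (pos + 1)) := by
          rw [hv₇, hg, hA, hQ, F₆.1, F₆.2.1, F₆.2.2.1, j8, j10, j7, ja8, b10]
        obtain ⟨τ, hτ⟩ : ∃ τ, τ = (g (P pos) - s.rreg 1) / (g (P pos) - g (P (pos + 1))) :=
          ⟨_, rfl⟩
        have hden : 0 < g (P pos) - g (P (pos + 1)) := by linarith
        have hτ0 : 0 ≤ τ := by rw [hτ]; exact div_nonneg (by linarith) hden.le
        have hτ1 : τ ≤ 1 := by rw [hτ, div_le_one hden]; linarith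
        have hle := hPs pos (pos + 1) (by omega) hp1
        -- no breakpoint lies strictly between two neighbours of the sorted table
        have hbetween : ∀ x, (∃ j < 2 ^ k, P j = x) → x ≤ P pos ∨ P (pos + 1) ≤ x := by
          rintro x ⟨j, hj, rfl⟩
          rcases Nat.lt_or_ge pos j with h | h
          · exact Or.inr (hPs _ _ h hj)
          · exact Or.inl (hPs _ _ h hpos)
        have haff : g (P pos + (P (pos + 1) - P pos) * τ) = s.rreg 1 := by
          rw [hg, knapLoad_affine hQ0 (hP0 _) hle hτ0 hτ1
            (fun c hc => hbetween _ (hmemA c hc)) (fun c hc => hbetween _ (hmemAQ c hc)), ← hg, hτ]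
          field_simp
          ring
        have hx : (HCmd.eff (.asgR 10 (.reg 13 + (.reg 10 - .reg 13) *
            ((.reg 12 - .reg 1) / (.reg 12 - .reg 11)))) s₇).rreg 10 =
            P pos + (P (pos + 1) - P pos) * τ := by
          simp [HCmd.eff, f₇.r 13 rfl, f₇.r 12 rfl, f₇.r 10 rfl, f₇.r 1 rfl, b10, b12, b13, b1,
            hv₇', hτ]
        rw [hx, haff]
        refine ⟨add_nonneg (hP0 _) (mul_nonneg (by linarith) hτ0), le_rfl, Or.inr rfl⟩
      · intro ht
        simp only [HTest.holds_rlt, RExp.eval_reg, j1, hv₅, not_lt] at ht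
        refine Run.straight rfl (by simp [HCmd.cost]) ?_
        simp only [HCmd.eff, jr10]
        refine ⟨hP0 _, ht, Or.inl ?_⟩
        rcases hlo with h | h
        · rw [h, hPz]
        · linarith
      · have : HTest.cost (.rlt (.reg 1) (.reg 11)) = 2 := rfl
        omega
    · rintro s₆ f₆ ⟨hx0, hx1, hx2⟩
      have l8 : s₆.narr 8 = s.narr 8 := by rw [f₆.na 8 rfl, j8]
      have l10 : s₆.nreg 10 = s.nreg 10 := by rw [f₆.n 10 rfl, j10]
      have l11 : s₆.nreg 11 = d := by rw [f₆.n 11 rfl, j11]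
      have l7 : s₆.rarr 7 = s.rarr 7 := by rw [f₆.ra 7 rfl, j7]
      have la8 : s₆.rarr 8 = s.rarr 8 := by rw [f₆.ra 8 rfl, ja8]
      have l6 : s₆.rarr 6 = s.rarr 6 := by rw [f₆.ra 6 rfl, j6]
      refine (Run.forLoop_const (n := d) (τ := 26) l11 rfl rfl (fun l s' =>
        (∀ q, (∃ c < l, s.narr 8 (s.nreg 10 + c) = q) →
          s'.rarr 6 q = max 0 (min 1 ((s.rarr 7 q - s₆.rreg 10) / s.rarr 8 q))) ∧
        ∀ q, (¬ ∃ c < l, s.narr 8 (s.nreg 10 + c) = q) → s'.rarr 6 q = s.rarr 6 q) _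
        ⟨by simp, by simp [l6]⟩ ?_ (by omega)).mono le_rfl ?_
      · rintro c hc s' hf hi ⟨h1, h2⟩
        refine Run.straight rfl (by decide) ?_
        have hst : ∀ q, ((HCmd.eff (.stR 6 slotE clampE) s').setN 8 (c + 1)).rarr 6 q =
            if q = s.narr 8 (s.nreg 10 + c) then
              max 0 (min 1 ((s.rarr 7 q - s₆.rreg 10) / s.rarr 8 q)) else s'.rarr 6 q := by
          intro q
          simp only [HCmd.eff, slotE, clampE, setN_rarr, setRArr_rarr, if_true, NExp.eval_load,
            NExp.eval_add, NExp.eval_reg, hi, hf.n 10 rfl, l10, hf.na 8 rfl, l8,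
            Function.update_apply]
          split_ifs with h
          · simp [h, hi, hf.n 10 rfl, l10, hf.na 8 rfl, l8, hf.ra 7 rfl, l7, hf.ra 8 rfl, la8,
              hf.r 10 rfl]
          · rfl
        refine ⟨fun q hq => ?_, fun q hq => ?_⟩
        · rw [hst]
          split_ifs with h
          · rfl
          · obtain ⟨c', hc', e⟩ := hq
            have : c' ≠ c := fun h' => h (by rw [← e, h'])
            exact h1 q ⟨c', by omega, e⟩
        · rw [hst, if_neg fun h => hq ⟨c, by omega, h.symm⟩]
          exact h2 q fun ⟨c', hc', e⟩ => hq ⟨c', by omega, e⟩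
      · rintro s' ⟨-, -, h1, h2⟩
        exact ⟨_, hx0, by rw [← hg]; exact hx1, by rw [← hg]; exact hx2, h1, h2⟩
  refine hrun.time_le ?_
  obtain ⟨l, hl⟩ : ∃ l, Nat.log 2 d = l := ⟨_, rfl⟩
  rw [hl] at hk ⊢
  have h1 : k * (360 * d + 30) + k * (30 * d + 40) ≤ (l + 2) * (460 * d) := by
    rw [← Nat.mul_add]
    exact Nat.mul_le_mul hk (by omega)
  have h2 : (l + 2) * (460 * d) = 460 * (d * (l + 2)) := by ring
  have h3 : 1000 * (d * (l + 3)) = 1000 * (d * (l + 2)) + 1000 * d := by ring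
  omega

end

noncomputable section

/-! ### The incidence lists in memory -/

section layout

variable {n m : ℕ} {ends : Fin m → Fin 2 → Fin n}

/-- The data that describe the graph. Incidence `q = 2 e + k` is the pair of edge `e` and its
endpoint `ends e k`. The vertices that are covered by edges are numbered by `i < reg 3`; vertex
number `i` is `narr 5 i`, has degree `narr 7 i`, and its incidences are listed in the integer array
`8` from position `narr 6 i` on. -/
structure Layout (ends : Fin m → Fin 2 → Fin n) (s : RamState) : Prop where
  n0 : s.nreg 0 = n
  n1 : s.nreg 1 = m
  n2 : s.nreg 2 = 2 * m
  zero : s.nreg 40 = 0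
  ends_eq : ∀ (e : Fin m) (k : Fin 2), s.narr k e = ends e k
  pos : ∀ i < s.nreg 3, 1 ≤ s.narr 7 i
  vtx_inj : ∀ i < s.nreg 3, ∀ j < s.nreg 3, s.narr 5 i = s.narr 5 j → i = j
  vtx_lt : ∀ i < s.nreg 3, s.narr 5 i < n
  cover : ∀ (e : Fin m) (k : Fin 2), ∃ i < s.nreg 3, s.narr 5 i = ends e k
  slot_inj : ∀ i < s.nreg 3, ∀ c < s.narr 7 i, ∀ c' < s.narr 7 i,
    s.narr 8 (s.narr 6 i + c) = s.narr 8 (s.narr 6 i + c') → c = c'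
  slot : ∀ i < s.nreg 3, ∀ q, (∃ c < s.narr 7 i, s.narr 8 (s.narr 6 i + c) = q) ↔
    ∃ (e : Fin m) (k : Fin 2), q = 2 * e + k ∧ (ends e k : ℕ) = s.narr 5 i

/-- The command leaves the description of the graph alone. -/
def HCmd.keepsLayout (c : HCmd) : Bool :=
  !c.wN 0 && !c.wN 1 && !c.wN 2 && !c.wN 3 && !c.wN 40 && !c.wNA 0 && !c.wNA 1 && !c.wNA 5 &&
    !c.wNA 6 && !c.wNA 7 && !c.wNA 8

lemma Layout.frame {s s' : RamState} {c : HCmd} (h : Layout ends s) (hf : Frame c s s')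
    (hc : c.keepsLayout = true) : Layout ends s' := by
  simp only [HCmd.keepsLayout, Bool.and_eq_true, Bool.not_eq_true'] at hc
  obtain ⟨⟨⟨⟨⟨⟨⟨⟨⟨⟨h0, h1⟩, h2⟩, h3⟩, h4⟩, h5⟩, h6⟩, h7⟩, h8⟩, h9⟩, h10⟩ := hc
  have e3 := hf.n 3 h3
  have e5 := hf.na 5 h7
  have e6 := hf.na 6 h8
  have e7 := hf.na 7 h9
  have e8 := hf.na 8 h10
  refine ⟨(hf.n 0 h0).trans h.n0, (hf.n 1 h1).trans h.n1, (hf.n 2 h2).trans h.n2,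
    (hf.n 40 h4).trans h.zero, fun e k => ?_, ?_, ?_, ?_, ?_, ?_, ?_⟩
  · have : s'.narr k = s.narr k := by
      fin_cases k
      · exact hf.na 0 h5
      · exact hf.na 1 h6
    rw [this]
    exact h.ends_eq e k
  · rw [e3, e7]; exact h.pos
  · rw [e3, e5]; exact h.vtx_inj
  · rw [e3, e5]; exact h.vtx_lt
  · rw [e3, e5]; exact h.cover
  · rw [e3, e6, e7, e8]; exact h.slot_inj
  · rw [e3, e5, e6, e7, e8]; exact h.slot

/-- Sums over the list of a vertex are sums over its incidences. -/
lemma Layout.sum_slots {α : Type*} [AddCommMonoid α] {s : RamState} (h : Layout ends s) {i : ℕ}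
    (hi : i < s.nreg 3) (f : ℕ → α) :
    ∑ c ∈ range (s.narr 7 i), f (s.narr 8 (s.narr 6 i + c)) =
      ∑ e, ∑ k, if (ends e k : ℕ) = s.narr 5 i then f (2 * e + k) else 0 := by
  have h1 : ∑ c ∈ range (s.narr 7 i), f (s.narr 8 (s.narr 6 i + c)) =
      ∑ q ∈ (range (s.narr 7 i)).image (fun c => s.narr 8 (s.narr 6 i + c)), f q := by
    rw [Finset.sum_image]
    intro c hc c' hc' e
    exact h.slot_inj i hi c (by simpa using hc) c' (by simpa using hc') e
  have h2 : ∑ e, ∑ k, (if (ends e k : ℕ) = s.narr 5 i then f (2 * e + k) else 0) =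
      ∑ q ∈ ({p | (ends p.1 p.2 : ℕ) = s.narr 5 i} : Finset (Fin m × Fin 2)).image
        (fun p => 2 * (p.1 : ℕ) + p.2), f q := by
    rw [Finset.sum_image, Finset.sum_filter, Fintype.sum_prod_type]
    rintro ⟨e, k⟩ - ⟨e', k'⟩ - he
    simp only at he
    ext <;> simp only <;> omega
  rw [h1, h2]
  congr 1
  ext q
  simp only [Finset.mem_image, Finset.mem_range, Finset.mem_filter, Finset.mem_univ, true_and,
    Prod.exists]
  rw [h.slot i hi q]
  exact ⟨fun ⟨e, k, h1, h2⟩ => ⟨e, k, h2, h1.symm⟩, fun ⟨e, k, h1, h2⟩ => ⟨e, k, h2.symm, h1⟩⟩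

lemma Layout.count_eq {s : RamState} (h : Layout ends s) {i : ℕ} (hi : i < s.nreg 3) :
    s.narr 7 i = degIn ends univ ⟨s.narr 5 i, h.vtx_lt i hi⟩ := by
  have := h.sum_slots hi (fun _ => 1)
  simp only [Finset.sum_const, card_range, smul_eq_mul, mul_one] at this
  rw [this, degIn]
  simp only [Fin.ext_iff]

lemma Layout.sum_count_le {s : RamState} (h : Layout ends s) :
    ∑ i ∈ range (s.nreg 3), s.narr 7 i ≤ 2 * m := by
  have h1 : ∀ i ∈ range (s.nreg 3), s.narr 7 i =
      ∑ e : Fin m, ∑ k, if (ends e k : ℕ) = s.narr 5 i then 1 else 0 := fun i hi => by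
    rw [← h.sum_slots (Finset.mem_range.mp hi) (fun _ => 1)]
    simp
  rw [Finset.sum_congr rfl h1, Finset.sum_comm]
  calc _ ≤ ∑ _e : Fin m, 2 := ?_
    _ = 2 * m := by simp [mul_comm]
  refine Finset.sum_le_sum fun e _ => ?_
  rw [Finset.sum_comm]
  calc _ ≤ ∑ _k : Fin 2, 1 := ?_
    _ = 2 := by simp
  refine Finset.sum_le_sum fun k _ => ?_
  rw [← Finset.card_filter, Finset.card_le_one]
  intro i hi j hj
  simp only [Finset.mem_filter, Finset.mem_range] at hi hj
  exact h.vtx_inj i hi.1 j hj.1 (hi.2.symm.trans hj.2)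

lemma Layout.nv_le {s : RamState} (h : Layout ends s) : s.nreg 3 ≤ 2 * m := by
  refine le_trans ?_ h.sum_count_le
  calc s.nreg 3 = ∑ i ∈ range (s.nreg 3), 1 := by simp
    _ ≤ _ := Finset.sum_le_sum fun i hi => h.pos i (Finset.mem_range.mp hi)

/-! ### One round of the oracle -/

/-- Solves the knapsack problems of all vertices. -/
def solveAll : HCmd :=
  forLoop 7 3 ((.asgN 10 (.load 6 (.reg 7)) ;; .asgN 11 (.load 7 (.reg 7))) ;; solveVertex)

/-- The vector on incidences stored in an array. -/
def incVec (a : ℕ → ℝ) (e : Fin m) (k : Fin 2) : ℝ := a (2 * e + k)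

/-- The total capacity used at `u` by a solution `z` given on incidences. -/
def loadAt (ends : Fin m → Fin 2 → Fin n) (z : Fin m → Fin 2 → ℝ) (u : Fin n) : ℝ :=
  ∑ e, ∑ k, if ends e k = u then z e k else 0

/-- The times of the vertices add up to `O(m log Δ)`, since the degrees sum to `2 m`. -/
lemma run_solveAll {s : RamState} (hs : Layout ends s) (hm : 1 ≤ m) (hD : 0 ≤ s.rreg 1)
    (hA : ∀ (e : Fin m) (k : Fin 2), 0 ≤ s.rarr 7 (2 * e + k))
    (hQ : ∀ (e : Fin m) (k : Fin 2), 0 < s.rarr 8 (2 * e + k)) {Δ : ℕ}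
    (hΔ : ∀ u, degIn ends univ u ≤ Δ) :
    Run solveAll s (2013 * (m * (Nat.log 2 Δ + 3))) (fun s' => ∃ lam : Fin n → ℝ,
      (∀ u, 0 ≤ lam u) ∧
      (∀ (e : Fin m) (k : Fin 2), s'.rarr 6 (2 * e + k) =
        max 0 (min 1 ((s.rarr 7 (2 * e + k) - lam (ends e k)) / s.rarr 8 (2 * e + k)))) ∧
      ∀ u, loadAt ends (incVec (s'.rarr 6)) u ≤ s.rreg 1 ∧
        (lam u = 0 ∨ loadAt ends (incVec (s'.rarr 6)) u = s.rreg 1)) := by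
  obtain ⟨Λ, hΛ⟩ : ∃ Λ, Λ = Nat.log 2 Δ + 3 := ⟨_, rfl⟩
  rw [← hΛ]
  have hdΔ : ∀ i < s.nreg 3, s.narr 7 i ≤ Δ := fun i hi => by
    rw [hs.count_eq hi]; exact hΔ _
  have hslotA : ∀ i < s.nreg 3, ∀ c < s.narr 7 i, 0 ≤ s.rarr 7 (s.narr 8 (s.narr 6 i + c)) ∧
      0 < s.rarr 8 (s.narr 8 (s.narr 6 i + c)) := fun i hi c hc => by
    obtain ⟨e, k, h, -⟩ := (hs.slot i hi _).mp ⟨c, hc, rfl⟩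
    rw [h]
    exact ⟨hA e k, hQ e k⟩
  let Good : ℕ → (ℕ → ℝ) → Prop := fun i ζ => ∃ x, 0 ≤ x ∧
    (∑ e : Fin m, ∑ k : Fin 2, if (ends e k : ℕ) = s.narr 5 i then ζ (2 * e + k) else 0) ≤ s.rreg 1 ∧
    (x = 0 ∨ (∑ e : Fin m, ∑ k : Fin 2, if (ends e k : ℕ) = s.narr 5 i then ζ (2 * e + k) else 0) =
      s.rreg 1) ∧
    ∀ (e : Fin m) (k : Fin 2), (ends e k : ℕ) = s.narr 5 i → ζ (2 * e + k) =
      max 0 (min 1 ((s.rarr 7 (2 * e + k) - x) / s.rarr 8 (2 * e + k)))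
  refine (Run.forLoop (n := s.nreg 3) rfl rfl rfl (fun i s' => ∀ i' < i, Good i' (s'.rarr 6))
    (fun i => 1000 * (s.narr 7 i * Λ) + 6) (by simp) ?_).mono ?_ ?_
  · intro i hi s' hf h7 hI
    have k8 : s'.narr 8 = s.narr 8 := hf.na 8 rfl
    refine Run.straight_seq (T₂ := 1000 * (s.narr 7 i * Λ)) rfl ?_ (by
      have : HCmd.cost (.asgN 10 (.load 6 (.reg 7)) ;; .asgN 11 (.load 7 (.reg 7))) = 6 := rfl
      omega)
    set s₁ := HCmd.eff (.asgN 10 (.load 6 (.reg 7)) ;; .asgN 11 (.load 7 (.reg 7))) s' with hs₁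
    have a10 : s₁.nreg 10 = s.narr 6 i := by simp [hs₁, HCmd.eff, h7, hf.na 6 rfl]
    have a11 : s₁.nreg 11 = s.narr 7 i := by simp [hs₁, HCmd.eff, h7, hf.na 7 rfl]
    have a40 : s₁.nreg 40 = 0 := by simp [hs₁, HCmd.eff, hf.n 40 rfl, hs.zero]
    have ra : s₁.rarr = s'.rarr := by simp [hs₁, HCmd.eff]
    have na : s₁.narr = s'.narr := by simp [hs₁, HCmd.eff]
    have r1 : s₁.rreg 1 = s.rreg 1 := by simp [hs₁, HCmd.eff, hf.r 1 rfl]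
    have e7 : s₁.rarr 7 = s.rarr 7 := by rw [ra, hf.ra 7 rfl]
    have e8 : s₁.rarr 8 = s.rarr 8 := by rw [ra, hf.ra 8 rfl]
    have n8 : s₁.narr 8 = s.narr 8 := by rw [na, k8]
    clear_value s₁
    refine (run_solveVertex a11 (hs.pos i hi) a40 (by rw [r1]; exact hD) _ _ rfl rfl ?_ ?_).mono ?_ ?_
    · intro c hc
      rw [a10, e7, n8]
      exact (hslotA i hi c hc).1
    · intro c hc
      rw [a10, e8, n8]
      exact (hslotA i hi c hc).2
    · refine Nat.mul_le_mul_left _ (Nat.mul_le_mul_left _ ?_)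
      rw [hΛ]
      exact Nat.add_le_add_right (Nat.log_mono_right (hdΔ i hi)) 3
    · rintro s₂ ⟨x, hx0, hx1, hx2, hx3, hx4⟩
      simp only [a10, e7, e8, n8, r1, hs.slot i hi, ra] at hx1 hx2 hx3 hx4
      intro i' hi'
      simp only [setN_rarr]
      rcases Nat.lt_or_ge i' i with hlt | hge
      · obtain ⟨x', y0, y1, y2, y3⟩ := hI i' hlt
        -- the incidences of earlier vertices are not touched
        have hsame : ∀ (e : Fin m) (k : Fin 2), (ends e k : ℕ) = s.narr 5 i' →
            s₂.rarr 6 (2 * e + k) = s'.rarr 6 (2 * e + k) := by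
          intro e k hek
          refine hx4 _ ?_
          rintro ⟨e', k', h1, h2⟩
          have h3 : e' = e := by ext; omega
          have h4 : k' = k := by ext; omega
          rw [h3, h4, hek] at h2
          exact hlt.ne (hs.vtx_inj i' (hlt.trans hi) i hi h2)
        have hsum : (∑ e : Fin m, ∑ k : Fin 2,
            if (ends e k : ℕ) = s.narr 5 i' then s₂.rarr 6 (2 * e + k) else 0) =
            ∑ e : Fin m, ∑ k : Fin 2,
              if (ends e k : ℕ) = s.narr 5 i' then s'.rarr 6 (2 * e + k) else 0 := by
          refine Finset.sum_congr rfl fun e _ => Finset.sum_congr rfl fun k _ => ?_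
          split_ifs with h
          · exact hsame e k h
          · rfl
        refine ⟨x', y0, by rw [hsum]; exact y1, by rw [hsum]; exact y2, fun e k h => ?_⟩
        rw [hsame e k h]
        exact y3 e k h
      · obtain rfl : i' = i := by omega
        have hval : ∀ (e : Fin m) (k : Fin 2), (ends e k : ℕ) = s.narr 5 i' →
            s₂.rarr 6 (2 * e + k) =
              max 0 (min 1 ((s.rarr 7 (2 * e + k) - x) / s.rarr 8 (2 * e + k))) :=
          fun e k h => hx3 _ ⟨e, k, rfl, h⟩
        have hsum : knapLoad (fun c => s.rarr 7 (s.narr 8 (s.narr 6 i' + c)))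
            (fun c => s.rarr 8 (s.narr 8 (s.narr 6 i' + c))) (s.narr 7 i') x =
            ∑ e : Fin m, ∑ k : Fin 2,
              if (ends e k : ℕ) = s.narr 5 i' then s₂.rarr 6 (2 * e + k) else 0 := by
          rw [knapLoad, hs.sum_slots hi (fun q => max 0 (min 1 ((s.rarr 7 q - x) / s.rarr 8 q)))]
          refine Finset.sum_congr rfl fun e _ => Finset.sum_congr rfl fun k _ => ?_
          split_ifs with h
          · rw [hval e k h]
          · rfl
        rw [hsum] at hx1 hx2
        exact ⟨x, hx0, hx1, hx2, hval⟩
  · have h1 : ∀ i ∈ range (s.nreg 3), 1000 * (s.narr 7 i * Λ) + 6 + 5 ≤ s.narr 7 i * (1004 * Λ) := by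
      intro i hi
      have : 1 * 3 ≤ s.narr 7 i * Λ :=
        Nat.mul_le_mul (hs.pos i (Finset.mem_range.mp hi)) (by omega)
      have e : s.narr 7 i * (1004 * Λ) = 1004 * (s.narr 7 i * Λ) := by ring
      omega
    have h2 := Finset.sum_le_sum h1
    rw [← Finset.sum_mul] at h2
    have h3 := Nat.mul_le_mul_right (1004 * Λ) hs.sum_count_le
    have h4 : 2 * m * (1004 * Λ) = 2008 * (m * Λ) := by ring
    have h5 : 1 * 3 ≤ m * Λ := Nat.mul_le_mul hm (by omega)
    omega
  · rintro s' ⟨-, -, hI⟩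
    choose! x hx0 hx1 hx2 hx3 using hI
    have hex : ∀ u : Fin n, ∃ l : ℝ, 0 ≤ l ∧
        loadAt ends (incVec (s'.rarr 6)) u ≤ s.rreg 1 ∧
        (l = 0 ∨ loadAt ends (incVec (s'.rarr 6)) u = s.rreg 1) ∧
        ∀ (e : Fin m) (k : Fin 2), ends e k = u → s'.rarr 6 (2 * e + k) =
          max 0 (min 1 ((s.rarr 7 (2 * e + k) - l) / s.rarr 8 (2 * e + k))) := by
      intro u
      by_cases hu : ∃ i < s.nreg 3, s.narr 5 i = u
      · obtain ⟨i, hi, hiu⟩ := hu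
        have e1 : loadAt ends (incVec (s'.rarr 6)) u = ∑ e : Fin m, ∑ k : Fin 2,
            if (ends e k : ℕ) = s.narr 5 i then s'.rarr 6 (2 * e + k) else 0 := by
          simp only [loadAt, incVec, hiu, Fin.ext_iff]
        rw [e1]
        exact ⟨x i, hx0 i hi, hx1 i hi, hx2 i hi, fun e k h => hx3 i hi e k (by rw [h, hiu])⟩
      · have hno : ∀ e k, ends e k ≠ u := fun e k h => hu (by
          obtain ⟨i, hi, h'⟩ := hs.cover e k
          exact ⟨i, hi, by rw [h', h]⟩)
        have e1 : loadAt ends (incVec (s'.rarr 6)) u = 0 := by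
          simp [loadAt, hno]
        rw [e1]
        exact ⟨0, le_rfl, hD, Or.inl rfl, fun e k h => absurd h (hno e k)⟩
    choose lam h0 h1 h2 h3 using hex
    exact ⟨lam, h0, fun e k => h3 _ e k rfl, fun u => ⟨h1 u, h2 u⟩⟩

/-- `for i in [0, lim) do (arr[2 i] := e₀; arr[2 i + 1] := e₁)`. -/
lemma Run.mapPair {i lim arr : ℕ} {e₀ e₁ : RExp} {s : RamState} {n : ℕ} (F : ℕ → ℕ → ℝ)
    (hne : i ≠ lim) (hn : s.nreg lim = n) {T : ℕ}
    (hF₀ : ∀ k < n, ∀ s', Frame (_root_.forLoop i lim (.stR arr (.reg i + .reg i) e₀ ;;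
      .stR arr (.reg i + .reg i + 1) e₁)) s s' → s'.nreg i = k → e₀.eval s' = F k 0)
    (hF₁ : ∀ k < n, ∀ s', Frame (_root_.forLoop i lim (.stR arr (.reg i + .reg i) e₀ ;;
      .stR arr (.reg i + .reg i + 1) e₁)) s s' → s'.nreg i = k → e₁.eval s' = F k 1)
    (hT : n * (e₀.cost + e₁.cost + 15) + 3 ≤ T) :
    Run (_root_.forLoop i lim (.stR arr (.reg i + .reg i) e₀ ;; .stR arr (.reg i + .reg i + 1) e₁)) s T
      (fun s' => ∀ (e : Fin n) (k : Fin 2), s'.rarr arr (2 * (e : ℕ) + (k : ℕ)) = F e k) := by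
  refine (Run.forLoop_const hn rfl (by simpa [_root_.forLoop, HCmd.wN] using hne)
    (fun l s' => ∀ e < l, ∀ k < 2, s'.rarr arr (2 * e + k) = F e k) (e₀.cost + e₁.cost + 10) T
    (by simp) ?_ (by simpa using hT)).mono le_rfl
      (fun s' h e k => h.2.2 e e.isLt k k.isLt)
  intro l hl s' hf hil hI
  have hf' : Frame (_root_.forLoop i lim (.stR arr (.reg i + .reg i) e₀ ;;
      .stR arr (.reg i + .reg i + 1) e₁)) s (HCmd.eff (.stR arr (.reg i + .reg i) e₀) s') := by
    refine hf.trans ?_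
    refine (HExec.stR arr (.reg i + .reg i) e₀ s').frame.mono ?_
    refine ⟨fun r hr => rfl, fun r hr => rfl, fun r hr => rfl, fun r hr => ?_⟩
    simp only [_root_.forLoop, HCmd.wRA, Bool.or_eq_false_iff] at hr ⊢
    tauto
  have h0 := hF₀ l hl s' hf hil
  have h1 := hF₁ l hl _ hf' (by simpa [HCmd.eff] using hil)
  refine Run.straight rfl (by
    have h2 : (NExp.reg i + .reg i).cost = 3 := rfl
    have h3 : (NExp.reg i + .reg i + 1).cost = 5 := rfl
    simp only [HCmd.cost, h2, h3]
    omega) ?_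
  intro e he k hk
  simp only [HCmd.eff, h0, NExp.eval_add, NExp.eval_reg, hil] at h1
  simp only [HCmd.eff, h0, h1, NExp.eval_add, NExp.eval_reg, NExp.eval_ofNat, hil, setN_rarr,
    setRArr_rarr, setRArr_nreg, if_true, Function.update_apply]
  rcases Nat.lt_or_ge e l with h | h
  · rw [if_neg (by omega), if_neg (by omega)]
    exact hI e h k hk
  · obtain rfl : e = l := by omega
    interval_cases k
    · rw [if_neg (by omega), if_pos (by omega)]
    · rw [if_pos (by omega)]

end layout

end

noncomputable section

/-! ### The minimization oracle -/

section oracle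

variable {n m : ℕ} {ends : Fin m → Fin 2 → Fin n}

/-- The unnormalized optimal `y_e` for the current `z`; the real register `7` holds `6√3`. -/
def softmaxE : RExp :=
  .exp ((.load 4 (.reg 6) / .reg 7 - .load 6 (.reg 6 + .reg 6) * .load 6 (.reg 6 + .reg 6) -
    .load 6 (.reg 6 + .reg 6 + 1) * .load 6 (.reg 6 + .reg 6 + 1)) / 6)

/-- Computes the optimal `y` for the `z` in the real array `6`, and twice the quadratic coefficients
of the knapsack problems that belong to it. -/
def softmax : HCmd :=
  forLoop 6 1 (.stR 5 (.reg 6) softmaxE) ;;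
    (.asgR 9 0 ;; forLoop 6 1 (.asgR 9 (.reg 9 + .load 5 (.reg 6)))) ;;
    forLoop 6 1 (.stR 5 (.reg 6) (.load 5 (.reg 6) / .reg 9)) ;;
    forLoop 6 1 (.stR 8 (.reg 6 + .reg 6) (2 * .reg 7 * .load 5 (.reg 6)) ;;
      .stR 8 (.reg 6 + .reg 6 + 1) (2 * .reg 7 * .load 5 (.reg 6)))

lemma run_softmax {s : RamState} (h1 : s.nreg 1 = m) (hm : 1 ≤ m)
    (h7 : s.rreg 7 = 6 * Real.sqrt 3) :
    Run softmax s (150 * m) (fun s' =>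
      IsSoftmax (fun e => s.rarr 4 e) (incVec (m := m) (s.rarr 6)) (fun e => s'.rarr 5 e) ∧
      ∀ (e : Fin m) (k : Fin 2), s'.rarr 8 (2 * e + k) = 12 * Real.sqrt 3 * s'.rarr 5 e) := by
  have hκ : (0 : ℝ) < 6 * Real.sqrt 3 := by positivity
  obtain ⟨g, hg⟩ : ∃ g : ℕ → ℝ, g = fun e => (s.rarr 4 e / (6 * Real.sqrt 3) -
      s.rarr 6 (2 * e) ^ 2 - s.rarr 6 (2 * e + 1) ^ 2) / 6 := ⟨_, rfl⟩
  obtain ⟨Sm, hZ⟩ : ∃ x : ℝ, x = ∑ e ∈ range m, Real.exp (g e) := ⟨_, rfl⟩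
  have hZ0 : 0 < Sm := by
    rw [hZ]
    exact Finset.sum_pos (fun _ _ => Real.exp_pos _) ⟨0, Finset.mem_range.mpr hm⟩
  refine (Run.seq (T₁ := 42 * m + 3) (Run.mapR (fun e => Real.exp (g e)) (by decide) h1 ?_ ?_)
    fun s₁ f₁ q₁ => Run.seq (T₁ := 12 * m + 10) (Run.foldR (fun e x => x + Real.exp (g e)) 0
      (by decide) (by rw [f₁.n 1 rfl, h1]) (by simp) ?_ ?_) fun s₂ f₂ q₂ =>
      Run.seq (T₁ := 12 * m + 3) (Run.mapR (fun e => Real.exp (g e) / Sm) (by decide)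
        (by rw [f₂.n 1 rfl, f₁.n 1 rfl, h1]) ?_ ?_) fun s₃ f₃ q₃ =>
        Run.time_le (T := 40 * m + 3) ?_ le_rfl).time_le (by omega)
  · intro e he s' hf hi _
    simp only [softmaxE, RExp.eval_exp, RExp.eval_div, RExp.eval_sub, RExp.eval_load, RExp.eval_mul,
      RExp.eval_reg, NExp.eval_reg, NExp.eval_add, NExp.eval_ofNat, RExp.eval_ofNat, hi,
      hf.ra 4 rfl, hf.ra 6 rfl, hf.r 7 rfl, h7, hg]
    rw [← two_mul]
    congr 1
    norm_num
    ring
  · have : softmaxE.cost = 32 := rfl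
    rw [this]
    omega
  · intro e he s' hf hi
    have : s'.rarr 5 = s₁.rarr 5 := hf.ra 5 rfl
    simp [hi, this, q₁, he]
  · have e1 : (RExp.reg 9 + .load 5 (.reg 6)).cost = 4 := rfl
    have e2 : (0 : RExp).cost = 2 := rfl
    rw [e1, e2]
    omega
  · intro e he s' hf hi hj
    rw [Nat.rec_add_eq_sum] at q₂
    have e9 : s'.rreg 9 = Sm := by rw [hf.r 9 rfl, q₂, hZ]
    have e5 := hj e le_rfl
    rw [f₂.ra 5 rfl, q₁, if_pos he] at e5
    simp [hi, e9, e5]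
  · have : (RExp.load 5 (.reg 6) / .reg 9).cost = 4 := rfl
    rw [this]
    omega
  · have hr5 : ∀ e < m, s₃.rarr 5 e = Real.exp (g e) / Sm := fun e he => by rw [q₃, if_pos he]
    have hr7 : s₃.rreg 7 = 6 * Real.sqrt 3 := by rw [f₃.r 7 rfl, f₂.r 7 rfl, f₁.r 7 rfl, h7]
    have hval : ∀ e < m, ∀ s' : RamState, s'.rarr 5 = s₃.rarr 5 → s'.rreg 7 = s₃.rreg 7 →
        s'.nreg 6 = e → (2 * RExp.reg 7 * .load 5 (.reg 6)).eval s' =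
          12 * Real.sqrt 3 * s₃.rarr 5 e := by
      intro e he s' h5 h7' h6
      simp only [RExp.eval_mul, RExp.eval_reg, RExp.eval_load, NExp.eval_reg, RExp.eval_ofNat,
        h5, h7', h6, hr7]
      push_cast
      ring
    refine (Run.mapPair (fun e _ => 12 * Real.sqrt 3 * s₃.rarr 5 e) (by decide)
      (by rw [f₃.n 1 rfl, f₂.n 1 rfl, f₁.n 1 rfl, h1])
      (fun e he s' hf hi => hval e he s' (hf.ra 5 rfl) (hf.r 7 rfl) hi)
      (fun e he s' hf hi => hval e he s' (hf.ra 5 rfl) (hf.r 7 rfl) hi) ?_).frame.mono le_rfl ?_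
    · have : (2 * RExp.reg 7 * .load 5 (.reg 6)).cost = 7 := rfl
      rw [this]
      omega
    · rintro s' ⟨hf, h8⟩
      have e5 : s'.rarr 5 = s₃.rarr 5 := hf.ra 5 rfl
      refine ⟨⟨fun e => ?_, ?_, 6 * (6 * Real.sqrt 3) * Real.log Sm, fun e => ?_⟩, fun e k => ?_⟩
      · rw [e5, hr5 e e.isLt]
        exact div_pos (Real.exp_pos _) hZ0
      · have : ∀ e : Fin m, s'.rarr 5 e = Real.exp (g e) / Sm := fun e => by
          rw [e5, hr5 e e.isLt]
        simp only [this]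
        rw [← Finset.sum_div, ← Finset.sum_range (fun e => Real.exp (g e)), ← hZ, div_self hZ0.ne']
      · rw [e5, hr5 e e.isLt, Real.log_div (Real.exp_pos _).ne' hZ0.ne', Real.log_exp, hg]
        simp only [incVec, Fin.val_zero, Fin.val_one, add_zero]
        field_simp
        ring
      · rw [h8, e5]

/-- A round computes the softmax `y` of the old `z`, and a `z` that is optimal for this `y`. -/
lemma run_round {s : RamState} (hs : Layout ends s) (hm : 1 ≤ m) (hD : 0 ≤ s.rreg 1)
    (hA : ∀ (e : Fin m) (k : Fin 2), 0 ≤ s.rarr 7 (2 * e + k)) (h7 : s.rreg 7 = 6 * Real.sqrt 3)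
    {Δ : ℕ} (hΔ : ∀ u, degIn ends univ u ≤ Δ) :
    Run (softmax ;; solveAll) s (150 * m + 2013 * (m * (Nat.log 2 Δ + 3))) (fun s' => ∃ y,
      IsSoftmax (fun e => s.rarr 4 e) (incVec (s.rarr 6)) y ∧
      incVec (s'.rarr 6) ∈ feasibleSet ends (s.rreg 1) ∧
      ∀ x ∈ feasibleSet ends (s.rreg 1),
        zObj (incVec (s.rarr 7)) x y ≤ zObj (incVec (s.rarr 7)) (incVec (s'.rarr 6)) y) := by
  refine Run.seq (run_softmax hs.n1 hm h7) fun s₁ f₁ ⟨hy, hq⟩ => ?_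
  have e1 : s₁.rreg 1 = s.rreg 1 := f₁.r 1 rfl
  have e7 : s₁.rarr 7 = s.rarr 7 := f₁.ra 7 rfl
  refine (run_solveAll (hs.frame f₁ rfl) hm (by rw [e1]; exact hD) (by rw [e7]; exact hA)
    (fun e k => ?_) hΔ).mono le_rfl ?_
  · rw [hq]
    exact mul_pos (by positivity) (hy.pos e)
  · rintro s' ⟨lam, h0, hz, hc⟩
    refine ⟨_, hy, ⟨fun e k => ?_, fun u => ?_⟩, ?_⟩
    · simp only [incVec, hz]
      exact ⟨le_max_left _ _, max_le zero_le_one (min_le_left _ _)⟩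
    · rw [← e1]
      exact (hc u).1
    · refine zObj_le_of_kkt hy.pos h0 (fun e k => ?_) (fun u => ?_)
      · simp only [incVec]
        rw [hz, hq, e7]
      · rw [← e1]
        exact (hc u).2

/-- Alternating maximization over `y` and `z` until the gap, which shrinks by the factor `3/4` in
each round, is at most the real register `6`. -/
def oracle : HCmd :=
  forLoop 9 2 (.stR 6 (.reg 9) 0) ;; .asgR 8 64 ;;
    .loop (.rlt 6 8) ((softmax ;; solveAll) ;; .asgR 8 (.reg 8 * 3 / 4)) ;; softmax

lemma run_oracle {s : RamState} (hs : Layout ends s) (hm : 1 ≤ m) (hD : 0 ≤ s.rreg 1)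
    (hA : ∀ (e : Fin m) (k : Fin 2), 0 ≤ s.rarr 7 (2 * e + k)) (h7 : s.rreg 7 = 6 * Real.sqrt 3)
    {Δ N : ℕ} (hΔ : ∀ u, degIn ends univ u ≤ Δ) (hδ : s.rreg 6 < 64)
    (hN : 64 * (3 / 4) ^ N ≤ s.rreg 6) :
    Run oracle s ((N + 1) * (2100 * (m * (Nat.log 2 Δ + 3)))) (fun s' =>
      IsOracleAnswer ends (s.rreg 1) (s.rreg 6) (incVec (s.rarr 7), fun e => s.rarr 4 e)
        (incVec (s'.rarr 6), fun e => s'.rarr 5 e)) := by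
  obtain ⟨Λ, hΛ⟩ : ∃ Λ, Λ = m * (Nat.log 2 Δ + 3) := ⟨_, rfl⟩
  have hΛm : 3 * m ≤ Λ := by
    rw [hΛ, mul_comm]; exact Nat.mul_le_mul_left _ (by omega)
  rw [← hΛ]
  obtain ⟨D, hDd⟩ : ∃ D, D = s.rreg 1 := ⟨_, rfl⟩
  obtain ⟨a, ha⟩ : ∃ a : Fin m → Fin 2 → ℝ, a = incVec (s.rarr 7) := ⟨_, rfl⟩
  obtain ⟨b, hb⟩ : ∃ b : Fin m → ℝ, b = fun e : Fin m => s.rarr 4 e := ⟨_, rfl⟩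
  rw [← hDd, ← ha, ← hb]
  refine (Run.seq (T₁ := 20 * m + 3) (Run.mapR (n := 2 * m) (fun _ => 0) (by decide) hs.n2 (by simp)
    ?_) fun s₁ f₁ q₁ => Run.straight_seq (T₂ := (N * (150 * m + 2013 * Λ + 10 + 1) + 1) + 150 * m)
      (T := N * (150 * m + 2013 * Λ + 10 + 1) + 1 + 150 * m + 3) rfl ?_ ?_).time_le ?_
  · have : (0 : RExp).cost = 2 := rfl
    rw [this]
    omega
  · set s₂ := HCmd.eff (.asgR 8 64) s₁ with hs₂
    have g4 : s₂.rarr 4 = s.rarr 4 := by simp [hs₂, HCmd.eff, f₁.ra 4 rfl]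
    have g7 : s₂.rarr 7 = s.rarr 7 := by simp [hs₂, HCmd.eff, f₁.ra 7 rfl]
    have g6 : ∀ q < 2 * m, s₂.rarr 6 q = 0 := fun q hq => by simp [hs₂, HCmd.eff, q₁, hq]
    have r1 : s₂.rreg 1 = D := by simp [hs₂, HCmd.eff, f₁.r 1 rfl, hDd]
    have r6 : s₂.rreg 6 = s.rreg 6 := by simp [hs₂, HCmd.eff, f₁.r 6 rfl]
    have r7 : s₂.rreg 7 = 6 * Real.sqrt 3 := by simp [hs₂, HCmd.eff, f₁.r 7 rfl, h7]
    have r8 : s₂.rreg 8 = 64 := by simp [hs₂, HCmd.eff]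
    have hs2 : Layout ends s₂ :=
      (hs.frame f₁ rfl).frame (HExec.asgR 8 64 s₁).frame rfl
    clear_value s₂
    -- before the first round `z` is only feasible; afterwards register `8` bounds the gap
    refine Run.seq (Run.loop (τ := 150 * m + 2013 * Λ + 10) (fun j s' => j ≤ N ∧
      s'.rreg 8 = 64 * (3 / 4) ^ (N - j) ∧ (incVec (s'.rarr 6) : Fin m → Fin 2 → ℝ) ∈
        feasibleSet ends D ∧ (j = N ∨ ∀ y, IsSoftmax b (incVec (s'.rarr 6)) y →
          ∀ w ∈ saddleDomain ends D,
            oracleObj (a, b) w - oracleObj (a, b) (incVec (s'.rarr 6), y) ≤ s'.rreg 8)) N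
      ?_ ?_ ?_) ?_
    · refine ⟨le_rfl, by simp [r8], ⟨fun e k => ?_, fun u => ?_⟩, Or.inl rfl⟩
      · rw [incVec, g6 _ (by omega)]; simp
      · have : ∀ (e : Fin m) (k : Fin 2), incVec (s₂.rarr 6) e k = 0 := fun e k => g6 _ (by omega)
        simp only [this, ite_self, Finset.sum_const_zero]
        rw [hDd]; exact hD
    · rintro s' hf ⟨-, h8, -⟩
      rw [Nat.sub_zero] at h8
      simp only [RamTest.holds, h8, hf.r 6 rfl, r6]
      exact not_lt.mpr hN
    · rintro j s' hf ⟨hj, h8, hz, hgap⟩ -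
      have k1 : s'.rreg 1 = D := by rw [hf.r 1 rfl, r1]
      have k7 : s'.rarr 7 = s.rarr 7 := by rw [hf.ra 7 rfl, g7]
      have k4 : s'.rarr 4 = s.rarr 4 := by rw [hf.ra 4 rfl, g4]
      have hr := run_round (Δ := Δ) (hs2.frame hf rfl) hm (by rw [k1, hDd]; exact hD)
        (by rw [k7]; exact hA) (by rw [hf.r 7 rfl, r7]) hΔ
      rw [k1, k7, k4, ← ha, ← hb, ← hΛ] at hr
      refine Run.seq hr fun s₃ f₃ ⟨y, hy, hz', hmax⟩ => Run.straight rfl (by decide) ?_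
      have e8 : s₃.rreg 8 = s'.rreg 8 := f₃.r 8 rfl
      have hpow : (3 / 4 : ℝ) ^ (N - j) = (3 / 4) ^ (N - (j + 1)) * (3 / 4) := by
        rw [← pow_succ]; congr 1; omega
      have h8' : (HCmd.eff (.asgR 8 (.reg 8 * 3 / 4)) s₃).rreg 8 = 3 / 4 * s'.rreg 8 := by
        simp [HCmd.eff, e8]; ring
      have h6' : (HCmd.eff (.asgR 8 (.reg 8 * 3 / 4)) s₃).rarr 6 = s₃.rarr 6 := by
        simp [HCmd.eff]
      rw [h8', h6']
      refine ⟨by omega, by rw [h8, hpow]; ring, hz', Or.inr fun y' hy' w hw => ?_⟩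
      rcases hgap with hgap | hgap
      · refine (oracleObj_first hz.1 hy hz' hmax hy' hw).trans ?_
        rw [h8, hgap, Nat.sub_self, pow_zero]
        norm_num
      · exact (oracleObj_contract hz hy hz' hmax hy' hw).trans
          (mul_le_mul_of_nonneg_left (hgap y hy w hw) (by norm_num))
    · rintro s₃ - ⟨f₃, ⟨j, hj, -, h8, hz, hgap⟩, ht⟩
      have k4 : s₃.rarr 4 = s.rarr 4 := by rw [f₃.ra 4 rfl, g4]
      have k6 : s₃.rreg 6 = s.rreg 6 := by rw [f₃.r 6 rfl, r6]
      have hr := run_softmax (hs2.frame f₃ rfl).n1 hm (by rw [f₃.r 7 rfl, r7])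
      refine hr.frame.mono le_rfl ?_
      rintro s' ⟨hf, hy, -⟩
      rw [k4, ← hb] at hy
      have e6 : s'.rarr 6 = s₃.rarr 6 := hf.ra 6 rfl
      rw [RamTest.holds, not_lt, k6] at ht
      have hgap' := hgap.resolve_left (by
        -- the initial bound exceeds the requested accuracy
        rintro rfl
        rw [h8, Nat.sub_self, pow_zero] at ht
        linarith)
      rw [e6]
      refine ⟨⟨hz, hy.mem⟩, fun w hw => ?_⟩
      have := hgap' _ hy w hw
      simp only [oracleObj] at this
      linarith
  · have : HCmd.cost (.asgR 8 64) = 3 := rfl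
    omega
  · have h1 : N * (150 * m + 2013 * Λ + 10 + 1) ≤ N * (2100 * Λ) :=
      Nat.mul_le_mul_left _ (by omega)
    rw [Nat.add_mul]
    omega

end oracle

end

noncomputable section

/-! ### The extragradient step in the program -/

section step

variable {n m : ℕ} {ends : Fin m → Fin 2 → Fin n}

/-- Writes a query to the real arrays `7` and `4`. The `z`-part of the query is the same at both
endpoints of an edge. -/
def query (ea eb : RExp) : HCmd :=
  forLoop 6 1 (.stR 7 (.reg 6 + .reg 6) ea ;; .stR 7 (.reg 6 + .reg 6 + 1) ea) ;;
    forLoop 6 1 (.stR 4 (.reg 6) eb)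

lemma run_query {ea eb : RExp} {s : RamState} (h1 : s.nreg 1 = m) (fa fb : ℕ → ℝ)
    (h : ∀ e < m, ∀ s' : RamState, s'.rarr 0 = s.rarr 0 → s'.rarr 1 = s.rarr 1 →
      s'.rarr 2 = s.rarr 2 → s'.rarr 5 = s.rarr 5 → s'.rarr 6 = s.rarr 6 → s'.nreg 6 = e →
      ea.eval s' = fa e ∧ eb.eval s' = fb e) (hc : ea.cost ≤ 30) (hc' : eb.cost ≤ 30) :
    Run (query ea eb) s (120 * m + 6) (fun s' =>
      (incVec (s'.rarr 7) : Fin m → Fin 2 → ℝ) = (fun (e : Fin m) _ => fa e) ∧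
      (fun e : Fin m => s'.rarr 4 e) = fun e : Fin m => fb e) := by
  have p₁ := Run.mapPair (i := 6) (lim := 1) (arr := 7) (e₀ := ea) (e₁ := ea) (s := s) (n := m)
    (T := 75 * m + 3) (fun e _ => fa e) (by decide) h1
    (fun e he s' hf hi => (h e he s' (hf.ra 0 rfl) (hf.ra 1 rfl) (hf.ra 2 rfl) (hf.ra 5 rfl)
      (hf.ra 6 rfl) hi).1)
    (fun e he s' hf hi => (h e he s' (hf.ra 0 rfl) (hf.ra 1 rfl) (hf.ra 2 rfl) (hf.ra 5 rfl)
      (hf.ra 6 rfl) hi).1) (by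
    have : m * (ea.cost + ea.cost + 15) ≤ m * 75 := Nat.mul_le_mul_left _ (by omega)
    omega)
  refine (Run.seq p₁ fun s₁ f₁ q₁ => ?_).time_le (T := 75 * m + 3 + (45 * m + 3)) (by omega)
  have p₂ := Run.mapR (i := 6) (lim := 1) (arr := 4) (e := eb) (s := s₁) (n := m)
    (T := 45 * m + 3) fb (by decide) (by rw [f₁.n 1 rfl, h1])
    (fun e he s' hf hi _ => (h e he s' ((hf.ra 0 rfl).trans (f₁.ra 0 rfl))
      ((hf.ra 1 rfl).trans (f₁.ra 1 rfl)) ((hf.ra 2 rfl).trans (f₁.ra 2 rfl))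
      ((hf.ra 5 rfl).trans (f₁.ra 5 rfl)) ((hf.ra 6 rfl).trans (f₁.ra 6 rfl)) hi).2) (by
    have : m * (eb.cost + 7) ≤ m * 45 := Nat.mul_le_mul_left _ (by omega)
    omega)
  refine p₂.frame.mono le_rfl fun s' ⟨hf, q₂⟩ => ⟨?_, ?_⟩
  · funext e k
    simp only [incVec, hf.ra 7 rfl, q₁]
  · funext e
    rw [q₂, if_pos e.isLt]

/-- One extragradient step on the iterate in the real arrays `0`, `1`, `2`. -/
def extragradient : HCmd :=
  query (.load 2 (.reg 6)) (0 - (.load 0 (.reg 6) + .load 1 (.reg 6))) ;; oracle ;;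
    query (.load 2 (.reg 6) + 2 * .load 5 (.reg 6))
      (0 - (.load 0 (.reg 6) + .load 1 (.reg 6)) -
        2 * (.load 6 (.reg 6 + .reg 6) + .load 6 (.reg 6 + .reg 6 + 1))) ;; oracle ;;
    forLoop 6 1 (.stR 0 (.reg 6) (.load 0 (.reg 6) + .load 6 (.reg 6 + .reg 6))) ;;
    forLoop 6 1 (.stR 1 (.reg 6) (.load 1 (.reg 6) + .load 6 (.reg 6 + .reg 6 + 1))) ;;
    forLoop 6 1 (.stR 2 (.reg 6) (.load 2 (.reg 6) + .load 5 (.reg 6)))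

lemma run_extragradient {s : RamState} (hs : Layout ends s) (hm : 1 ≤ m) (hD : 0 ≤ s.rreg 1)
    (hY : ∀ e < m, 0 ≤ s.rarr 2 e) (h7 : s.rreg 7 = 6 * Real.sqrt 3)
    {Δ N : ℕ} (hΔ : ∀ u, degIn ends univ u ≤ Δ) (hδ : s.rreg 6 < 64)
    (hN : 64 * (3 / 4) ^ N ≤ s.rreg 6) :
    Run extragradient s ((N + 1) * (4400 * (m * (Nat.log 2 Δ + 3)))) (fun s' =>
      IsExtragradientStep ends (s.rreg 1) (s.rreg 6) (iterateOf m s) (iterateOf m s')) := by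
  obtain ⟨Λ, hΛ⟩ : ∃ Λ, Λ = m * (Nat.log 2 Δ + 3) := ⟨_, rfl⟩
  have hΛm : 3 * m ≤ Λ := by
    rw [hΛ, mul_comm]; exact Nat.mul_le_mul_left _ (by omega)
  refine (Run.seq (run_query hs.n1 (fun e => s.rarr 2 e) (fun e => -(s.rarr 0 e + s.rarr 1 e))
    ?_ (by decide) (by decide)) fun s₁ f₁ ⟨a₁, b₁⟩ => ?_).time_le
    (T := 120 * m + 6 + ((N + 1) * (2100 * Λ) + (120 * m + 6 + ((N + 1) * (2100 * Λ) +
      (15 * m + 3 + (17 * m + 3 + (15 * m + 3))))))) ?_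
  · rintro e he s' g0 g1 g2 - - hi
    simp [g0, g1, g2, hi]
  · have r1 : s₁.rreg 1 = s.rreg 1 := f₁.r 1 rfl
    have r6 : s₁.rreg 6 = s.rreg 6 := f₁.r 6 rfl
    have hs₁ := hs.frame f₁ rfl
    have h₁ := run_oracle hs₁ hm (by rw [r1]; exact hD) (fun e k => by
      have := congrFun (congrFun a₁ e) k
      simp only [incVec] at this
      rw [this]
      exact hY e e.isLt) ((f₁.r 7 rfl).trans h7) hΔ (by rw [r6]; exact hδ)
      (by rw [r6]; exact hN)
    rw [r1, r6, a₁, b₁, ← hΛ] at h₁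
    refine Run.seq h₁ fun s₂ f₂ hp => ?_
    have e0 : s₂.rarr 0 = s.rarr 0 := (f₂.ra 0 rfl).trans (f₁.ra 0 rfl)
    have e1 : s₂.rarr 1 = s.rarr 1 := (f₂.ra 1 rfl).trans (f₁.ra 1 rfl)
    have e2 : s₂.rarr 2 = s.rarr 2 := (f₂.ra 2 rfl).trans (f₁.ra 2 rfl)
    refine Run.seq (run_query (hs₁.frame f₂ rfl).n1 (fun e => s.rarr 2 e + 2 * s₂.rarr 5 e)
      (fun e => -(s.rarr 0 e + s.rarr 1 e) - 2 * (s₂.rarr 6 (2 * e) + s₂.rarr 6 (2 * e + 1)))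
      ?_ (by decide) (by decide)) fun s₃ f₃ ⟨a₃, b₃⟩ => ?_
    · rintro e he s' g0 g1 g2 g5 g6 hi
      simp [g0, g1, g2, g5, g6, e0, e1, e2, hi, ← two_mul]
    have r1' : s₃.rreg 1 = s.rreg 1 := (f₃.r 1 rfl).trans ((f₂.r 1 rfl).trans r1)
    have r6' : s₃.rreg 6 = s.rreg 6 := (f₃.r 6 rfl).trans ((f₂.r 6 rfl).trans r6)
    have hs₃ := (hs₁.frame f₂ rfl).frame f₃ rfl
    have h₃ := run_oracle hs₃ hm (by rw [r1']; exact hD) (fun e k => by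
      have := congrFun (congrFun a₃ e) k
      simp only [incVec] at this
      rw [this]
      exact add_nonneg (hY e e.isLt) (mul_nonneg zero_le_two (hp.1.2.1 e)))
      ((f₃.r 7 rfl).trans ((f₂.r 7 rfl).trans ((f₁.r 7 rfl).trans h7))) hΔ
      (by rw [r6']; exact hδ) (by rw [r6']; exact hN)
    rw [r1', r6', a₃, b₃, ← hΛ] at h₃
    refine Run.seq h₃ fun s₄ f₄ hq => ?_
    have e0' : s₄.rarr 0 = s.rarr 0 := (f₄.ra 0 rfl).trans ((f₃.ra 0 rfl).trans e0)
    have e1' : s₄.rarr 1 = s.rarr 1 := (f₄.ra 1 rfl).trans ((f₃.ra 1 rfl).trans e1)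
    have e2' : s₄.rarr 2 = s.rarr 2 := (f₄.ra 2 rfl).trans ((f₃.ra 2 rfl).trans e2)
    have n4 : s₄.nreg 1 = m := (hs₃.frame f₄ rfl).n1
    refine Run.seq (Run.mapR (fun e => s.rarr 0 e + s₄.rarr 6 (2 * e)) (by decide) n4 ?_ ?_)
      fun s₅ f₅ q₅ => Run.seq (Run.mapR (fun e => s.rarr 1 e + s₄.rarr 6 (2 * e + 1)) (by decide)
        (by rw [f₅.n 1 rfl, n4]) ?_ ?_)
      fun s₆ f₆ q₆ => (Run.mapR (fun e => s.rarr 2 e + s₄.rarr 5 e) (by decide)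
        (by rw [f₆.n 1 rfl, f₅.n 1 rfl, n4]) ?_ ?_).frame.mono le_rfl ?_
    · intro e he s' hf hi hj
      simp [hi, hj e le_rfl, e0', hf.ra 6 rfl, ← two_mul]
    · have : (RExp.load 0 (.reg 6) + .load 6 (.reg 6 + .reg 6)).cost = 7 := rfl
      rw [this]
      omega
    · intro e he s' hf hi hj
      simp [hi, hj e le_rfl, f₅.ra 1 rfl, e1', hf.ra 6 rfl, f₅.ra 6 rfl, ← two_mul]
    · have : (RExp.load 1 (.reg 6) + .load 6 (.reg 6 + .reg 6 + 1)).cost = 9 := rfl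
      rw [this]
      omega
    · intro e he s' hf hi hj
      simp [hi, hj e le_rfl, f₅.ra 2 rfl, f₆.ra 2 rfl, e2', hf.ra 5 rfl, f₆.ra 5 rfl, f₅.ra 5 rfl]
    · have : (RExp.load 2 (.reg 6) + .load 5 (.reg 6)).cost = 5 := rfl
      rw [this]
      omega
    · rintro s₇ ⟨f₇, q₇⟩
      have hA : saddleOp (iterateOf m s) =
          (fun (e : Fin m) _ => s.rarr 2 e, fun e : Fin m => -(s.rarr 0 e + s.rarr 1 e)) := rfl
      refine ⟨(incVec (s₂.rarr 6), fun e => s₂.rarr 5 e), (incVec (s₄.rarr 6), fun e => s₄.rarr 5 e),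
        hp, ?_, ?_⟩
      · rw [hA]
        convert hq using 1
        refine Prod.ext (by funext e k; simp [saddleOp]) ?_
        funext e
        simp [saddleOp, incVec]
        ring
      · have g0 : s₇.rarr 0 = s₅.rarr 0 := (f₇.ra 0 rfl).trans (f₆.ra 0 rfl)
        have g1 : s₇.rarr 1 = s₆.rarr 1 := f₇.ra 1 rfl
        refine Prod.ext ?_ ?_
        · funext e k
          fin_cases k
          · simp [iterateOf, incVec, g0, q₅]
          · simp [iterateOf, incVec, g1, q₆]
        · funext e
          simp [iterateOf, q₇]
  · have h1 : (N + 1) * (4400 * Λ) = (N + 1) * (2100 * Λ) + (N + 1) * (2100 * Λ) +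
      (N + 1) * (200 * Λ) := by ring
    have h2 : 1 * (200 * Λ) ≤ (N + 1) * (200 * Λ) := Nat.mul_le_mul_right _ (by omega)
    rw [← hΛ]
    omega

end step

end

noncomputable section

/-! ### One iteration of the main loop -/

section body

variable {n m : ℕ} {G : SimpleGraph (Fin n)} {E : EdgeListing G m} {ε : ℝ} {j T : ℕ} {s s' : RamState}

/-- Starts a new run: the guess is `1 - 2 η` times the upper bound for `OPT` in the real
register `3`, where `η` is the real register `2`. -/
def restart : HCmd :=
  .asgR 1 ((1 - 2 * .reg 2) * .reg 3) ;; forLoop 6 1 (.stR 0 (.reg 6) 0) ;;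
    forLoop 6 1 (.stR 1 (.reg 6) 0) ;; forLoop 6 1 (.stR 2 (.reg 6) (1 / .nat (.reg 1))) ;;
    (.asgR 5 0 ;; .asgN 5 0)

lemma run_restart (h1 : s.nreg 1 = m) :
    Run restart s (40 * m + 30) (fun s' => s'.rreg 1 = (1 - 2 * s.rreg 2) * s.rreg 3 ∧
      iterateOf m s' = startVec m ∧ s'.rreg 5 = 0 ∧ s'.nreg 5 = 0) := by
  refine Run.straight_seq (T₂ := 9 * m + 3 + (9 * m + 3 + (12 * m + 3 + 6))) rfl ?_ (by
    have : HCmd.cost (.asgR 1 ((1 - 2 * .reg 2) * .reg 3)) = 10 := rfl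
    omega)
  have c0 : (0 : RExp).cost = 2 := rfl
  have c1 : (1 / RExp.nat (.reg 1)).cost = 5 := rfl
  refine Run.seq (Run.mapR (i := 6) (lim := 1) (arr := 0) (e := 0) (n := m) (fun _ => 0)
    (by decide) (by simpa [HCmd.eff] using h1) (by simp) (by rw [c0]; omega))
    fun s₁ f₁ q₁ => ?_
  refine Run.seq (Run.mapR (i := 6) (lim := 1) (arr := 1) (e := 0) (n := m) (fun _ => 0)
    (by decide) (by rw [f₁.n 1 rfl]; simpa [HCmd.eff] using h1)
    (by simp) (by rw [c0]; omega)) fun s₂ f₂ q₂ => ?_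
  have k1 : s₂.nreg 1 = m := by rw [f₂.n 1 rfl, f₁.n 1 rfl]; exact h1
  refine Run.seq (Run.mapR (i := 6) (n := m) (fun _ => 1 / (m : ℝ)) (by decide) k1
    (fun e he s' hf hi hj => by simp [hf.n 1 rfl, k1]) (by rw [c1]; omega)) fun s₃ f₃ q₃ => ?_
  refine Run.straight rfl (by decide) ⟨?_, Prod.ext ?_ ?_, ?_, ?_⟩
  · simp [HCmd.eff, f₃.r 1 rfl, f₂.r 1 rfl, f₁.r 1 rfl]
  · funext e k
    fin_cases k
    · simp [HCmd.eff, iterateOf, startVec, f₃.ra 0 rfl, f₂.ra 0 rfl, q₁]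
    · simp [HCmd.eff, iterateOf, startVec, f₃.ra 1 rfl, q₂]
  · funext e
    simp [HCmd.eff, iterateOf, startVec, q₃]
  · simp [HCmd.eff]
  · simp [HCmd.eff]

/-- When the number `T` of steps satisfies `T η ≥ 256 (log m + 1)`, the run is evaluated: if some edge
is covered badly, the guess is infeasible, and either the search is over or it goes on with `η / 2`;
otherwise the upper bound for `OPT` improves. -/
def judge : HCmd :=
  .ite (.rlt (.reg 5 * .reg 2) (.reg 4)) .skip
    ((.asgR 14 (.load 0 0 + .load 1 0) ;;
      forLoop 6 1 (.asgR 14 (.min (.reg 14) (.load 0 (.reg 6) + .load 1 (.reg 6))))) ;;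
      .ite (.rlt (.reg 14) ((1 - .reg 2) * .reg 5))
        (.ite (.rlt (.reg 0) (2 * .reg 2)) (.asgR 2 (.reg 2 / 2) ;; .asgN 5 1) (.asgN 4 1))
        (.asgR 3 (.reg 1 / (1 - .reg 2)) ;; .asgN 5 1))

/-- The body of the main loop. -/
def mainBody : HCmd :=
  .ite (.neq (.reg 5) 1) restart .skip ;; extragradient ;; .asgR 5 (.reg 5 + 1) ;; judge

/-- The part of the loop invariant that does not concern the current run. The upper bound `U` for
`OPT` in the real register `3` is at most `(1 + (12 - j) η) OPT`. -/
structure SearchInv (E : EdgeListing G m) (ε : ℝ) (j : ℕ) (s : RamState) : Prop where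
  layout : Layout E.ends s
  active : s.nreg 4 = 0
  eps : s.rreg 0 = ε
  gap : s.rreg 4 = 256 * (Real.log m + 1)
  delta : s.rreg 6 = ε / 16
  scale : s.rreg 7 = 6 * Real.sqrt 3
  lt_eta : ε / 4 < s.rreg 2
  eta_le : s.rreg 2 ≤ 1 / 4
  j_le : j ≤ 12
  opt_le : maxDensity G ≤ s.rreg 3
  le_opt : s.rreg 3 ≤ maxDensity G * (1 + (12 - j) * s.rreg 2)

/-- The current run has made `T` steps for the current guess. -/
structure CurrentRun (E : EdgeListing G m) (ε : ℝ) (T : ℕ) (s : RamState) : Prop where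
  count : s.rreg 5 = T
  guess : s.rreg 1 = (1 - 2 * s.rreg 2) * s.rreg 3
  run : RunInv E.ends (s.rreg 1) (ε / 16) T (iterateOf m s)
  flag : s.nreg 5 = 0

/-- The loop invariant: either a new run starts in the next iteration, or the current run has made
`T` steps, which are not yet enough to evaluate it. -/
def Active (E : EdgeListing G m) (ε : ℝ) (j T : ℕ) (s : RamState) : Prop :=
  SearchInv E ε j s ∧ ((s.nreg 5 = 1 ∧ T = 0) ∨
    (CurrentRun E ε T s ∧ T * s.rreg 2 < 256 * (Real.log m + 1)))

/-- The state after the last iteration: the guess is good enough, and `y` certifies with slack that it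
is infeasible. -/
structure Certified (E : EdgeListing G m) (ε : ℝ) (s : RamState) : Prop where
  layout : Layout E.ends s
  stopped : s.nreg 4 = 1
  eps : s.rreg 0 = ε
  guess_pos : 0 < s.rreg 1
  le_guess : (1 - ε) * maxDensity G ≤ s.rreg 1
  y_nonneg : ∀ e : Fin m, 0 ≤ s.rarr 2 e
  cert : ∃ T : ℕ, s.rreg 5 = T ∧ ∑ e : Fin m, s.rarr 2 e = T + 1 ∧
    ∀ z ∈ feasibleSet E.ends (s.rreg 1),
      ∑ e : Fin m, s.rarr 2 e * (z e 0 + z e 1) ≤ (1 - 2 * (ε / 16)) * T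

/-- An upper bound for the number of remaining iterations, with `R = 256 (log m + 1)`: at most `13 - j`
runs of at most `R / η + 1` steps for the current `η`, of which `T` are done, and the runs for all
smaller values of `η`, whose costs form a geometric sum. -/
def budget (R ε η : ℝ) (j T : ℕ) : ℝ :=
  (13 - j) * (R / η + 1) - T + 26 * (R + 1) * (4 / ε - 1 / η)

lemma budget_succ (R ε η : ℝ) (j T : ℕ) : budget R ε η j (T + 1) + 1 = budget R ε η j T := by
  simp only [budget]; push_cast; ring

lemma budget_feasible {R ε η : ℝ} (hη : 0 < η) (hT : T * η < R) :
    budget R ε η (j + 1) 0 + 1 ≤ budget R ε η j T := by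
  have : (T : ℝ) < R / η := by rwa [lt_div_iff₀ hη]
  simp only [budget]; push_cast; nlinarith

lemma budget_infeasible {R ε η : ℝ} (hη : 0 < η) (hη1 : η ≤ 1 / 4) (hR : 0 ≤ R) (hT : T * η < R)
    (hj : j ≤ 12) : budget R ε (η / 2) 0 0 + 1 ≤ budget R ε η j T := by
  have h1 : (T : ℝ) < R / η := by rwa [lt_div_iff₀ hη]
  have h2 : 4 ≤ 1 / η := by rw [le_div_iff₀ hη]; linarith
  have h3 : (j : ℝ) ≤ 12 := by exact_mod_cast hj
  have h4 : 0 ≤ R / η := by positivity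
  have e1 : R / (η / 2) = 2 * (R / η) := by field_simp
  have e2 : 1 / (η / 2) = 2 * (1 / η) := by field_simp
  have e3 : R / η = R * (1 / η) := by ring
  simp only [budget, e1, e2]
  rw [e3] at h1 h4 ⊢
  push_cast
  nlinarith [mul_nonneg (sub_nonneg.mpr h3) (by linarith : 0 ≤ R * (1 / η) + 1)]

lemma one_le_budget {R ε η : ℝ} (hε : 0 < ε) (hη : ε / 4 < η) (hR : 0 ≤ R) (hT : T * η < R ∨ T = 0)
    (hj : j ≤ 12) : 1 ≤ budget R ε η j T := by
  have hη0 : 0 < η := by linarith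
  have h4 : 0 ≤ R / η := by positivity
  have h1 : (T : ℝ) ≤ R / η := by
    rcases hT with h | h
    · exact ((lt_div_iff₀ hη0).mpr h).le
    · rw [h]; simpa using h4
  have h3 : (j : ℝ) ≤ 12 := by exact_mod_cast hj
  have h5 : 1 / η ≤ 4 / ε := by rw [div_le_div_iff₀ hη0 hε]; linarith
  have h6 := mul_nonneg (by linarith : 0 ≤ 26 * (R + 1)) (sub_nonneg.mpr h5)
  simp only [budget]
  nlinarith [mul_nonneg (sub_nonneg.mpr h3) (by linarith : 0 ≤ R / η + 1)]

lemma SearchInv.congr (h : SearchInv E ε j s) (hl : Layout E.ends s') (e4 : s'.nreg 4 = s.nreg 4)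
    (hr : ∀ r ∈ [0, 2, 3, 4, 6, 7], s'.rreg r = s.rreg r) : SearchInv E ε j s' := by
  have r0 := hr 0 (by decide)
  have r2 := hr 2 (by decide)
  have r3 := hr 3 (by decide)
  have r4 := hr 4 (by decide)
  have r6 := hr 6 (by decide)
  have r7 := hr 7 (by decide)
  exact ⟨hl, e4.trans h.active, r0.trans h.eps, r4.trans h.gap, r6.trans h.delta, r7.trans h.scale,
    by rw [r2]; exact h.lt_eta, by rw [r2]; exact h.eta_le, h.j_le, by rw [r3]; exact h.opt_le,
    by rw [r3, r2]; exact h.le_opt⟩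

/-- A certificate of infeasibility with slack shows that the guess is below `OPT`. -/
lemma lt_maxDensity_of_certificate {D δ η : ℝ} {w : SaddleVec m} (hD : 0 ≤ D)
    (h : RunInv E.ends D δ T w) (hη : 0 < η) (hη1 : η ≤ 1 / 4)
    (hcert : ∀ z ∈ feasibleSet E.ends D, ∑ e, w.2 e * (z e 0 + z e 1) ≤ (1 - η / 2) * T) :
    D < maxDensity G := by
  obtain ⟨J, hJ⟩ : ∃ J : ℕ, m * (1 - η / 4) ^ (J + 1) ≤ η / 4 := by
    obtain ⟨J, hJ⟩ := exists_pow_lt_of_lt_one (show 0 < η / 4 / (m + 1) by positivity)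
      (show 1 - η / 4 < 1 by linarith)
    refine ⟨J, ?_⟩
    have h0 : 0 ≤ 1 - η / 4 := by linarith
    have h1 : (1 - η / 4) ^ (J + 1) ≤ (1 - η / 4) ^ J :=
      pow_le_pow_of_le_one h0 (by linarith) (Nat.le_succ J)
    rw [lt_div_iff₀ (by positivity)] at hJ
    have h2 := pow_nonneg h0 J
    have h3 := mul_le_mul_of_nonneg_left h1 (Nat.cast_nonneg m)
    nlinarith
  obtain ⟨i, -, hi⟩ := exists_dense_level hD h.y_nonneg h.y_sum (by linarith : 0 < η / 4)
    (by linarith) hJ (fun z hz => (hcert z hz).trans (le_of_eq (by ring)))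
  obtain ⟨hne, hlt⟩ := lt_density_of_level E hi
    (S := univ.filter fun u => D < degIn E.ends (levelSet w.2 ((T + 1) * (1 - η / 4) ^ i)) u)
    (fun u => by simp)
  exact hlt.trans_le (density_le_maxDensity G hne)

/-- The value of a loop that computes a minimum. -/
lemma Nat.rec_min (f : ℕ → ℝ) (k : ℕ) :
    (∀ e < k, Nat.rec (motive := fun _ => ℝ) (f 0) (fun e x => min x (f e)) k ≤ f e) ∧
    ∃ e, e < max k 1 ∧ Nat.rec (motive := fun _ => ℝ) (f 0) (fun e x => min x (f e)) k = f e := by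
  induction k with
  | zero => exact ⟨by simp, 0, by simp, rfl⟩
  | succ k ih =>
    obtain ⟨h1, e, he, h2⟩ := ih
    refine ⟨fun e' he' => ?_, ?_⟩
    · rcases Nat.lt_or_ge e' k with h | h
      · exact (min_le_left _ _).trans (h1 e' h)
      · obtain rfl : e' = k := by omega
        exact min_le_right _ _
    · rcases min_choice (Nat.rec (motive := fun _ => ℝ) (f 0) (fun e x => min x (f e)) k) (f k)
        with h | h
      · exact ⟨e, by omega, h.trans h2⟩
      · exact ⟨k, by omega, h⟩

lemma HCmd.frame_eff {c : HCmd} (hc : c.straight = true) (s : RamState) : Frame c s (c.eff s) := by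
  obtain ⟨s', t, he, -, rfl⟩ := Run.straight (Q := fun s' => s' = c.eff s) hc le_rfl rfl
  exact he.frame

/-- Every evaluation that does not end the search pays for itself with the budget. -/
lemma run_judge (hm : 1 ≤ m) (hε : 0 < ε) (h : SearchInv E ε j s) (hr : CurrentRun E ε (T + 1) s)
    (hT : T * s.rreg 2 < 256 * (Real.log m + 1)) :
    Run judge s (20 * m + 60) (fun s' => Certified E ε s' ∨ ∃ j' T', Active E ε j' T' s' ∧
      budget (256 * (Real.log m + 1)) ε (s'.rreg 2) j' T' + 1 ≤
        budget (256 * (Real.log m + 1)) ε (s.rreg 2) j T) := by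
  obtain ⟨R, hR⟩ : ∃ R, R = 256 * (Real.log m + 1) := ⟨_, rfl⟩
  obtain ⟨η, hη⟩ : ∃ η, η = s.rreg 2 := ⟨_, rfl⟩
  obtain ⟨D, hD⟩ : ∃ D, D = s.rreg 1 := ⟨_, rfl⟩
  obtain ⟨U, hU⟩ : ∃ U, U = s.rreg 3 := ⟨_, rfl⟩
  have hη4 := h.lt_eta
  have hη1 := h.eta_le
  have hDU := hr.guess
  have hrun := hr.run
  have hUo := h.opt_le
  have hoU := h.le_opt
  have hopt : 0 < maxDensity G := maxDensity_pos E hm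
  rw [← hη] at hη4 hη1 hDU hT hoU
  rw [← hU] at hUo hoU hDU
  rw [← hD] at hDU hrun
  have hη0 : 0 < η := by linarith
  have hD0 : 0 < D := by rw [hDU]; exact mul_pos (by linarith) (by linarith)
  have hR0 : 0 ≤ R := by
    have := Real.log_nonneg (show (1 : ℝ) ≤ m by exact_mod_cast hm)
    rw [hR]; linarith
  rw [← hη, ← hR]
  rw [← hR] at hT
  refine (Run.ite (T := 20 * m + 54) ?_ ?_).time_le ?_
  · -- the run goes on
    intro ht
    simp only [HTest.holds_rlt, RExp.eval_mul, RExp.eval_reg, hr.count, h.gap, ← hη, ← hR] at ht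
    refine Run.straight rfl (by simp [HCmd.cost]) (Or.inr ⟨j, T + 1, ⟨h, Or.inr ⟨hr, ?_⟩⟩, ?_⟩)
    · rw [HCmd.eff, ← hη, ← hR]; exact ht
    · rw [HCmd.eff, ← hη, budget_succ]
  · intro ht
    simp only [HTest.holds_rlt, RExp.eval_mul, RExp.eval_reg, hr.count, h.gap, ← hη, ← hR,
      not_lt] at ht
    obtain ⟨f, hf⟩ : ∃ f : ℕ → ℝ, f = fun e => s.rarr 0 e + s.rarr 1 e := ⟨_, rfl⟩
    refine (Run.seq (T₁ := 15 * m + 12) (T₂ := 35) (Run.foldR (n := m)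
      (fun e x => min x (f e)) (f 0) (by decide) h.layout.n1
      (by simp [hf]) ?_ ?_) fun s₁ f₁ q₁ => ?_).time_le (by omega)
    · intro e he s' hf' hi
      simp [hi, hf'.ra 0 rfl, hf'.ra 1 rfl, hf]
    · have c1 : (RExp.min (.reg 14) (.load 0 (.reg 6) + .load 1 (.reg 6))).cost = 8 := rfl
      have c2 : (RExp.load 0 0 + .load 1 0).cost = 5 := rfl
      rw [c1, c2]
      omega
    obtain ⟨hmin, e₀, he₀, hmin'⟩ := Nat.rec_min f m
    rw [← q₁] at hmin hmin'
    have he₀' : e₀ < m := by omega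
    have r0 : s₁.rreg 0 = ε := (f₁.r 0 rfl).trans h.eps
    have r1 : s₁.rreg 1 = D := (f₁.r 1 rfl).trans hD.symm
    have r2 : s₁.rreg 2 = η := (f₁.r 2 rfl).trans hη.symm
    have r3 : s₁.rreg 3 = U := (f₁.r 3 rfl).trans hU.symm
    have r5 : s₁.rreg 5 = (T + 1 : ℕ) := (f₁.r 5 rfl).trans hr.count
    have hs₁ : SearchInv E ε j s₁ := h.congr (h.layout.frame f₁ rfl) (f₁.n 4 rfl) (by
      intro r hr'
      fin_cases hr' <;> exact f₁.r _ rfl)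
    have hTpos : (0 : ℝ) < (T + 1 : ℕ) := by positivity
    refine (Run.ite (T := 20) ?_ ?_).time_le (by
      have : HTest.cost (.rlt (.reg 14) ((1 - .reg 2) * .reg 5)) = 7 := rfl
      omega)
    · intro hbad
      simp only [HTest.holds_rlt, RExp.eval_mul, RExp.eval_reg, RExp.eval_sub, RExp.eval_ofNat, r2,
        r5, hmin', hf, Nat.cast_one] at hbad
      have hcert := hrun.certificate (η := η) (e₀ := ⟨e₀, he₀'⟩) (by linarith) (by rw [← hR]; exact ht)
        hbad
      have hlt := lt_maxDensity_of_certificate hD0.le hrun hη0 hη1 hcert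
      refine (Run.ite (T := 8) ?_ ?_).time_le (by
        have : HTest.cost (.rlt (.reg 0) (2 * .reg 2)) = 5 := rfl
        omega)
      · -- infeasible, and the accuracy is not reached yet
        intro hgo
        simp only [HTest.holds_rlt, RExp.eval_mul, RExp.eval_reg, RExp.eval_ofNat, r0, r2,
          Nat.cast_ofNat] at hgo
        have e2 : (HCmd.eff (.asgR 2 (.reg 2 / 2) ;; .asgN 5 1) s₁).rreg 2 = η / 2 := by
          simp [HCmd.eff, r2]
        have e3 : (HCmd.eff (.asgR 2 (.reg 2 / 2) ;; .asgN 5 1) s₁).rreg 3 = U := by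
          simp [HCmd.eff, r3]
        refine Run.straight rfl (by decide) (Or.inr ⟨0, 0, ⟨⟨hs₁.layout.frame
          (HCmd.frame_eff rfl _) rfl, by simpa [HCmd.eff] using hs₁.active,
          by simpa [HCmd.eff] using hs₁.eps, by simpa [HCmd.eff] using hs₁.gap,
          by simpa [HCmd.eff] using hs₁.delta, by simpa [HCmd.eff] using hs₁.scale,
          by rw [e2]; linarith, by rw [e2]; linarith, by norm_num, by rw [e3]; exact hUo, ?_⟩,
          Or.inl ⟨by simp [HCmd.eff], rfl⟩⟩, ?_⟩)
        · rw [e2, e3]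
          rw [hDU] at hlt
          push_cast
          nlinarith
        · rw [e2]
          exact budget_infeasible hη0 hη1 hR0 hT h.j_le
      · -- infeasible, and the accuracy is reached
        intro hend
        simp only [HTest.holds_rlt, RExp.eval_mul, RExp.eval_reg, RExp.eval_ofNat, r0, r2,
          Nat.cast_ofNat, not_lt] at hend
        have e1 : (HCmd.eff (.asgN 4 1) s₁).rreg 1 = D := by simp [HCmd.eff, r1]
        have e2 : (HCmd.eff (.asgN 4 1) s₁).rarr 2 = s.rarr 2 := by simp [HCmd.eff, f₁.ra 2 rfl]
        refine Run.straight rfl (by decide) (Or.inl ⟨hs₁.layout.frame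
          (HCmd.frame_eff rfl _) rfl, by simp [HCmd.eff], by simpa [HCmd.eff] using hs₁.eps,
          by rw [e1]; exact hD0, ?_, by rw [e2]; exact hrun.y_nonneg, T + 1,
          by simpa [HCmd.eff] using r5, by rw [e2]; exact hrun.y_sum, ?_⟩)
        · rw [e1, hDU]
          nlinarith
        · rw [e1, e2]
          refine fun z hz => (hcert z hz).trans (mul_le_mul_of_nonneg_right ?_ hTpos.le)
          linarith
    · -- feasible
      intro hgood
      simp only [HTest.holds_rlt, RExp.eval_mul, RExp.eval_reg, RExp.eval_sub, RExp.eval_ofNat, r2,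
        r5, not_lt, Nat.cast_one] at hgood
      have hnew := hrun.maxDensity_le E hm (η := η) (by linarith) (Nat.succ_pos T) (fun e => by
        refine hgood.trans ((hmin e e.isLt).trans ?_)
        rw [hf]; exact le_rfl)
      have e2 : (HCmd.eff (.asgR 3 (.reg 1 / (1 - .reg 2)) ;; .asgN 5 1) s₁).rreg 2 = η := by
        simp [HCmd.eff, r2]
      have e3 : (HCmd.eff (.asgR 3 (.reg 1 / (1 - .reg 2)) ;; .asgN 5 1) s₁).rreg 3 =
          D / (1 - η) := by simp [HCmd.eff, r1, r2]
      -- the new bound is `(1 - 2 η) / (1 - η)` times the old one, a loss of at least `η OPT`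
      have hle : D / (1 - η) ≤ maxDensity G * (1 + (11 - j) * η) := by
        have h1 : D / (1 - η) ≤ U * (1 - η) := by
          rw [div_le_iff₀ (by linarith), hDU]
          nlinarith [mul_nonneg (hopt.le.trans hUo) (sq_nonneg η)]
        have h2 := mul_le_mul_of_nonneg_right hoU (by linarith : 0 ≤ 1 - η)
        have h3 : (j : ℝ) ≤ 12 := by exact_mod_cast h.j_le
        nlinarith [mul_nonneg (mul_nonneg hopt.le (sub_nonneg.mpr h3)) (sq_nonneg η)]
      -- for `j = 12` the new bound would be less than `OPT`
      have hj : j + 1 ≤ 12 := by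
        by_contra hcon
        have : (j : ℝ) = 12 := by exact_mod_cast (by have := h.j_le; omega : j = 12)
        rw [this] at hle
        nlinarith [mul_pos hopt hη0]
      refine Run.straight rfl (by decide) (Or.inr ⟨j + 1, 0, ⟨⟨hs₁.layout.frame
        (HCmd.frame_eff rfl _) rfl, by simpa [HCmd.eff] using hs₁.active,
        by simpa [HCmd.eff] using hs₁.eps, by simpa [HCmd.eff] using hs₁.gap,
        by simpa [HCmd.eff] using hs₁.delta, by simpa [HCmd.eff] using hs₁.scale,
        by rw [e2]; exact hη4, by rw [e2]; exact hη1, hj, by rw [e3]; exact hnew, ?_⟩,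
        Or.inl ⟨by simp [HCmd.eff], rfl⟩⟩, ?_⟩)
      · rw [e2, e3]
        refine hle.trans (le_of_eq ?_)
        push_cast
        ring
      · rw [e2]
        exact budget_feasible hη0 hT
  · have : HTest.cost (.rlt (.reg 5 * .reg 2) (.reg 4)) = 4 := rfl
    omega

lemma IsOracleAnswer.mono {ends : Fin m → Fin 2 → Fin n} {D δ δ' : ℝ} {x w : SaddleVec m}
    (h : IsOracleAnswer ends D δ x w) (hδ : δ ≤ δ') : IsOracleAnswer ends D δ' x w :=
  ⟨h.1, fun w' hw' => (h.2 w' hw').trans (by linarith)⟩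

lemma IsExtragradientStep.mono {ends : Fin m → Fin 2 → Fin n} {D δ δ' : ℝ} {w w' : SaddleVec m}
    (h : IsExtragradientStep ends D δ w w') (hδ : δ ≤ δ') : IsExtragradientStep ends D δ' w w' := by
  obtain ⟨p, q, hp, hq, e⟩ := h
  exact ⟨p, q, hp.mono hδ, hq.mono hδ, e⟩

/-- An iteration makes one extragradient step, and either ends the search or reduces the budget by at
least one. -/
lemma run_mainBody (hm : 1 ≤ m) (hε : 0 < ε) (hε1 : ε < 1) (h : Active E ε j T s) {Δ N : ℕ}
    (hΔ : ∀ u, degIn E.ends univ u ≤ Δ) (hN : 64 * (3 / 4) ^ N ≤ ε / 16) :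
    Run mainBody s ((N + 1) * (4500 * (m * (Nat.log 2 Δ + 3)))) (fun s' =>
      (∃ w : SaddleVec m, (w = startVec m ∨ (w = iterateOf m s ∧ guessOf s' = guessOf s)) ∧
        IsExtragradientStep E.ends (guessOf s') ε w (iterateOf m s')) ∧
      (Certified E ε s' ∨ ∃ j' T', Active E ε j' T' s' ∧
        budget (256 * (Real.log m + 1)) ε (s'.rreg 2) j' T' + 1 ≤
          budget (256 * (Real.log m + 1)) ε (s.rreg 2) j T)) := by
  obtain ⟨hs, hcase⟩ := h
  obtain ⟨Λ, hΛ⟩ : ∃ Λ, Λ = m * (Nat.log 2 Δ + 3) := ⟨_, rfl⟩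
  have hΛm : 3 * m ≤ Λ := by
    rw [hΛ, mul_comm]; exact Nat.mul_le_mul_left _ (by omega)
  have hT : T * s.rreg 2 < 256 * (Real.log m + 1) := by
    rcases hcase with ⟨-, h0⟩ | ⟨-, h0⟩
    · have := Real.log_nonneg (show (1 : ℝ) ≤ m by exact_mod_cast hm)
      rw [h0, Nat.cast_zero, zero_mul]
      linarith
    · exact h0
  -- after the optional restart, a run for the current guess is under way
  have p₁ : Run (.ite (.neq (.reg 5) 1) restart .skip) s (2 + (40 * m + 30 + 1)) (fun s₁ =>
      SearchInv E ε j s₁ ∧ CurrentRun E ε T s₁ ∧ s₁.rreg 2 = s.rreg 2 ∧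
      (iterateOf m s₁ = startVec m ∨ (iterateOf m s₁ = iterateOf m s ∧ guessOf s₁ = guessOf s))) := by
    refine Run.ite ?_ ?_
    · intro hf
      simp only [HTest.holds_neq, NExp.eval_reg, NExp.eval_ofNat] at hf
      have hT0 : T = 0 := by
        rcases hcase with ⟨-, h0⟩ | ⟨h0, -⟩
        · exact h0
        · rw [h0.flag] at hf; omega
      refine (run_restart hs.layout.n1).frame.mono le_rfl ?_
      rintro s₁ ⟨f₁, h1, h2, h3, h4⟩
      refine ⟨hs.congr (hs.layout.frame f₁ rfl) (f₁.n 4 rfl) (by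
        intro r hr; fin_cases hr <;> exact f₁.r _ rfl), ⟨by rw [h3, hT0]; simp, ?_, ?_, h4⟩,
        f₁.r 2 rfl, Or.inl h2⟩
      · rw [h1, f₁.r 2 rfl, f₁.r 3 rfl]
      · rw [h2, hT0]
        exact runInv_start _ _ _ hm
    · intro hf
      simp only [HTest.holds_neq, NExp.eval_reg, NExp.eval_ofNat] at hf
      refine Run.straight rfl (by simp [HCmd.cost]) ⟨hs, ?_, rfl, Or.inr ⟨rfl, rfl⟩⟩
      rcases hcase with ⟨h0, -⟩ | ⟨h0, -⟩
      · exact absurd h0 hf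
      · exact h0
  refine (Run.seq p₁ fun s₁ f₁ ⟨hs₁, hr₁, he₁, hw⟩ => ?_).time_le
    (T := 2 + (40 * m + 30 + 1) + ((N + 1) * (4400 * Λ) + (5 + (20 * m + 60)))) ?_
  · have hD0 : 0 ≤ s₁.rreg 1 := by
      rw [hr₁.guess]
      exact mul_nonneg (by linarith [hs₁.eta_le]) ((maxDensity_pos E hm).le.trans hs₁.opt_le)
    have p₂ := run_extragradient hs₁.layout hm hD0 (fun e he => hr₁.run.y_nonneg ⟨e, he⟩) hs₁.scale
      hΔ (by rw [hs₁.delta]; linarith) (by rw [hs₁.delta]; exact hN)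
    rw [hs₁.delta, ← hΛ] at p₂
    refine Run.seq p₂ fun s₂ f₂ hstep => Run.straight_seq (T₂ := 20 * m + 60) rfl ?_ (by
      have : HCmd.cost (.asgR 5 (.reg 5 + 1)) = 5 := rfl
      omega)
    set s₃ := HCmd.eff (.asgR 5 (.reg 5 + 1)) s₂ with hs₃
    have f₃ : Frame (.asgR 5 (.reg 5 + 1)) s₂ s₃ := HCmd.frame_eff rfl s₂
    have r5 : s₃.rreg 5 = (T + 1 : ℕ) := by
      simp [hs₃, HCmd.eff, f₂.r 5 rfl, hr₁.count]
    have g2 : s₃.rreg 2 = s₁.rreg 2 := (f₃.r 2 rfl).trans (f₂.r 2 rfl)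
    have g1 : s₃.rreg 1 = s₁.rreg 1 := (f₃.r 1 rfl).trans (f₂.r 1 rfl)
    have hit : iterateOf m s₃ = iterateOf m s₂ := by simp [hs₃, HCmd.eff, iterateOf]
    clear_value s₃
    have hS : SearchInv E ε j s₃ := hs₁.congr ((hs₁.layout.frame f₂ rfl).frame f₃ rfl)
      ((f₃.n 4 rfl).trans (f₂.n 4 rfl)) (by
        intro r hr; fin_cases hr <;> exact (f₃.r _ rfl).trans (f₂.r _ rfl))
    have hR : CurrentRun E ε (T + 1) s₃ := by
      refine ⟨r5, ?_, ?_, ?_⟩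
      · rw [g1, g2, hr₁.guess, f₃.r 3 rfl, f₂.r 3 rfl]
      · rw [g1, hit]
        exact hr₁.run.step hstep
      · rw [f₃.n 5 rfl, f₂.n 5 rfl, hr₁.flag]
    refine (run_judge hm hε hS hR (by rw [g2, he₁]; exact hT)).frame.mono le_rfl ?_
    rintro s' ⟨f', hres⟩
    rw [g2, he₁] at hres
    have hguess : guessOf s' = s₁.rreg 1 := (f'.r 1 rfl).trans g1
    have hiter : iterateOf m s' = iterateOf m s₂ := by
      rw [← hit]
      refine Prod.ext ?_ ?_
      · funext e k
        fin_cases k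
        · simp [iterateOf, f'.ra 0 rfl]
        · simp [iterateOf, f'.ra 1 rfl]
      · funext e
        simp [iterateOf, f'.ra 2 rfl]
    refine ⟨⟨iterateOf m s₁, ?_, ?_⟩, hres⟩
    · refine hw.imp_right fun h => ⟨h.1, ?_⟩
      rw [hguess, ← h.2]; rfl
    · rw [hguess, hiter]
      exact hstep.mono (by linarith)
  · have h1 : (N + 1) * (4500 * Λ) = (N + 1) * (4400 * Λ) + (N + 1) * (100 * Λ) := by ring
    have h2 : 1 * (100 * Λ) ≤ (N + 1) * (100 * Λ) := Nat.mul_le_mul_right _ (by omega)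
    rw [← hΛ]
    omega

end body

end

noncomputable section

/-! ### Degrees in the subgraph of the flagged edges -/

section post

variable {n m : ℕ} {G : SimpleGraph (Fin n)} {E : EdgeListing G m} {ends : Fin m → Fin 2 → Fin n}

/-- Computes the number of edges that are flagged in the integer array `10`, and the degrees in the
subgraph of the flagged edges. -/
def degrees : HCmd :=
  forLoop 7 3 (.stN 9 (.load 5 (.reg 7)) 0) ;; .asgN 23 0 ;;
    forLoop 6 1 (.ite (.neq (.load 10 (.reg 6)) 1)
      (.stN 9 (.load 0 (.reg 6)) (.load 9 (.load 0 (.reg 6)) + 1) ;;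
        .stN 9 (.load 1 (.reg 6)) (.load 9 (.load 1 (.reg 6)) + 1) ;; .asgN 23 (.reg 23 + 1))
      .skip)

/-- The integer array `9` holds the degrees in the subgraph with edge set `F` of all vertices that
are covered by edges. -/
def DegreesAre (ends : Fin m → Fin 2 → Fin n) (F : Finset (Fin m)) (s : RamState) : Prop :=
  ∀ e k, s.narr 9 (ends e k) = degIn ends F (ends e k)

lemma run_degrees {s : RamState} (hs : Layout ends s) (hm : 1 ≤ m) (F : Finset (Fin m))
    (hF : ∀ e, e ∈ F ↔ s.narr 10 e = 1) :
    Run degrees s (80 * m) (fun s' => DegreesAre ends F s' ∧ s'.nreg 23 = F.card) := by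
  have hnv := hs.nv_le
  refine (Run.seq (T₁ := 20 * m + 3) (T₂ := 48 * m + 8) (Run.forLoop_const (n := s.nreg 3) (τ := 5)
    rfl rfl rfl (fun l s' => ∀ i < l, s'.narr 9 (s.narr 5 i) = 0) _ (by simp) ?_ (by omega))
    fun s₁ f₁ q₁ => Run.straight_seq (T₂ := 48 * m + 3) rfl ?_ ?_).time_le (by omega)
  · intro l hl s' hf hi hI
    refine Run.straight rfl (by decide) fun i hi' => ?_
    simp only [HCmd.eff, setN_narr, setNArr_narr, if_true, NExp.eval_load, NExp.eval_reg, hi,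
      hf.na 5 rfl, NExp.eval_ofNat, Function.update_apply]
    split_ifs with h
    · rfl
    · refine hI i (Nat.lt_of_le_of_ne (by omega) fun h' => h (by rw [h']))
  · obtain ⟨-, -, q₁⟩ := q₁
    set s₂ := HCmd.eff (.asgN 23 0) s₁ with hs₂
    have f₂ : Frame (.asgN 23 0) s₁ s₂ := HCmd.frame_eff rfl s₁
    have hL : Layout ends s₂ := (hs.frame f₁ rfl).frame f₂ rfl
    have z23 : s₂.nreg 23 = 0 := by simp [hs₂, HCmd.eff]
    have k9 : s₂.narr 9 = s₁.narr 9 := f₂.na 9 rfl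
    have k10 : s₂.narr 10 = s.narr 10 := (f₂.na 10 rfl).trans (f₁.na 10 rfl)
    clear_value s₂
    refine (Run.forLoop_const (n := m) (τ := 43) hL.n1 rfl rfl (fun l s' =>
      DegreesAre ends (F.filter fun e : Fin m => (e : ℕ) < l) s' ∧
        s'.nreg 23 = (F.filter fun e : Fin m => (e : ℕ) < l).card) _
      ⟨?_, ?_⟩ ?_ (by omega)).mono le_rfl ?_
    · intro e k
      obtain ⟨i, hi, h⟩ := hs.cover e k
      simp only [setN_narr, k9, ← h, q₁ i hi]
      simp [degIn]
    · simp [z23]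
    · rintro l hl s' hf hi ⟨h1, h2⟩
      have hL' : Layout ends s' := hL.frame hf rfl
      have e10 : s'.narr 10 l = s.narr 10 l := by rw [hf.na 10 rfl, k10]
      have g0 : s'.narr 0 l = ends ⟨l, hl⟩ 0 := hL'.ends_eq ⟨l, hl⟩ 0
      have g1 : s'.narr 1 l = ends ⟨l, hl⟩ 1 := hL'.ends_eq ⟨l, hl⟩ 1
      refine (Run.ite (T := 38) ?_ ?_).time_le (by
        have : HTest.cost (.neq (.load 10 (.reg 6)) 1) = 3 := rfl
        omega)
      · intro ht
        simp only [HTest.holds_neq, NExp.eval_load, NExp.eval_reg, hi, NExp.eval_ofNat, e10] at ht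
        have hmem : (⟨l, hl⟩ : Fin m) ∈ F := (hF ⟨l, hl⟩).mpr ht
        have hins : (F.filter fun e : Fin m => (e : ℕ) < l + 1) =
            insert ⟨l, hl⟩ (F.filter fun e : Fin m => (e : ℕ) < l) := by
          ext e
          simp only [Finset.mem_filter, Finset.mem_insert, Fin.ext_iff]
          constructor
          · rintro ⟨h3, h4⟩
            rcases Nat.lt_or_ge e l with h | h
            · exact Or.inr ⟨h3, h⟩
            · exact Or.inl (by omega)
          · rintro (h3 | ⟨h3, h4⟩)
            · have : e = ⟨l, hl⟩ := Fin.ext h3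
              rw [this]
              exact ⟨hmem, Nat.lt_succ_self l⟩
            · exact ⟨h3, by omega⟩
        have hnot : (⟨l, hl⟩ : Fin m) ∉ (F.filter fun e : Fin m => (e : ℕ) < l) := by simp
        refine Run.straight rfl (by decide) ⟨fun e k => ?_, ?_⟩
        · rw [hins, degIn, Finset.sum_insert hnot, ← degIn, ← h1 e k, Fin.sum_univ_two]
          simp only [HCmd.eff, setN_narr, setNArr_narr, if_true, NExp.eval_load, NExp.eval_reg, hi,
            NExp.eval_ofNat, NExp.eval_add, Function.update_apply, g0, g1, setNArr_nreg,
            show (1 : ℕ) ≠ 9 by decide, if_false, Fin.ext_iff]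
          generalize (ends ⟨l, hl⟩ 0 : ℕ) = a
          generalize (ends ⟨l, hl⟩ 1 : ℕ) = b
          generalize (ends e k : ℕ) = v
          by_cases h3 : v = b
          · by_cases h4 : v = a
            · simp [← h3, ← h4]; omega
            · simp [← h3, h4, Ne.symm h4]; omega
          · by_cases h4 : v = a
            · simp [h3, ← h4, Ne.symm h3]; omega
            · simp [h3, h4, Ne.symm h3, Ne.symm h4]
        · rw [hins, Finset.card_insert_of_notMem hnot]
          simp [HCmd.eff, h2]
      · intro ht
        simp only [HTest.holds_neq, NExp.eval_load, NExp.eval_reg, hi, NExp.eval_ofNat, e10] at ht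
        have hins : (F.filter fun e : Fin m => (e : ℕ) < l + 1) =
            F.filter fun e : Fin m => (e : ℕ) < l := by
          refine Finset.filter_congr fun e he => ⟨fun h => ?_, fun h => by omega⟩
          have : (e : ℕ) ≠ l := fun h' => ht (by rw [← h']; exact (hF e).mp he)
          omega
        refine Run.straight rfl (by decide) ?_
        simp only [HCmd.eff]
        rw [hins]
        exact ⟨fun e k => h1 e k, by simpa using h2⟩
    · rintro s' ⟨-, -, h1, h2⟩
      have : (F.filter fun e : Fin m => (e : ℕ) < m) = F :=
        Finset.filter_true_of_mem fun e _ => e.isLt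
      rw [this] at h1 h2
      exact ⟨h1, h2⟩
  · have : HCmd.cost (.asgN 23 0) = 2 := rfl
    omega

/-! ### Postprocessing -/

/-- Flags the edges `e` with `y_e` at least the real register `15`, and compares their number with
the sum of the degrees truncated at the guess. If the level set is not too dense, then the level is
lowered, otherwise the integer register `28` is set. -/
def testLevel : HCmd :=
  forLoop 6 1 (.ite (.rlt (.load 2 (.reg 6)) (.reg 15)) (.stN 10 (.reg 6) 0) (.stN 10 (.reg 6) 1)) ;;
    degrees ;;
    (.asgR 9 0 ;;
      forLoop 7 3 (.asgR 9 (.reg 9 + .min (.reg 1) (.nat (.load 9 (.load 5 (.reg 7))))))) ;;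
    .ite (.rlt (.reg 9) (.nat (.reg 23))) (.asgN 28 1) (.asgR 15 (.reg 15 * (1 - .reg 0 / 16)))

/-- Sums over the numbered vertices are sums over all vertices, provided that isolated vertices
contribute nothing. -/
lemma Layout.sum_vertices {s : RamState} (hs : Layout ends s) (f : ℕ → ℝ)
    (hf : ∀ u : Fin n, (∀ e k, ends e k ≠ u) → f u = 0) :
    ∑ i ∈ range (s.nreg 3), f (s.narr 5 i) = ∑ u : Fin n, f u := by
  have hinj : Set.InjOn (s.narr 5) (range (s.nreg 3)) := fun i hi j hj h =>
    hs.vtx_inj i (by simpa using hi) j (by simpa using hj) h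
  rw [← Finset.sum_range (fun u => f u), ← Finset.sum_image (f := f) hinj]
  refine Finset.sum_subset ?_ ?_
  · intro u hu
    obtain ⟨i, hi, rfl⟩ := Finset.mem_image.mp hu
    exact Finset.mem_range.mpr (hs.vtx_lt i (Finset.mem_range.mp hi))
  · intro u hu hu'
    refine hf ⟨u, Finset.mem_range.mp hu⟩ fun e k h => hu' ?_
    obtain ⟨i, hi, h'⟩ := hs.cover e k
    exact Finset.mem_image.mpr ⟨i, Finset.mem_range.mpr hi, by rw [h', h]⟩

lemma run_testLevel {s : RamState} (hs : Layout ends s) (hm : 1 ≤ m) (hD : 0 < s.rreg 1) :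
    Run testLevel s (160 * m) (fun s' =>
      let F := levelSet (fun e : Fin m => s.rarr 2 e) (s.rreg 15)
      (∑ u, min (s.rreg 1) (degIn ends F u : ℝ) < F.card → s'.nreg 28 = 1 ∧ DegreesAre ends F s') ∧
      (¬ ∑ u, min (s.rreg 1) (degIn ends F u : ℝ) < F.card → s'.nreg 28 = s.nreg 28 ∧
        s'.rreg 15 = s.rreg 15 * (1 - s.rreg 0 / 16))) := by
  have hnv := hs.nv_le
  obtain ⟨F, hF⟩ : ∃ F, F = levelSet (fun e : Fin m => s.rarr 2 e) (s.rreg 15) := ⟨_, rfl⟩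
  simp only [← hF]
  refine (Run.seq (T₁ := 15 * m + 3) (T₂ := 80 * m + (30 * m + 6 + 20))
    (Run.forLoop_const (n := m) (τ := 10)
    hs.n1 rfl rfl (fun l s' => ∀ e < l, s'.narr 10 e = if s.rarr 2 e < s.rreg 15 then 0 else 1) _
    (by simp) ?_ (by omega)) fun s₁ f₁ q₁ => ?_).time_le (by omega)
  · intro l hl s' hf hi hI
    refine Run.straight rfl (by decide) fun e he => ?_
    simp only [HCmd.eff, HTest.holds_rlt, RExp.eval_load, RExp.eval_reg, NExp.eval_reg, hi,
      hf.ra 2 rfl, hf.r 15 rfl, NExp.eval_ofNat]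
    by_cases h : e = l
    · subst h
      split_ifs <;> simp
    · have := hI e (by omega)
      split_ifs with h' h'' <;> simp_all
  · obtain ⟨-, -, q₁⟩ := q₁
    have hs₁ := hs.frame f₁ rfl
    refine Run.seq (run_degrees hs₁ hm F (fun e => ?_)) fun s₂ f₂ ⟨h9, h23⟩ => ?_
    · rw [q₁ e e.isLt, hF]
      simp [levelSet]
    have hs₂ := hs₁.frame f₂ rfl
    have r1 : s₂.rreg 1 = s.rreg 1 := (f₂.r 1 rfl).trans (f₁.r 1 rfl)
    have hn3 : s₂.nreg 3 = s.nreg 3 := (f₂.n 3 rfl).trans (f₁.n 3 rfl)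
    refine Run.seq (Run.foldR (n := s₂.nreg 3) (fun i x => x + min (s.rreg 1)
      (s₂.narr 9 (s₂.narr 5 i) : ℝ)) 0 (by decide) rfl (by simp) ?_ ?_) fun s₃ f₃ q₃ => ?_
    · intro i hi s' hf hi'
      simp [hi', hf.r 1 rfl, r1, hf.na 9 rfl, hf.na 5 rfl]
    · have c1 : (RExp.reg 9 + .min (.reg 1) (.nat (.load 9 (.load 5 (.reg 7))))).cost = 9 := rfl
      have c2 : (0 : RExp).cost = 2 := rfl
      rw [c1, c2, hn3]
      omega
    rw [Nat.rec_add_eq_sum] at q₃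
    have hsum : s₃.rreg 9 = ∑ u, min (s.rreg 1) (degIn ends F u : ℝ) := by
      have h1 : ∀ i ∈ range (s₂.nreg 3), min (s.rreg 1) (s₂.narr 9 (s₂.narr 5 i) : ℝ) =
          (fun u : ℕ => if h : u < n then min (s.rreg 1) (degIn ends F ⟨u, h⟩ : ℝ) else 0)
            (s₂.narr 5 i) := by
        intro i hi
        have hi := Finset.mem_range.mp hi
        obtain ⟨c, hc⟩ : ∃ c, c < s₂.narr 7 i := ⟨0, hs₂.pos i hi⟩
        obtain ⟨e, k, -, h⟩ := (hs₂.slot i hi _).mp ⟨c, hc, rfl⟩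
        simp only
        rw [dif_pos (hs₂.vtx_lt i hi)]
        simp only [← h, h9 e k]
      rw [q₃, Finset.sum_congr rfl h1, hs₂.sum_vertices (fun u : ℕ => if h : u < n then
        min (s.rreg 1) (degIn ends F ⟨u, h⟩ : ℝ) else 0) ?_]
      · exact Finset.sum_congr rfl fun u _ => by simp
      · intro u hu
        have h0 : degIn ends F u = 0 := by
          by_contra hne
          obtain ⟨e, -, k, h⟩ := exists_of_degIn_pos (Nat.pos_of_ne_zero hne)
          exact hu e k h
        simp [h0, hD.le]
    have k23 : s₃.nreg 23 = F.card := (f₃.n 23 rfl).trans h23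
    refine (Run.ite (T := 10) ?_ ?_).time_le (by
      have : HTest.cost (.rlt (.reg 9) (.nat (.reg 23))) = 3 := rfl
      omega)
    · intro ht
      simp only [HTest.holds_rlt, RExp.eval_reg, RExp.eval_nat, NExp.eval_reg, hsum, k23] at ht
      refine Run.straight rfl (by decide) ⟨fun _ => ⟨by simp [HCmd.eff], fun e k => ?_⟩,
        fun h => absurd ht h⟩
      simp only [HCmd.eff, setN_narr, f₃.na 9 rfl]
      exact h9 e k
    · intro ht
      simp only [HTest.holds_rlt, RExp.eval_reg, RExp.eval_nat, NExp.eval_reg, hsum, k23] at ht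
      refine Run.straight rfl (by decide) ⟨fun h => absurd h ht, fun _ => ⟨?_, ?_⟩⟩
      · simp [HCmd.eff, f₃.n 28 rfl, f₂.n 28 rfl, f₁.n 28 rfl]
      · simp [HCmd.eff, f₃.r 15 rfl, f₂.r 15 rfl, f₁.r 15 rfl, f₃.r 0 rfl, f₂.r 0 rfl, f₁.r 0 rfl]

/-- Lowers the level, from the sum `T + 1` of `y` on, until the level set is too dense for the guess, and
returns the vertices of degree more than the guess in it. -/
def postprocessing : HCmd :=
  (.asgR 15 (.reg 5 + 1) ;; .asgN 28 0) ;; .loop (.neq 28 40) testLevel ;;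
    forLoop 7 3 (.ite (.rlt (.reg 1) (.nat (.load 9 (.load 5 (.reg 7)))))
      (.stN 2 (.load 5 (.reg 7)) 1) .skip)

/-- The loop ends because some level on the grid is too dense by `exists_dense_level`. -/
lemma run_postprocessing {ε : ℝ} {s : RamState} (h : Certified E ε s) (hm : 1 ≤ m) (hε : 0 < ε)
    (hε1 : ε < 1) (h2 : ∀ v, s.narr 2 v = 0) {J : ℕ}
    (hJ : m * (1 - ε / 16) ^ (J + 1) ≤ ε / 16) :
    Run postprocessing s ((J + 2) * (200 * m)) (fun s' => (outputSet n s').Nonempty ∧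
      s.rreg 1 < density G (outputSet n s')) := by
  obtain ⟨T, hT, hsum, hcert⟩ := h.cert
  obtain ⟨j₀, hj₀, hdense⟩ := exists_dense_level h.guess_pos.le h.y_nonneg hsum
    (by linarith : 0 < ε / 16) (by linarith) hJ hcert
  have hnv := h.layout.nv_le
  refine Run.straight_seq (T₂ := ((j₀ + 1) * (160 * m + 1) + 1) + (40 * m + 3)) rfl ?_ ?_
  · set s₀ := HCmd.eff (.asgR 15 (.reg 5 + 1) ;; .asgN 28 0) s with hs₀
    have f₀ : Frame (.asgR 15 (.reg 5 + 1) ;; .asgN 28 0) s s₀ := HCmd.frame_eff rfl s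
    have hL : Layout E.ends s₀ := h.layout.frame f₀ rfl
    have e15 : s₀.rreg 15 = T + 1 := by simp [hs₀, HCmd.eff, hT]
    have e28 : s₀.nreg 28 = 0 := by simp [hs₀, HCmd.eff]
    clear_value s₀
    have r1 : s₀.rreg 1 = s.rreg 1 := f₀.r 1 rfl
    have r0 : s₀.rreg 0 = ε := (f₀.r 0 rfl).trans h.eps
    have a2 : s₀.rarr 2 = s.rarr 2 := f₀.ra 2 rfl
    refine Run.seq (Run.loop (τ := 160 * m) (fun j s' =>
      (s'.nreg 28 = 0 ∧ ∃ i ≤ j₀, i + j = j₀ + 1 ∧ s'.rreg 15 = (T + 1) * (1 - ε / 16) ^ i) ∨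
      (s'.nreg 28 = 1 ∧ ∃ F, DegreesAre E.ends F s' ∧
        ∑ u, min (s.rreg 1) (degIn E.ends F u : ℝ) < F.card)) (j₀ + 1)
      (Or.inl ⟨e28, 0, by omega, by omega, by rw [e15]; simp⟩) ?_ ?_) ?_
    · rintro s' hf (⟨-, i, hi, hi', -⟩ | ⟨h28, -⟩)
      · omega
      · simp [RamTest.holds, h28, hf.n 40 rfl, hL.zero]
    · rintro j s' hf hI ht
      simp only [RamTest.holds, hf.n 40 rfl, hL.zero] at ht
      rcases hI with ⟨-, i, hi, hij, h15⟩ | ⟨h28, -⟩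
      · have k1 : s'.rreg 1 = s.rreg 1 := (hf.r 1 rfl).trans r1
        have k2 : s'.rarr 2 = s.rarr 2 := (hf.ra 2 rfl).trans a2
        have k0 : s'.rreg 0 = ε := (hf.r 0 rfl).trans r0
        refine (run_testLevel (hL.frame hf rfl) hm (by rw [k1]; exact h.guess_pos)).mono le_rfl ?_
        intro s'' hres
        simp only [k1, k2, k0, h15] at hres
        by_cases hd : ∑ u, min (s.rreg 1) (degIn E.ends (levelSet (fun e : Fin m => s.rarr 2 e)
            ((T + 1) * (1 - ε / 16) ^ i)) u : ℝ) <
            (levelSet (fun e : Fin m => s.rarr 2 e) ((T + 1) * (1 - ε / 16) ^ i)).card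
        · obtain ⟨g1, g2⟩ := hres.1 hd
          exact Or.inr ⟨g1, _, g2, hd⟩
        · obtain ⟨g1, g2⟩ := hres.2 hd
          have hne : i ≠ j₀ := fun h' => hd (by rw [h']; exact hdense)
          refine Or.inl ⟨by rw [g1, ht], i + 1, by omega, by omega, ?_⟩
          rw [g2, pow_succ]
          ring
      · omega
    · rintro s₁ - ⟨f₁, ⟨j, -, hI⟩, ht⟩
      have k40 : s₁.nreg 40 = 0 := (f₁.n 40 rfl).trans hL.zero
      have hL₁ : Layout E.ends s₁ := hL.frame f₁ rfl
      rw [RamTest.holds, k40] at ht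
      rcases hI with ⟨h28, -⟩ | ⟨-, F, hdeg, hF⟩
      · exact absurd h28 ht
      have k1 : s₁.rreg 1 = s.rreg 1 := (f₁.r 1 rfl).trans r1
      have n2 : ∀ v, s₁.narr 2 v = 0 := fun v => by
        rw [f₁.na 2 rfl, f₀.na 2 rfl, h2]
      have n3 : s₁.nreg 3 = s.nreg 3 := (f₁.n 3 rfl).trans (f₀.n 3 rfl)
      refine (Run.forLoop_const (n := s₁.nreg 3) (τ := 15) rfl rfl rfl (fun l s' =>
        ∀ v, s'.narr 2 v ≠ 0 ↔ ∃ i < l, s₁.narr 5 i = v ∧ s.rreg 1 < (s₁.narr 9 v : ℝ)) _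
        (by simp [n2]) ?_ (by rw [n3]; omega)).mono le_rfl ?_
      · intro l hl s' hf hi hI
        refine Run.straight rfl (by decide) fun v => ?_
        have hstep : (∃ i < l + 1, s₁.narr 5 i = v ∧ s.rreg 1 < (s₁.narr 9 v : ℝ)) ↔
            (∃ i < l, s₁.narr 5 i = v ∧ s.rreg 1 < (s₁.narr 9 v : ℝ)) ∨
              (s₁.narr 5 l = v ∧ s.rreg 1 < (s₁.narr 9 v : ℝ)) := by
          constructor
          · rintro ⟨i, hi, h1⟩
            rcases Nat.lt_or_ge i l with h | h
            · exact Or.inl ⟨i, h, h1⟩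
            · obtain rfl : i = l := by omega
              exact Or.inr h1
          · rintro (⟨i, hi, h1⟩ | h1)
            · exact ⟨i, by omega, h1⟩
            · exact ⟨l, by omega, h1⟩
        rw [hstep, ← hI v]
        simp only [HCmd.eff, HTest.holds_rlt, RExp.eval_reg, RExp.eval_nat, NExp.eval_load,
          NExp.eval_reg, hi, hf.na 5 rfl, hf.na 9 rfl, hf.r 1 rfl, k1, NExp.eval_ofNat]
        split_ifs with hlt
        · simp only [setN_narr, setNArr_narr, if_true, Function.update_apply]
          split_ifs with hv
          · simp only [ne_eq, one_ne_zero, not_false_iff, true_iff]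
            exact Or.inr ⟨hv.symm, by rw [hv]; exact hlt⟩
          · exact ⟨Or.inl, fun h => h.resolve_right fun h' => hv h'.1.symm⟩
        · simp only [setN_narr]
          exact ⟨Or.inl, fun h => h.resolve_right fun h' => hlt (by rw [h'.1]; exact h'.2)⟩
      · rintro s' ⟨-, -, hI⟩
        refine lt_density_of_level E hF fun u => ?_
        simp only [outputSet, Finset.mem_filter, Finset.mem_univ, true_and]
        rw [hI]
        constructor
        · rintro ⟨i, hi, hu, hlt⟩
          obtain ⟨e, k, -, hek⟩ := (hL₁.slot i hi _).mp ⟨0, hL₁.pos i hi, rfl⟩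
          have : E.ends e k = u := Fin.ext (hek.trans hu)
          rw [← this] at hlt ⊢
          rwa [hdeg e k] at hlt
        · intro hlt
          have hpos : 0 < degIn E.ends F u := by
            have := h.guess_pos.trans hlt
            exact_mod_cast this
          obtain ⟨e, -, k, rfl⟩ := exists_of_degIn_pos hpos
          obtain ⟨i, hi, h'⟩ := hL₁.cover e k
          exact ⟨i, hi, h', by rw [hdeg e k]; exact hlt⟩
  · have c : HCmd.cost (.asgR 15 (.reg 5 + 1) ;; .asgN 28 0) = 7 := rfl
    have h1 : (j₀ + 1) * (160 * m + 1) ≤ (J + 1) * (161 * m) :=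
      Nat.mul_le_mul (by omega) (by omega)
    have h2 : (J + 2) * (200 * m) = (J + 1) * (161 * m) + (J + 1) * (39 * m) + 200 * m := by ring
    have h3 : 1 * (39 * m) ≤ (J + 1) * (39 * m) := Nat.mul_le_mul_right _ (by omega)
    omega

end post

end

noncomputable section

/-! ### Grouping the incidences by vertex -/

section group

variable {n m : ℕ} {ends : Fin m → Fin 2 → Fin n}

/-- The first `Q` incidences have been distributed to `nv` lists of stride `S`: vertex `v` owns list
number `idx v - 1`, and `idx v = 0` if `v` has not been met. -/
structure Grouped (vert : ℕ → ℕ) (S Q nv : ℕ) (idx vtx base cnt sl : ℕ → ℕ) : Prop where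
  base_eq : ∀ i < nv, base i = i * S
  idx_le : ∀ v, idx v ≤ nv
  idx_vtx : ∀ i < nv, idx (vtx i) = i + 1
  vtx_idx : ∀ v, 0 < idx v → vtx (idx v - 1) = v
  mem : ∀ i < nv, ∀ c < cnt i, sl (i * S + c) < Q ∧ vert (sl (i * S + c)) = vtx i
  surj : ∀ q < Q, 0 < idx (vert q) ∧
    ∃ c < cnt (idx (vert q) - 1), sl ((idx (vert q) - 1) * S + c) = q
  mono : ∀ i < nv, ∀ c c', c < c' → c' < cnt i → sl (i * S + c) < sl (i * S + c')
  cnt_le : ∀ i < nv, cnt i ≤ Q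

/-- A new vertex gets an empty list. -/
lemma Grouped.new {vert : ℕ → ℕ} {S Q nv : ℕ} {idx vtx base cnt sl : ℕ → ℕ}
    (h : Grouped vert S Q nv idx vtx base cnt sl) {v : ℕ} (hv : idx v = 0) :
    Grouped vert S Q (nv + 1) (Function.update idx v (nv + 1)) (Function.update vtx nv v)
      (Function.update base nv (nv * S)) (Function.update cnt nv 0) sl := by
  have hne : ∀ i < nv, vtx i ≠ v := fun i hi h' => by
    have := h.idx_vtx i hi
    rw [h', hv] at this
    omega
  refine ⟨fun i hi => ?_, fun v' => ?_, fun i hi => ?_, fun v' hv' => ?_, fun i hi c hc => ?_,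
    fun q hq => ?_, fun i hi c c' hc hc' => ?_, fun i hi => ?_⟩
  · rcases Nat.lt_or_ge i nv with h' | h'
    · rw [Function.update_of_ne (by omega), h.base_eq i h']
    · obtain rfl : i = nv := by omega
      simp
  · have := h.idx_le v'
    rw [Function.update_apply]
    split_ifs <;> omega
  · rcases Nat.lt_or_ge i nv with h' | h'
    · rw [Function.update_of_ne (show i ≠ nv by omega), Function.update_of_ne (hne i h'),
        h.idx_vtx i h']
    · obtain rfl : i = nv := by omega
      simp
  · by_cases h' : v' = v
    · subst h'
      simp
    · rw [Function.update_of_ne h'] at hv' ⊢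
      have := h.idx_le v'
      rw [Function.update_of_ne (by omega), h.vtx_idx v' hv']
  · rcases Nat.lt_or_ge i nv with h' | h'
    · rw [Function.update_of_ne (by omega)] at hc ⊢
      exact h.mem i h' c hc
    · obtain rfl : i = nv := by omega
      simp at hc
  · obtain ⟨h1, h2⟩ := h.surj q hq
    have hvq : vert q ≠ v := fun h' => by rw [h', hv] at h1; omega
    have := h.idx_le (vert q)
    rw [Function.update_of_ne hvq, Function.update_of_ne (by omega)]
    exact ⟨h1, h2⟩
  · rcases Nat.lt_or_ge i nv with h' | h'
    · rw [Function.update_of_ne (by omega)] at hc'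
      exact h.mono i h' c c' hc hc'
    · obtain rfl : i = nv := by omega
      simp at hc'
  · rcases Nat.lt_or_ge i nv with h' | h'
    · rw [Function.update_of_ne (by omega)]
      exact h.cnt_le i h'
    · obtain rfl : i = nv := by omega
      simp

lemma stride_inj {S i i' c c' : ℕ} (hc : c < S) (hc' : c' < S) (h : i * S + c = i' * S + c') :
    i = i' ∧ c = c' := by
  have h1 : i = i' := by
    rcases Nat.lt_trichotomy i i' with h' | h' | h'
    · have := Nat.mul_le_mul_right S h'
      rw [Nat.succ_mul] at this
      omega
    · exact h'
    · have := Nat.mul_le_mul_right S h'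
      rw [Nat.succ_mul] at this
      omega
  subst h1
  exact ⟨rfl, by omega⟩

/-- Incidence number `Q` is appended to the list of its vertex. The stride `S` exceeds the length of
every list, so that the lists do not overlap. -/
lemma Grouped.push {vert : ℕ → ℕ} {S Q nv : ℕ} {idx vtx base cnt sl : ℕ → ℕ}
    (h : Grouped vert S Q nv idx vtx base cnt sl) {i : ℕ} (hi : i < nv) (hv : vtx i = vert Q)
    (hQ : Q < S) :
    Grouped vert S (Q + 1) nv idx vtx base (Function.update cnt i (cnt i + 1))
      (Function.update sl (i * S + cnt i) Q) := by
  have hold : ∀ i' < nv, ∀ c < cnt i', i' * S + c ≠ i * S + cnt i := fun i' hi' c hc h' => by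
    have h1 := h.cnt_le i' hi'
    have h2 := h.cnt_le i hi
    obtain ⟨rfl, rfl⟩ := stride_inj (by omega) (by omega) h'
    omega
  have hcnt : ∀ i' c, c < Function.update cnt i (cnt i + 1) i' → c < cnt i' ∨ (i' = i ∧ c = cnt i) := by
    intro i' c hc
    rw [Function.update_apply] at hc
    split_ifs at hc with h'
    · subst h'; omega
    · exact Or.inl hc
  have hle : ∀ i' c, c < cnt i' → c < Function.update cnt i (cnt i + 1) i' := by
    intro i' c hc
    rw [Function.update_apply]
    split_ifs with h'
    · subst h'; omega
    · exact hc
  refine ⟨h.base_eq, h.idx_le, h.idx_vtx, h.vtx_idx, fun i' hi' c hc => ?_, fun q hq => ?_,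
    fun i' hi' c c' hc hc' => ?_, fun i' hi' => ?_⟩
  · rcases hcnt i' c hc with hc | ⟨rfl, rfl⟩
    · rw [Function.update_of_ne (hold i' hi' c hc)]
      have := h.mem i' hi' c hc
      exact ⟨by omega, this.2⟩
    · rw [Function.update_self]
      exact ⟨by omega, hv.symm⟩
  · rcases Nat.lt_or_ge q Q with hq' | hq'
    · obtain ⟨h1, c, h2, h3⟩ := h.surj q hq'
      have := h.idx_le (vert q)
      exact ⟨h1, c, hle _ _ h2, by rw [Function.update_of_ne (hold _ (by omega) c h2), h3]⟩
    · obtain rfl : q = Q := by omega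
      have h1 := h.idx_vtx i hi
      rw [hv] at h1
      rw [h1]
      exact ⟨by omega, cnt i, by simp, by simp⟩
  · rcases hcnt i' c' hc' with hc' | ⟨rfl, rfl⟩
    · rw [Function.update_of_ne (hold i' hi' c (hc.trans hc')), Function.update_of_ne
        (hold i' hi' c' hc')]
      exact h.mono i' hi' c c' hc hc'
    · rw [Function.update_of_ne (hold i' hi' c hc), Function.update_self]
      exact (h.mem i' hi' c hc).1
  · have := h.cnt_le i' hi'
    rw [Function.update_apply]
    split_ifs with h'
    · subst h'; omega
    · omega

/-- Lists the vertices of the incidences, and groups the incidences by vertex. -/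
def groupIncidences : HCmd :=
  .asgN 2 (.reg 1 + .reg 1) ;;
    forLoop 6 1 (.stN 3 (.reg 6 + .reg 6) (.load 0 (.reg 6)) ;;
      .stN 3 (.reg 6 + .reg 6 + 1) (.load 1 (.reg 6))) ;;
    forLoop 9 2 (.asgN 24 (.load 3 (.reg 9)) ;;
      .ite (.neq (.load 4 (.reg 24)) 0)
        (.stN 5 (.reg 3) (.reg 24) ;; .stN 6 (.reg 3) (.reg 25) ;; .stN 7 (.reg 3) 0 ;;
          .asgN 25 (.reg 25 + .reg 2) ;; .asgN 3 (.reg 3 + 1) ;; .stN 4 (.reg 24) (.reg 3))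
        .skip ;;
      .asgN 17 (.load 4 (.reg 24) - 1) ;;
      .stN 8 (.load 6 (.reg 17) + .load 7 (.reg 17)) (.reg 9) ;;
      .stN 7 (.reg 17) (.load 7 (.reg 17) + 1))

/-- The loop invariant of the grouping loop in memory. -/
def GroupedMem (S Q : ℕ) (s : RamState) : Prop :=
  Grouped (s.narr 3) S Q (s.nreg 3) (s.narr 4) (s.narr 5) (s.narr 6) (s.narr 7) (s.narr 8) ∧
    (∀ i < s.nreg 3, 1 ≤ s.narr 7 i) ∧ s.nreg 25 = s.nreg 3 * S

lemma run_groupIncidences {s : RamState} (h0 : s.nreg 0 = n) (h1 : s.nreg 1 = m)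
    (h40 : s.nreg 40 = 0) (hends : ∀ (e : Fin m) (k : Fin 2), s.narr k e = ends e k)
    (h3 : s.nreg 3 = 0) (h25 : s.nreg 25 = 0) (h4 : ∀ v, s.narr 4 v = 0) :
    Run groupIncidences s (200 * m + 20) (Layout ends) := by
  refine Run.straight_seq (T₂ := 25 * m + 3 + (2 * m * 80 + 3)) rfl ?_ (by
    have : HCmd.cost (.asgN 2 (.reg 1 + .reg 1)) = 4 := rfl
    omega)
  set s₀ := HCmd.eff (.asgN 2 (.reg 1 + .reg 1)) s with hs₀
  have f₀ : Frame (.asgN 2 (.reg 1 + .reg 1)) s s₀ := HCmd.frame_eff rfl s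
  have k2 : s₀.nreg 2 = 2 * m := by simp [hs₀, HCmd.eff, h1, two_mul]
  clear_value s₀
  refine Run.seq (Run.forLoop_const (n := m) (τ := 20) ((f₀.n 1 rfl).trans h1) rfl rfl (fun l s' =>
    ∀ e : Fin m, (e : ℕ) < l → ∀ k : Fin 2, s'.narr 3 (2 * e + k) = ends e k) _ (by simp) ?_
    (by omega)) ?_
  · intro l hl s' hf hi hI
    refine Run.straight rfl (by decide) fun e he k => ?_
    have g0 : s'.narr 0 l = ends ⟨l, hl⟩ 0 := by
      rw [hf.na 0 rfl, f₀.na 0 rfl]; exact hends ⟨l, hl⟩ 0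
    have g1 : s'.narr 1 l = ends ⟨l, hl⟩ 1 := by
      rw [hf.na 1 rfl, f₀.na 1 rfl]; exact hends ⟨l, hl⟩ 1
    simp only [HCmd.eff, setN_narr, setNArr_narr, if_true, NExp.eval_load, NExp.eval_reg, hi,
      NExp.eval_ofNat, NExp.eval_add, Function.update_apply, setNArr_nreg, g0, g1,
      show (1 : ℕ) ≠ 3 by decide, if_false]
    rcases Nat.lt_or_ge e l with h | h
    · rw [if_neg (by omega), if_neg (by omega)]
      exact hI e h k
    · obtain rfl : e = ⟨l, hl⟩ := Fin.ext (by simp only; omega)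
      fin_cases k
      · simp only [Fin.zero_eta]
        rw [if_neg (by omega), if_pos (by omega)]
      · simp only [Fin.mk_one]
        rw [if_pos (by omega)]
  · rintro s₁ f₁ ⟨-, -, hvert⟩
    have j2 : s₁.nreg 2 = 2 * m := (f₁.n 2 rfl).trans k2
    have j3 : s₁.nreg 3 = 0 := (f₁.n 3 rfl).trans ((f₀.n 3 rfl).trans h3)
    have j25 : s₁.nreg 25 = 0 := (f₁.n 25 rfl).trans ((f₀.n 25 rfl).trans h25)
    have j4 : s₁.narr 4 = fun _ => 0 := by
      rw [f₁.na 4 rfl, f₀.na 4 rfl]; funext v; exact h4 v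
    refine (Run.forLoop_const (n := 2 * m) (τ := 75) j2 rfl rfl (fun Q s' =>
      GroupedMem (2 * m) Q s') _ ?_ ?_ le_rfl).mono le_rfl ?_
    · refine ⟨?_, by simp [j3], by simp [j3, j25]⟩
      simp only [setN_nreg, setN_narr, j3, j4, show (3 : ℕ) ≠ 9 by decide, if_false]
      constructor <;> simp
    · rintro Q hQ s' hf hi ⟨hG, hpos, hbs⟩
      have i2 : s'.nreg 2 = 2 * m := (hf.n 2 rfl).trans j2
      refine Run.straight_seq (T₂ := 70) rfl ?_ (by decide)
      set s₂ := HCmd.eff (.asgN 24 (.load 3 (.reg 9))) s' with hs₂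
      have a24 : s₂.nreg 24 = s'.narr 3 Q := by simp [hs₂, HCmd.eff, hi]
      have an : s₂.narr = s'.narr := by simp [hs₂, HCmd.eff]
      have an3 : s₂.nreg 3 = s'.nreg 3 := by simp [hs₂, HCmd.eff]
      have an25 : s₂.nreg 25 = s'.nreg 25 := by simp [hs₂, HCmd.eff]
      have an2 : s₂.nreg 2 = 2 * m := by simp [hs₂, HCmd.eff, i2]
      have an9 : s₂.nreg 9 = Q := by simp [hs₂, HCmd.eff, hi]
      clear_value s₂
      rw [← an, ← an3] at hG
      rw [← an, ← an3] at hpos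
      rw [← an3, ← an25] at hbs
      rw [← an] at a24
      refine (Run.seq (T₁ := 3 + (30 + 1)) (T₂ := 30) (Q₁ := fun s₃ =>
        Grouped (s₃.narr 3) (2 * m) Q (s₃.nreg 3) (s₃.narr 4) (s₃.narr 5) (s₃.narr 6) (s₃.narr 7)
          (s₃.narr 8) ∧ (∀ i < s₃.nreg 3, 1 ≤ s₃.narr 7 i ∨ i + 1 = s₃.narr 4 (s₃.narr 3 Q)) ∧
          s₃.nreg 25 = s₃.nreg 3 * (2 * m) ∧ s₃.nreg 24 = s₃.narr 3 Q ∧ s₃.nreg 9 = Q ∧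
          0 < s₃.narr 4 (s₃.narr 3 Q)) (Run.ite ?_ ?_) ?_).time_le (by decide)
      · intro hnew
        simp only [HTest.holds_neq, NExp.eval_load, NExp.eval_reg, NExp.eval_ofNat, a24] at hnew
        refine Run.straight rfl (by decide) ?_
        have := hG.new hnew
        rw [← hbs] at this
        simp only [HCmd.eff, setN_narr, setNArr_narr, NExp.eval_reg,
          NExp.eval_ofNat, NExp.eval_add, setNArr_nreg, setN_nreg, if_true, if_false, a24, an2, an9,
          Nat.reduceEqDiff]
        refine ⟨this, fun i hi => ?_, ?_, trivial, trivial, by simp⟩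
        · rw [Function.update_apply, Function.update_self]
          split_ifs with h
          · exact Or.inr (by omega)
          · exact Or.inl (hpos i (by omega))
        · rw [hbs]; ring
      · intro hold
        simp only [HTest.holds_neq, NExp.eval_load, NExp.eval_reg, NExp.eval_ofNat, a24] at hold
        exact Run.straight rfl (by decide) ⟨hG, fun i hi => Or.inl (hpos i hi), hbs, a24, an9,
          Nat.pos_of_ne_zero hold⟩
      · rintro s₃ - ⟨hG, hpos, hbs, h24, h9, hid⟩
        refine Run.straight rfl (by decide) ?_
        have hlt : s₃.narr 4 (s₃.narr 3 Q) - 1 < s₃.nreg 3 := by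
          have := hG.idx_le (s₃.narr 3 Q)
          omega
        have := hG.push hlt (hG.vtx_idx _ hid) hQ
        rw [← hG.base_eq _ hlt] at this
        simp only [GroupedMem, HCmd.eff, setN_narr, setNArr_narr, NExp.eval_load, NExp.eval_reg,
          NExp.eval_ofNat, NExp.eval_add, NExp.eval_sub, setNArr_nreg, setN_nreg, if_true, if_false,
          h24, h9, Nat.reduceEqDiff]
        refine ⟨this, fun i hi => ?_, hbs⟩
        rw [Function.update_apply]
        split_ifs with h
        · omega
        · exact (hpos i hi).resolve_right (by omega)
    · rintro s₂ ⟨f₂, -, hG, hpos, -⟩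
      have e3 : s₂.narr 3 = s₁.narr 3 := f₂.na 3 rfl
      have hv : ∀ (e : Fin m) (k : Fin 2), s₂.narr 3 (2 * e + k) = ends e k := fun e k => by
        rw [e3]; exact hvert e e.isLt k
      have hq : ∀ q < 2 * m, ∃ (e : Fin m) (k : Fin 2), q = 2 * e + k := fun q hq =>
        ⟨⟨q / 2, by omega⟩, ⟨q % 2, by omega⟩, by simp only; omega⟩
      have hslot : ∀ i < s₂.nreg 3, ∀ q, (∃ c < s₂.narr 7 i, s₂.narr 8 (s₂.narr 6 i + c) = q) ↔
          ∃ (e : Fin m) (k : Fin 2), q = 2 * e + k ∧ (ends e k : ℕ) = s₂.narr 5 i := by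
        intro i hi q
        rw [hG.base_eq i hi]
        constructor
        · rintro ⟨c, hc, rfl⟩
          obtain ⟨g1, g2⟩ := hG.mem i hi c hc
          obtain ⟨e, k, h⟩ := hq _ g1
          exact ⟨e, k, h, by rw [← hv, ← h, g2]⟩
        · rintro ⟨e, k, rfl, h⟩
          obtain ⟨-, c, hc, h'⟩ := hG.surj (2 * e + k) (by omega)
          rw [hv, h, hG.idx_vtx i hi, Nat.add_sub_cancel] at hc h'
          exact ⟨c, hc, h'⟩
      refine ⟨?_, ?_, ?_, ?_, fun e k => ?_, hpos, fun i hi j hj h => ?_, fun i hi => ?_,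
        fun e k => ?_, fun i hi c hc c' hc' h => ?_, hslot⟩
      · rw [f₂.n 0 rfl, f₁.n 0 rfl, f₀.n 0 rfl, h0]
      · rw [f₂.n 1 rfl, f₁.n 1 rfl, f₀.n 1 rfl, h1]
      · rw [f₂.n 2 rfl, j2]
      · rw [f₂.n 40 rfl, f₁.n 40 rfl, f₀.n 40 rfl, h40]
      · rw [← hends e k]
        fin_cases k
        · exact congrFun ((f₂.na 0 rfl).trans ((f₁.na 0 rfl).trans (f₀.na 0 rfl))) _
        · exact congrFun ((f₂.na 1 rfl).trans ((f₁.na 1 rfl).trans (f₀.na 1 rfl))) _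
      · have h5 := hG.idx_vtx i hi
        rw [h, hG.idx_vtx j hj] at h5
        omega
      · obtain ⟨e, k, -, h⟩ := (hslot i hi _).mp ⟨0, hpos i hi, rfl⟩
        rw [← h]
        exact (ends e k).isLt
      · obtain ⟨g, -⟩ := hG.surj (2 * e + k) (by omega)
        rw [hv] at g
        have := hG.idx_le (ends e k)
        exact ⟨_, by omega, hG.vtx_idx _ g⟩
      · rw [hG.base_eq i hi] at h
        rcases Nat.lt_trichotomy c c' with h' | h' | h'
        · have := hG.mono i hi c c' h' hc'
          omega
        · exact h'
        · have := hG.mono i hi c' c h' hc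
          omega

end group

end

noncomputable section

/-! ### Preprocessing -/

section pre

variable {n m : ℕ} {G : SimpleGraph (Fin n)} {E : EdgeListing G m}

/-- Counts the vertices of positive degree in the integer register `29`, updates the best density
found so far in the real register `16`, removes the edges at vertices of degree at most four times
the current density, and recomputes the degrees. -/
def peelPass : HCmd :=
  .asgN 29 0 ;;
    forLoop 7 3 (.ite (.nlt 0 (.load 9 (.load 5 (.reg 7)))) (.asgN 29 (.reg 29 + 1)) .skip) ;;
    (.asgR 17 (.nat (.reg 23) / .nat (.reg 29)) ;; .asgR 16 (.max (.reg 16) (.reg 17))) ;;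
    forLoop 6 1 (.ite (.rlt (4 * .reg 17) (.nat (.load 9 (.load 0 (.reg 6)))))
      (.ite (.rlt (4 * .reg 17) (.nat (.load 9 (.load 1 (.reg 6))))) .skip (.stN 10 (.reg 6) 0))
      (.stN 10 (.reg 6) 0)) ;;
    degrees

/-- Computes a constant factor approximation of `OPT` in the real register `16`. -/
def peel : HCmd :=
  forLoop 6 1 (.stN 10 (.reg 6) 1) ;; .asgR 16 0 ;; degrees ;; .loop (.nlt 40 23) peelPass

/-- The flagged edges form the set `F`, whose degrees and cardinality are known, and the best density
found so far is at least `OPT / 4` unless all edges of the densest set `S` are still there. -/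
structure PeelInv (E : EdgeListing G m) (S : Finset (Fin n)) (F : Finset (Fin m)) (s : RamState) :
    Prop where
  mem_iff : ∀ e, e ∈ F ↔ s.narr 10 e = 1
  degs : DegreesAre E.ends F s
  count : s.nreg 23 = F.card
  best_le : s.rreg 16 ≤ maxDensity G
  le_best : edgesIn E.ends S ⊆ F ∨ maxDensity G ≤ 4 * s.rreg 16

/-- A pass removes an edge of the densest set `S` only if the current density is at least `OPT / 4`. -/
lemma run_peelPass {s : RamState} (hs : Layout E.ends s) (hm : 1 ≤ m) {S : Finset (Fin n)}
    (hS : S.Nonempty) (hSd : density G S = maxDensity G) {F : Finset (Fin m)}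
    (h : PeelInv E S F s) (hF : F.Nonempty) :
    Run peelPass s (200 * m) (fun s' => ∃ F', PeelInv E S F' s' ∧
      2 * #{u | 0 < degIn E.ends F' u} ≤ #{u | 0 < degIn E.ends F u}) := by
  have hnv := hs.nv_le
  obtain ⟨ρ, hρ⟩ : ∃ ρ : ℝ, ρ = F.card / #{u | 0 < degIn E.ends F u} := ⟨_, rfl⟩
  refine Run.straight_seq (T₂ := 30 * m + 3 + (11 + (40 * m + 3 + 80 * m))) rfl ?_ (by
    have : HCmd.cost (.asgN 29 0) = 2 := rfl
    omega)
  set s₀ := HCmd.eff (.asgN 29 0) s with hs₀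
  have f₀ : Frame (.asgN 29 0) s s₀ := HCmd.frame_eff rfl s
  have z29 : s₀.nreg 29 = 0 := by simp [hs₀, HCmd.eff]
  clear_value s₀
  have hs0 : Layout E.ends s₀ := hs.frame f₀ rfl
  have k9 : s₀.narr 9 = s.narr 9 := f₀.na 9 rfl
  have k3 : s₀.nreg 3 = s.nreg 3 := f₀.n 3 rfl
  refine Run.seq (Run.forLoop_const (n := s₀.nreg 3) (τ := 10) rfl rfl rfl (fun l s' =>
    (s'.nreg 29 : ℝ) = ∑ i ∈ range l, if 0 < s.narr 9 (s₀.narr 5 i) then 1 else 0) _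
    (by simp [z29]) ?_ (by rw [k3]; omega)) fun s₁ f₁ q₁ => ?_
  · intro l hl s' hf hi hI
    refine Run.straight rfl (by decide) ?_
    rw [Finset.sum_range_succ, ← hI]
    simp only [HCmd.eff, HTest.holds_nlt, NExp.eval_ofNat, NExp.eval_load, NExp.eval_reg, hi,
      hf.na 9 rfl, hf.na 5 rfl, k9]
    split_ifs <;> simp
  · obtain ⟨-, -, q₁⟩ := q₁
    have hs₁ : Layout E.ends s₁ := hs0.frame f₁ rfl
    have hcov : (s₁.nreg 29 : ℝ) = #{u | 0 < degIn E.ends F u} := by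
      have hdeg : ∀ i < s₀.nreg 3, ∃ e k, (E.ends e k : ℕ) = s₀.narr 5 i := fun i hi => by
        obtain ⟨e, k, -, h'⟩ := (hs0.slot i hi _).mp ⟨0, hs0.pos i hi, rfl⟩
        exact ⟨e, k, h'⟩
      have h1 : ∀ i ∈ range (s₀.nreg 3), (if 0 < s.narr 9 (s₀.narr 5 i) then 1 else 0 : ℝ) =
          (fun u : ℕ => if h : u < n then (if 0 < degIn E.ends F ⟨u, h⟩ then 1 else 0 : ℝ) else 0)
            (s₀.narr 5 i) := by
        intro i hi
        obtain ⟨e, k, h'⟩ := hdeg i (Finset.mem_range.mp hi)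
        simp only [← h', h.degs e k, Fin.is_lt, dif_pos, Fin.eta]
      rw [q₁, Finset.sum_congr rfl h1, hs0.sum_vertices (fun u : ℕ => if h : u < n then
        (if 0 < degIn E.ends F ⟨u, h⟩ then 1 else 0 : ℝ) else 0) ?_]
      · simp
      · intro u hu
        have h0 : degIn E.ends F u = 0 := by
          by_contra hne
          obtain ⟨e, -, k, h'⟩ := exists_of_degIn_pos (Nat.pos_of_ne_zero hne)
          exact hu e k h'
        simp [h0]
    refine Run.straight_seq (T₂ := 40 * m + 3 + 80 * m) rfl ?_ (by
      have : HCmd.cost (.asgR 17 (.nat (.reg 23) / .nat (.reg 29)) ;;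
        .asgR 16 (.max (.reg 16) (.reg 17))) = 11 := rfl
      omega)
    set s₂ := HCmd.eff (.asgR 17 (.nat (.reg 23) / .nat (.reg 29)) ;;
        .asgR 16 (.max (.reg 16) (.reg 17))) s₁ with hs₂
    have f₂ : Frame (.asgR 17 (.nat (.reg 23) / .nat (.reg 29)) ;;
        .asgR 16 (.max (.reg 16) (.reg 17))) s₁ s₂ := HCmd.frame_eff rfl s₁
    have e23 : s₁.nreg 23 = F.card := (f₁.n 23 rfl).trans ((f₀.n 23 rfl).trans h.count)
    have e16' : s₁.rreg 16 = s.rreg 16 := (f₁.r 16 rfl).trans (f₀.r 16 rfl)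
    have r17 : s₂.rreg 17 = ρ := by simp [hs₂, HCmd.eff, e23, hcov, hρ]
    have r16 : s₂.rreg 16 = max (s.rreg 16) ρ := by simp [hs₂, HCmd.eff, e23, e16', hcov, hρ]
    clear_value s₂
    have hL₂ : Layout E.ends s₂ := hs₁.frame f₂ rfl
    have g9 : s₂.narr 9 = s.narr 9 := (f₂.na 9 rfl).trans ((f₁.na 9 rfl).trans k9)
    have g10 : s₂.narr 10 = s.narr 10 :=
      (f₂.na 10 rfl).trans ((f₁.na 10 rfl).trans (f₀.na 10 rfl))
    obtain ⟨F', hF'⟩ : ∃ F' : Finset (Fin m), F' = F.filter fun e =>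
      ∀ k, 4 * ρ < (degIn E.ends F (E.ends e k) : ℝ) := ⟨_, rfl⟩
    refine Run.seq (Run.forLoop_const (n := m) (τ := 25) hL₂.n1 rfl rfl (fun l s' =>
      ∀ e : Fin m, s'.narr 10 e = 1 ↔ if (e : ℕ) < l then e ∈ F' else e ∈ F) _ ?_ ?_ (by omega))
      fun s₃ f₃ q₃ => ?_
    · intro e
      simp only [setN_narr, g10, Nat.not_lt_zero, if_false]
      exact (h.mem_iff e).symm
    · intro l hl s' hf hi hI
      have d0 : s'.narr 9 (s'.narr 0 l) = degIn E.ends F (E.ends ⟨l, hl⟩ 0) := by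
        rw [show s'.narr 0 l = E.ends ⟨l, hl⟩ 0 from (hL₂.frame hf rfl).ends_eq ⟨l, hl⟩ 0,
          hf.na 9 rfl, g9, h.degs]
      have d1 : s'.narr 9 (s'.narr 1 l) = degIn E.ends F (E.ends ⟨l, hl⟩ 1) := by
        rw [show s'.narr 1 l = E.ends ⟨l, hl⟩ 1 from (hL₂.frame hf rfl).ends_eq ⟨l, hl⟩ 1,
          hf.na 9 rfl, g9, h.degs]
      have r17' : s'.rreg 17 = ρ := (hf.r 17 rfl).trans r17
      have hl0 := hI ⟨l, hl⟩
      simp only [lt_self_iff_false, if_false] at hl0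
      have hmem : (⟨l, hl⟩ : Fin m) ∈ F' ↔ (⟨l, hl⟩ : Fin m) ∈ F ∧
          4 * ρ < (degIn E.ends F (E.ends ⟨l, hl⟩ 0) : ℝ) ∧
          4 * ρ < (degIn E.ends F (E.ends ⟨l, hl⟩ 1) : ℝ) := by
        rw [hF', Finset.mem_filter, Fin.forall_fin_two]
      refine Run.straight rfl (by decide) fun e => ?_
      simp only [HCmd.eff, HTest.holds_rlt, RExp.eval_mul, RExp.eval_ofNat, RExp.eval_reg,
        RExp.eval_nat, NExp.eval_load, NExp.eval_reg, NExp.eval_ofNat, hi, d0, d1, r17',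
        Nat.cast_ofNat]
      rcases Nat.lt_trichotomy (e : ℕ) l with hlt | heq | hgt
      · have := hI e
        rw [if_pos hlt] at this
        have h' : (e : ℕ) < l + 1 := by omega
        simp only [h', if_true, ← this]
        split_ifs <;> simp [hlt.ne]
      · obtain rfl : e = ⟨l, hl⟩ := Fin.ext heq
        have h' : l < l + 1 := by omega
        simp only [h', if_true, hmem]
        split_ifs with c0 c1
        · simp [hl0, c0, c1]
        · simp [c1]
        · simp [c0]
      · have := hI e
        rw [if_neg (by omega)] at this
        have h' : ¬ (e : ℕ) < l + 1 := by omega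
        simp only [h', if_false, ← this]
        split_ifs <;> simp [hgt.ne']
    · obtain ⟨-, -, q₃⟩ := q₃
      have hq : ∀ e : Fin m, e ∈ F' ↔ s₃.narr 10 e = 1 := fun e => by
        rw [q₃ e, if_pos e.isLt]
      refine (run_degrees (hL₂.frame f₃ rfl) hm F' hq).frame.mono le_rfl ?_
      rintro s' ⟨f₄, h1, h2⟩
      have r16' : s'.rreg 16 = max (s.rreg 16) ρ := (f₄.r 16 rfl).trans ((f₃.r 16 rfl).trans r16)
      refine ⟨F', ⟨fun e => ?_, h1, h2, ?_, ?_⟩, peel_card hF hρ fun e he => ?_⟩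
      · rw [f₄.na 10 rfl]; exact hq e
      · rw [r16']
        exact max_le h.best_le (by rw [hρ]; exact peel_le_maxDensity E hF)
      · rw [r16']
        rcases h.le_best with hsub | hle
        · by_cases hsub' : edgesIn E.ends S ⊆ F'
          · exact Or.inl hsub'
          · obtain ⟨e, he, he'⟩ := Finset.not_subset.mp hsub'
            rw [hF', Finset.mem_filter, not_and] at he'
            have := he' (hsub he)
            push Not at this
            obtain ⟨k, hk⟩ := this
            refine Or.inr ((maxDensity_le_of_peel E hS hSd hsub he hk).trans ?_)
            linarith [le_max_right (s.rreg 16) ρ]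
        · exact Or.inr (hle.trans (by linarith [le_max_left (s.rreg 16) ρ]))
      · rw [hF', Finset.mem_filter] at he
        exact he

/-- The number of covered vertices is at most `2 m` at first and halves in each pass. -/
lemma run_peel {s : RamState} (hs : Layout E.ends s) (hm : 1 ≤ m) :
    Run peel s ((Nat.log 2 m + 4) * (201 * m)) (fun s' =>
      s'.rreg 16 ≤ maxDensity G ∧ maxDensity G ≤ 4 * s'.rreg 16) := by
  obtain ⟨S, hS, hSd⟩ := exists_density_eq_maxDensity G (E.pos hm)
  obtain ⟨N, hN⟩ : ∃ N, N = Nat.log 2 m + 2 := ⟨_, rfl⟩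
  refine (Run.seq (T₁ := 10 * m + 3) (T₂ := 3 + (80 * m + (N * (200 * m + 1) + 1)))
    (Run.mapN (n := m) (fun _ => 1) (by decide) hs.n1 (by simp) ?_) fun s₁ f₁ q₁ =>
    Run.straight_seq (T₂ := 80 * m + (N * (200 * m + 1) + 1)) rfl ?_ ?_).time_le ?_
  · have : (1 : NExp).cost = 1 := rfl
    rw [this]
    omega
  · set s₂ := HCmd.eff (.asgR 16 0) s₁ with hs₂
    have f₂ : Frame (.asgR 16 0) s₁ s₂ := HCmd.frame_eff rfl s₁
    have r16 : s₂.rreg 16 = 0 := by simp [hs₂, HCmd.eff]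
    clear_value s₂
    have hL₂ : Layout E.ends s₂ := (hs.frame f₁ rfl).frame f₂ rfl
    have hall : ∀ e : Fin m, e ∈ (univ : Finset (Fin m)) ↔ s₂.narr 10 e = 1 := fun e => by
      rw [f₂.na 10 rfl, q₁, if_pos e.isLt]; simp
    refine Run.seq (run_degrees hL₂ hm univ hall) fun s₃ f₃ ⟨h1, h2⟩ => ?_
    have hL₃ : Layout E.ends s₃ := hL₂.frame f₃ rfl
    have h0 : PeelInv E S univ s₃ := ⟨fun e => by rw [f₃.na 10 rfl]; exact hall e, h1, h2, by
      rw [f₃.r 16 rfl, r16]; exact (maxDensity_pos E hm).le, Or.inl (Finset.subset_univ _)⟩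
    have hcov : #{u | 0 < degIn E.ends univ u} < 2 ^ N := by
      have e1 : #{u | 0 < degIn E.ends univ u} ≤ 2 * m := by
        calc #{u | 0 < degIn E.ends univ u} = ∑ u with 0 < degIn E.ends univ u, 1 := by simp
          _ ≤ ∑ u with 0 < degIn E.ends univ u, degIn E.ends univ u :=
            Finset.sum_le_sum fun u hu => (Finset.mem_filter.mp hu).2
          _ ≤ ∑ u, degIn E.ends univ u := Finset.sum_le_sum_of_subset (Finset.filter_subset _ _)
          _ = 2 * m := by rw [sum_degIn]; simp
      have e2 := Nat.lt_pow_succ_log_self (b := 2) (by norm_num) m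
      rw [hN, show Nat.log 2 m + 2 = (Nat.log 2 m).succ + 1 from rfl, pow_succ]
      omega
    refine (Run.loop (τ := 200 * m) (fun j s' => ∃ F, PeelInv E S F s' ∧
      #{u | 0 < degIn E.ends F u} < 2 ^ j) N ⟨univ, h0, hcov⟩ ?_ ?_).mono le_rfl ?_
    · rintro s' hf ⟨F, hF, hc⟩
      have hempty : F = ∅ := by
        by_contra hne
        obtain ⟨e, he⟩ := Finset.nonempty_iff_ne_empty.mpr hne
        have : 0 < #{u | 0 < degIn E.ends F u} :=
          Finset.card_pos.mpr ⟨E.ends e 0, by simpa using degIn_pos he 0⟩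
        rw [pow_zero] at hc
        omega
      simp [RamTest.holds, hF.count, hempty]
    · rintro j s' hf ⟨F, hF, hc⟩ ht
      rw [RamTest.holds, hF.count, hf.n 40 rfl, hL₃.zero] at ht
      refine (run_peelPass (hL₃.frame hf rfl) hm hS hSd hF (Finset.card_pos.mp ht)).mono le_rfl ?_
      rintro s'' ⟨F', hF', hc'⟩
      refine ⟨F', hF', ?_⟩
      rw [pow_succ] at hc
      omega
    · rintro s' ⟨hf, ⟨j, -, F, hF, -⟩, ht⟩
      rw [RamTest.holds, hF.count, hf.n 40 rfl, hL₃.zero, Nat.not_lt, Nat.le_zero,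
        Finset.card_eq_zero] at ht
      refine ⟨hF.best_le, hF.le_best.resolve_left fun hsub => ?_⟩
      -- no edge is left, but the densest set has one
      rw [ht, Finset.subset_empty] at hsub
      have := maxDensity_pos E hm
      rw [← hSd, density_eq E, hsub] at this
      simp at this
  · have : HCmd.cost (.asgR 16 0) = 3 := rfl
    omega
  · have h1 : N * (200 * m + 1) ≤ N * (201 * m) := Nat.mul_le_mul_left _ (by omega)
    have h2 : (Nat.log 2 m + 4) * (201 * m) = N * (201 * m) + 402 * m := by rw [hN]; ring
    omega

/-- Groups the incidences, computes the initial upper bound for `OPT` and the constants, and writes the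
starting point. `√3` is computed as `exp (log 3 / 2)`. -/
def preprocessing : HCmd :=
  groupIncidences ;; peel ;;
    (.asgR 7 (6 * .exp (.log 3 / 2)) ;; .asgR 3 (4 * .reg 16) ;; .asgR 2 (1 / 4) ;;
      .asgR 4 (256 * (.log (.nat (.reg 1)) + 1)) ;; .asgR 6 (.reg 0 / 16) ;; .asgN 5 1) ;;
    forLoop 6 1 (.stR 2 (.reg 6) (1 / .nat (.reg 1)))

lemma run_preprocessing {ε : ℝ} (hε1 : ε < 1) (hm : 1 ≤ m) :
    Run preprocessing (inputState E.ends ε) ((Nat.log 2 m + 4) * (500 * m)) (fun s =>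
      Active E ε 0 0 s ∧ s.rreg 2 = 1 / 4 ∧ iterateOf m s = startVec m ∧ ∀ v, s.narr 2 v = 0) := by
  obtain ⟨s, hs⟩ : ∃ s, s = inputState E.ends ε := ⟨_, rfl⟩
  rw [← hs]
  have p₁ : Run groupIncidences s (200 * m + 20) (Layout E.ends) := by
    refine run_groupIncidences ?_ ?_ ?_ (fun e k => ?_) ?_ ?_ (fun v => ?_)
    · simp [hs, inputState]
    · simp [hs, inputState]
    · simp [hs, inputState]
    · fin_cases k <;> simp [hs, inputState]
    all_goals simp [hs, inputState]
  refine (Run.seq p₁ fun s₁ f₁ hL₁ => Run.seq (run_peel hL₁ hm) fun s₂ f₂ ⟨hb1, hb2⟩ =>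
    Run.straight_seq (T₂ := 12 * m + 3) (T := 12 * m + 60) rfl ?_ ?_).time_le ?_
  · obtain ⟨c, hc⟩ : ∃ c : HCmd, c = (.asgR 7 (6 * .exp (.log 3 / 2)) ;; .asgR 3 (4 * .reg 16) ;;
      .asgR 2 (1 / 4) ;; .asgR 4 (256 * (.log (.nat (.reg 1)) + 1)) ;; .asgR 6 (.reg 0 / 16) ;;
      .asgN 5 1) := ⟨_, rfl⟩
    rw [← hc]
    have hL₂ : Layout E.ends s₂ := hL₁.frame f₂ rfl
    have f₃ : Frame c s₂ (c.eff s₂) := HCmd.frame_eff (by rw [hc]; rfl) s₂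
    have r0 : s₂.rreg 0 = ε := (f₂.r 0 rfl).trans ((f₁.r 0 rfl).trans (by simp [hs, inputState]))
    have n4 : s₂.nreg 4 = 0 := (f₂.n 4 rfl).trans ((f₁.n 4 rfl).trans (by simp [hs, inputState]))
    have a0 : s₂.rarr 0 = fun _ => 0 := (f₂.ra 0 rfl).trans (f₁.ra 0 rfl |>.trans (by
      simp [hs, inputState]))
    have a1 : s₂.rarr 1 = fun _ => 0 := (f₂.ra 1 rfl).trans (f₁.ra 1 rfl |>.trans (by
      simp [hs, inputState]))
    have b2 : s₂.narr 2 = fun _ => 0 := (f₂.na 2 rfl).trans (f₁.na 2 rfl |>.trans (by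
      simp [hs, inputState]))
    have hsqrt : Real.exp (Real.log 3 / 2) = Real.sqrt 3 := by
      rw [Real.sqrt_eq_rpow, Real.rpow_def_of_pos (by norm_num)]
      congr 1
      ring
    have v7 : (c.eff s₂).rreg 7 = 6 * Real.sqrt 3 := by simp [hc, HCmd.eff, hsqrt]
    have v3 : (c.eff s₂).rreg 3 = 4 * s₂.rreg 16 := by simp [hc, HCmd.eff]
    have v2 : (c.eff s₂).rreg 2 = 1 / 4 := by simp [hc, HCmd.eff]
    have v4 : (c.eff s₂).rreg 4 = 256 * (Real.log m + 1) := by simp [hc, HCmd.eff, hL₂.n1]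
    have v6 : (c.eff s₂).rreg 6 = ε / 16 := by simp [hc, HCmd.eff, r0]
    have v5 : (c.eff s₂).nreg 5 = 1 := by simp [hc, HCmd.eff]
    have v0 : (c.eff s₂).rreg 0 = ε := by simp [hc, HCmd.eff, r0]
    have w4 : (c.eff s₂).nreg 4 = 0 := by simp [hc, HCmd.eff, n4]
    have wr : (c.eff s₂).rarr = s₂.rarr := by simp [hc, HCmd.eff]
    have wn : (c.eff s₂).narr = s₂.narr := by simp [hc, HCmd.eff]
    have hL₃ : Layout E.ends (c.eff s₂) := hL₂.frame f₃ (by rw [hc]; rfl)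
    refine (Run.mapR (n := m) (fun _ => 1 / (m : ℝ)) (by decide) hL₃.n1
      (fun e he s' hf hi hj => by simp [hf.n 1 rfl, hL₃.n1]) ?_).frame.mono le_rfl ?_
    · have : (1 / RExp.nat (.reg 1)).cost = 5 := rfl
      rw [this]
      omega
    · rintro s₄ ⟨f₄, q₄⟩
      refine ⟨⟨⟨hL₃.frame f₄ rfl, (f₄.n 4 rfl).trans w4, (f₄.r 0 rfl).trans v0,
        (f₄.r 4 rfl).trans v4, (f₄.r 6 rfl).trans v6, (f₄.r 7 rfl).trans v7, ?_, ?_, by norm_num,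
        ?_, ?_⟩, Or.inl ⟨(f₄.n 5 rfl).trans v5, rfl⟩⟩, (f₄.r 2 rfl).trans v2,
        Prod.ext ?_ ?_, fun v => ?_⟩
      · rw [f₄.r 2 rfl, v2]; linarith
      · rw [f₄.r 2 rfl, v2]
      · rw [f₄.r 3 rfl, v3]; exact hb2
      · rw [f₄.r 3 rfl, v3, f₄.r 2 rfl, v2]
        push_cast
        linarith
      · funext e k
        fin_cases k
        · simp [iterateOf, startVec, f₄.ra 0 rfl, wr, a0]
        · simp [iterateOf, startVec, f₄.ra 1 rfl, wr, a1]
      · funext e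
        simp [iterateOf, startVec, q₄]
      · rw [f₄.na 2 rfl, wn, b2]
  · have : HCmd.cost (.asgR 7 (6 * .exp (.log 3 / 2)) ;; .asgR 3 (4 * .reg 16) ;;
      .asgR 2 (1 / 4) ;; .asgR 4 (256 * (.log (.nat (.reg 1)) + 1)) ;; .asgR 6 (.reg 0 / 16) ;;
      .asgN 5 1) ≤ 57 := by decide
    omega
  · have h2 : (Nat.log 2 m + 4) * (500 * m) = (Nat.log 2 m + 4) * (201 * m) +
      (Nat.log 2 m + 4) * (299 * m) := by ring
    have h3 : 4 * (299 * m) ≤ (Nat.log 2 m + 4) * (299 * m) := Nat.mul_le_mul_right _ (by omega)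
    omega

end pre

end

/-! ### The trace of the main loop and the total time -/

noncomputable section

section trace

/-- A run of `while g do b` with `K` iterations: `σ i` is the state before iteration number `i`,
which takes `c i ≤ τ` steps and satisfies `S (σ i) (σ (i + 1))`. -/
structure LoopTrace (g : RamTest) (b : RamCmd) (S : RamState → RamState → Prop) (τ K : ℕ)
    (σ : ℕ → RamState) (c : ℕ → ℕ) (t : ℕ) : Prop where
  iter : ∀ i < K, g.holds (σ i) ∧ RamExec b (σ i) (σ (i + 1)) (c i)
  step : ∀ i < K, c i ≤ τ ∧ S (σ i) (σ (i + 1))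
  exit : ¬ g.holds (σ K)
  exec : RamExec (.loop g b) (σ 0) (σ K) t
  time : t ≤ K * (τ + 1) + 1

variable {g : RamTest} {b : RamCmd} {S : RamState → RamState → Prop} {τ K t : ℕ}
  {σ : ℕ → RamState} {c : ℕ → ℕ}

lemma LoopTrace.nil {r : RamState} (h : ¬ g.holds r) :
    LoopTrace g b S τ 0 (fun _ => r) (fun _ => 0) 1 :=
  ⟨fun _ h => absurd h (Nat.not_lt_zero _), fun _ h => absurd h (Nat.not_lt_zero _), h,
    .loop_false h, by omega⟩

lemma LoopTrace.cons (h : LoopTrace g b S τ K σ c t) {r : RamState} {t₀ : ℕ} (hg : g.holds r)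
    (hb : RamExec b r (σ 0) t₀) (ht : t₀ ≤ τ) (hS : S r (σ 0)) :
    LoopTrace g b S τ (K + 1) (Nat.rec r fun i _ => σ i) (Nat.rec t₀ fun i _ => c i)
      (t₀ + t + 1) := by
  refine ⟨fun i hi => ?_, fun i hi => ?_, h.exit, .loop_true hg hb h.exec, ?_⟩
  · cases i with
    | zero => exact ⟨hg, hb⟩
    | succ i => exact h.iter i (by omega)
  · cases i with
    | zero => exact ⟨ht, hS⟩
    | succ i => exact h.step i (by omega)
  · have := h.time
    rw [Nat.add_mul]
    omega

variable {n m : ℕ} {G : SimpleGraph (Fin n)} {E : EdgeListing G m} {ε : ℝ}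

/-- `r'` arises from `r` by one extragradient step, from the current iterate for the current guess
or from the starting point for a new guess. -/
def StepsTo (E : EdgeListing G m) (ε : ℝ) (r r' : RamState) : Prop :=
  ∃ w : SaddleVec m, (w = startVec m ∨ (w = iterateOf m r ∧ guessOf r' = guessOf r)) ∧
    IsExtragradientStep E.ends (guessOf r') ε w (iterateOf m r')

lemma Agree.iterateOf {s r : RamState} (h : Agree s r) : iterateOf m s = iterateOf m r := by
  simp only [_root_.iterateOf, h.rarr]

lemma Agree.guessOf {s r : RamState} (h : Agree s r) : guessOf s = guessOf r :=
  h.rreg 1 (by norm_num)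

lemma Agree.outputSet {s r : RamState} (h : Agree s r) : outputSet n s = outputSet n r := by
  simp only [_root_.outputSet, h.narr]

/-- The main loop halts within its budget, by induction on a natural bound for the budget. The
assertions about structured states are carried over to the states of the RAM program. -/
lemma exists_loopTrace (hm : 1 ≤ m) (hε : 0 < ε) (hε1 : ε < 1) {Δ N : ℕ}
    (hΔ : ∀ u, degIn E.ends univ u ≤ Δ) (hN : 64 * (3 / 4) ^ N ≤ ε / 16) (L : ℕ) :
    ∀ {j T : ℕ} {s r : RamState}, Active E ε j T s → (∀ v, s.narr 2 v = 0) → Agree s r →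
      budget (256 * (Real.log m + 1)) ε (s.rreg 2) j T ≤ L →
      ∃ K σ c t s', LoopTrace (.neq 4 40) mainBody.comp (StepsTo E ε)
        ((N + 1) * (4500 * (m * (Nat.log 2 Δ + 3)))) K σ c t ∧ σ 0 = r ∧
        K ≤ budget (256 * (Real.log m + 1)) ε (s.rreg 2) j T ∧
        Certified E ε s' ∧ (∀ v, s'.narr 2 v = 0) ∧ Agree s' (σ K) := by
  have hR : 0 ≤ 256 * (Real.log m + 1) := by
    have := Real.log_nonneg (show (1 : ℝ) ≤ m by exact_mod_cast hm)
    linarith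
  have hone : ∀ {j T : ℕ} {s : RamState}, Active E ε j T s →
      1 ≤ budget (256 * (Real.log m + 1)) ε (s.rreg 2) j T := by
    rintro j T s ⟨hs, hc⟩
    exact one_le_budget hε hs.lt_eta hR (hc.symm.imp And.right And.right) hs.j_le
  induction L with
  | zero =>
    intro j T s r hA _ _ hb
    have := hone hA
    norm_num at hb
    linarith
  | succ L ih =>
    intro j T s r hA h2 hr hb
    have hg : RamTest.holds r (.neq 4 40) := by
      rw [← hr.test_iff _ rfl]
      simp [RamTest.holds, hA.1.active, hA.1.layout.zero]
    obtain ⟨s₁, t₁, he, ht, ⟨hstep, hres⟩⟩ := run_mainBody hm hε hε1 hA hΔ hN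
    have hf := he.frame
    obtain ⟨r₁, hex, hr₁⟩ := he.exec_comp rfl r hr
    have h2' : ∀ v, s₁.narr 2 v = 0 := fun v => by rw [hf.na 2 rfl, h2]
    have hS : StepsTo E ε r r₁ := by
      rw [StepsTo, ← hr.iterateOf, ← hr.guessOf, ← hr₁.iterateOf, ← hr₁.guessOf]
      exact hstep
    rcases hres with hC | ⟨j', T', hA', hb'⟩
    · have hx : ¬ RamTest.holds r₁ (.neq 4 40) := by
        rw [← hr₁.test_iff _ rfl]
        simp [RamTest.holds, hC.stopped, hC.layout.zero]
      refine ⟨_, _, _, _, s₁, (LoopTrace.nil hx).cons hg hex ht hS, rfl, ?_, hC, h2', hr₁⟩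
      simpa using hone hA
    · obtain ⟨K, σ, c, t, s', hT, rfl, hK, hC, h2'', ha⟩ := ih hA' h2' hr₁ (by
        push_cast at hb; linarith)
      refine ⟨_, _, _, _, s', hT.cons hg hex ht hS, rfl, ?_, hC, h2'', ha⟩
      push_cast
      linarith

end trace

section bounds

lemma half_lt_log_two : (69 / 100 : ℝ) < Real.log 2 := by
  linarith [Real.log_two_gt_d9]

lemma lt_log_add_one {x : ℝ} (hx : 1 ≤ x) : 69 / 100 < Real.log (x + 1) :=
  half_lt_log_two.trans_le (Real.log_le_log (by norm_num) (by linarith))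

lemma log_le_log_add_one {x : ℝ} (hx : 1 ≤ x) : Real.log x ≤ Real.log (x + 1) :=
  Real.log_le_log (by linarith) (by linarith)

lemma natLog_le_log {k : ℕ} (hk : 1 ≤ k) : (Nat.log 2 k : ℝ) ≤ 3 / 2 * Real.log (k + 1) := by
  have h1 : (Nat.log 2 k : ℝ) * Real.log 2 ≤ Real.log k := by
    rw [← Real.log_pow]
    exact Real.log_le_log (by positivity) (by exact_mod_cast Nat.pow_log_le_self 2 (by omega))
  have h2 := log_le_log_add_one (show (1 : ℝ) ≤ k by exact_mod_cast hk)
  have h3 := half_lt_log_two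
  have h4 : (0 : ℝ) ≤ Nat.log 2 k := Nat.cast_nonneg _
  nlinarith

/-- `O(log (1 + 1/ε))` rounds of the oracle reduce its error to `ε / 16`. -/
lemma exists_rounds {ε : ℝ} (hε : 0 < ε) (hε1 : ε < 1) :
    ∃ N : ℕ, 64 * (3 / 4 : ℝ) ^ N ≤ ε / 16 ∧ (N + 1 : ℝ) ≤ 47 * Real.log (1 + 1 / ε) := by
  have h1 : 1 < 1 / ε := by rw [lt_div_iff₀ hε]; linarith
  have hL : 69 / 100 < Real.log (1 + 1 / ε) := by rw [add_comm]; exact lt_log_add_one h1.le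
  set L := Real.log (1 + 1 / ε) with hLdef
  refine ⟨⌈44 * L⌉₊, ?_, ?_⟩
  -- `(3/4)^N ≤ exp (-N/4) ≤ (1 + 1/ε)^(-11)`, and `1 + 1/ε ≥ 2` gives `(1 + 1/ε)^11 ≥ 2^10 / ε`
  · have h2 : (44 * L : ℝ) ≤ ⌈44 * L⌉₊ := Nat.le_ceil _
    have h3 : (3 / 4 : ℝ) ≤ Real.exp (-(1 / 4)) := by
      have := Real.add_one_le_exp (-(1 / 4) : ℝ); linarith
    have h4 : (3 / 4 : ℝ) ^ ⌈44 * L⌉₊ ≤ Real.exp (-(11 * L)) := by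
      refine (pow_le_pow_left₀ (by norm_num) h3 _).trans ?_
      rw [← Real.exp_nat_mul]
      exact Real.exp_le_exp.mpr (by linarith)
    have h5 : Real.exp (11 * L) = (1 + 1 / ε) ^ 11 := by
      rw [show (11 : ℝ) * L = (11 : ℕ) * L by norm_num, Real.exp_nat_mul, hLdef,
        Real.exp_log (by positivity)]
    have h6 : 1024 / ε ≤ (1 + 1 / ε) ^ 11 := by
      have h7 : (2 : ℝ) ^ 10 ≤ (1 + 1 / ε) ^ 10 := pow_le_pow_left₀ (by norm_num) (by linarith) _
      calc 1024 / ε = 2 ^ 10 * (1 / ε) := by ring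
        _ ≤ (1 + 1 / ε) ^ 10 * (1 + 1 / ε) := by gcongr; linarith
        _ = (1 + 1 / ε) ^ 11 := by ring
    have h8 : Real.exp (-(11 * L)) ≤ ε / 1024 := by
      rw [Real.exp_neg, h5, inv_le_comm₀ (by positivity) (by positivity), inv_div]
      exact h6
    linarith
  · have := Nat.ceil_lt_add_one (show 0 ≤ 44 * L by linarith)
    linarith

/-- `O(log (m + 1) log (1 + 1/ε) / ε)` level sets suffice for the rounding. -/
lemma exists_levels {ε : ℝ} {m : ℕ} (hε : 0 < ε) (hε1 : ε < 1) (hm : 1 ≤ m) :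
    ∃ J : ℕ, m * (1 - ε / 16) ^ (J + 1) ≤ ε / 16 ∧
      (J + 2 : ℝ) ≤ 151 * (Real.log (m + 1) * Real.log (1 + 1 / ε) / ε) := by
  have hm' : (1 : ℝ) ≤ m := by exact_mod_cast hm
  have h1 : 1 < 1 / ε := by rw [lt_div_iff₀ hε]; linarith
  have hL : 69 / 100 < Real.log (1 + 1 / ε) := by rw [add_comm]; exact lt_log_add_one h1.le
  have hM := lt_log_add_one hm'
  have hlogm := log_le_log_add_one hm'
  have hlog : Real.log (1 / ε) ≤ Real.log (1 + 1 / ε) :=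
    Real.log_le_log (by positivity) (by linarith)
  have h2le : Real.log 2 ≤ Real.log (1 + 1 / ε) := Real.log_le_log (by norm_num) (by linarith)
  set L := Real.log (1 + 1 / ε) with hLdef
  set M := Real.log (m + 1) with hMdef
  have hLM : 47 / 100 ≤ M * L := by nlinarith
  refine ⟨⌈144 * (M * L / ε)⌉₊, ?_, ?_⟩
  · have h2 : 144 * (M * L / ε) ≤ ⌈144 * (M * L / ε)⌉₊ := Nat.le_ceil _
    have h3 : 1 - ε / 16 ≤ Real.exp (-(ε / 16)) := by
      have := Real.add_one_le_exp (-(ε / 16)); linarith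
    have h4 : (1 - ε / 16) ^ (⌈144 * (M * L / ε)⌉₊ + 1) ≤ Real.exp (-(9 * (M * L))) := by
      refine (pow_le_pow_left₀ (by linarith) h3 _).trans ?_
      rw [← Real.exp_nat_mul]
      refine Real.exp_le_exp.mpr ?_
      have h5 : 144 * (M * L / ε) * (ε / 16) = 9 * (M * L) := by field_simp; ring
      have h6 := mul_le_mul_of_nonneg_right h2 (by linarith : 0 ≤ ε / 16)
      push_cast
      nlinarith
    have h5 : Real.log (16 * m / ε) ≤ 9 * (M * L) := by
      have : Real.log (16 * m / ε) = 4 * Real.log 2 + Real.log m + Real.log (1 / ε) := by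
        rw [show (16 * m / ε : ℝ) = 2 ^ 4 * m * (1 / ε) by ring, Real.log_mul (by positivity)
          (by positivity), Real.log_mul (by positivity) (by positivity), Real.log_pow]
        norm_num
      rw [this]
      nlinarith
    have h6 : 16 * m / ε ≤ Real.exp (9 * (M * L)) := by
      rwa [← Real.log_le_iff_le_exp (by positivity)]
    have h7 : Real.exp (-(9 * (M * L))) ≤ ε / (16 * m) := by
      rw [Real.exp_neg, inv_le_comm₀ (Real.exp_pos _) (by positivity), inv_div]
      exact h6
    calc m * (1 - ε / 16) ^ (⌈144 * (M * L / ε)⌉₊ + 1) ≤ m * (ε / (16 * m)) := by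
          gcongr; exact h4.trans h7
      _ = ε / 16 := by field_simp
  · have h2 := Nat.ceil_lt_add_one (show 0 ≤ 144 * (M * L / ε) by positivity)
    have h3 : 3 / 7 ≤ M * L / ε := by
      rw [le_div_iff₀ hε]; nlinarith
    linarith

end bounds

end

set_option maxHeartbeats 600000 in
/-- The number of iterations, the time of an iteration and the total time, with an explicit constant.
All logarithms are at least `log 2`, so that additive constants can be absorbed. -/
lemma cost_bounds {ε : ℝ} {m Δ N J K t₀ t t₂ : ℕ} (hε : 0 < ε) (hε1 : ε < 1) (hm : 1 ≤ m)
    (hΔ : 1 ≤ Δ) (hN : (N + 1 : ℝ) ≤ 47 * Real.log (1 + 1 / ε))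
    (hJ : (J + 2 : ℝ) ≤ 151 * (Real.log (m + 1) * Real.log (1 + 1 / ε) / ε))
    (hK : K ≤ budget (256 * (Real.log m + 1)) ε (1 / 4) 0 0)
    (ht₀ : t₀ ≤ (Nat.log 2 m + 4) * (500 * m))
    (ht : t ≤ K * ((N + 1) * (4500 * (m * (Nat.log 2 Δ + 3))) + 1) + 1)
    (ht₂ : t₂ ≤ (J + 2) * (200 * m)) :
    (K : ℝ) ≤ 2 * 10 ^ 11 * (Real.log (m + 1) / ε) ∧
    (((N + 1) * (4500 * (m * (Nat.log 2 Δ + 3))) : ℕ) : ℝ) ≤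
      2 * 10 ^ 11 * (m * Real.log (Δ + 1) * Real.log (1 + 1 / ε)) ∧
    ((t₀ + (t + t₂) : ℕ) : ℝ) ≤
      2 * 10 ^ 11 * (m / ε * Real.log (m + 1) * Real.log (Δ + 1) * Real.log (1 + 1 / ε)) := by
  have hm' : (1 : ℝ) ≤ m := by exact_mod_cast hm
  have h1ε : 1 < 1 / ε := by rw [lt_div_iff₀ hε]; linarith
  have hM := lt_log_add_one hm'
  have hX := lt_log_add_one (show (1 : ℝ) ≤ Δ by exact_mod_cast hΔ)
  have hL : 69 / 100 < Real.log (1 + 1 / ε) := by rw [add_comm]; exact lt_log_add_one h1ε.le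
  have hlogm := log_le_log_add_one hm'
  have hm2 := natLog_le_log hm
  have hΔ2 := natLog_le_log hΔ
  generalize Real.log (1 + 1 / ε) = L at *
  generalize Real.log (m + 1) = M at *
  generalize Real.log (Δ + 1) = X at *
  generalize Nat.log 2 m = a at *
  generalize Nat.log 2 Δ = b at *
  have hXL : 47 / 100 ≤ X * L := by nlinarith
  have hML : 47 / 100 ≤ M * L := by nlinarith
  have hm2' : (a + 4 : ℝ) ≤ 8 * M := by linarith
  have hΔ2' : (b + 3 : ℝ) ≤ 6 * X := by linarith
  have hK' : (K : ℝ) ≤ 80080 * (M / ε) := by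
    have h1 : budget (256 * (Real.log m + 1)) ε (1 / 4) 0 0 ≤
        104 * ((256 * (Real.log m + 1) + 1) * (1 / ε)) := by
      have h0 : 0 ≤ Real.log m := Real.log_nonneg hm'
      have h4 : 4 / ε = 4 * (1 / ε) := by ring
      simp only [budget, h4]
      push_cast
      nlinarith
    have h2 : (256 * (Real.log m + 1) + 1) * (1 / ε) ≤ 770 * M * (1 / ε) :=
      mul_le_mul_of_nonneg_right (by linarith) (by linarith)
    calc (K : ℝ) ≤ 104 * (770 * M * (1 / ε)) := by linarith
      _ = 80080 * (M / ε) := by ring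
  have hiter : (((N + 1) * (4500 * (m * (b + 3))) : ℕ) : ℝ) ≤
      1269000 * (m * X * L) := by
    push_cast
    calc ((N : ℝ) + 1) * (4500 * (m * (b + 3)))
        ≤ (47 * L) * (4500 * (m * (6 * X))) := by gcongr
      _ = 1269000 * (m * X * L) := by ring
  have hmXL : 47 / 100 ≤ m * X * L := by rw [mul_assoc]; nlinarith
  have hmML : 0 ≤ m * (M * L) := by positivity
  have hmM : 0 ≤ m * M := by positivity
  have hunit : 3 / 10 ≤ m * M * X * L := by
    have : m * M * X * L = M * (m * X * L) := by ring
    rw [this]; nlinarith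
  refine ⟨hK'.trans ?_, hiter.trans ?_, ?_⟩
  · have : 0 ≤ M / ε := by positivity
    linarith
  · linarith
  -- every contribution to the total time is compared with `Q`
  · obtain ⟨Q, hQ⟩ : ∃ Q, Q = m / ε * M * X * L := ⟨_, rfl⟩
    have hQe : Q = m * M * X * L / ε := by rw [hQ]; ring
    rw [← hQ]
    have hdiv : ∀ x : ℝ, 0 ≤ x → x ≤ x / ε := fun x hx => by
      rw [le_div_iff₀ hε]; nlinarith
    have hQ1 : 3 / 10 ≤ Q := by
      rw [hQe]; exact hunit.trans (hdiv _ (by positivity))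
    have e₀ : (t₀ : ℝ) ≤ 10000 * Q := by
      have h1 : (t₀ : ℝ) ≤ 8 * M * (500 * m) := by
        refine (Nat.cast_le.mpr ht₀).trans ?_
        push_cast
        gcongr
      have h2 : m * M ≤ 5 / 2 * (m * M * X * L) := by
        have : m * M * X * L = m * M * (X * L) := by ring
        rw [this]; nlinarith
      have h3 : m * M * X * L ≤ Q := by rw [hQe]; exact hdiv _ (by positivity)
      linarith
    have e₁ : (t : ℝ) ≤ 80080 * 1269003 * Q + 1 := by
      have h1 : (t : ℝ) ≤ K * (((N + 1) * (4500 * (m * (b + 3))) : ℕ) + 1) + 1 := by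
        exact_mod_cast ht
      have h2 : (((N + 1) * (4500 * (m * (b + 3))) : ℕ) : ℝ) + 1 ≤
          1269003 * (m * X * L) := by linarith
      have h3 := mul_le_mul hK' h2 (by positivity) (by positivity)
      have h4 : 80080 * (M / ε) * (1269003 * (m * X * L)) = 80080 * 1269003 * Q := by
        rw [hQe]; ring
      linarith
    have e₂ : (t₂ : ℝ) ≤ 50000 * Q := by
      have h1 : (t₂ : ℝ) ≤ 151 * (M * L / ε) * (200 * m) := by
        refine (Nat.cast_le.mpr ht₂).trans ?_
        push_cast
        gcongr
      have h2 : m * M * L / ε ≤ 3 / 2 * Q := by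
        have : Q = X * (m * M * L / ε) := by rw [hQe]; ring
        have h0 : 0 ≤ m * M * L / ε := by positivity
        rw [this]; nlinarith
      have h3 : 151 * (M * L / ε) * (200 * m) = 30200 * (m * M * L / ε) := by ring
      linarith
    push_cast
    linarith

theorem mainTheorem3 :
    ∃ (P : IterProgram) (C : ℝ), 0 < C ∧
      ∀ (n m : ℕ) (G : SimpleGraph (Fin n)) [DecidableRel G.Adj] (E : EdgeListing G m) (ε : ℝ),
        1 ≤ m → 0 < ε → ε < 1 →
        ∃ (K : ℕ) (σ : ℕ → RamState) (c : ℕ → ℕ) (s : RamState) (t : ℕ),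
          P.Runs (inputState E.ends ε) K σ c s t ∧
          -- the output is a `(1 - ε)`-approximately densest subgraph
          (outputSet n s).Nonempty ∧
          (1 - ε) * maxDensity G ≤ density G (outputSet n s) ∧
          -- number of iterations, time of each iteration, total time
          (K : ℝ) ≤ C * (Real.log (m + 1) / ε) ∧
          (∀ i < K, (c i : ℝ) ≤
            C * (m * Real.log (G.maxDegree + 1) * Real.log (1 + 1 / ε))) ∧
          (t : ℝ) ≤ C * (m / ε * Real.log (m + 1) * Real.log (G.maxDegree + 1) *
            Real.log (1 + 1 / ε)) ∧
          -- each iteration is one extragradient step for the current guess `D`, either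
          -- continuing from the current iterate or starting afresh with a new guess
          iterateOf m (σ 0) = startVec m ∧
          (∀ i < K, ∃ w : SaddleVec m,
            (w = startVec m ∨ (w = iterateOf m (σ i) ∧ guessOf (σ (i + 1)) = guessOf (σ i))) ∧
            IsExtragradientStep E.ends (guessOf (σ (i + 1))) ε w (iterateOf m (σ (i + 1)))) ∧
          -- the final dual iterate `y`, normalized to the simplex, certifies that the
          -- feasibility problem is infeasible for the final guess, which is at least
          -- `(1 - ε) OPT` and at most the density of the output
          (∀ z ∈ feasibleSet E.ends (guessOf (σ K)),
            ∑ e, (iterateOf m (σ K)).2 e * (z e 0 + z e 1) < ∑ e, (iterateOf m (σ K)).2 e) ∧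
          (1 - ε) * maxDensity G ≤ guessOf (σ K) ∧
          guessOf (σ K) ≤ density G (outputSet n s) := by
  refine ⟨⟨preprocessing.comp, .neq 4 40, mainBody.comp, postprocessing.comp⟩, 2 * 10 ^ 11,
    by norm_num, ?_⟩
  intro n m G _ E ε hm hε hε1
  obtain ⟨N, hN, hNle⟩ := exists_rounds hε hε1
  obtain ⟨J, hJ, hJle⟩ := exists_levels hε hε1 hm
  have hm' : (1 : ℝ) ≤ m := by exact_mod_cast hm
  have hΔ : 1 ≤ G.maxDegree :=
    (degIn_pos (F := univ) (Finset.mem_univ (⟨0, hm⟩ : Fin m)) 0).trans_le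
      (degIn_univ_le_maxDegree E _)
  obtain ⟨s₀, t₀, he₀, ht₀, hA, hη, hstart, hout⟩ := run_preprocessing (E := E) hε1 hm
  obtain ⟨r₀, hx₀, ha₀⟩ := he₀.exec_comp rfl _
    (⟨fun _ _ => rfl, fun _ _ => rfl, rfl, rfl⟩ : Agree (inputState E.ends ε) _)
  obtain ⟨L, hL⟩ := exists_nat_ge (budget (256 * (Real.log m + 1)) ε (s₀.rreg 2) 0 0)
  obtain ⟨K, σ, c, t, s₁, hT, rfl, hK, hC, hout', ha₁⟩ :=
    exists_loopTrace hm hε hε1 (degIn_univ_le_maxDegree E) hN L hA hout ha₀ hL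
  obtain ⟨s₂, t₂, he₂, ht₂, hne, hdens⟩ := run_postprocessing hC hm hε hε1 hout' hJ
  obtain ⟨r₂, hx₂, ha₂⟩ := he₂.exec_comp rfl _ ha₁
  rw [ha₂.outputSet] at hne hdens
  have hguess : guessOf (σ K) = s₁.rreg 1 := ha₁.guessOf.symm
  rw [hη] at hK
  obtain ⟨h1, h2, h3⟩ := cost_bounds hε hε1 hm hΔ hNle hJle hK ht₀ hT.time ht₂
  refine ⟨K, σ, c, r₂, t₀ + (t + t₂), ⟨⟨_, hx₀⟩, hT.iter, hT.exit, ⟨_, hx₂⟩,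
    .seq hx₀ (.seq hT.exec hx₂)⟩, hne, hC.le_guess.trans hdens.le, h1, fun i hi => ?_, h3, ?_,
    fun i hi => (hT.step i hi).2, ?_, ?_, ?_⟩
  · exact (Nat.cast_le.mpr (hT.step i hi).1).trans h2
  · rw [← ha₀.iterateOf, hstart]
  · intro z hz
    obtain ⟨T, -, hsum, hcert⟩ := hC.cert
    rw [hguess] at hz
    rw [← ha₁.iterateOf]
    refine (hcert z hz).trans_lt (lt_of_lt_of_eq ?_ hsum.symm)
    have : (0 : ℝ) ≤ T := Nat.cast_nonneg T
    nlinarith [mul_nonneg hε.le this]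
  · rw [hguess]; exact hC.le_guess
  · rw [hguess]; exact hdens.le
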